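/- Let $\mathcal N=\{x\in\mathbb R^3: x_1\ge 0\}$, let $a\in[0,1)$ and let $\theta\in(0,\pi/2]$ be the angle with $\cos\theta=a$. Let $(\Sigma,\Gamma)$ be a pair of smooth embedded surfaces with (possibly empty) smooth boundary in $\mathbb R^3\setminus\{0\}$, relatively closed in $\mathbb R^3\setminus\{0\}$, with $\Sigma\subset\mathcal N$, $\Gamma\subset\partial\mathcal N$ and $\Sigma\cap\Gamma=\partial\Sigma=\partial\Gamma$. For smooth vector fields $X$ on $\mathbb R^3$ with compact support in $\mathbb R^3\setminus\{0\}$ that are tangent to $\partial\mathcal N$ along $\partial\mathcal N$, suppose that $(\Sigma,\Gamma)$ is (i) stationary for the capillarity functional $F_a(\Sigma,\Gamma)=\mathcal H^2(\Sigma)+a\,\mathcal H^2(\Gamma)$ in $\mathcal N\setminus\{0\}$, that is, for all such $X$, $$\int_\Sigma \operatorname{div}_{\Sigma}X\,d\mathcal H^2+a\int_\Gamma\operatorname{div}_{\partial\mathcal N}X\,d\mathcal H^2=0;$$ (ii) stable for $F_a$ in $\mathcal N\setminus\{0\}$, that is, for all such $X$, with flow $\psi_t$, $$\frac{d^2}{dt^2}\Big|_{t=0}\Big(\int_{\Sigma\cap\operatorname{supp}X}J_{T_x\Sigma}\psi_t\,d\mathcal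 H^2+a\int_{\Gamma\cap\operatorname{supp}X}J_{T_x\partial\mathcal N}\psi_t\,d\mathcal H^2\Big)\ge 0,$$ where $J_P\psi=\sqrt{\det\big((d\psi|_P)^*\,d\psi|_P\big)}$. Suppose also that there is a constant $M>0$ with $\mathcal H^2(\Sigma\cap B_R(0))\le MR^2$ for all $R>0$, where $B_R(0)$ is the closed ball. Then: (1) If $\Sigma$ is connected and $\partial\Sigma\ne\emptyset$, then $\Sigma$ and $\Gamma$ are half-planes (up to the point $0$), and $\Sigma$ meets $\partial\mathcal N$ at angle $\theta$. Precisely, there are $q\in\partial\mathcal N$ and orthonormal vectors $n,w$ parallel to $\partial\mathcal N$ such that $$\Sigma=\{q+s(\sin\theta\,e_1+\cos\theta\,n)+tw: s\ge0,\ t\in\mathbb R\}\setminus\{0\},\qquad \Gamma=\{q-sn+tw: s\ge0,\ t\in\mathbb R\}\setminus\{0\}.$$ (2) Without the assumptions of (1), every connected component of $\Sigma$ is, up to the point $0$, either a half-plane $\{q+s(\sin\theta\,e_1+\cos\theta\,n)+tw: s\ge0,\ t\in\mathbb R\}$ with $q\in\partial\mathcal N$ and $n,w$ orthonormal and parallel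 to $\partial\mathcal N$, or a plane $\{x_1=c\}$ with $c\ge0$. -/

import Mathlib

open MeasureTheory
open scoped ContDiff

noncomputable section

namespace Capillary

/-- The ambient space `ℝ³`; the coordinate called `x₁` on paper is `x 0` here. -/
abbrev E3 : Type := EuclideanSpace ℝ (Fin 3)

/-- The closed half-space `N = {x₁ ≥ 0}`. -/
def halfSpace : Set E3 := {x | 0 ≤ x 0}

/-- The boundary plane `∂N = {x₁ = 0}`, as a set of points. -/
def wall : Set E3 := {x | x 0 = 0}

/-- The plane of directions tangent to `∂N` (the tangent plane of `∂N` at each of its points). -/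
def wallPlane : Submodule ℝ E3 :=
  LinearMap.ker (EuclideanSpace.proj (𝕜 := ℝ) (0 : Fin 3) : E3 →L[ℝ] ℝ).toLinearMap

/-! ### Smooth embedded surfaces with boundary -/

/-- A local smooth diffeomorphism between open subsets of `ℝ³`. -/
def IsSmoothChart (Φ : OpenPartialHomeomorph E3 E3) : Prop :=
  ContDiffOn ℝ ∞ Φ Φ.source ∧ ContDiffOn ℝ ∞ Φ.symm Φ.target

/-- `S` is, near its point `p`, a smooth embedded surface without boundary:
a smooth local diffeomorphism of `ℝ³` straightens `S` to the plane `{y₃ = 0}`. -/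
def IsInteriorPoint (S : Set E3) (p : E3) : Prop :=
  p ∈ S ∧ ∃ Φ : OpenPartialHomeomorph E3 E3, p ∈ Φ.source ∧ IsSmoothChart Φ ∧
    ∀ x ∈ Φ.source, (x ∈ S ↔ Φ x 2 = 0)

/-- `S` is, near its point `p`, a smooth embedded surface with boundary, and `p` lies on the boundary:
a smooth local diffeomorphism of `ℝ³` straightens `S` to the half-plane `{y₃ = 0, y₂ ≥ 0}`
and sends `p` to the line `{y₃ = 0, y₂ = 0}`. -/
def IsBoundaryPoint (S : Set E3) (p : E3) : Prop :=
  p ∈ S ∧ ∃ Φ : OpenPartialHomeomorph E3 E3, p ∈ Φ.source ∧ IsSmoothChart Φ ∧ Φ p 1 = 0 ∧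
    ∀ x ∈ Φ.source, (x ∈ S ↔ Φ x 2 = 0 ∧ 0 ≤ Φ x 1)

/-- The boundary `∂S` in the sense of differential topology. -/
def bdry (S : Set E3) : Set E3 := {p | IsBoundaryPoint S p}

/-- `S` is a smooth embedded surface with (possibly empty) smooth boundary in `ℝ³ ∖ {0}`, and it is
relatively closed in `ℝ³ ∖ {0}`. No regularity is required at the origin. -/
structure IsPuncturedSurface (S : Set E3) : Prop where
  zero_notMem : (0 : E3) ∉ S
  closed : closure S ⊆ S ∪ {0}
  smooth : ∀ p ∈ S, IsInteriorPoint S p ∨ IsBoundaryPoint S p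

/-- A pair of surfaces `(S, G)` in the punctured half-space `N ∖ {0}`: `S ⊆ N`, `G ⊆ ∂N`
and `S ∩ G = ∂S = ∂G`. -/
structure IsSurfacePair (S G : Set E3) : Prop where
  surface_left : IsPuncturedSurface S
  surface_right : IsPuncturedSurface G
  left_subset : S ⊆ halfSpace
  right_subset : G ⊆ wall
  inter_eq : S ∩ G = bdry S
  bdry_eq : bdry S = bdry G

/-- The tangent plane `T_x S` (the linear span of the tangent cone, which on a smooth surface with
boundary is the tangent plane, also at boundary points). -/
def tangentPlane (S : Set E3) (x : E3) : Submodule ℝ E3 :=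
  Submodule.span ℝ (tangentConeAt ℝ S x)

/-! ### The capillarity functional, its first and its second variation -/

/-- Test vector fields: smooth, compactly supported away from the origin,
and tangent to `∂N` along `∂N`. -/
structure IsTestField (X : E3 → E3) : Prop where
  smooth : ContDiff ℝ ∞ X
  compact : HasCompactSupport X
  zero_notMem : (0 : E3) ∉ tsupport X
  tangent : ∀ x ∈ wall, X x ∈ wallPlane

/-- The tangential divergence `div_P X (x) = ∑ ⟪D_{τᵢ} X (x), τᵢ⟫` over an orthonormal basis `τᵢ`
of the subspace `P`. -/
def tangentialDiv (P : Submodule ℝ E3) (X : E3 → E3) (x : E3) : ℝ :=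
  ∑ i, inner ℝ (fderiv ℝ X x (stdOrthonormalBasis ℝ P i : E3)) (stdOrthonormalBasis ℝ P i : E3)

/-- First variation of the capillarity functional `ℋ²(S) + a ℋ²(G)` in the direction `X`. -/
def firstVariation (a : ℝ) (S G : Set E3) (X : E3 → E3) : ℝ :=
  (∫ x in S, tangentialDiv (tangentPlane S x) X x ∂(Measure.euclideanHausdorffMeasure 2)) +
    a * ∫ x in G, tangentialDiv wallPlane X x ∂(Measure.euclideanHausdorffMeasure 2)

/-- `(S, G)` is stationary for the capillarity functional in `N ∖ {0}`. -/
def IsStationary (a : ℝ) (S G : Set E3) : Prop :=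
  ∀ X : E3 → E3, IsTestField X → firstVariation a S G X = 0

/-- The Jacobian `J_P ψ (x) = √ det ((dψ_x|_P)* ∘ dψ_x|_P)` of `ψ` relative to the subspace `P`. -/
def jacobianAlong (P : Submodule ℝ E3) (ψ : E3 → E3) (x : E3) : ℝ :=
  let L : P →ₗ[ℝ] E3 := (fderiv ℝ ψ x : E3 →ₗ[ℝ] E3) ∘ₗ P.subtype
  Real.sqrt (LinearMap.det (LinearMap.adjoint L ∘ₗ L))

/-- The capillarity functional of the push-forward of `(S, G)` by the map `ψ`, restricted to the part
coming from the set `K`. The varifold push-forward of `ℋ² ⌞ S` has mass `∫_S J_{T_x S} ψ dℋ²`. -/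
def pushedEnergy (a : ℝ) (S G K : Set E3) (ψ : E3 → E3) : ℝ :=
  (∫ x in S ∩ K, jacobianAlong (tangentPlane S x) ψ x ∂(Measure.euclideanHausdorffMeasure 2)) +
    a * ∫ x in G ∩ K, jacobianAlong wallPlane ψ x ∂(Measure.euclideanHausdorffMeasure 2)

/-- `ψ` is the (global, smooth) flow of the vector field `X`; for a smooth compactly supported `X`
there is exactly one. -/
structure IsFlow (X : E3 → E3) (ψ : ℝ → E3 → E3) : Prop where
  smooth : ContDiff ℝ ∞ (fun z : ℝ × E3 => ψ z.1 z.2)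
  initial : ∀ x, ψ 0 x = x
  ode : ∀ t x, HasDerivAt (fun s => ψ s x) (X (ψ t x)) t

/-- `(S, G)` is stable for the capillarity functional in `N ∖ {0}`: for each test field `X` with
flow `ψ`, the second derivative at time `0` of the functional along `ψ` is nonnegative.
Only the (compact) support of `X` matters, because `ψ t` is the identity off it. -/
def IsStable (a : ℝ) (S G : Set E3) : Prop :=
  ∀ X : E3 → E3, IsTestField X → ∃ ψ : ℝ → E3 → E3, IsFlow X ψ ∧
    0 ≤ iteratedDeriv 2 (fun t => pushedEnergy a S G (tsupport X) (ψ t)) 0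

/-! ### Planes and half-planes -/

/-- The first coordinate vector, the inner unit normal of the half-space. -/
def e₁ : E3 := EuclideanSpace.single 0 1

/-- The closed half-plane with boundary line `q + ℝ w`, on the side of `v`. -/
def halfPlane (q v w : E3) : Set E3 := {x | ∃ s t : ℝ, 0 ≤ s ∧ x = q + s • v + t • w}

/-- The plane `{x₁ = c}`. -/
def parallelPlane (c : ℝ) : Set E3 := {x | x 0 = c}

/-- `q, n, w` describe a line in `∂N`: it passes through `q`, has unit direction `w`, and has unit
normal `n` within `∂N`. -/
structure IsWallFrame (q n w : E3) : Prop where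
  q_mem : q ∈ wall
  n_mem : n ∈ wallPlane
  w_mem : w ∈ wallPlane
  n_norm : ‖n‖ = 1
  w_norm : ‖w‖ = 1
  orth : inner ℝ n w = 0

/-- The half-plane in `N` that starts at the line `q + ℝ w` of `∂N` and makes the angle `θ` with the
half-plane of `∂N` on the side of `n`. Its outer conormal is `-(sin θ e₁ + cos θ n)`. -/
def tiltedHalfPlane (θ : ℝ) (q n w : E3) : Set E3 :=
  halfPlane q (Real.sin θ • e₁ + Real.cos θ • n) w

end Capillary

end

open scoped MeasureTheory

noncomputable section

namespace Capillary

open Metric (ball closedBall ball_mem_nhds mem_ball_self isOpen_ball)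
open Filter (Tendsto atTop inter_mem)
open scoped Topology

/-! Write S, G for Σ, Γ, let ν be a unit normal of S and |A|² the squared norm of its second
fundamental form. Stationarity has two consequences. First, S has zero mean curvature
(`edivg_eq_zero`). Second, a blow-up at boundary points yields Young's law: the inner conormals of S
and G have inner product −a (`inner_conormal_eq`). Equivalently, the normal that points away from
the wetted region G satisfies ν₁ = −a along ∂S. Hence the field ν + a e₁ is tangent to the wall
along ∂S and, multiplied by any cutoff φ supported away from 0, extends to an admissible variation.
Its second variation, integrated by parts, is ∫ (1 + aν₁)² |∇φ|² − (1 + aν₁) |A|² φ² over S, without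
boundary term. As 1 − a ≤ 1 + aν₁ ≤ 2, stability gives (1 − a) ∫ φ²|A|² ≤ 4 ∫ |∇φ|²
(`stability_inequality`). A logarithmic cutoff at 0 and at infinity, together with the quadratic
area bound, sends the right side to zero, so A = 0 (`curv_eq_zero`). A flat surface agrees near each
point with a plane or a half-plane, an open and closed argument identifies its components, and
Young's law gives the angle.

Three points need care.

Tangency. Nothing forbids S from touching the wall at interior points, where ν₁ = −a is not
available. Since x₁ is a nonnegative harmonic function on a minimal surface, a mean value inequality
shows that the interior contact points form an open subset of S (`contact_isOpen`). That part of S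
lies in the wall, and the variation is set to zero there. The remaining part is called the sheet.

Orientation. The normal has to be chosen globally, with ν₁ = −a on all of ∂S at once. Within the
open half-space S is relatively closed, and the half-space is contractible, so there is a function
that changes sign exactly across S (`exists_side`). Immediately above the wall it has one sign over
G and the other over the complement of G; which of the two is the same everywhere, because the wall
without the origin is connected (`exists_oriented_side`). The normal pointing to the positive side
is the required one (`exists_isOrientation`).

Integration by parts. No divergence theorem on S or G is invoked. Stationarity itself says that the
divergence of any test field Z integrates to zero over S and a G together. So it suffices to exhibit
one test field Z for which the second variation integrand minus the divergence of Z is the desired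
expression on S (`surface_integrand`) and zero on the wall, where the integrand is a null Lagrangian
(`wall_integrand`). This prescribes Z on the wall and its tangential part on the sheet. The two
prescriptions agree along ∂S after adding a divergence free field n × ∇ψ. The agreement is a
computation from zero mean curvature and the constancy of the contact angle
(`contact_compat_linear`), and `exists_correction` glues the pieces. -/

/-- The parameter plane. -/
abbrev E2 : Type := EuclideanSpace ℝ (Fin 2)

variable {a r : ℝ} {S G U : Set E3} {p τ m : E3} {D : Set E2} {F : E2 → E3} {c : E3 → E2}
  {h : E3 → ℝ} {ν : E3 → E3}

/-- The coordinate functionals. -/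
abbrev coordL (i : Fin 3) : E3 →L[ℝ] ℝ := EuclideanSpace.proj i

lemma mem_perp_iff {n ξ : E3} : ξ ∈ (ℝ ∙ n)ᗮ ↔ inner ℝ n ξ = 0 :=
  Submodule.mem_orthogonal_singleton_iff_inner_right



/-! ### Linear algebra in `ℝ³` -/

/-- The standard basis vectors of `ℝ³`. -/
def bv (i : Fin 3) : E3 := EuclideanSpace.single i 1

@[simp] lemma bv_apply (i j : Fin 3) : bv i j = if j = i then 1 else 0 := by
  simp [bv]

lemma e₁_eq : e₁ = bv 0 := rfl

lemma norm_bv (i : Fin 3) : ‖bv i‖ = 1 := by simp [bv]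

lemma eq_sum_bv (x : E3) : x = ∑ i, x i • bv i := by
  ext j; simp [Finset.sum_apply]

lemma inner_three (x y : E3) : inner ℝ x y = x 0 * y 0 + x 1 * y 1 + x 2 * y 2 := by
  simp [PiLp.inner_apply, Fin.sum_univ_three]; ring

lemma map_apply_three (B : E3 →L[ℝ] E3) (x : E3) (i : Fin 3) :
    B x i = x 0 * B (bv 0) i + x 1 * B (bv 1) i + x 2 * B (bv 2) i := by
  conv_lhs => rw [eq_sum_bv x]
  simp [Fin.sum_univ_three, map_add, map_smul]

lemma norm_sq_three (x : E3) : ‖x‖ ^ 2 = x 0 ^ 2 + x 1 ^ 2 + x 2 ^ 2 := by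
  rw [← real_inner_self_eq_norm_sq, inner_three]; ring

/-- The trace of `B` on the plane orthogonal to the unit vector `n`. -/
def sdiv (B : E3 →L[ℝ] E3) (n : E3) : ℝ :=
  B (bv 0) 0 + B (bv 1) 1 + B (bv 2) 2 - inner ℝ (B n) n

/-- The cofactor map of `B` applied to `n`. -/
def cofv (B : E3 →L[ℝ] E3) (n : E3) : E3 :=
  let c (i j : Fin 3) : ℝ := B (bv j) i
  !₂[n 0 * (c 1 1 * c 2 2 - c 2 1 * c 1 2) + n 1 * (c 1 2 * c 2 0 - c 2 2 * c 1 0) +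
      n 2 * (c 1 0 * c 2 1 - c 2 0 * c 1 1),
    n 0 * (c 2 1 * c 0 2 - c 0 1 * c 2 2) + n 1 * (c 2 2 * c 0 0 - c 0 2 * c 2 0) +
      n 2 * (c 2 0 * c 0 1 - c 0 0 * c 2 1),
    n 0 * (c 0 1 * c 1 2 - c 1 1 * c 0 2) + n 1 * (c 0 2 * c 1 0 - c 1 2 * c 0 0) +
      n 2 * (c 0 0 * c 1 1 - c 1 0 * c 0 1)]

lemma sum_onb_orthogonal {ι : Type*} [Fintype ι] {P : Submodule ℝ E3} {n : E3} (hn : ‖n‖ = 1)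
    (hP : P = (ℝ ∙ n)ᗮ) (b : OrthonormalBasis ι ℝ P) (x : E3) :
    ∑ i, inner ℝ (b i : E3) x • (b i : E3) = x - inner ℝ n x • n := by
  have hbn : ∀ i, inner ℝ (b i : E3) n = 0 := fun i => by
    exact Submodule.mem_orthogonal_singleton_iff_inner_left.1 (hP.le (b i).2)
  have hy : x - inner ℝ n x • n ∈ P := by
    rw [hP, mem_perp_iff, inner_sub_right, inner_smul_right,
      real_inner_self_eq_norm_sq, hn]
    ring
  have h := congrArg (fun y : P => (y : E3)) (b.sum_repr' ⟨_, hy⟩)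
  simpa [Submodule.coe_sum, inner_sub_right, inner_smul_right, hbn] using h

/-- The orthogonal projection to `P` has matrix Id − n nᵀ in any basis. Traces and Gram determinants
over `P` become independent of the basis through this identity. -/
lemma sum_onb_orthogonal_coord {ι : Type*} [Fintype ι] {P : Submodule ℝ E3} {n : E3} (hn : ‖n‖ = 1)
    (hP : P = (ℝ ∙ n)ᗮ) (b : OrthonormalBasis ι ℝ P) (j k : Fin 3) :
    ∑ i, (b i : E3) j * (b i : E3) k = (if k = j then 1 else 0) - n j * n k := by
  have h := congrArg (fun y : E3 => y k) (sum_onb_orthogonal hn hP b (bv j))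
  simp only [PiLp.sub_apply, PiLp.smul_apply, bv_apply, smul_eq_mul] at h
  have h2 : ∀ x : E3, inner ℝ x (bv j) = x j := by
    intro x; simp [bv, PiLp.inner_apply]
  rw [h2] at h
  rw [← h]
  simp [Finset.sum_apply, h2]

lemma sum_inner_onb {ι : Type*} [Fintype ι] {P : Submodule ℝ E3} {n : E3} (hn : ‖n‖ = 1)
    (hP : P = (ℝ ∙ n)ᗮ) (b : OrthonormalBasis ι ℝ P) (B : E3 →L[ℝ] E3) :
    ∑ i, inner ℝ (B (b i : E3)) (b i : E3) = sdiv B n := by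
  have h := sum_onb_orthogonal_coord hn hP b
  have key : ∀ i, inner ℝ (B (b i : E3)) (b i : E3) =
      ∑ j, ∑ k, B (bv j) k * ((b i : E3) j * (b i : E3) k) := by
    intro i
    rw [inner_three, map_apply_three B _ 0, map_apply_three B _ 1, map_apply_three B _ 2]
    simp only [Fin.sum_univ_three]; ring
  simp_rw [key]
  rw [Finset.sum_comm]
  simp_rw [Finset.sum_comm (s := (Finset.univ : Finset ι)), ← Finset.mul_sum, h]
  rw [sdiv, inner_three, map_apply_three B n 0, map_apply_three B n 1, map_apply_three B n 2]
  simp [Fin.sum_univ_three]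
  ring

lemma finrank_orthogonal_unit {n : E3} (hn : ‖n‖ = 1) :
    Module.finrank ℝ ((ℝ ∙ n)ᗮ : Submodule ℝ E3) = 2 := by
  have hn0 : n ≠ 0 := by intro h; simp [h] at hn
  have : Fact (Module.finrank ℝ E3 = 2 + 1) := ⟨by simp⟩
  exact Submodule.finrank_orthogonal_span_singleton hn0

lemma det_gram_onb {P : Submodule ℝ E3} (b : OrthonormalBasis (Fin 2) ℝ P) (B : E3 →L[ℝ] E3) :
    LinearMap.det (LinearMap.adjoint ((B : E3 →ₗ[ℝ] E3) ∘ₗ P.subtype) ∘ₗ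
      ((B : E3 →ₗ[ℝ] E3) ∘ₗ P.subtype)) =
    ‖B (b 0 : E3)‖ ^ 2 * ‖B (b 1 : E3)‖ ^ 2 - (inner ℝ (B (b 0 : E3)) (B (b 1 : E3))) ^ 2 := by
  rw [← LinearMap.det_toMatrix b.toBasis, Matrix.det_fin_two]
  simp only [LinearMap.toMatrix_apply, OrthonormalBasis.coe_toBasis,
    OrthonormalBasis.coe_toBasis_repr_apply, OrthonormalBasis.repr_apply_apply, LinearMap.comp_apply,
    LinearMap.adjoint_inner_right, Submodule.subtype_apply, ContinuousLinearMap.coe_coe]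
  rw [real_inner_self_eq_norm_sq, real_inner_self_eq_norm_sq, real_inner_comm (B (b 0 : E3))]
  ring

/-- The Gram determinant is the squared area of the image parallelogram, |Bp × Bq|² = |cof(B)(p ×
q)|², and p × q = ±n for an orthonormal basis p, q of n^⊥. -/
lemma gram_eq_norm_cofv {P : Submodule ℝ E3} {n : E3} (hn : ‖n‖ = 1)
    (hP : P = (ℝ ∙ n)ᗮ) (b : OrthonormalBasis (Fin 2) ℝ P) (B : E3 →L[ℝ] E3) :
    ‖B (b 0 : E3)‖ ^ 2 * ‖B (b 1 : E3)‖ ^ 2 - (inner ℝ (B (b 0 : E3)) (B (b 1 : E3))) ^ 2 =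
      ‖cofv B n‖ ^ 2 := by
  have hc := sum_onb_orthogonal_coord hn hP b
  simp only [Fin.sum_univ_two] at hc
  have hn2 : n 0 ^ 2 + n 1 ^ 2 + n 2 ^ 2 = 1 := by rw [← norm_sq_three, hn]; norm_num
  generalize (b 0 : E3) = p at *
  generalize (b 1 : E3) = q at *
  have h00 := hc 0 0
  have h11 := hc 1 1
  have h22 := hc 2 2
  have h01 := hc 0 1
  have h02 := hc 0 2
  have h12 := hc 1 2
  simp at h00 h11 h22 h01 h02 h12
  -- This is p × q, hence ±n. The sign is not determined, so only the products of its coordinates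
  -- are compared with those of `n`.
  set r : E3 := !₂[p 1 * q 2 - p 2 * q 1, p 2 * q 0 - p 0 * q 2, p 0 * q 1 - p 1 * q 0] with hr
  have hr0 : r 0 = p 1 * q 2 - p 2 * q 1 := rfl
  have hr1 : r 1 = p 2 * q 0 - p 0 * q 2 := rfl
  have hr2 : r 2 = p 0 * q 1 - p 1 * q 0 := rfl
  have r00 : r 0 * r 0 = n 0 * n 0 := by
    have : r 0 * r 0 = (p 1 * p 1 + q 1 * q 1) * (p 2 * p 2 + q 2 * q 2) -
      (p 1 * p 2 + q 1 * q 2) ^ 2 := by rw [hr0]; ring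
    rw [this, h11, h22, h12]; linear_combination -hn2
  have r11 : r 1 * r 1 = n 1 * n 1 := by
    have : r 1 * r 1 = (p 0 * p 0 + q 0 * q 0) * (p 2 * p 2 + q 2 * q 2) -
      (p 0 * p 2 + q 0 * q 2) ^ 2 := by rw [hr1]; ring
    rw [this, h00, h22, h02]; linear_combination -hn2
  have r22 : r 2 * r 2 = n 2 * n 2 := by
    have : r 2 * r 2 = (p 0 * p 0 + q 0 * q 0) * (p 1 * p 1 + q 1 * q 1) -
      (p 0 * p 1 + q 0 * q 1) ^ 2 := by rw [hr2]; ring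
    rw [this, h00, h11, h01]; linear_combination -hn2
  have r01 : r 0 * r 1 = n 0 * n 1 := by
    have : r 0 * r 1 = (p 1 * p 2 + q 1 * q 2) * (p 0 * p 2 + q 0 * q 2) -
      (p 0 * p 1 + q 0 * q 1) * (p 2 * p 2 + q 2 * q 2) := by rw [hr0, hr1]; ring
    rw [this, h12, h02, h01, h22]; ring
  have r02 : r 0 * r 2 = n 0 * n 2 := by
    have : r 0 * r 2 = (p 1 * p 2 + q 1 * q 2) * (p 0 * p 1 + q 0 * q 1) -
      (p 0 * p 2 + q 0 * q 2) * (p 1 * p 1 + q 1 * q 1) := by rw [hr0, hr2]; ring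
    rw [this, h12, h02, h01, h11]; ring
  have r12 : r 1 * r 2 = n 1 * n 2 := by
    have : r 1 * r 2 = (p 0 * p 2 + q 0 * q 2) * (p 0 * p 1 + q 0 * q 1) -
      (p 1 * p 2 + q 1 * q 2) * (p 0 * p 0 + q 0 * q 0) := by rw [hr1, hr2]; ring
    rw [this, h12, h02, h01, h00]; ring
  have hquad : ∀ v : E3, ∀ c d e : ℝ, (v 0 * c + v 1 * d + v 2 * e) ^ 2 =
      (v 0 * v 0) * c ^ 2 + (v 1 * v 1) * d ^ 2 + (v 2 * v 2) * e ^ 2 + 2 * (v 0 * v 1) * (c * d) +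
      2 * (v 0 * v 2) * (c * e) + 2 * (v 1 * v 2) * (d * e) := by intros; ring
  have hcof : ‖cofv B n‖ ^ 2 = ‖cofv B r‖ ^ 2 := by
    rw [norm_sq_three, norm_sq_three]
    simp only [cofv, Matrix.cons_val_zero, Matrix.cons_val_one, Matrix.cons_val, hquad,
      r00, r11, r22, r01, r02, r12]
  rw [hcof]
  simp only [norm_sq_three, inner_three, map_apply_three B p, map_apply_three B q, cofv, hr0, hr1,
    hr2, Matrix.cons_val_zero, Matrix.cons_val_one, Matrix.cons_val]
  ring

/-- The area density becomes the norm of a vector that is polynomial in the derivative of `ψ`, which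
can be differentiated in time as long as this vector is nonzero. -/
lemma jacobianAlong_eq {P : Submodule ℝ E3} {n : E3} (hn : ‖n‖ = 1)
    (hP : P = (ℝ ∙ n)ᗮ) (ψ : E3 → E3) (x : E3) :
    jacobianAlong P ψ x = ‖cofv (fderiv ℝ ψ x) n‖ := by
  have hfr : Module.finrank ℝ P = 2 := by rw [hP]; exact finrank_orthogonal_unit hn
  let b : OrthonormalBasis (Fin 2) ℝ P := (stdOrthonormalBasis ℝ P).reindex (finCongr hfr)
  rw [jacobianAlong]
  simp only
  rw [det_gram_onb b, gram_eq_norm_cofv hn hP, Real.sqrt_sq (norm_nonneg _)]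

lemma tangentialDiv_eq {P : Submodule ℝ E3} {n : E3} (hn : ‖n‖ = 1)
    (hP : P = (ℝ ∙ n)ᗮ) (X : E3 → E3) (x : E3) :
    tangentialDiv P X x = sdiv (fderiv ℝ X x) n := sum_inner_onb hn hP _ _

lemma wallPlane_eq : wallPlane = (ℝ ∙ (bv 0))ᗮ := by
  ext x
  rw [mem_perp_iff, inner_three]
  simp [wallPlane]

/-! ### Pointwise identities for the second variation -/

/-- The zeroth order part of the second variation of the area density for the plane `n^⊥` and the
derivative `B` of the variation field. -/
def qf (B : E3 →L[ℝ] E3) (n : E3) : ℝ :=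
  (∑ j, (inner ℝ (B (bv j)) n) ^ 2) - (inner ℝ (B n) n) ^ 2 + 2 * inner ℝ (cofv B n) n

/-- The squared norm of the restriction of `B` to the plane `n^⊥`. -/
def sff (B : E3 →L[ℝ] E3) (n : E3) : ℝ := ∑ j, ‖B (bv j - n j • n)‖ ^ 2

lemma sff_nonneg (B : E3 →L[ℝ] E3) (n : E3) : 0 ≤ sff B n :=
  Finset.sum_nonneg fun _ _ => sq_nonneg _

/-- The cross product on `ℝ³`. -/
def cross (x y : E3) : E3 :=
  !₂[x 1 * y 2 - x 2 * y 1, x 2 * y 0 - x 0 * y 2, x 0 * y 1 - x 1 * y 0]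

lemma cross_zero (x y : E3) : cross x y 0 = x 1 * y 2 - x 2 * y 1 := rfl
lemma cross_one (x y : E3) : cross x y 1 = x 2 * y 0 - x 0 * y 2 := rfl
lemma cross_two (x y : E3) : cross x y 2 = x 0 * y 1 - x 1 * y 0 := rfl

lemma cofv_zero (B : E3 →L[ℝ] E3) (n : E3) : cofv B n 0 =
    n 0 * (B (bv 1) 1 * B (bv 2) 2 - B (bv 1) 2 * B (bv 2) 1) +
    n 1 * (B (bv 2) 1 * B (bv 0) 2 - B (bv 2) 2 * B (bv 0) 1) +
    n 2 * (B (bv 0) 1 * B (bv 1) 2 - B (bv 0) 2 * B (bv 1) 1) := rfl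

lemma cofv_one (B : E3 →L[ℝ] E3) (n : E3) : cofv B n 1 =
    n 0 * (B (bv 1) 2 * B (bv 2) 0 - B (bv 1) 0 * B (bv 2) 2) +
    n 1 * (B (bv 2) 2 * B (bv 0) 0 - B (bv 2) 0 * B (bv 0) 2) +
    n 2 * (B (bv 0) 2 * B (bv 1) 0 - B (bv 0) 0 * B (bv 1) 2) := rfl

lemma cofv_two (B : E3 →L[ℝ] E3) (n : E3) : cofv B n 2 =
    n 0 * (B (bv 1) 0 * B (bv 2) 1 - B (bv 1) 1 * B (bv 2) 0) +
    n 1 * (B (bv 2) 0 * B (bv 0) 1 - B (bv 2) 1 * B (bv 0) 0) +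
    n 2 * (B (bv 0) 0 * B (bv 1) 1 - B (bv 0) 1 * B (bv 1) 0) := rfl

/-- Cayley–Hamilton: the adjugate of B is B² − (tr B) B + ½((tr B)² − tr B²) Id, and the cofactor
map is its transpose. -/
lemma inner_cofv_eq (B : E3 →L[ℝ] E3) (n : E3) :
    2 * inner ℝ (cofv B n) n = 2 * inner ℝ (B (B n)) n -
      2 * (B (bv 0) 0 + B (bv 1) 1 + B (bv 2) 2) * inner ℝ (B n) n +
      ((B (bv 0) 0 + B (bv 1) 1 + B (bv 2) 2) ^ 2 -
        ∑ i, ∑ j, B (bv i) j * B (bv j) i) * (n 0 ^ 2 + n 1 ^ 2 + n 2 ^ 2) := by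
  simp only [inner_three, cofv_zero, cofv_one, cofv_two, map_apply_three B (B n),
    map_apply_three B n, Fin.sum_univ_three]
  ring

/-- Splitting of a linear map into its restriction to `n^⊥` and a normal part. -/
structure IsSplit (M A : E3 →L[ℝ] E3) (n k : E3) : Prop where
  eq : ∀ ξ, M ξ = A ξ + inner ℝ n ξ • k
  symm : ∀ i j, A (bv i) j = A (bv j) i
  ker : A n = 0

lemma IsSplit.inner_left {M A : E3 →L[ℝ] E3} {n k : E3} (h : IsSplit M A n k) (ξ : E3) :
    inner ℝ (A ξ) n = 0 := by
  have h0 := congrArg (fun y : E3 => y 0) h.ker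
  have h1 := congrArg (fun y : E3 => y 1) h.ker
  have h2 := congrArg (fun y : E3 => y 2) h.ker
  simp only [map_apply_three A n, PiLp.zero_apply] at h0 h1 h2
  simp only [inner_three, map_apply_three A ξ]
  rw [h.symm 1 0, h.symm 2 0, h.symm 2 1] at *
  linear_combination ξ 0 * h0 + ξ 1 * h1 + ξ 2 * h2

lemma IsSplit.entry {M A : E3 →L[ℝ] E3} {n k : E3} (h : IsSplit M A n k) (i j : Fin 3) :
    M (bv j) i = A (bv j) i + n j * k i := by
  rw [h.eq]
  have : inner ℝ n (bv j) = n j := by simp [bv, PiLp.inner_apply]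
  simp [this]

lemma IsSplit.sff_eq {M A : E3 →L[ℝ] E3} {n k : E3} (h : IsSplit M A n k) (hn : ‖n‖ = 1) :
    sff M n = ∑ i, ∑ j, A (bv i) j * A (bv j) i := by
  have h1 : ∀ j, M (bv j - n j • n) = A (bv j) := fun j => by
    have h3 : inner ℝ n (bv j) = n j := by simp [bv, PiLp.inner_apply]
    rw [h.eq, map_sub, map_smul, h.ker, inner_sub_right, inner_smul_right,
      real_inner_self_eq_norm_sq, hn, h3]
    simp
  simp only [sff, h1, norm_sq_three, Fin.sum_univ_three]
  rw [h.symm 1 0, h.symm 2 0, h.symm 2 1]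
  ring

/-- The algebra of the second variation in the direction f V, where B is the derivative of this
product and g the gradient of f. Because A is trace free, the terms quadratic in f reduce to
−f²|A|². The mixed term ⟨g, A V⟩ survives and is later absorbed by the divergence of the correction
field. -/
lemma qf_smul_split {M A : E3 →L[ℝ] E3} {n b : E3} (h : IsSplit M A n b) (hn : ‖n‖ = 1)
    (htr : A (bv 0) 0 + A (bv 1) 1 + A (bv 2) 2 = 0) (B : E3 →L[ℝ] E3) (f : ℝ) (g V : E3)
    (hB : ∀ ξ, B ξ = f • M ξ + inner ℝ g ξ • V) :
    qf B n = (inner ℝ n V) ^ 2 * (‖g‖ ^ 2 - (inner ℝ g n) ^ 2) - f ^ 2 * sff M n -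
      2 * f * inner ℝ g (A V) := by
  have hin : ∀ (y : E3) j, inner ℝ y (bv j) = y j := fun y j => by simp [bv, PiLp.inner_apply]
  have hn2 : n 0 ^ 2 + n 1 ^ 2 + n 2 ^ 2 = 1 := by rw [← norm_sq_three, hn]; norm_num
  have hAn : ∀ ξ, inner ℝ (A ξ) n = 0 := h.inner_left
  -- the map without the normal part
  set B' : E3 →L[ℝ] E3 := f • A + (innerSL ℝ g).smulRight V with hB'
  have hBe : ∀ j i, B (bv j) i = B' (bv j) i + n j * (f * b i) := by
    intro j i
    rw [hB, h.eq]
    simp [hB', hin]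
    ring
  have hB'i : ∀ ξ, B' ξ = f • A ξ + inner ℝ g ξ • V := by
    intro ξ; simp [hB']
  -- `qf` depends only on the restriction to n^⊥, and the two maps differ by one that vanishes
  -- there.
  have hq : qf B n = qf B' n := by
    simp only [qf, inner_three, cofv_zero, cofv_one, cofv_two, map_apply_three B n,
      map_apply_three B' n, Fin.sum_univ_three, hBe]
    linear_combination (-(2 * f * (b 0 * n 0 + b 1 * n 1 + b 2 * n 2) *
      ((n 0 * B' (bv 0) 0 + n 1 * B' (bv 1) 0 + n 2 * B' (bv 2) 0) * n 0 +
       (n 0 * B' (bv 0) 1 + n 1 * B' (bv 1) 1 + n 2 * B' (bv 2) 1) * n 1 +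
       (n 0 * B' (bv 0) 2 + n 1 * B' (bv 1) 2 + n 2 * B' (bv 2) 2) * n 2) +
      f ^ 2 * (b 0 * n 0 + b 1 * n 1 + b 2 * n 2) ^ 2 * (n 0 ^ 2 + n 1 ^ 2 + n 2 ^ 2))) * hn2
  rw [hq, h.sff_eq hn, qf, inner_cofv_eq, hn2]
  have hBB : inner ℝ (B' (B' n)) n = inner ℝ g n * inner ℝ g V * inner ℝ V n := by
    rw [hB'i n, h.ker, smul_zero, zero_add, map_smul, inner_smul_left, hB'i, inner_add_left,
      inner_smul_left, inner_smul_left, hAn]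
    simp; ring
  have hBn : inner ℝ (B' n) n = inner ℝ g n * inner ℝ V n := by
    rw [hB'i n, h.ker, smul_zero, zero_add, inner_smul_left]; simp
  have hBj : ∀ j, inner ℝ (B' (bv j)) n = g j * inner ℝ V n := by
    intro j
    rw [hB'i, inner_add_left, inner_smul_left, inner_smul_left, hAn, hin]; simp
  have htr' : B' (bv 0) 0 + B' (bv 1) 1 + B' (bv 2) 2 = inner ℝ g V := by
    simp only [hB'i, PiLp.add_apply, PiLp.smul_apply, smul_eq_mul, hin, inner_three g V]
    linear_combination f * htr
  have htr2 : ∑ i, ∑ j, B' (bv i) j * B' (bv j) i =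
      f ^ 2 * (∑ i, ∑ j, A (bv i) j * A (bv j) i) + 2 * f * inner ℝ g (A V) +
        (inner ℝ g V) ^ 2 := by
    simp only [hB'i, PiLp.add_apply, PiLp.smul_apply, smul_eq_mul, hin, inner_three g,
      map_apply_three A V, Fin.sum_univ_three]
    rw [h.symm 1 0, h.symm 2 0, h.symm 2 1]
    ring
  rw [hBB, hBn, htr', htr2]
  simp only [hBj, Fin.sum_univ_three, norm_sq_three g, real_inner_comm V n]
  ring

/-- The surface divergence of `n × G` when `G` is a gradient. -/
lemma sdiv_cross {M A : E3 →L[ℝ] E3} {n k : E3} (h : IsSplit M A n k) (hn : ‖n‖ = 1) (G : E3)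
    (Hs : E3 →L[ℝ] E3) (hH : ∀ i j, Hs (bv i) j = Hs (bv j) i) (W : E3 →L[ℝ] E3)
    (hW : ∀ ξ, W ξ = cross (M ξ) G + cross n (Hs ξ)) : sdiv W n = 0 := by
  have hn2 : n 0 ^ 2 + n 1 ^ 2 + n 2 ^ 2 = 1 := by rw [← norm_sq_three, hn]; norm_num
  simp only [sdiv, inner_three, map_apply_three W n]
  simp only [hW, PiLp.add_apply, cross_zero, cross_one, cross_two, h.entry]
  rw [h.symm 1 0, h.symm 2 0, h.symm 2 1, hH 1 0, hH 2 0, hH 2 1]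
  have h0 := congrArg (fun y : E3 => y 0) h.ker
  have h1 := congrArg (fun y : E3 => y 1) h.ker
  have h2 := congrArg (fun y : E3 => y 2) h.ker
  simp only [map_apply_three A n, PiLp.zero_apply] at h0 h1 h2
  rw [h.symm 1 0, h.symm 2 0, h.symm 2 1] at *
  linear_combination (-(n 0 * (k 1 * G 2 - k 2 * G 1) + n 1 * (k 2 * G 0 - k 0 * G 2) +
    n 2 * (k 0 * G 1 - k 1 * G 0))) * hn2 - (G 1 * n 2 - G 2 * n 1) * h0 -
    (G 2 * n 0 - G 0 * n 2) * h1 - (G 0 * n 1 - G 1 * n 0) * h2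

lemma inner_bv_right (y : E3) (j : Fin 3) : inner ℝ y (bv j) = y j := by
  simp [bv, PiLp.inner_apply]

/-- The divergence of a vector field on `ℝ³`. -/
def edivg (W : E3 → E3) (x : E3) : ℝ :=
  fderiv ℝ W x (bv 0) 0 + fderiv ℝ W x (bv 1) 1 + fderiv ℝ W x (bv 2) 2

lemma two_le_infty : (2 : WithTop ℕ∞) ≤ ∞ := by
  have : ((2 : ℕ∞) : WithTop ℕ∞) ≤ ((⊤ : ℕ∞) : WithTop ℕ∞) := WithTop.coe_le_coe.2 le_top
  exact this

lemma one_le_infty : (1 : WithTop ℕ∞) ≤ ∞ := by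
  have : ((1 : ℕ∞) : WithTop ℕ∞) ≤ ((⊤ : ℕ∞) : WithTop ℕ∞) := WithTop.coe_le_coe.2 le_top
  exact this

lemma smooth_fderiv {F G : Type*} [NormedAddCommGroup F] [NormedSpace ℝ F] [NormedAddCommGroup G]
    [NormedSpace ℝ G] {f : F → G} {x : F} (hf : ContDiffAt ℝ ∞ f x) :
    ContDiffAt ℝ ∞ (fderiv ℝ f) x := hf.fderiv_right (by simp)

lemma eventually_differentiableAt {F G : Type*} [NormedAddCommGroup F] [NormedSpace ℝ F]
    [NormedAddCommGroup G] [NormedSpace ℝ G] {f : F → G} {x : F} (hf : ContDiffAt ℝ ∞ f x) :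
    ∀ᶠ y in nhds x, DifferentiableAt ℝ f y :=
  ((hf.of_le one_le_infty).eventually (by simp)).mono fun y hy => hy.differentiableAt (by simp)

lemma fderiv_coord {F : Type*} [NormedAddCommGroup F] [NormedSpace ℝ F] {f : F → E3} {x : F}
    (hf : DifferentiableAt ℝ f x) (ξ : F) (i : Fin 3) :
    fderiv ℝ (fun y => f y i) x ξ = fderiv ℝ f x ξ i := by
  have := ((coordL i).hasFDerivAt.comp x hf.hasFDerivAt).fderiv
  exact congrArg (fun L => L ξ) this

lemma fderiv_const_apply {F : Type*} [NormedAddCommGroup F] [NormedSpace ℝ F]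
    {f : E3 → F →L[ℝ] E3} {x : E3} (hf : DifferentiableAt ℝ f x) (η : F) (ξ : E3) :
    fderiv ℝ (fun y => f y η) x ξ = fderiv ℝ f x ξ η := by
  rw [fderiv_clm_apply hf (differentiableAt_const _)]; simp

lemma inner_fderiv_unit {n : E3 → E3} (hd : DifferentiableAt ℝ n p)
    (hn : ∀ᶠ x in nhds p, ‖n x‖ = 1) (ξ : E3) : inner ℝ (fderiv ℝ n p ξ) (n p) = 0 := by
  have h1 : (fun x => inner ℝ (n x) (n x)) =ᶠ[nhds p] fun _ => (1 : ℝ) := by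
    filter_upwards [hn] with x hx
    rw [real_inner_self_eq_norm_sq, hx]; norm_num
  have h2 := fderiv_inner_apply (𝕜 := ℝ) hd hd ξ
  rw [h1.fderiv_eq] at h2
  simp only [fderiv_fun_const, Pi.zero_apply, zero_apply] at h2
  rw [real_inner_comm] at h2
  linarith

/-- The surface divergence of the tangential field `A e₁`. -/
lemma sdiv_shape {n : E3 → E3} (hs : ContDiffAt ℝ ∞ n p)
    (hn : ∀ᶠ x in nhds p, ‖n x‖ = 1) {A : E3 →L[ℝ] E3} {k : E3}
    (h : IsSplit (fderiv ℝ n p) A (n p) k)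
    (htr : ∀ ξ, inner ℝ (n p) ξ = 0 → fderiv ℝ (edivg n) p ξ = 0) :
    sdiv (fderiv ℝ (fun x => fderiv ℝ n x (bv 0 - n x 0 • n x)) p) (n p) =
      -(sff (fderiv ℝ n p) (n p) * n p 0) := by
  have hn1 : ‖n p‖ = 1 := hn.self_of_nhds
  have hn2 : n p 0 ^ 2 + n p 1 ^ 2 + n p 2 ^ 2 = 1 := by rw [← norm_sq_three, hn1]; norm_num
  have hnn : inner ℝ (n p) (n p) = (1 : ℝ) := by rw [real_inner_self_eq_norm_sq, hn1]; norm_num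
  have hd : DifferentiableAt ℝ n p := hs.differentiableAt (by simp)
  have hd1 : DifferentiableAt ℝ (fderiv ℝ n) p :=
    (smooth_fderiv hs).differentiableAt (by simp)
  set M := fderiv ℝ n p with hM
  set D2 := fderiv ℝ (fderiv ℝ n) p with hD2
  set v := bv 0 - n p 0 • n p with hv
  -- Symmetry of the second derivative of the ambient field `n` plays the part of the Codazzi
  -- equation.
  have hsymm : ∀ ξ η, D2 ξ η = D2 η ξ := by
    intro ξ η
    have := (hs.isSymmSndFDerivAt (by simpa using two_le_infty)).eq ξ η
    exact this
  have hMn : ∀ ξ, inner ℝ (M ξ) (n p) = 0 := inner_fderiv_unit hd hn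
  have hdev : ∀ᶠ x in nhds p, DifferentiableAt ℝ n x :=
    eventually_differentiableAt hs
  have hF1 : ∀ ξ η, inner ℝ (D2 ξ η) (n p) = -inner ℝ (M η) (M ξ) := by
    intro ξ η
    have h1 : (fun x => inner ℝ (fderiv ℝ n x η) (n x)) =ᶠ[nhds p] fun _ => (0 : ℝ) := by
      filter_upwards [hdev, hn.eventually_nhds] with x hx hx2
      exact inner_fderiv_unit hx hx2 η
    have h2 := fderiv_inner_apply (𝕜 := ℝ) (f := fun x => fderiv ℝ n x η) (g := n)
      (hd1.clm_apply (differentiableAt_const _)) hd ξ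
    rw [h1.fderiv_eq, fderiv_const_apply hd1] at h2
    simp only [fderiv_fun_const, Pi.zero_apply, zero_apply] at h2
    linarith
  -- The tangential derivative of the mean curvature is zero by hypothesis; this is the trace of D²n
  -- in a tangential direction.
  have hF3 : ∀ ξ, inner ℝ (n p) ξ = 0 → D2 ξ (bv 0) 0 + D2 ξ (bv 1) 1 + D2 ξ (bv 2) 2 = 0 := by
    intro ξ hξ
    rw [← htr ξ hξ]
    have hc : ∀ i, DifferentiableAt ℝ (fun x => fderiv ℝ n x (bv i) i) p := fun i =>
      ((coordL i).differentiableAt).comp p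
        (hd1.clm_apply (differentiableAt_const _))
    unfold edivg
    rw [fderiv_fun_add ((hc 0).fun_add (hc 1)) (hc 2), fderiv_fun_add (hc 0) (hc 1)]
    simp only [add_apply]
    rw [fderiv_coord (hd1.clm_apply (differentiableAt_const _)),
      fderiv_coord (hd1.clm_apply (differentiableAt_const _)),
      fderiv_coord (hd1.clm_apply (differentiableAt_const _)), fderiv_const_apply hd1,
      fderiv_const_apply hd1, fderiv_const_apply hd1]
  have hn0d : DifferentiableAt ℝ (fun x => n x 0) p :=
    ((coordL 0).differentiableAt).comp p hd
  have hvd : DifferentiableAt ℝ (fun x => bv 0 - n x 0 • n x) p :=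
    (differentiableAt_const _).fun_sub (hn0d.fun_smul hd)
  have hY : ∀ ξ, fderiv ℝ (fun x => fderiv ℝ n x (bv 0 - n x 0 • n x)) p ξ =
      D2 ξ v - (M ξ 0 • M (n p) + n p 0 • M (M ξ)) := by
    intro ξ
    rw [fderiv_clm_apply hd1 hvd]
    simp only [add_apply, ContinuousLinearMap.comp_apply,
      ContinuousLinearMap.flip_apply]
    rw [fderiv_fun_sub (differentiableAt_const _) (hn0d.fun_smul hd), fderiv_fun_smul hn0d hd]
    simp only [fderiv_fun_const, Pi.zero_apply, zero_sub, neg_apply,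
      add_apply, smul_apply,
      ContinuousLinearMap.smulRight_apply, map_neg, map_add, map_smul, fderiv_coord hd]
    rw [← hM, ← hD2, ← hv]
    module
  have hkn : M (n p) = k := by rw [h.eq, h.ker, hnn]; simp
  have hkn0 : inner ℝ k (n p) = 0 := by rw [← hkn]; exact hMn _
  have hnv : inner ℝ (n p) v = 0 := by
    rw [hv, inner_sub_right, inner_smul_right, hnn, inner_bv_right]; ring
  have hMv : M v = A (bv 0) := by
    rw [h.eq, hnv, hv, map_sub, map_smul, h.ker]; simp
  rw [h.sff_eq hn1, sdiv]
  simp only [hY, inner_sub_left, inner_add_left, inner_smul_left, hMn, hF1, hMv]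
  rw [hsymm (bv 0), hsymm (bv 1), hsymm (bv 2), hkn]
  have h3 := hF3 v hnv
  have hMM : ∀ j i, M (M (bv j)) i = A (A (bv j)) i + n p j * A k i := by
    intro j i
    have h1 : inner ℝ (n p) (M (bv j)) = 0 := by rw [real_inner_comm]; exact hMn _
    rw [h.eq (M (bv j)), h1, h.eq (bv j), inner_bv_right]
    simp
  simp only [PiLp.sub_apply, PiLp.add_apply, PiLp.smul_apply, smul_eq_mul, hMM, h.entry]
  have hAk : inner ℝ (A k) (n p) = 0 := h.inner_left _
  rw [inner_three] at hAk hkn0 ⊢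
  simp only [map_apply_three A k, map_apply_three A (A _), Fin.sum_univ_three] at hAk ⊢
  simp only [conj_trivial, mul_zero, add_zero, sub_zero] at *
  rw [h.symm 1 0, h.symm 2 0, h.symm 2 1] at *
  linear_combination h3 - n p 0 * hAk - k 0 * hkn0

/-- The gradient of a function on `ℝ³`. -/
def grd (f : E3 → ℝ) (x : E3) : E3 :=
  !₂[fderiv ℝ f x (bv 0), fderiv ℝ f x (bv 1), fderiv ℝ f x (bv 2)]

lemma grd_apply (f : E3 → ℝ) (x : E3) (i : Fin 3) : grd f x i = fderiv ℝ f x (bv i) := by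
  fin_cases i <;> rfl

lemma inner_grd (f : E3 → ℝ) (x ξ : E3) : inner ℝ (grd f x) ξ = fderiv ℝ f x ξ := by
  conv_rhs => rw [eq_sum_bv ξ]
  simp only [inner_three, Fin.sum_univ_three, map_add, map_smul, grd_apply, smul_eq_mul]
  ring

lemma grd_smooth {f : E3 → ℝ} {x : E3} (hf : ContDiffAt ℝ ∞ f x) : ContDiffAt ℝ ∞ (grd f) x := by
  rw [contDiffAt_euclidean]
  intro i
  simp only [grd_apply]
  exact (smooth_fderiv hf).clm_apply contDiffAt_const

lemma fderiv_grd_symm {f : E3 → ℝ} {x : E3} (hf : ContDiffAt ℝ ∞ f x) (i j : Fin 3) :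
    fderiv ℝ (grd f) x (bv i) j = fderiv ℝ (grd f) x (bv j) i := by
  have hd : DifferentiableAt ℝ (fderiv ℝ f) x := (smooth_fderiv hf).differentiableAt (by simp)
  rw [← fderiv_coord ((grd_smooth hf).differentiableAt (by simp)),
    ← fderiv_coord ((grd_smooth hf).differentiableAt (by simp))]
  simp only [grd_apply]
  rw [fderiv_clm_apply hd (differentiableAt_const _), fderiv_clm_apply hd (differentiableAt_const _)]
  simpa using (hf.isSymmSndFDerivAt (by simpa using two_le_infty)).eq (bv i) (bv j)

/-- The surface divergence only sees the values on the surface. -/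
lemma fderiv_eq_of_eqOn {F : Type*} [NormedAddCommGroup F] [NormedSpace ℝ F]
    {f g : E3 → F} (hp : p ∈ S) (hf : DifferentiableAt ℝ f p) (hg : DifferentiableAt ℝ g p)
    (h : ∀ᶠ x in nhds p, x ∈ S → f x = g x) {ξ : E3} (hξ : ξ ∈ tangentPlane S p) :
    fderiv ℝ f p ξ = fderiv ℝ g p ξ := by
  have h1 : HasFDerivWithinAt g (fderiv ℝ f p) S p := by
    refine hf.hasFDerivAt.hasFDerivWithinAt.congr_of_eventuallyEq ?_ (h.self_of_nhds hp).symm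
    filter_upwards [mem_nhdsWithin_of_mem_nhds h, self_mem_nhdsWithin] with x hx hxS
    exact (hx hxS).symm
  have h2 := h1.unique_on hg.hasFDerivAt.hasFDerivWithinAt
  have h3 : tangentPlane S p ≤ LinearMap.eqLocus (fderiv ℝ f p : E3 →ₗ[ℝ] F)
      (fderiv ℝ g p : E3 →ₗ[ℝ] F) := Submodule.span_le.2 fun ξ hξ => h2 hξ
  exact h3 hξ

lemma sdiv_eq_of_eqOn_plane {B C : E3 →L[ℝ] E3} {n : E3} (hn : ‖n‖ = 1)
    (h : ∀ ξ ∈ (ℝ ∙ n)ᗮ, B ξ = C ξ) : sdiv B n = sdiv C n := by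
  let b := stdOrthonormalBasis ℝ ((ℝ ∙ n)ᗮ : Submodule ℝ E3)
  rw [← sum_inner_onb hn rfl b, ← sum_inner_onb hn rfl b]
  exact Finset.sum_congr rfl fun i _ => by rw [h _ (b i).2]

lemma sff_eq_of_eqOn_plane {B C : E3 →L[ℝ] E3} {n : E3} (hn : ‖n‖ = 1)
    (h : ∀ ξ ∈ (ℝ ∙ n)ᗮ, B ξ = C ξ) : sff B n = sff C n := by
  refine Finset.sum_congr rfl fun j _ => ?_
  rw [h]
  rw [mem_perp_iff, inner_sub_right, inner_smul_right,
    real_inner_self_eq_norm_sq, hn, inner_bv_right]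
  ring

lemma sdiv_fderiv_congr {p n : E3} {f g : E3 → E3} (hn : ‖n‖ = 1) (hp : p ∈ S)
    (hT : tangentPlane S p = (ℝ ∙ n)ᗮ) (hf : DifferentiableAt ℝ f p)
    (hg : DifferentiableAt ℝ g p) (h : ∀ᶠ x in nhds p, x ∈ S → f x = g x) :
    sdiv (fderiv ℝ f p) n = sdiv (fderiv ℝ g p) n :=
  sdiv_eq_of_eqOn_plane hn fun _ hξ => fderiv_eq_of_eqOn hp hf hg h (hT.symm ▸ hξ)

lemma sdiv_add (B C : E3 →L[ℝ] E3) (n : E3) : sdiv (B + C) n = sdiv B n + sdiv C n := by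
  simp [sdiv, inner_add_left]; ring

lemma sdiv_sub (B C : E3 →L[ℝ] E3) (n : E3) : sdiv (B - C) n = sdiv B n - sdiv C n := by
  simp [sdiv, inner_sub_left]; ring

lemma sdiv_smul (c : ℝ) (B : E3 →L[ℝ] E3) (n : E3) : sdiv (c • B) n = c * sdiv B n := by
  simp [sdiv, inner_smul_left]; ring

lemma sdiv_fderiv_smul {f : E3 → ℝ} {W : E3 → E3} (n : E3) (hf : DifferentiableAt ℝ f p)
    (hW : DifferentiableAt ℝ W p) :
    sdiv (fderiv ℝ (fun x => f x • W x) p) n =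
      f p * sdiv (fderiv ℝ W p) n + fderiv ℝ f p (W p) - fderiv ℝ f p n * inner ℝ (W p) n := by
  rw [fderiv_fun_smul hf hW, sdiv_add, sdiv_smul]
  have : sdiv ((fderiv ℝ f p).smulRight (W p)) n =
      fderiv ℝ f p (W p) - fderiv ℝ f p n * inner ℝ (W p) n := by
    rw [← inner_grd f p (W p)]
    simp [sdiv, inner_smul_left, inner_three, grd_apply]
  rw [this]; ring

lemma cross_differentiableAt {f g : E3 → E3} (hf : ContDiffAt ℝ ∞ f p)
    (hg : ContDiffAt ℝ ∞ g p) : ContDiffAt ℝ ∞ (fun x => cross (f x) (g x)) p := by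
  have hc : ∀ i, ContDiffAt ℝ ∞ (fun x => f x i) p := contDiffAt_euclidean.1 hf
  have hd : ∀ i, ContDiffAt ℝ ∞ (fun x => g x i) p := contDiffAt_euclidean.1 hg
  rw [contDiffAt_euclidean]
  intro i
  fin_cases i
  · exact ((hc 1).mul (hd 2)).sub ((hc 2).mul (hd 1))
  · exact ((hc 2).mul (hd 0)).sub ((hc 0).mul (hd 2))
  · exact ((hc 0).mul (hd 1)).sub ((hc 1).mul (hd 0))

lemma fderiv_cross {f g : E3 → E3} (hf : ContDiffAt ℝ ∞ f p) (hg : ContDiffAt ℝ ∞ g p) (ξ : E3) :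
    fderiv ℝ (fun x => cross (f x) (g x)) p ξ =
      cross (fderiv ℝ f p ξ) (g p) + cross (f p) (fderiv ℝ g p ξ) := by
  have hf' := hf.differentiableAt (by simp : (∞ : WithTop ℕ∞) ≠ 0)
  have hg' := hg.differentiableAt (by simp : (∞ : WithTop ℕ∞) ≠ 0)
  have hc : ∀ i, DifferentiableAt ℝ (fun x => f x i) p := differentiableAt_euclidean.1 hf'
  have hd : ∀ i, DifferentiableAt ℝ (fun x => g x i) p := differentiableAt_euclidean.1 hg'
  have key : ∀ i j, fderiv ℝ (fun x => f x i * g x j - f x j * g x i) p ξ =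
      fderiv ℝ f p ξ i * g p j + f p i * fderiv ℝ g p ξ j -
      (fderiv ℝ f p ξ j * g p i + f p j * fderiv ℝ g p ξ i) := by
    intro i j
    rw [fderiv_fun_sub ((hc i).fun_mul (hd j)) ((hc j).fun_mul (hd i)), fderiv_fun_mul (hc i) (hd j),
      fderiv_fun_mul (hc j) (hd i)]
    simp only [sub_apply, add_apply, smul_apply, fderiv_coord hf', fderiv_coord hg', smul_eq_mul]
    ring
  ext i
  rw [← fderiv_coord ((cross_differentiableAt hf hg).differentiableAt (by simp))]
  fin_cases i
  · have := key 1 2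
    simp only [Fin.zero_eta, cross_zero, PiLp.add_apply] at this ⊢
    rw [this]; ring
  · have := key 2 0
    simp only [Fin.mk_one, cross_one, PiLp.add_apply] at this ⊢
    rw [this]; ring
  · have := key 0 1
    simp only [Fin.reduceFinMk, cross_two, PiLp.add_apply] at this ⊢
    rw [this]; ring

/-- A local smooth unit normal field of the minimal surface `S` near `p`. -/
structure IsMinimalNormal (S : Set E3) (n : E3 → E3) (p : E3) : Prop where
  smooth : ContDiffAt ℝ ∞ n p
  unit : ∀ᶠ x in nhds p, ‖n x‖ = 1
  plane : ∀ᶠ x in nhds p, x ∈ S → tangentPlane S x = (ℝ ∙ (n x))ᗮ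
  split : ∃ A k, IsSplit (fderiv ℝ n p) A (n p) k
  div_eq : ∀ᶠ x in nhds p, x ∈ S → edivg n x = 0

lemma sdiv_unit {n : E3 → E3} (hd : DifferentiableAt ℝ n p)
    (hn : ∀ᶠ x in nhds p, ‖n x‖ = 1) : sdiv (fderiv ℝ n p) (n p) = edivg n p := by
  rw [sdiv, inner_fderiv_unit hd hn, edivg, sub_zero]

lemma edivg_smooth {n : E3 → E3} (hs : ContDiffAt ℝ ∞ n p) :
    ContDiffAt ℝ ∞ (edivg n) p := by
  have hc : ∀ i, ContDiffAt ℝ ∞ (fun x => fderiv ℝ n x (bv i) i) p := fun i =>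
    contDiffAt_euclidean.1 ((smooth_fderiv hs).clm_apply contDiffAt_const) i
  exact ((hc 0).add (hc 1)).add (hc 2)

/-- Pointwise form of the second variation on the surface. -/
lemma surface_integrand {n : E3 → E3} (hp : p ∈ S)
    (h : IsMinimalNormal S n p) {φ ψ : E3 → ℝ} {V Z : E3 → E3}
    (hφ : ContDiffAt ℝ ∞ φ p) (hψ : ContDiffAt ℝ ∞ ψ p) (hV : ContDiffAt ℝ ∞ V p)
    (hZ : ContDiffAt ℝ ∞ Z p) (hVS : ∀ᶠ x in nhds p, x ∈ S → V x = n x + a • bv 0)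
    (hZS : ∀ᶠ x in nhds p, x ∈ S → Z x - inner ℝ (Z x) (n x) • n x =
      cross (n x) (grd ψ x) - (φ x ^ 2 * a) • fderiv ℝ n x (bv 0 - n x 0 • n x)) :
    qf (fderiv ℝ (fun x => φ x • V x) p) (n p) - sdiv (fderiv ℝ Z p) (n p) =
      (1 + a * n p 0) ^ 2 * (‖grd φ p‖ ^ 2 - (inner ℝ (grd φ p) (n p)) ^ 2) -
        φ p ^ 2 * (1 + a * n p 0) * sff (fderiv ℝ n p) (n p) := by
  obtain ⟨A, k, hsp⟩ := h.split
  have hn1 : ‖n p‖ = 1 := h.unit.self_of_nhds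
  have hnn : inner ℝ (n p) (n p) = (1 : ℝ) := by rw [real_inner_self_eq_norm_sq, hn1]; norm_num
  have hT := h.plane.self_of_nhds hp
  have hnd : DifferentiableAt ℝ n p := h.smooth.differentiableAt (by simp)
  have hφd : DifferentiableAt ℝ φ p := hφ.differentiableAt (by simp)
  have hZd : DifferentiableAt ℝ Z p := hZ.differentiableAt (by simp)
  have hVd : DifferentiableAt ℝ V p := hV.differentiableAt (by simp)
  have hVp := hVS.self_of_nhds hp
  have hn0s : ContDiffAt ℝ ∞ (fun x => n x 0) p := contDiffAt_euclidean.1 h.smooth 0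
  have hvs : ContDiffAt ℝ ∞ (fun x => bv 0 - n x 0 • n x) p :=
    contDiffAt_const.sub (hn0s.smul h.smooth)
  have hYs : ContDiffAt ℝ ∞ (fun x => fderiv ℝ n x (bv 0 - n x 0 • n x)) p :=
    (smooth_fderiv h.smooth).clm_apply hvs
  have hnv : inner ℝ (n p) (bv 0 - n p 0 • n p) = 0 := by
    rw [inner_sub_right, inner_smul_right, hnn, inner_bv_right]; ring
  have hMn : ∀ ξ, inner ℝ (fderiv ℝ n p ξ) (n p) = 0 := inner_fderiv_unit hnd h.unit
  -- traces
  have hdp : edivg n p = 0 := h.div_eq.self_of_nhds hp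
  have hkn : inner ℝ k (n p) = 0 := by
    have := hMn (n p)
    rwa [hsp.eq, hsp.ker, hnn, zero_add, one_smul] at this
  have htrA : A (bv 0) 0 + A (bv 1) 1 + A (bv 2) 2 = 0 := by
    rw [edivg] at hdp
    simp only [hsp.entry] at hdp
    rw [inner_three] at hkn
    linear_combination hdp - hkn
  -- the divergence of `Z`
  have hdivZ : sdiv (fderiv ℝ Z p) (n p) = φ p ^ 2 * a * (sff (fderiv ℝ n p) (n p) * n p 0) -
      2 * a * φ p * inner ℝ (grd φ p) (A (bv 0)) := by
    have hgs : ContDiffAt ℝ ∞ (fun x => inner ℝ (Z x) (n x)) p := hZ.inner ℝ h.smooth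
    have hcs := cross_differentiableAt h.smooth (grd_smooth hψ)
    have hfs : ContDiffAt ℝ ∞ (fun x => φ x ^ 2 * a) p := (hφ.pow 2).mul contDiffAt_const
    have d1 := hcs.differentiableAt (by simp : (∞ : WithTop ℕ∞) ≠ 0)
    have d2 : DifferentiableAt ℝ
        (fun x => (φ x ^ 2 * a) • fderiv ℝ n x (bv 0 - n x 0 • n x)) p := (hfs.smul hYs).differentiableAt (by simp : (∞ : WithTop ℕ∞) ≠ 0)
    have d3 : DifferentiableAt ℝ (fun x => inner ℝ (Z x) (n x) • n x) p := (hgs.smul h.smooth).differentiableAt (by simp : (∞ : WithTop ℕ∞) ≠ 0)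
    -- The divergence along S only sees values on S. There Z splits into the divergence free field n
    -- × ∇ψ, the shape operator term, and a normal part, whose divergence is a multiple of the mean
    -- curvature and therefore zero.
    have e1 : sdiv (fderiv ℝ Z p) (n p) = sdiv (fderiv ℝ (fun x => cross (n x) (grd ψ x) -
        (φ x ^ 2 * a) • fderiv ℝ n x (bv 0 - n x 0 • n x) + inner ℝ (Z x) (n x) • n x) p) (n p) := by
      refine sdiv_fderiv_congr hn1 hp hT hZd ((d1.sub d2).add d3) ?_
      filter_upwards [hZS] with x hx hxS
      rw [← hx hxS]; abel
    rw [e1, fderiv_fun_add (d1.fun_sub d2) d3, fderiv_fun_sub d1 d2, sdiv_add, sdiv_sub,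
      sdiv_fderiv_smul (n p) (hgs.differentiableAt (by simp)) hnd, sdiv_unit hnd h.unit, hdp,
      sdiv_cross hsp hn1 (grd ψ p) (fderiv ℝ (grd ψ) p) (fderiv_grd_symm hψ) _
        (fderiv_cross h.smooth (grd_smooth hψ)), hnn,
      sdiv_fderiv_smul (n p) (hfs.differentiableAt (by simp)) (hYs.differentiableAt (by simp)),
      sdiv_shape h.smooth h.unit hsp, hMn]
    · have hfd : ∀ ξ, fderiv ℝ (fun x => φ x ^ 2 * a) p ξ = 2 * a * φ p * inner ℝ (grd φ p) ξ := by
        intro ξ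
        rw [fderiv_mul_const (hφd.fun_pow 2), fderiv_fun_pow 2 hφd, inner_grd]
        simp; ring
      have hMv : fderiv ℝ n p (bv 0 - n p 0 • n p) = A (bv 0) := by
        rw [hsp.eq, hnv, map_sub, map_smul, hsp.ker]; simp
      rw [hfd, hMv]; ring
    · intro ξ hξ
      have : fderiv ℝ (edivg n) p ξ = fderiv ℝ (fun _ => (0 : ℝ)) p ξ := by
        refine fderiv_eq_of_eqOn hp ((edivg_smooth h.smooth).differentiableAt (by simp))
          (differentiableAt_const _) h.div_eq ?_
        rw [hT, mem_perp_iff]; exact hξ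
      rw [this]; simp
  -- the quadratic form
  set M' := fderiv ℝ V p with hM'
  -- `V` is prescribed on S only, so its derivative agrees with the shape operator on tangential
  -- vectors and is arbitrary on `n p`.
  have hM'n : ∀ ξ, inner ℝ (n p) ξ = 0 → M' ξ = A ξ := by
    intro ξ hξ
    have h1 : M' ξ = fderiv ℝ (fun x => n x + a • bv 0) p ξ := by
      refine fderiv_eq_of_eqOn hp hVd (hnd.add (differentiableAt_const _)) hVS ?_
      rw [hT, mem_perp_iff]; exact hξ
    rw [h1, fderiv_add_const, hsp.eq, hξ]; simp
  have hsp' : IsSplit M' A (n p) (M' (n p)) := by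
    refine ⟨fun ξ => ?_, hsp.symm, hsp.ker⟩
    have h1 : M' (ξ - inner ℝ (n p) ξ • n p) = A (ξ - inner ℝ (n p) ξ • n p) := by
      apply hM'n
      rw [inner_sub_right, inner_smul_right, hnn]; ring
    rw [map_sub, map_sub, map_smul, map_smul, hsp.ker, smul_zero, sub_zero] at h1
    rw [← h1]; abel
  have hsf : sff M' (n p) = sff (fderiv ℝ n p) (n p) := by
    rw [hsp'.sff_eq hn1, hsp.sff_eq hn1]
  rw [qf_smul_split hsp' hn1 htrA (fderiv ℝ (fun x => φ x • V x) p) (φ p) (grd φ p) (V p), hdivZ,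
    hsf, hVp]
  · rw [inner_add_right, inner_smul_right, hnn, inner_bv_right, map_add, map_smul, hsp.ker, zero_add,
      inner_smul_right]
    ring
  · intro ξ
    rw [fderiv_fun_smul hφd hVd, inner_grd]; simp [hM']

lemma fderiv_eq_of_wall {F : Type*} [NormedAddCommGroup F] [NormedSpace ℝ F]
    {f g : E3 → F} (hp : p ∈ wall) (hf : DifferentiableAt ℝ f p) (hg : DifferentiableAt ℝ g p)
    (h : ∀ x ∈ wall, f x = g x) {j : Fin 3} (hj : j ≠ 0) :
    fderiv ℝ f p (bv j) = fderiv ℝ g p (bv j) := by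
  rw [← hf.lineDeriv_eq_fderiv, ← hg.lineDeriv_eq_fderiv, lineDeriv, lineDeriv]
  congr 1
  ext t
  apply h
  simp only [wall, Set.mem_ofPred_eq] at hp ⊢
  simp [hp, hj.symm]

/-- Pointwise form of the second variation on the wall: a null Lagrangian. -/
lemma wall_integrand {X Z : E3 → E3} (hp : p ∈ wall) (hX : ContDiff ℝ ∞ X)
    (hZ : ContDiff ℝ ∞ Z) (hXw : ∀ x ∈ wall, X x 0 = 0) (hZw : ∀ x ∈ wall, Z x =
      (fderiv ℝ X x (bv 1) 1 + fderiv ℝ X x (bv 2) 2) • X x - fderiv ℝ X x (X x)) :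
    qf (fderiv ℝ X p) (bv 0) - sdiv (fderiv ℝ Z p) (bv 0) = 0 := by
  have hXd : DifferentiableAt ℝ X p := hX.contDiffAt.differentiableAt (by simp)
  have hD1s : ContDiffAt ℝ ∞ (fderiv ℝ X) p := smooth_fderiv hX.contDiffAt
  have hD1 : DifferentiableAt ℝ (fderiv ℝ X) p := hD1s.differentiableAt (by simp)
  have hZd : DifferentiableAt ℝ Z p := hZ.contDiffAt.differentiableAt (by simp)
  -- As `X` is tangent to the wall, `qf` reduces to twice the determinant of the tangential 2×2
  -- block of DX, and that is the plane divergence of (div X) X − DX X.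
  have h0 : ∀ j : Fin 3, j ≠ 0 → fderiv ℝ X p (bv j) 0 = 0 := by
    intro j hj
    rw [← fderiv_coord hXd, fderiv_eq_of_wall hp (g := fun _ => (0 : ℝ)) _
      (differentiableAt_const _) hXw hj]
    · simp
    · exact (coordL 0).differentiableAt.comp p hXd
  have hc : ∀ i, DifferentiableAt ℝ (fun x => fderiv ℝ X x (bv i) i) p := fun i =>
    ((coordL i).differentiableAt).comp p
      (hD1.clm_apply (differentiableAt_const _))
  set M := fderiv ℝ X p with hM
  set D2 := fderiv ℝ (fderiv ℝ X) p with hD2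
  have hsymm : ∀ ξ η, D2 ξ η = D2 η ξ := fun ξ η =>
    (hX.contDiffAt.isSymmSndFDerivAt (by simpa using two_le_infty)).eq ξ η
  have d1 : DifferentiableAt ℝ
      (fun x => (fderiv ℝ X x (bv 1) 1 + fderiv ℝ X x (bv 2) 2) • X x) p :=
    ((hc 1).add (hc 2)).smul hXd
  have d2 : DifferentiableAt ℝ (fun x => fderiv ℝ X x (X x)) p := hD1.clm_apply hXd
  have hZj : ∀ j, j ≠ 0 → fderiv ℝ Z p (bv j) =
      (M (bv 1) 1 + M (bv 2) 2) • M (bv j) + (D2 (bv j) (bv 1) 1 + D2 (bv j) (bv 2) 2) • X p -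
      (D2 (bv j) (X p) + M (M (bv j))) := by
    intro j hj
    rw [fderiv_eq_of_wall hp hZd (d1.fun_sub d2) hZw hj, fderiv_fun_sub d1 d2,
      fderiv_fun_smul ((hc 1).fun_add (hc 2)) hXd, fderiv_fun_add (hc 1) (hc 2),
      fderiv_clm_apply hD1 hXd]
    simp only [sub_apply, add_apply, smul_apply, ContinuousLinearMap.smulRight_apply,
      ContinuousLinearMap.comp_apply, ContinuousLinearMap.flip_apply]
    rw [fderiv_coord (hD1.clm_apply (differentiableAt_const _)),
      fderiv_coord (hD1.clm_apply (differentiableAt_const _)), fderiv_const_apply hD1,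
      fderiv_const_apply hD1, add_comm (M (M (bv j)))]
  have hX0 : X p 0 = 0 := hXw p hp
  simp only [sdiv, qf, inner_bv_right, hZj 1 (by decide), hZj 2 (by decide), cofv_zero,
    Fin.sum_univ_three, h0 1 (by decide), h0 2 (by decide), PiLp.sub_apply, PiLp.add_apply,
    PiLp.smul_apply, smul_eq_mul, map_apply_three M (M _), map_apply_three (D2 _) (X p), hX0,
    bv_apply, hsymm (bv 2) (bv 1)]
  simp
  ring

lemma cofv_id (n : E3) : cofv (ContinuousLinearMap.id ℝ E3) n = n := by
  ext i
  fin_cases i <;> simp [cofv_zero, cofv_one, cofv_two]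

/-- The polarisation of `cofv`. -/
def cofP (B C : E3 →L[ℝ] E3) (n : E3) : E3 := cofv (B + C) n - cofv B n - cofv C n

lemma cofP_zero (B C : E3 →L[ℝ] E3) (n : E3) : cofP B C n 0 =
    n 0 * (B (bv 1) 1 * C (bv 2) 2 + C (bv 1) 1 * B (bv 2) 2 - B (bv 1) 2 * C (bv 2) 1 -
      C (bv 1) 2 * B (bv 2) 1) +
    n 1 * (B (bv 2) 1 * C (bv 0) 2 + C (bv 2) 1 * B (bv 0) 2 - B (bv 2) 2 * C (bv 0) 1 -
      C (bv 2) 2 * B (bv 0) 1) +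
    n 2 * (B (bv 0) 1 * C (bv 1) 2 + C (bv 0) 1 * B (bv 1) 2 - B (bv 0) 2 * C (bv 1) 1 -
      C (bv 0) 2 * B (bv 1) 1) := by
  simp only [cofP, PiLp.sub_apply, cofv_zero, add_apply, PiLp.add_apply]; ring

lemma cofP_one (B C : E3 →L[ℝ] E3) (n : E3) : cofP B C n 1 =
    n 0 * (B (bv 1) 2 * C (bv 2) 0 + C (bv 1) 2 * B (bv 2) 0 - B (bv 1) 0 * C (bv 2) 2 -
      C (bv 1) 0 * B (bv 2) 2) +
    n 1 * (B (bv 2) 2 * C (bv 0) 0 + C (bv 2) 2 * B (bv 0) 0 - B (bv 2) 0 * C (bv 0) 2 -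
      C (bv 2) 0 * B (bv 0) 2) +
    n 2 * (B (bv 0) 2 * C (bv 1) 0 + C (bv 0) 2 * B (bv 1) 0 - B (bv 0) 0 * C (bv 1) 2 -
      C (bv 0) 0 * B (bv 1) 2) := by
  simp only [cofP, PiLp.sub_apply, cofv_one, add_apply, PiLp.add_apply]; ring

lemma cofP_two (B C : E3 →L[ℝ] E3) (n : E3) : cofP B C n 2 =
    n 0 * (B (bv 1) 0 * C (bv 2) 1 + C (bv 1) 0 * B (bv 2) 1 - B (bv 1) 1 * C (bv 2) 0 -
      C (bv 1) 1 * B (bv 2) 0) +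
    n 1 * (B (bv 2) 0 * C (bv 0) 1 + C (bv 2) 0 * B (bv 0) 1 - B (bv 2) 1 * C (bv 0) 0 -
      C (bv 2) 1 * B (bv 0) 0) +
    n 2 * (B (bv 0) 0 * C (bv 1) 1 + C (bv 0) 0 * B (bv 1) 1 - B (bv 0) 1 * C (bv 1) 0 -
      C (bv 0) 1 * B (bv 1) 0) := by
  simp only [cofP, PiLp.sub_apply, cofv_two, add_apply, PiLp.add_apply]; ring

lemma cofP_self (B : E3 →L[ℝ] E3) (n : E3) : cofP B B n = (2 : ℝ) • cofv B n := by
  ext i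
  fin_cases i <;> simp [cofP, cofv_zero, cofv_one, cofv_two] <;> ring

lemma hasDerivAt_E3 {w : ℝ → E3} {w' : E3} {t : ℝ} (h : ∀ i, HasDerivAt (fun s => w s i) (w' i) t) :
    HasDerivAt w w' t := by
  have h1 : HasFDerivAt w (ContinuousLinearMap.toSpanSingleton ℝ w') t := by
    rw [← hasFDerivWithinAt_univ, hasFDerivWithinAt_euclidean]
    intro i
    rw [hasFDerivWithinAt_univ]
    exact (h i).hasFDerivAt.congr_fderiv (by ext; simp)
  simpa using h1.hasDerivAt

lemma hasDerivAt_entry {B : ℝ → E3 →L[ℝ] E3} {B' : E3 →L[ℝ] E3} {t : ℝ} (h : HasDerivAt B B' t)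
    (i j : Fin 3) : HasDerivAt (fun s => B s (bv j) i) (B' (bv j) i) t := by
  have h1 := h.clm_apply (hasDerivAt_const t (bv j))
  simp only [map_zero, add_zero] at h1
  exact (coordL i).hasFDerivAt.comp_hasDerivAt t h1

lemma hasDerivAt_cofP {B C : ℝ → E3 →L[ℝ] E3} {B' C' : E3 →L[ℝ] E3} {t : ℝ}
    (hB : HasDerivAt B B' t) (hC : HasDerivAt C C' t) (n : E3) :
    HasDerivAt (fun s => cofP (B s) (C s) n) (cofP B' (C t) n + cofP (B t) C' n) t := by
  have b := hasDerivAt_entry hB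
  have c := hasDerivAt_entry hC
  have key : ∀ i j k l, HasDerivAt (fun s => B s (bv i) j * C s (bv k) l + C s (bv i) j * B s (bv k) l
      - B s (bv i) l * C s (bv k) j - C s (bv i) l * B s (bv k) j)
      (B' (bv i) j * C t (bv k) l + B t (bv i) j * C' (bv k) l +
        (C' (bv i) j * B t (bv k) l + C t (bv i) j * B' (bv k) l) -
        (B' (bv i) l * C t (bv k) j + B t (bv i) l * C' (bv k) j) -
        (C' (bv i) l * B t (bv k) j + C t (bv i) l * B' (bv k) j)) t := fun i j k l =>
    ((((b j i).fun_mul (c l k)).fun_add ((c j i).fun_mul (b l k))).fun_sub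
      ((b l i).fun_mul (c j k))).fun_sub ((c l i).fun_mul (b j k))
  apply hasDerivAt_E3
  intro i
  fin_cases i
  · change HasDerivAt (fun s => cofP (B s) (C s) n 0) ((cofP B' (C t) n + cofP (B t) C' n) 0) t
    simp only [PiLp.add_apply, cofP_zero]
    exact ((((key 1 1 2 2).const_mul (n 0)).fun_add ((key 2 1 0 2).const_mul (n 1))).fun_add
      ((key 0 1 1 2).const_mul (n 2))).congr_deriv (by ring)
  · change HasDerivAt (fun s => cofP (B s) (C s) n 1) ((cofP B' (C t) n + cofP (B t) C' n) 1) t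
    simp only [PiLp.add_apply, cofP_one]
    exact ((((key 1 2 2 0).const_mul (n 0)).fun_add ((key 2 2 0 0).const_mul (n 1))).fun_add
      ((key 0 2 1 0).const_mul (n 2))).congr_deriv (by ring)
  · change HasDerivAt (fun s => cofP (B s) (C s) n 2) ((cofP B' (C t) n + cofP (B t) C' n) 2) t
    simp only [PiLp.add_apply, cofP_two]
    exact ((((key 1 0 2 1).const_mul (n 0)).fun_add ((key 2 0 0 1).const_mul (n 1))).fun_add
      ((key 0 0 1 1).const_mul (n 2))).congr_deriv (by ring)

lemma cofP_id (B : E3 →L[ℝ] E3) (n : E3) (i : Fin 3) :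
    cofP (ContinuousLinearMap.id ℝ E3) B n i =
      (B (bv 0) 0 + B (bv 1) 1 + B (bv 2) 2) * n i - inner ℝ (B (bv i)) n := by
  fin_cases i <;> simp [cofP, cofv_zero, cofv_one, cofv_two, inner_three] <;> ring

lemma cofP_comm (B C : E3 →L[ℝ] E3) (n : E3) : cofP B C n = cofP C B n := by
  rw [cofP, cofP, add_comm]; abel

lemma cofv_eq_cofP (B : E3 →L[ℝ] E3) (n : E3) : cofv B n = (1 / 2 : ℝ) • cofP B B n := by
  rw [cofP_self, smul_smul]; norm_num

/-- The second derivative of the area density along a curve of linear maps through the identity. -/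
lemma deriv2_norm_cofv {B B1 : ℝ → E3 →L[ℝ] E3} {C : E3 →L[ℝ] E3} {n : E3} (hn : ‖n‖ = 1)
    (hB0 : B 0 = ContinuousLinearMap.id ℝ E3) (hB : ∀ t, HasDerivAt B (B1 t) t)
    (hB1 : HasDerivAt B1 C 0) :
    deriv (deriv fun t => ‖cofv (B t) n‖) 0 = qf (B1 0) n + sdiv C n := by
  have hw : ∀ t, HasDerivAt (fun s => cofv (B s) n) (cofP (B t) (B1 t) n) t := by
    intro t
    have h1 := (hasDerivAt_cofP (hB t) (hB t) n).const_smul (1 / 2 : ℝ)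
    simp_rw [cofv_eq_cofP]
    refine h1.congr_deriv ?_
    rw [cofP_comm (B1 t), smul_add, ← add_smul]; norm_num
  have hw2 := hasDerivAt_cofP (hB 0) hB1 n
  have hnorm : ∀ t, cofv (B t) n ≠ 0 → HasDerivAt (fun s => ‖cofv (B s) n‖)
      (inner ℝ (cofv (B t) n) (cofP (B t) (B1 t) n) / ‖cofv (B t) n‖) t := by
    intro t ht
    have h1 := (hw t).norm_sq.sqrt (by positivity)
    simp only [Real.sqrt_sq (norm_nonneg _)] at h1
    refine h1.congr_deriv ?_
    field_simp
  have h0 : cofv (B 0) n = n := by rw [hB0, cofv_id]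
  -- The norm is differentiable only away from zero; at time 0 the vector is the unit vector `n`.
  have hne : ∀ᶠ t in nhds (0 : ℝ), cofv (B t) n ≠ 0 := by
    apply (hw 0).continuousAt.eventually_ne
    rw [h0]; intro h; simp [h] at hn
  have hd : deriv (fun t => ‖cofv (B t) n‖) =ᶠ[nhds 0]
      fun t => inner ℝ (cofv (B t) n) (cofP (B t) (B1 t) n) / ‖cofv (B t) n‖ :=
    hne.mono fun t ht => (hnorm t ht).deriv
  rw [hd.deriv_eq]
  have h3 := ((hw 0).inner ℝ hw2).fun_div (hnorm 0 hne.self_of_nhds) (by rw [h0, hn]; norm_num)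
  rw [h3.deriv]
  simp only [h0, hn]
  rw [hB0, cofP_self, inner_add_right, inner_smul_right]
  have e1 : ∀ D : E3 →L[ℝ] E3, inner ℝ n (cofP (ContinuousLinearMap.id ℝ E3) D n) = sdiv D n := by
    intro D
    have hn2 : n 0 ^ 2 + n 1 ^ 2 + n 2 ^ 2 = 1 := by rw [← norm_sq_three, hn]; norm_num
    rw [sdiv, inner_three]
    simp only [cofP_id, inner_three, map_apply_three D n]
    linear_combination (D (bv 0) 0 + D (bv 1) 1 + D (bv 2) 2) * hn2
  rw [e1, e1, qf, real_inner_self_eq_norm_sq, norm_sq_three, sdiv]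
  simp only [cofP_id, Fin.sum_univ_three]
  have hn2 : n 0 ^ 2 + n 1 ^ 2 + n 2 ^ 2 = 1 := by rw [← norm_sq_three, hn]; norm_num
  have e2 : inner ℝ (B1 0 n) n = n 0 * inner ℝ (B1 0 (bv 0)) n + n 1 * inner ℝ (B1 0 (bv 1)) n +
      n 2 * inner ℝ (B1 0 (bv 2)) n := by
    simp only [inner_three, map_apply_three (B1 0) n]; ring
  have hcm : inner ℝ n (cofv (B1 0) n) = inner ℝ (cofv (B1 0) n) n := real_inner_comm _ _
  rw [sdiv, e2]
  generalize inner ℝ (B1 0 (bv 0)) n = x0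
  generalize inner ℝ (B1 0 (bv 1)) n = x1
  generalize inner ℝ (B1 0 (bv 2)) n = x2
  linear_combination ((B1 0 (bv 0) 0 + B1 0 (bv 1) 1 + B1 0 (bv 2) 2) ^ 2) * hn2 + 2 * hcm

/-! ### Local parametrisations -/

/-- The linear map `(s, t) ↦ s τ + t m`. -/
def frameMap (τ m : E3) : E2 →L[ℝ] E3 :=
  (EuclideanSpace.proj (𝕜 := ℝ) (0 : Fin 2) : E2 →L[ℝ] ℝ).smulRight τ +
    (EuclideanSpace.proj (𝕜 := ℝ) (1 : Fin 2) : E2 →L[ℝ] ℝ).smulRight m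

lemma frameMap_apply (τ m : E3) (y : E2) : frameMap τ m y = y 0 • τ + y 1 • m := by
  simp [frameMap]

/-- The coordinates of a vector in the directions `τ, m`. -/
def frameCoord (τ m : E3) : E3 →L[ℝ] E2 :=
  (innerSL ℝ τ).smulRight (EuclideanSpace.single 0 1) +
    (innerSL ℝ m).smulRight (EuclideanSpace.single 1 1)

lemma frameCoord_zero (τ m x : E3) : frameCoord τ m x 0 = inner ℝ τ x := by
  simp [frameCoord]

lemma frameCoord_one (τ m x : E3) : frameCoord τ m x 1 = inner ℝ m x := by
  simp [frameCoord]

/-- A pair of orthonormal vectors. -/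
structure IsFrame (τ m : E3) : Prop where
  norm_left : ‖τ‖ = 1
  norm_right : ‖m‖ = 1
  orth : inner ℝ τ m = 0

lemma IsFrame.inner_left (h : IsFrame τ m) : inner ℝ τ τ = (1 : ℝ) := by
  rw [real_inner_self_eq_norm_sq, h.norm_left]; norm_num

lemma IsFrame.inner_right (h : IsFrame τ m) : inner ℝ m m = (1 : ℝ) := by
  rw [real_inner_self_eq_norm_sq, h.norm_right]; norm_num

lemma IsFrame.coord_map (h : IsFrame τ m) (y : E2) :
    frameCoord τ m (frameMap τ m y) = y := by
  have h2 : inner ℝ m τ = (0 : ℝ) := by rw [real_inner_comm]; exact h.orth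
  ext i
  fin_cases i
  · simp [frameCoord_zero, frameMap_apply, h.norm_left, h.orth]
  · simp [frameCoord_one, frameMap_apply, h.norm_right, h2]

lemma IsFrame.norm_map (h : IsFrame τ m) (y : E2) : ‖frameMap τ m y‖ = ‖y‖ := by
  have h2 : inner ℝ m τ = (0 : ℝ) := by rw [real_inner_comm]; exact h.orth
  rw [← sq_eq_sq₀ (norm_nonneg _) (norm_nonneg _), ← real_inner_self_eq_norm_sq,
    EuclideanSpace.norm_sq_eq, frameMap_apply]
  simp only [inner_add_left, inner_add_right, inner_smul_left, inner_smul_right, h.inner_left,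
    h.inner_right, h.orth, h2, Fin.sum_univ_two, Real.norm_eq_abs, sq_abs, conj_trivial]
  ring

/-- Gram–Schmidt for the preimages of the first two basis vectors: τ spans the preimage of the line
{y₂ = y₃ = 0}, and m is orthogonal to τ in the preimage of {y₃ = 0} and points to the side y₂ > 0.
-/
lemma exists_frame (A : E3 ≃L[ℝ] E3) : ∃ τ m : E3, IsFrame τ m ∧ A τ 1 = 0 ∧ A τ 2 = 0 ∧
    0 < A m 1 ∧ A m 2 = 0 := by
  set u := A.symm (bv 0) with hu
  set v := A.symm (bv 1) with hv
  have hu0 : u ≠ 0 := by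
    intro h
    have : A u = bv 0 := by simp [hu]
    rw [h, map_zero] at this
    have := congrArg norm this
    simp [norm_bv] at this
  set τ := (‖u‖⁻¹ : ℝ) • u with hτ
  have hτn : ‖τ‖ = 1 := by rw [hτ, norm_smul, norm_inv, norm_norm]; field_simp
  have hAτ : A τ = (‖u‖⁻¹ : ℝ) • bv 0 := by rw [hτ, map_smul]; simp [hu]
  set w := v - inner ℝ τ v • τ with hw
  have hAw : A w = bv 1 - (inner ℝ τ v * ‖u‖⁻¹) • bv 0 := by
    rw [hw, map_sub, map_smul, hAτ, smul_smul]; simp [hv]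
  have hw0 : w ≠ 0 := by
    intro h
    rw [h, map_zero] at hAw
    have := congrArg (fun y : E3 => y 1) hAw
    simp at this
  have hwn : 0 < ‖w‖ := norm_pos_iff.2 hw0
  refine ⟨τ, (‖w‖⁻¹ : ℝ) • w, ⟨hτn, ?_, ?_⟩, ?_, ?_, ?_, ?_⟩
  · rw [norm_smul, norm_inv, norm_norm]; field_simp
  · rw [inner_smul_right, hw, inner_sub_right, inner_smul_right, real_inner_self_eq_norm_sq, hτn]
    ring
  · rw [hAτ]; simp
  · rw [hAτ]; simp
  · rw [map_smul, hAw]; simp; exact hw0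
  · rw [map_smul, hAw]; simp

/-- A local parametrisation of the surface `S` near `p` over the part `D` of the plane. -/
structure IsParam (S : Set E3) (p : E3) (D : Set E2) (F : E2 → E3) (c : E3 → E2) (h : E3 → ℝ)
    (τ m : E3) (r : ℝ) (U : Set E3) : Prop where
  frame : IsFrame τ m
  pos : 0 < r
  isOpen : IsOpen U
  mem : p ∈ U
  base : F 0 = p
  smooth : ContDiffOn ℝ ∞ F (ball 0 r)
  deriv_zero : HasFDerivAt F (frameMap τ m) 0
  maps : ∀ y ∈ ball (0 : E2) r, F y ∈ U ∧ c (F y) = y ∧ (F y ∈ S ↔ y ∈ D)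
  coord : ∀ x ∈ U, h x = 0 → c x ∈ ball (0 : E2) r ∧ F (c x) = x
  coord_smooth : ContDiffOn ℝ ∞ c U
  def_smooth : ContDiffOn ℝ ∞ h U
  def_zero : ∀ x ∈ U, x ∈ S → h x = 0
  def_ne : ∀ x ∈ U, fderiv ℝ h x ≠ 0
  def_map : ∀ y ∈ ball (0 : E2) r, h (F y) = 0

/-- The half-plane `{(s, t) : t ≥ 0}`. -/
def halfD : Set E2 := {y | 0 ≤ y 1}

lemma chart_fderiv {Φ : OpenPartialHomeomorph E3 E3} (hΦ : IsSmoothChart Φ) {x : E3}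
    (hx : x ∈ Φ.source) : ∃ A : E3 ≃L[ℝ] E3, HasFDerivAt Φ (A : E3 →L[ℝ] E3) x ∧
      HasFDerivAt Φ.symm (A.symm : E3 →L[ℝ] E3) (Φ x) := by
  have h1 : HasFDerivAt Φ (fderiv ℝ Φ x) x :=
    ((hΦ.1.contDiffAt (Φ.open_source.mem_nhds hx)).differentiableAt (by simp)).hasFDerivAt
  have h2 : HasFDerivAt Φ.symm (fderiv ℝ Φ.symm (Φ x)) (Φ x) :=
    ((hΦ.2.contDiffAt (Φ.open_target.mem_nhds (Φ.map_source hx))).differentiableAt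
      (by simp)).hasFDerivAt
  have h3 : (fderiv ℝ Φ.symm (Φ x)).comp (fderiv ℝ Φ x) = ContinuousLinearMap.id ℝ E3 := by
    refine (h2.comp x h1).unique ((hasFDerivAt_id x).congr_of_eventuallyEq ?_)
    filter_upwards [Φ.open_source.mem_nhds hx] with y hy using Φ.left_inv hy
  have h4 : (fderiv ℝ Φ x).comp (fderiv ℝ Φ.symm (Φ x)) = ContinuousLinearMap.id ℝ E3 := by
    have h2' : HasFDerivAt Φ (fderiv ℝ Φ x) (Φ.symm (Φ x)) := by rwa [Φ.left_inv hx]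
    refine (h2'.comp (Φ x) h2).unique ((hasFDerivAt_id _).congr_of_eventuallyEq ?_)
    filter_upwards [Φ.open_target.mem_nhds (Φ.map_source hx)] with y hy using Φ.right_inv hy
  exact ⟨ContinuousLinearEquiv.equivOfInverse (fderiv ℝ Φ x) (fderiv ℝ Φ.symm (Φ x))
    (fun y => congrArg (fun L => L y) h3) (fun y => congrArg (fun L => L y) h4), h1, h2⟩

/-- The inverse chart is composed with the linear map A ∘ `frameMap τ m`, so that the
parametrisation has an isometric derivative at 0. The blow-up at boundary points relies on this
normalisation. -/
lemma exists_param_of_chart {Φ : OpenPartialHomeomorph E3 E3}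
    (hp : p ∈ Φ.source) (hΦ : IsSmoothChart Φ) {A : E3 ≃L[ℝ] E3}
    (hA' : HasFDerivAt Φ.symm (A.symm : E3 →L[ℝ] E3) (Φ p)) (hf : IsFrame τ m)
    (h1 : A τ 1 = 0) (h2 : A τ 2 = 0) (h3 : 0 < A m 1) (h4 : A m 2 = 0) (h0 : Φ p 2 = 0)
    (hS : ∀ x ∈ Φ.source, x ∈ S → Φ x 2 = 0)
    (hD : ∀ x ∈ Φ.source, ∀ y, Φ x = Φ p + A (frameMap τ m y) → (x ∈ S ↔ y ∈ D)) :
    ∃ r U, IsParam S p D (fun y => Φ.symm (Φ p + A (frameMap τ m y)))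
      (fun x => frameCoord τ m (A.symm (Φ x - Φ p))) (fun x => Φ x 2) τ m r U ∧ U ⊆ Φ.source ∧
      ∀ y ∈ ball (0 : E2) r, Φ p + A (frameMap τ m y) ∈ Φ.target := by
  have hcont : Continuous fun y : E2 => Φ p + A (frameMap τ m y) := by fun_prop
  have hnb : ∀ᶠ y in nhds (0 : E2), Φ p + A (frameMap τ m y) ∈ Φ.target := by
    apply hcont.continuousAt.eventually_mem
    simpa using Φ.open_target.mem_nhds (Φ.map_source hp)
  obtain ⟨r, hr, hrt⟩ := Metric.eventually_nhds_iff_ball.1 hnb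
  have hcs : ContDiffOn ℝ ∞ (fun x => frameCoord τ m (A.symm (Φ x - Φ p))) Φ.source :=
    (frameCoord τ m).contDiff.comp_contDiffOn
      ((A.symm : E3 →L[ℝ] E3).contDiff.comp_contDiffOn (hΦ.1.sub contDiffOn_const))
  have hco : ∀ y ∈ ball (0 : E2) r,
      frameCoord τ m (A.symm (Φ (Φ.symm (Φ p + A (frameMap τ m y))) - Φ p)) = y := by
    intro y hy
    rw [Φ.right_inv (hrt y hy), add_sub_cancel_left, A.symm_apply_apply, hf.coord_map]
  -- The preimage of the plane {y₃ = 0} is spanned by τ and m, because a vector of it that is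
  -- orthogonal to both must vanish.
  have hspan : ∀ w : E3, A w 2 = 0 → frameMap τ m (frameCoord τ m w) = w := by
    intro w hw
    set z := w - frameMap τ m (frameCoord τ m w) with hz
    have hzz : z = 0 := by
      by_contra hne
      have hz1 : inner ℝ τ z = 0 := by
        have := congrArg (fun y : E2 => y 0) (hf.coord_map (frameCoord τ m w))
        simp only [frameCoord_zero] at this
        rw [hz, inner_sub_right, this]; ring
      have hz2 : inner ℝ m z = 0 := by
        have := congrArg (fun y : E2 => y 1) (hf.coord_map (frameCoord τ m w))
        simp only [frameCoord_one] at this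
        rw [hz, inner_sub_right, this]; ring
      have hz3 : A z 2 = 0 := by
        rw [hz, frameMap_apply]; simp [hw, h2, h4]
      -- `A τ`, `A m`, `A z` lie in a plane, and `A τ`, `A m` span it
      have hAτ0 : A τ 0 ≠ 0 := by
        intro h
        have : A τ = 0 := by ext i; fin_cases i <;> simp [h, h1, h2]
        have h5 : τ = 0 := by simpa using this
        have := hf.norm_left
        simp [h5] at this
      set β := A z 1 / A m 1 with hβ
      set α := (A z 0 - β * A m 0) / A τ 0 with hα
      have : A z = A (α • τ + β • m) := by
        ext i
        fin_cases i
        · simp [hα]; field_simp; ring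
        · simp [h1, hβ]; field_simp
        · simp [h2, h4, hz3]
      have hz4 := A.injective this
      have : inner ℝ z z = (0 : ℝ) := by
        nth_rw 1 [hz4]
        rw [inner_add_left, inner_smul_left, inner_smul_left, hz1, hz2]; simp
      exact hne (inner_self_eq_zero.1 this)
    rw [hz, sub_eq_zero] at hzz
    exact hzz.symm
  refine ⟨r, Φ.source ∩ (fun x => frameCoord τ m (A.symm (Φ x - Φ p))) ⁻¹' ball 0 r,
    ⟨hf, hr, ?_, ?_, ?_, ?_, ?_, ?_, ?_, ?_, ?_, ?_, ?_, ?_⟩, Set.inter_subset_left, hrt⟩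
  · exact hcs.continuousOn.isOpen_inter_preimage Φ.open_source isOpen_ball
  · refine ⟨hp, ?_⟩
    simp [hr]
  · simp [Φ.left_inv hp]
  · refine hΦ.2.comp (ContDiff.contDiffOn ?_) hrt
    exact contDiff_const.add ((A : E3 →L[ℝ] E3).contDiff.comp (frameMap τ m).contDiff)
  · have e1 : HasFDerivAt (fun y : E2 => Φ p + A (frameMap τ m y))
        ((A : E3 →L[ℝ] E3).comp (frameMap τ m)) 0 :=
      ((A : E3 →L[ℝ] E3).comp (frameMap τ m)).hasFDerivAt.const_add _
    have e2 : HasFDerivAt Φ.symm (A.symm : E3 →L[ℝ] E3) (Φ p + A (frameMap τ m 0)) := by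
      simpa using hA'
    have e3 := e2.comp (0 : E2) e1
    refine e3.congr_fderiv ?_
    ext y; simp
  · intro y hy
    refine ⟨⟨Φ.map_target (hrt y hy), ?_⟩, hco y hy,
      hD _ (Φ.map_target (hrt y hy)) y (Φ.right_inv (hrt y hy))⟩
    simp only [Set.mem_preimage]
    rw [hco y hy]; exact hy
  · rintro x ⟨hx, hxr⟩ hxS
    refine ⟨hxr, ?_⟩
    rw [hspan, A.apply_symm_apply, add_sub_cancel, Φ.left_inv hx]
    simp [show Φ x 2 = 0 from hxS, h0]
  · exact hcs.mono Set.inter_subset_left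
  · exact ((coordL 2).contDiff.comp_contDiffOn
      hΦ.1).mono Set.inter_subset_left
  · rintro x ⟨hx, -⟩ hxS
    exact hS x hx hxS
  · rintro x ⟨hx, -⟩ h
    obtain ⟨B, hB, -⟩ := chart_fderiv hΦ hx
    have h5 := fderiv_coord hB.differentiableAt (B.symm (bv 2)) 2
    rw [h, hB.fderiv] at h5
    simp at h5
  · intro y hy
    rw [Φ.right_inv (hrt y hy), frameMap_apply]
    simp [h0, h2, h4]

lemma exists_param_interior (h : IsInteriorPoint S p) :
    ∃ F c h τ m r U, IsParam S p Set.univ F c h τ m r U := by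
  obtain ⟨hpS, Φ, hp, hΦ, hS⟩ := h
  obtain ⟨A, hA, hA'⟩ := chart_fderiv hΦ hp
  obtain ⟨τ, m, hf, h1, h2, h3, h4⟩ := exists_frame A
  have h0 := (hS p hp).1 hpS
  obtain ⟨r, U, h, -, -⟩ := exists_param_of_chart (S := S) (D := Set.univ) hp hΦ hA' hf h1 h2 h3 h4
    h0 (fun x hx hxS => (hS x hx).1 hxS) (by
      intro x hx y hy
      rw [hS x hx, hy, frameMap_apply]
      simp [h0, h2, h4])
  exact ⟨_, _, _, _, _, _, _, h⟩

lemma exists_param_boundary (h : IsBoundaryPoint S p) :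
    ∃ F c h τ m r U, IsParam S p halfD F c h τ m r U ∧
      ∀ y ∈ ball (0 : E2) r, (y 1 = 0 → IsBoundaryPoint S (F y)) ∧
        (0 < y 1 → IsInteriorPoint S (F y)) := by
  obtain ⟨hpS, Φ, hp, hΦ, h1p, hS⟩ := h
  obtain ⟨A, hA, hA'⟩ := chart_fderiv hΦ hp
  obtain ⟨τ, m, hf, h1, h2, h3, h4⟩ := exists_frame A
  have h0 := ((hS p hp).1 hpS).1
  have hD : ∀ x ∈ Φ.source, ∀ y, Φ x = Φ p + A (frameMap τ m y) → (x ∈ S ↔ y ∈ halfD) := by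
    intro x hx y hy
    rw [hS x hx, hy, frameMap_apply]
    simp [h0, h2, h4, h1p, h1, halfD, h3]
  obtain ⟨r, U, h, hU, ht⟩ := exists_param_of_chart (S := S) (D := halfD) hp hΦ hA' hf h1 h2 h3 h4
    h0 (fun x hx hxS => ((hS x hx).1 hxS).1) hD
  refine ⟨_, _, _, _, _, _, _, h, ?_⟩
  intro y hy
  set x := Φ.symm (Φ p + A (frameMap τ m y)) with hx
  have hxs : x ∈ Φ.source := hU (h.maps y hy).1
  have hxt : Φ p + A (frameMap τ m y) ∈ Φ.target := ht y hy
  have hΦx : Φ x 1 = y 1 * A m 1 := by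
    rw [hx, Φ.right_inv hxt, frameMap_apply]; simp [h1p, h1]
  have hmem : x ∈ S ↔ 0 ≤ y 1 := (h.maps y hy).2.2
  refine ⟨fun hy0 => ⟨hmem.2 hy0.ge, Φ, hxs, hΦ, by rw [hΦx, hy0]; ring, hS⟩, fun hy0 => ?_⟩
  -- On the open part {y₂ > 0} the condition y₂ ≥ 0 holds automatically, so the restricted boundary
  -- chart is an interior chart.
  refine ⟨hmem.2 hy0.le, Φ.restrOpen (Φ.source ∩ Φ ⁻¹' {z | 0 < z 1}) ?_, ?_, ?_, ?_⟩
  · exact Φ.isOpen_inter_preimage (isOpen_lt continuous_const (by fun_prop))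
  · simp [hxs, hΦx, hy0, h3]
  · refine ⟨hΦ.1.mono (by simp), hΦ.2.mono ?_⟩
    exact fun z hz => hz.1
  · intro z hz
    simp only [OpenPartialHomeomorph.restrOpen_source, Set.mem_inter_iff, Set.mem_preimage,
      Set.mem_ofPred_eq] at hz
    have := hS z hz.1
    change z ∈ S ↔ Φ z 2 = 0
    rw [this]
    exact ⟨fun h => h.1, fun h => ⟨h, hz.2.2.le⟩⟩

lemma IsParam.coord_hasFDerivAt (H : IsParam S p D F c h τ m r U) {y : E2}
    (hy : y ∈ ball (0 : E2) r) :
    (fderiv ℝ c (F y)).comp (fderiv ℝ F y) = ContinuousLinearMap.id ℝ E2 := by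
  have hF := ((H.smooth.contDiffAt (isOpen_ball.mem_nhds hy)).differentiableAt
    (by simp)).hasFDerivAt
  have hc := ((H.coord_smooth.contDiffAt (H.isOpen.mem_nhds (H.maps y hy).1)).differentiableAt
    (by simp)).hasFDerivAt
  refine (hc.comp y hF).unique ((hasFDerivAt_id y).congr_of_eventuallyEq ?_)
  filter_upwards [isOpen_ball.mem_nhds hy] with z hz using (H.maps z hz).2.1

/-- The domain of a parametrisation is a full plane or a half-plane. -/
def IsDomain2 (D : Set E2) : Prop := D = Set.univ ∨ D = halfD

lemma IsDomain2.convex (h : IsDomain2 D) : Convex ℝ D := by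
  rcases h with rfl | rfl
  · exact convex_univ
  · exact convex_halfSpace_ge (f := fun y : E2 => y 1) ⟨fun _ _ => rfl, fun _ _ => rfl⟩ 0

lemma IsDomain2.exists_ball (h : IsDomain2 D) (hr : 0 < r) :
    ∃ z : E2, ∃ s > 0, ball z s ⊆ D ∩ ball 0 r := by
  refine ⟨EuclideanSpace.single 1 (r / 2), r / 2, by positivity, fun y hy => ⟨?_, ?_⟩⟩
  · rcases h with rfl | rfl
    · trivial
    · have h1 := (PiLp.norm_apply_le (y - EuclideanSpace.single 1 (r / 2)) 1).trans_lt
        (mem_ball_iff_norm.1 hy)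
      simp only [PiLp.sub_apply, PiLp.single_apply, if_true, Real.norm_eq_abs, abs_lt] at h1
      have := h1.1
      simp only [halfD, Set.mem_ofPred_eq]
      linarith
  · have h2 : ‖(EuclideanSpace.single 1 (r / 2) : E2)‖ = r / 2 := by
      simp [abs_of_pos hr]
    rw [mem_ball_zero_iff]
    rw [mem_ball_iff_norm] at hy
    have := norm_add_le (y - EuclideanSpace.single 1 (r / 2)) (EuclideanSpace.single 1 (r / 2))
    rw [sub_add_cancel, h2] at this
    linarith

lemma grd_ne_zero {x : E3} (hx : fderiv ℝ h x ≠ 0) : grd h x ≠ 0 := by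
  intro h0
  apply hx
  ext ξ
  rw [← inner_grd, h0]; simp

/-- The tangent cone lies in the kernel of Dh because h vanishes on S. Conversely the tangent cone
of the convex domain D spans the parameter plane, also at its boundary points, and DF is injective;
a dimension count closes the gap. -/
lemma IsParam.tangentPlane_eq (H : IsParam S p D F c h τ m r U)
    (hD : IsDomain2 D) {x : E3} (hx : x ∈ U) (hxS : x ∈ S) :
    tangentPlane S x = (ℝ ∙ (grd h x))ᗮ := by
  obtain ⟨hcx, hFc⟩ := H.coord x hx (H.def_zero x hx hxS)
  set y := c x with hy
  have hg : grd h x ≠ 0 := grd_ne_zero (H.def_ne x hx)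
  have hle : tangentPlane S x ≤ (ℝ ∙ (grd h x))ᗮ := by
    intro ξ hξ
    rw [mem_perp_iff, inner_grd]
    have hd := (H.def_smooth.contDiffAt (H.isOpen.mem_nhds hx)).differentiableAt
      (by simp : (∞ : WithTop ℕ∞) ≠ 0)
    rw [fderiv_eq_of_eqOn hxS hd (differentiableAt_const (0 : ℝ)) _ hξ]
    · simp
    · filter_upwards [H.isOpen.mem_nhds hx] with z hz using H.def_zero z hz
  have hFd := ((H.smooth.contDiffAt (isOpen_ball.mem_nhds hcx)).differentiableAt
    (by simp)).hasFDerivAt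
  have hyD : y ∈ D := (H.maps y hcx).2.2.1 (hFc.symm ▸ hxS)
  have hsp : Submodule.span ℝ (tangentConeAt ℝ (D ∩ ball 0 r) y) = ⊤ := by
    refine (hD.convex.inter (convex_ball 0 r)).span_tangentConeAt ?_ (subset_closure ⟨hyD, hcx⟩)
    obtain ⟨z, s, hs, hz⟩ := hD.exists_ball H.pos
    exact ⟨z, interior_mono hz (by rw [isOpen_ball.interior_eq]; simpa using hs)⟩
  have hrange : LinearMap.range (fderiv ℝ F y : E2 →ₗ[ℝ] E3) ≤ tangentPlane S x := by
    rw [LinearMap.range_eq_map, ← hsp, Submodule.map_span_le]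
    intro ξ hξ
    have h1 := (hFd.hasFDerivWithinAt (s := D ∩ ball 0 r)).mapsTo_tangent_cone hξ
    rw [hFc] at h1
    refine Submodule.subset_span (tangentConeAt_mono ?_ h1)
    rintro _ ⟨z, ⟨hzD, hz⟩, rfl⟩
    exact (H.maps z hz).2.2.2 hzD
  have hinj : Function.Injective (fderiv ℝ F y : E2 →ₗ[ℝ] E3) := by
    intro u v huv
    have h1 := congrArg (fun L => L u) (H.coord_hasFDerivAt hcx)
    have h2 := congrArg (fun L => L v) (H.coord_hasFDerivAt hcx)
    simp only [ContinuousLinearMap.comp_apply, ContinuousLinearMap.id_apply] at h1 h2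
    rw [← h1, ← h2]
    exact congrArg _ huv
  have hfr : Module.finrank ℝ (LinearMap.range (fderiv ℝ F y : E2 →ₗ[ℝ] E3)) = 2 := by
    rw [LinearMap.finrank_range_of_inj hinj]; simp
  have hfr2 : Module.finrank ℝ ((ℝ ∙ (grd h x))ᗮ : Submodule ℝ E3) = 2 := by
    have : Fact (Module.finrank ℝ E3 = 2 + 1) := ⟨by simp⟩
    exact Submodule.finrank_orthogonal_span_singleton hg
  refine Submodule.eq_of_le_of_finrank_le hle ?_
  rw [hfr2, ← hfr]
  exact Submodule.finrank_mono hrange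

lemma volume_le_of_lipschitzOnWith {K : NNReal} {A : Set E3}
    (h : LipschitzOnWith K c A) : volume (c '' A) ≤ (K : ENNReal) ^ 2 * μHE[2] A := by
  rw [← EuclideanSpace.euclideanHausdorffMeasure_eq_volume, Measure.euclideanHausdorffMeasure_def,
    Measure.euclideanHausdorffMeasure_def]
  have h1 := h.hausdorffMeasure_image_le (d := ((2 : ℕ) : ℝ)) (by norm_num)
  simp only [Measure.smul_apply, ENNReal.smul_def, smul_eq_mul]
  calc _ ≤ _ * (((K : ENNReal) ^ ((2 : ℕ) : ℝ)) * (μH[((2 : ℕ) : ℝ)] A)) := by gcongr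
    _ = _ := by rw [ENNReal.rpow_natCast]; ring

/-- The coordinate map is Lipschitz near p and the image of S ∩ W contains a disc. This turns
vanishing almost everywhere on S into pointwise vanishing for continuous functions. -/
lemma IsParam.measure_pos (H : IsParam S p D F c h τ m r U)
    (hD : IsDomain2 D) {W : Set E3} (hW : W ∈ nhds p) : 0 < μHE[2] (S ∩ W) := by
  have hcp := H.coord_smooth.contDiffAt (H.isOpen.mem_nhds H.mem)
  obtain ⟨K, t, ht, hLip⟩ := (hcp.of_le one_le_infty).exists_lipschitzOnWith
  have hF : ContinuousAt F 0 := H.deriv_zero.continuousAt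
  have hnb : ∀ᶠ y in nhds (0 : E2), F y ∈ W ∩ t := by
    apply hF.eventually_mem
    rw [H.base]; exact inter_mem hW ht
  obtain ⟨s, hs, hst⟩ := Metric.eventually_nhds_iff_ball.1 hnb
  obtain ⟨z, s', hs', hz⟩ := hD.exists_ball (lt_min hs H.pos)
  have hsub : ball z s' ⊆ c '' (S ∩ W ∩ t) := by
    intro y hy
    have h1 := hz hy
    have hyr : y ∈ ball (0 : E2) r := Metric.ball_subset_ball (min_le_right _ _) h1.2
    have hys : y ∈ ball (0 : E2) s := Metric.ball_subset_ball (min_le_left _ _) h1.2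
    exact ⟨F y, ⟨⟨(H.maps y hyr).2.2.2 h1.1, (hst y hys).1⟩, (hst y hys).2⟩, (H.maps y hyr).2.1⟩
  have h1 := (measure_mono hsub).trans
    (volume_le_of_lipschitzOnWith (hLip.mono Set.inter_subset_right))
  have h2 : 0 < volume (ball z s') := Metric.measure_ball_pos _ _ hs'
  have h3 : 0 < (K : ENNReal) ^ 2 * μHE[2] (S ∩ W ∩ t) := h2.trans_le h1
  exact (ENNReal.mul_pos_iff.1 h3).2.trans_le (measure_mono Set.inter_subset_left)

/-- Along a full disc in S the boundary chart coordinate y₂ has a minimum at p and y₃ is constant.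
Both have zero derivative there, so the derivative of the parametrisation would have rank at most
one. -/
lemma not_interior_and_boundary (h1 : IsInteriorPoint S p) (h2 : IsBoundaryPoint S p) : False := by
  obtain ⟨F, c, h, τ, m, r, U, H⟩ := exists_param_interior h1
  obtain ⟨-, Φ, hp, hΦ, h1p, hS⟩ := h2
  obtain ⟨A, hA, hA'⟩ := chart_fderiv hΦ hp
  have hp0 := H.base
  have hcomp : HasFDerivAt (fun y => Φ (F y)) ((A : E3 →L[ℝ] E3).comp (frameMap τ m)) 0 := by
    have hA2 : HasFDerivAt Φ (A : E3 →L[ℝ] E3) (F 0) := by rwa [hp0]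
    exact hA2.comp 0 H.deriv_zero
  have hi : ∀ i, HasFDerivAt (fun y => Φ (F y) i)
      ((coordL i).comp
        ((A : E3 →L[ℝ] E3).comp (frameMap τ m))) 0 := fun i =>
    (coordL i).hasFDerivAt.comp 0 hcomp
  have hev : ∀ᶠ y in nhds (0 : E2), Φ (F y) 2 = 0 ∧ 0 ≤ Φ (F y) 1 := by
    have e1 : ∀ᶠ y in nhds (0 : E2), F y ∈ Φ.source := by
      apply H.deriv_zero.continuousAt.eventually_mem
      rw [hp0]; exact Φ.open_source.mem_nhds hp
    filter_upwards [e1, ball_mem_nhds _ H.pos] with y hy1 hy2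
    exact (hS _ hy1).1 ((H.maps y hy2).2.2.2 trivial)
  have d1 := IsLocalMin.hasFDerivAt_eq_zero (f := fun y => Φ (F y) 1) (a := (0 : E2)) (by
    filter_upwards [hev] with y hy
    simp only [hp0, h1p]; exact hy.2) (hi 1)
  have d2 := (hi 2).unique ((hasFDerivAt_const (0 : ℝ) (0 : E2)).congr_of_eventuallyEq (by
    filter_upwards [hev] with y hy using hy.1))
  have key : ∀ y, A (frameMap τ m y) 1 = 0 ∧ A (frameMap τ m y) 2 = 0 := fun y =>
    ⟨congrArg (fun L => L y) d1, congrArg (fun L => L y) d2⟩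
  have kτ := key (EuclideanSpace.single 0 1)
  have km := key (EuclideanSpace.single 1 1)
  simp [frameMap_apply] at kτ km
  have hz : A (A m 0 • τ - A τ 0 • m) = 0 := by
    ext i
    fin_cases i <;> simp [kτ, km]
    ring
  have hz2 : A m 0 • τ - A τ 0 • m = 0 := A.map_eq_zero_iff.1 hz
  have hA0 : A τ 0 = 0 := by
    have h5 := congrArg (fun v => inner ℝ m v) hz2
    simp only [inner_sub_right, inner_smul_right, real_inner_comm τ m, H.frame.orth,
      H.frame.inner_right, inner_zero_right] at h5
    linarith
  have : A τ = 0 := by ext i; fin_cases i <;> simp [hA0, kτ]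
  have h6 : τ = 0 := by simpa using this
  have := H.frame.norm_left
  simp [h6] at this

/-! ### Measurability and integrability on surfaces -/

lemma IsPuncturedSurface.eq_closure_diff (h : IsPuncturedSurface S) :
    S = closure S \ {0} := by
  ext x
  refine ⟨fun hx => ⟨subset_closure hx, fun h0 => h.zero_notMem (h0 ▸ hx)⟩, fun ⟨h1, h2⟩ => ?_⟩
  exact (h.closed h1).resolve_right h2

lemma IsPuncturedSurface.measurableSet (h : IsPuncturedSurface S) :
    MeasurableSet S := by
  rw [h.eq_closure_diff]
  exact isClosed_closure.measurableSet.diff (measurableSet_singleton 0)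

lemma IsPuncturedSurface.isCompact_inter {S K : Set E3} (h : IsPuncturedSurface S)
    (hK : IsCompact K) (h0 : (0 : E3) ∉ K) : IsCompact (S ∩ K) := by
  have : S ∩ K = K ∩ closure S := by
    ext x
    refine ⟨fun hx => ⟨hx.2, subset_closure hx.1⟩, fun hx => ⟨(h.closed hx.2).resolve_right ?_, hx.1⟩⟩
    rintro rfl
    exact h0 hx.1
  rw [this]
  exact hK.inter_right isClosed_closure

/-- The area of `S` is finite on compact sets. -/
def HasLocFiniteArea (S : Set E3) : Prop := ∀ K : Set E3, IsCompact K → μHE[2] (S ∩ K) < ⊤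

lemma hasLocFiniteArea_of_bound {M : ℝ}
    (h : ∀ R : ℝ, 0 < R → μHE[2] (S ∩ closedBall (0 : E3) R) ≤ ENNReal.ofReal (M * R ^ 2)) :
    HasLocFiniteArea S := by
  intro K hK
  obtain ⟨R, hR, hKR⟩ := hK.isBounded.subset_closedBall_lt 0 (0 : E3)
  exact (measure_mono (Set.inter_subset_inter_right S hKR)).trans_lt
    ((h R hR).trans_lt ENNReal.ofReal_lt_top)

lemma isFrame_wall : IsFrame (bv 1) (bv 2) :=
  ⟨norm_bv 1, norm_bv 2, by simp [inner_three, bv_apply]⟩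

/-- No area bound is assumed for G; none is needed, since the wall is an isometric copy of the
plane. -/
lemma hasLocFiniteArea_of_subset_wall {G : Set E3} (h : G ⊆ wall) : HasLocFiniteArea G := by
  intro K hK
  obtain ⟨R, -, hKR⟩ := hK.isBounded.subset_closedBall_lt 0 (0 : E3)
  have hiso : Isometry (frameMap (bv 1) (bv 2)) :=
    AddMonoidHomClass.isometry_of_norm _ isFrame_wall.norm_map
  have hsub : G ∩ K ⊆ frameMap (bv 1) (bv 2) '' closedBall 0 R := by
    intro x hx
    have hx0 : x 0 = 0 := h hx.1
    have hxm : frameMap (bv 1) (bv 2) (!₂[x 1, x 2]) = x := by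
      rw [frameMap_apply]
      ext i; fin_cases i <;> simp [bv_apply, hx0]
    refine ⟨!₂[x 1, x 2], ?_, hxm⟩
    have h1 := hKR hx.2
    rw [mem_closedBall_zero_iff] at h1 ⊢
    rwa [← isFrame_wall.norm_map, hxm]
  refine (measure_mono hsub).trans_lt ?_
  rw [hiso.euclideanHausdorffMeasure_image, EuclideanSpace.euclideanHausdorffMeasure_eq_volume]
  exact (isCompact_closedBall _ _).measure_lt_top

lemma integrableOn_of_support {S K : Set E3} (hS : IsPuncturedSurface S) (hfin : HasLocFiniteArea S)
    (hK : IsCompact K) (h0 : (0 : E3) ∉ K) {f : E3 → ℝ} (hf : ContinuousOn f (S ∩ K))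
    (hz : ∀ x ∈ S, x ∉ K → f x = 0) : IntegrableOn f S μHE[2] := by
  have hc := hS.isCompact_inter hK h0
  obtain ⟨C, hC⟩ := hc.exists_bound_of_continuousOn hf
  have h1 : IntegrableOn f (S ∩ K) μHE[2] := by
    have : IsFiniteMeasure (μHE[2].restrict (S ∩ K)) := ⟨by simpa using hfin K hK⟩
    refine Integrable.of_bound (hf.aestronglyMeasurable hc.measurableSet) C ?_
    exact (ae_restrict_iff' hc.measurableSet).2 (Filter.Eventually.of_forall hC)
  exact h1.of_forall_sdiff_eq_zero hS.measurableSet fun x hx => hz x hx.1 fun hxK => hx.2 ⟨hx.1, hxK⟩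

/-! ### Normal fields -/

/-- `n` is a smooth unit normal field of `S` near `p`, with symmetric shape operator. -/
structure IsNormal (S : Set E3) (n : E3 → E3) (p : E3) : Prop where
  smooth : ∀ᶠ x in nhds p, ContDiffAt ℝ ∞ n x
  unit : ∀ᶠ x in nhds p, ‖n x‖ = 1
  plane : ∀ᶠ x in nhds p, x ∈ S → tangentPlane S x = (ℝ ∙ (n x))ᗮ
  split : ∀ᶠ x in nhds p, ∃ A k, IsSplit (fderiv ℝ n x) A (n x) k

lemma IsNormal.eventually {n : E3 → E3} (h : IsNormal S n p) :
    ∀ᶠ x in nhds p, IsNormal S n x := by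
  filter_upwards [h.smooth.eventually_nhds, h.unit.eventually_nhds, h.plane.eventually_nhds,
    h.split.eventually_nhds] with x h1 h2 h3 h4 using ⟨h1, h2, h3, h4⟩

/-- With g = ∇h and n = g/|g|, the derivative of n is |g|⁻¹ (Id − n nᵀ) D²h. Composed with the
projection to n^⊥ it is symmetric because the Hessian is, and k collects the value on n. -/
lemma isSplit_of_gradient {x : E3} (hh : ContDiffAt ℝ ∞ h x) (h0 : fderiv ℝ h x ≠ 0) :
    ∃ A k, IsSplit (fderiv ℝ (fun y => (‖grd h y‖⁻¹ : ℝ) • grd h y) x) A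
      ((‖grd h x‖⁻¹ : ℝ) • grd h x) k := by
  set n : E3 → E3 := fun y => (‖grd h y‖⁻¹ : ℝ) • grd h y with hn
  have hg0 := grd_ne_zero h0
  have hgs := grd_smooth hh
  have hgd : DifferentiableAt ℝ (grd h) x := hgs.differentiableAt (by simp)
  have hls : ContDiffAt ℝ ∞ (fun y => (‖grd h y‖⁻¹ : ℝ)) x :=
    (hgs.norm ℝ hg0).inv (norm_ne_zero_iff.2 hg0)
  have hld : DifferentiableAt ℝ (fun y => (‖grd h y‖⁻¹ : ℝ)) x := hls.differentiableAt (by simp)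
  have hnd : DifferentiableAt ℝ n x := hld.fun_smul hgd
  have hun : ∀ᶠ y in nhds x, ‖n y‖ = 1 := by
    filter_upwards [hgs.continuousAt.eventually_ne hg0] with y hy
    rw [hn]; simp only [norm_smul, norm_inv, norm_norm]
    exact inv_mul_cancel₀ (norm_ne_zero_iff.2 hy)
  have hn1 : ‖n x‖ = 1 := hun.self_of_nhds
  have hortho : ∀ ξ, inner ℝ (fderiv ℝ n x ξ) (n x) = (0 : ℝ) := inner_fderiv_unit hnd hun
  set l : ℝ := ‖grd h x‖⁻¹ with hl
  have hform : ∀ ξ, fderiv ℝ n x ξ = l • fderiv ℝ (grd h) x ξ -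
      (l * inner ℝ (fderiv ℝ (grd h) x ξ) (n x)) • n x := by
    intro ξ
    -- The derivative of 1/|g| need not be computed: its contribution is a multiple of `n x`, and
    -- the multiple is forced by the orthogonality of `fderiv ℝ n x ξ` to `n x`.
    obtain ⟨c, hc⟩ : ∃ c : ℝ, fderiv ℝ n x ξ = l • fderiv ℝ (grd h) x ξ + c • n x := by
      refine ⟨fderiv ℝ (fun y => (‖grd h y‖⁻¹ : ℝ)) x ξ * ‖grd h x‖, ?_⟩
      rw [hn, fderiv_fun_smul hld hgd]
      simp only [add_apply, smul_apply, ContinuousLinearMap.smulRight_apply, smul_smul]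
      rw [mul_assoc, mul_inv_cancel₀ (norm_ne_zero_iff.2 hg0), mul_one]
    have h1 := hortho ξ
    rw [hc, inner_add_left, inner_smul_left, inner_smul_left, real_inner_self_eq_norm_sq, hn1] at h1
    simp only [conj_trivial] at h1
    have : c = -(l * inner ℝ (fderiv ℝ (grd h) x ξ) (n x)) := by linarith
    rw [hc, this]; module
  set P : E3 →L[ℝ] E3 := ContinuousLinearMap.id ℝ E3 - (innerSL ℝ (n x)).smulRight (n x) with hP
  have hPa : ∀ ξ, P ξ = ξ - inner ℝ (n x) ξ • n x := by intro ξ; simp [hP]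
  have hnn : inner ℝ (n x) (n x) = (1 : ℝ) := by rw [real_inner_self_eq_norm_sq, hn1]; norm_num
  refine ⟨(fderiv ℝ n x).comp P, fderiv ℝ n x (n x), ⟨?_, ?_, ?_⟩⟩
  · intro ξ
    simp only [ContinuousLinearMap.comp_apply, hPa, map_sub, map_smul]
    change _ = _ + inner ℝ (n x) ξ • _
    module
  · intro i j
    have hs := fderiv_grd_symm hh
    have hin : ∀ v : E3, inner ℝ (fderiv ℝ (grd h) x v) (n x) =
        inner ℝ (fderiv ℝ (grd h) x (n x)) v := by
      intro v
      conv_lhs => rw [eq_sum_bv v]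
      conv_rhs => rw [eq_sum_bv (n x)]
      simp only [Fin.sum_univ_three, map_add, map_smul, inner_three, PiLp.add_apply,
        PiLp.smul_apply, smul_eq_mul]
      rw [hs 0 1, hs 0 2, hs 1 2]
      ring
    have hc : ∀ j, fderiv ℝ (grd h) x (n x) j = inner ℝ (fderiv ℝ (grd h) x (bv j)) (n x) := by
      intro j
      rw [hin, inner_bv_right]
    simp only [ContinuousLinearMap.comp_apply, hPa, map_sub, map_smul, hform, PiLp.sub_apply,
      PiLp.smul_apply, smul_eq_mul]
    have e : ∀ i, inner ℝ (n x) (bv i) = n x i := fun i => inner_bv_right _ _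
    rw [e, e, hc i, hc j, hs i j]
    simp only [inner_sub_left, inner_smul_left, conj_trivial]
    ring
  · change fderiv ℝ n x (P (n x)) = 0
    rw [hPa, hnn, one_smul, sub_self, map_zero]

lemma IsParam.isNormal (H : IsParam S p D F c h τ m r U) (hD : IsDomain2 D) {x : E3} (hx : x ∈ U) :
    IsNormal S (fun y => (‖grd h y‖⁻¹ : ℝ) • grd h y) x := by
  have hU := H.isOpen.mem_nhds hx
  have hs : ∀ y ∈ U, ContDiffAt ℝ ∞ h y := fun y hy =>
    H.def_smooth.contDiffAt (H.isOpen.mem_nhds hy)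
  have hne : ∀ y ∈ U, grd h y ≠ 0 := fun y hy => grd_ne_zero (H.def_ne y hy)
  refine ⟨?_, ?_, ?_, ?_⟩
  · filter_upwards [hU] with y hy
    exact (((grd_smooth (hs y hy)).norm ℝ (hne y hy)).inv (norm_ne_zero_iff.2 (hne y hy))).smul
      (grd_smooth (hs y hy))
  · filter_upwards [hU] with y hy
    simp only [norm_smul, norm_inv, norm_norm]
    exact inv_mul_cancel₀ (norm_ne_zero_iff.2 (hne y hy))
  · filter_upwards [hU] with y hy hyS
    rw [H.tangentPlane_eq hD hy hyS, Submodule.span_singleton_smul_eq]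
    exact isUnit_iff_ne_zero.2 (inv_ne_zero (norm_ne_zero_iff.2 (hne y hy)))
  · filter_upwards [hU] with y hy using isSplit_of_gradient (hs y hy) (H.def_ne y hy)

lemma IsPuncturedSurface.exists_param (hS : IsPuncturedSurface S)
    (hp : p ∈ S) : ∃ D F c h τ m r U, IsDomain2 D ∧ IsParam S p D F c h τ m r U := by
  rcases hS.smooth p hp with h | h
  · obtain ⟨F, c, h, τ, m, r, U, H⟩ := exists_param_interior h
    exact ⟨_, F, c, h, τ, m, r, U, Or.inl rfl, H⟩
  · obtain ⟨F, c, h, τ, m, r, U, H, -⟩ := exists_param_boundary h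
    exact ⟨_, F, c, h, τ, m, r, U, Or.inr rfl, H⟩

lemma IsPuncturedSurface.exists_normal (hS : IsPuncturedSurface S)
    (hp : p ∈ S) : ∃ n, IsNormal S n p := by
  obtain ⟨D, F, c, h, τ, m, r, U, hD, H⟩ := hS.exists_param hp
  exact ⟨_, H.isNormal hD H.mem⟩

lemma IsPuncturedSurface.measure_pos (hS : IsPuncturedSurface S)
    (hp : p ∈ S) {W : Set E3} (hW : W ∈ nhds p) : 0 < μHE[2] (S ∩ W) := by
  obtain ⟨D, F, c, h, τ, m, r, U, hD, H⟩ := hS.exists_param hp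
  exact H.measure_pos hD hW

lemma eq_or_eq_neg_of_orthogonal_le {u v : E3} (hu : ‖u‖ = 1) (hv : ‖v‖ = 1)
    (h : (ℝ ∙ u)ᗮ ≤ (ℝ ∙ v)ᗮ) : u = v ∨ u = -v := by
  have h1 : v - inner ℝ u v • u ∈ (ℝ ∙ v)ᗮ := by
    refine h ?_
    rw [mem_perp_iff, inner_sub_right, inner_smul_right,
      real_inner_self_eq_norm_sq, hu]
    ring
  rw [mem_perp_iff, inner_sub_right, inner_smul_right,
    real_inner_self_eq_norm_sq, hv, real_inner_comm u v] at h1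
  set c := inner ℝ u v
  have hc : (c - 1) * (c + 1) = 0 := by nlinarith
  rcases mul_eq_zero.1 hc with hc | hc
  · left
    rw [← inner_eq_one_iff_of_norm_eq_one (𝕜 := ℝ) hu hv]
    change c = 1
    linarith
  · right
    rw [← inner_eq_one_iff_of_norm_eq_one (𝕜 := ℝ) hu (by rwa [norm_neg]), inner_neg_right]
    change -c = 1
    linarith

lemma tangentialDiv_eq_sdiv {x n : E3} (hn : ‖n‖ = 1)
    (h : tangentPlane S x = (ℝ ∙ n)ᗮ) (X : E3 → E3) :
    tangentialDiv (tangentPlane S x) X x = sdiv (fderiv ℝ X x) n :=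
  tangentialDiv_eq hn h X x

lemma continuousAt_sdiv {X : E3 → E3} {n : E3 → E3} (hX : ContDiffAt ℝ ∞ X p)
    (hn : ContinuousAt n p) : ContinuousAt (fun x => sdiv (fderiv ℝ X x) (n x)) p := by
  have h1 : ContinuousAt (fderiv ℝ X) p := (smooth_fderiv hX).continuousAt
  unfold sdiv
  refine ContinuousAt.sub ?_ ((h1.clm_apply hn).inner hn)
  fun_prop

lemma IsPuncturedSurface.continuousOn_tangentialDiv (hS : IsPuncturedSurface S)
    {X : E3 → E3} (hX : ContDiff ℝ ∞ X) :
    ContinuousOn (fun x => tangentialDiv (tangentPlane S x) X x) S := by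
  intro p hp
  obtain ⟨n, hn⟩ := hS.exists_normal hp
  have h1 : ContinuousWithinAt (fun x => sdiv (fderiv ℝ X x) (n x)) S p :=
    (continuousAt_sdiv hX.contDiffAt hn.smooth.self_of_nhds.continuousAt).continuousWithinAt
  refine h1.congr_of_eventuallyEq ?_ ?_
  · filter_upwards [mem_nhdsWithin_of_mem_nhds (hn.unit.and hn.plane), self_mem_nhdsWithin]
      with x hx hxS using tangentialDiv_eq_sdiv hx.1 (hx.2 hxS) X
  · exact tangentialDiv_eq_sdiv hn.unit.self_of_nhds (hn.plane.self_of_nhds hp) X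

/-! ### Minimality -/

lemma contDiff_smul_of_tsupport {F : Type*} [NormedAddCommGroup F] [NormedSpace ℝ F] {f : E3 → ℝ}
    {W : E3 → F} (hf : ContDiff ℝ ∞ f) (hW : ∀ x ∈ tsupport f, ContDiffAt ℝ ∞ W x) :
    ContDiff ℝ ∞ (fun x => f x • W x) := by
  rw [contDiff_iff_contDiffAt]
  intro x
  by_cases hx : x ∈ tsupport f
  · exact hf.contDiffAt.smul (hW x hx)
  · refine (contDiffAt_const (c := (0 : F))).congr_of_eventuallyEq ?_
    filter_upwards [(isClosed_tsupport f).isOpen_compl.mem_nhds hx] with y hy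
    rw [image_eq_zero_of_notMem_tsupport hy, zero_smul]

lemma tsupport_smul_subset {F : Type*} [NormedAddCommGroup F] [NormedSpace ℝ F] (f : E3 → ℝ)
    (W : E3 → F) : tsupport (fun x => f x • W x) ⊆ tsupport f :=
  closure_mono fun x hx h0 => hx (by simp only [h0, zero_smul])

lemma hasCompactSupport_smul {F : Type*} [NormedAddCommGroup F] [NormedSpace ℝ F] {f : E3 → ℝ}
    (hf : HasCompactSupport f) (W : E3 → F) : HasCompactSupport (fun x => f x • W x) :=
  hf.of_isClosed_subset (isClosed_tsupport _) (tsupport_smul_subset f W)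

lemma mem_wallPlane {v : E3} : v ∈ wallPlane ↔ v 0 = 0 := Iff.rfl

lemma isTestField_smul {f : E3 → ℝ} {W : E3 → E3} (hf : ContDiff ℝ ∞ f) (hc : HasCompactSupport f)
    (h0 : (0 : E3) ∉ tsupport f) (hW : ∀ x ∈ tsupport f, ContDiffAt ℝ ∞ W x)
    (ht : ∀ x ∈ wall, f x ≠ 0 → W x 0 = 0) : IsTestField (fun x => f x • W x) := by
  refine ⟨contDiff_smul_of_tsupport hf hW, hasCompactSupport_smul hc W,
    fun h => h0 (tsupport_smul_subset f W h), fun x hx => ?_⟩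
  rw [mem_wallPlane, PiLp.smul_apply, smul_eq_mul]
  by_cases h : f x = 0
  · simp [h]
  · rw [ht x hx h, mul_zero]

/-- A smooth bump function near `p`. -/
lemma exists_bump {W : Set E3} (hW : W ∈ nhds p) : ∃ f : E3 → ℝ, ContDiff ℝ ∞ f ∧
    HasCompactSupport f ∧ tsupport f ⊆ W ∧ (∀ x, 0 ≤ f x) ∧ ∀ᶠ x in nhds p, f x = 1 := by
  obtain ⟨r, hr, hrW⟩ := Metric.mem_nhds_iff.1 hW
  let f : ContDiffBump p := ⟨r / 4, r / 2, by positivity, by linarith⟩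
  refine ⟨f, f.contDiff, f.hasCompactSupport, ?_, fun x => f.nonneg, f.eventuallyEq_one⟩
  rw [f.tsupport_eq]
  exact (Metric.closedBall_subset_ball (by simp only [f]; linarith)).trans hrW

lemma sdiv_smul_normal {n : E3 → E3} {f : E3 → ℝ} (hf : DifferentiableAt ℝ f p)
    (hd : DifferentiableAt ℝ n p) (hn : ∀ᶠ x in nhds p, ‖n x‖ = 1) :
    sdiv (fderiv ℝ (fun x => f x • n x) p) (n p) = f p * edivg n p := by
  rw [sdiv_fderiv_smul _ hf hd, sdiv_unit hd hn, real_inner_self_eq_norm_sq, hn.self_of_nhds]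
  ring

lemma fderiv_zero_of_notMem_tsupport {X : E3 → E3} {x : E3} (hx : x ∉ tsupport X) :
    fderiv ℝ X x = 0 := by
  by_contra h
  exact hx (support_fderiv_subset ℝ h)

lemma sdiv_zero (n : E3) : sdiv 0 n = 0 := by simp [sdiv]

lemma tangentialDiv_of_notMem_tsupport (P : Submodule ℝ E3) {X : E3 → E3} {x : E3}
    (hx : x ∉ tsupport X) : tangentialDiv P X x = 0 := by
  simp [tangentialDiv, fderiv_zero_of_notMem_tsupport hx]

/-- First variation of a field supported away from the wall. -/
lemma IsStationary.integral_eq_zero (h : IsStationary a S G)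
    (hG : G ⊆ wall) {X : E3 → E3} (hX : IsTestField X) (hd : Disjoint (tsupport X) wall) :
    ∫ x in S, tangentialDiv (tangentPlane S x) X x ∂μHE[2] = 0 := by
  have h1 := h X hX
  unfold firstVariation at h1
  rw [setIntegral_eq_zero_of_forall_eq_zero (t := G), mul_zero, add_zero] at h1
  · exact h1
  · intro x hx
    exact tangentialDiv_of_notMem_tsupport _ fun hxs => Set.disjoint_left.1 hd hxs (hG hx)

/-- For a bump f and a constant ε with the sign of the mean curvature H at p, the field f ε n has
first variation ∫ f ε H, which is positive unless H(p) = 0. Such a field is in general not tangent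
to the wall, hence the restriction to points above it. -/
lemma edivg_eq_zero_of_pos (hpair : IsSurfacePair S G)
    (hstat : IsStationary a S G) (hfin : HasLocFiniteArea S) (hp : p ∈ S) (hp0 : 0 < p 0)
    {n : E3 → E3} (hn : IsNormal S n p) : edivg n p = 0 := by
  by_contra hne
  have hS := hpair.surface_left
  obtain ⟨ε, hpos⟩ : ∃ ε : ℝ, 0 < ε * edivg n p := ⟨edivg n p, mul_self_pos.2 hne⟩
  have hec : ContinuousAt (fun x => ε * edivg n x) p :=
    continuousAt_const.mul (edivg_smooth hn.smooth.self_of_nhds).continuousAt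
  have hx0 : ContinuousAt (fun x : E3 => x 0) p := by fun_prop
  obtain ⟨f, hf, hfc, hfW, hf0, hf1⟩ := exists_bump (p := p)
    (hn.eventually.and ((hec.eventually (lt_mem_nhds hpos)).and (hx0.eventually (lt_mem_nhds hp0))))
  have hW : ∀ x ∈ tsupport f, IsNormal S n x ∧ 0 < ε * edivg n x ∧ 0 < x 0 := fun x hx => hfW hx
  have htest : IsTestField (fun x => f x • (ε • n x)) := by
    refine isTestField_smul hf hfc (fun h => ?_) (fun x hx => ?_) (fun x hx hfx => ?_)
    · simpa using (hW 0 h).2.2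
    · exact (contDiffAt_const (c := ε)).smul (hW x hx).1.smooth.self_of_nhds
    · have := (hW x (subset_tsupport f hfx)).2.2
      rw [show x 0 = 0 from hx] at this
      exact absurd this (lt_irrefl 0)
  have hint := hstat.integral_eq_zero hpair.right_subset htest (by
    refine Set.disjoint_left.2 fun x hx hxw => ?_
    have := (hW x (tsupport_smul_subset f _ hx)).2.2
    rw [show x 0 = 0 from hxw] at this
    exact lt_irrefl 0 this)
  have hval : ∀ x ∈ S, tangentialDiv (tangentPlane S x) (fun x => f x • (ε • n x)) x =
      f x * (ε * edivg n x) := by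
    intro x hx
    by_cases hxs : x ∈ tsupport f
    · obtain ⟨h1, -, -⟩ := hW x hxs
      have hd : DifferentiableAt ℝ n x := h1.smooth.self_of_nhds.differentiableAt (by simp)
      have hfd : DifferentiableAt ℝ f x := hf.contDiffAt.differentiableAt (by simp)
      rw [tangentialDiv_eq_sdiv h1.unit.self_of_nhds (h1.plane.self_of_nhds hx)]
      simp only [smul_smul]
      rw [sdiv_smul_normal (hfd.mul_const ε) hd h1.unit]
      ring
    · rw [tangentialDiv_of_notMem_tsupport _ fun h => hxs (tsupport_smul_subset f _ h),
        image_eq_zero_of_notMem_tsupport hxs, zero_mul]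
  have hnonneg : ∀ x ∈ S, 0 ≤ f x * (ε * edivg n x) := by
    intro x _
    by_cases hxs : x ∈ tsupport f
    · exact mul_nonneg (hf0 x) (hW x hxs).2.1.le
    · rw [image_eq_zero_of_notMem_tsupport hxs, zero_mul]
  rw [setIntegral_congr_fun hS.measurableSet hval] at hint
  have hI : IntegrableOn (fun x => f x * (ε * edivg n x)) S μHE[2] := by
    refine (integrableOn_of_support hS hfin hfc (fun h => ?_)
      ((hS.continuousOn_tangentialDiv htest.smooth).mono Set.inter_subset_left)
      (fun x hx hxs => ?_)).congr_fun hval hS.measurableSet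
    · simpa using (hW 0 h).2.2
    · exact tangentialDiv_of_notMem_tsupport _ fun h => hxs (tsupport_smul_subset f _ h)
  have h0 := (setIntegral_eq_zero_iff_of_nonneg_ae
    ((ae_restrict_iff' hS.measurableSet).2 (Filter.Eventually.of_forall hnonneg)) hI).1 hint
  have hmp := hS.measure_pos hp (inter_mem hf1 (hec.eventually (lt_mem_nhds hpos)))
  rw [Filter.EventuallyEq, ae_iff, Measure.restrict_apply' hS.measurableSet] at h0
  refine hmp.ne' (measure_mono_null ?_ h0)
  rintro x ⟨hxS, hx1, hx2⟩
  refine ⟨?_, hxS⟩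
  have h1 : f x = 1 := hx1
  have h2 : 0 < ε * edivg n x := hx2
  simp only [Set.mem_ofPred_eq, Pi.zero_apply, h1, one_mul]
  exact h2.ne'

/-- If `S` is contained in the wall near `p`, its normal is vertical near `p`. -/
lemma IsNormal.eq_of_subset_wall {n : E3 → E3}
    (hn : IsNormal S n p) (hw : ∀ᶠ x in nhds p, x ∈ S → x 0 = 0) (hp : p ∈ S) :
    ∃ ε : ℝ, (ε = 1 ∨ ε = -1) ∧ ∀ᶠ x in nhds p, x ∈ S → n x = ε • bv 0 := by
  have key : ∀ᶠ x in nhds p, x ∈ S → n x = bv 0 ∨ n x = -bv 0 := by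
    filter_upwards [hn.eventually, hw.eventually_nhds] with x hx hwx hxS
    have hle : tangentPlane S x ≤ (ℝ ∙ (bv 0))ᗮ := by
      intro ξ hξ
      have h1 := fderiv_eq_of_eqOn (f := fun y : E3 => y 0) (g := fun _ => (0 : ℝ)) hxS
        (by fun_prop) (by fun_prop) hwx hξ
      have h2 : fderiv ℝ (fun y : E3 => y 0) x = EuclideanSpace.proj (𝕜 := ℝ) 0 :=
        (coordL 0).fderiv
      rw [h2] at h1
      rw [mem_perp_iff, real_inner_comm, inner_bv_right]
      simpa using h1
    have hne : n x ≠ 0 := by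
      intro h; have := hx.unit.self_of_nhds; simp [h] at this
    have hne2 : bv 0 ≠ 0 := by
      intro h; have := norm_bv 0; simp [h] at this
    have hfact : Fact (Module.finrank ℝ E3 = 2 + 1) := ⟨by simp⟩
    rw [hx.plane.self_of_nhds hxS] at hle
    have heq := Submodule.eq_of_le_of_finrank_le hle (by
      rw [Submodule.finrank_orthogonal_span_singleton (n := 2) hne,
        Submodule.finrank_orthogonal_span_singleton (n := 2) hne2])
    exact eq_or_eq_neg_of_orthogonal_le hx.unit.self_of_nhds (norm_bv 0) heq.le
  have hc : ContinuousAt (fun x => n x 0) p := by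
    have := hn.smooth.self_of_nhds.continuousAt
    fun_prop
  have hb : bv 0 0 = 1 := by simp [bv_apply]
  rcases key.self_of_nhds hp with h | h
  · refine ⟨1, Or.inl rfl, ?_⟩
    have h1 : 0 < n p 0 := by rw [h, hb]; norm_num
    filter_upwards [key, hc.eventually (lt_mem_nhds h1)] with x hx hx1 hxS
    rcases hx hxS with h2 | h2
    · rw [h2, one_smul]
    · rw [h2] at hx1; simp at hx1; linarith
  · refine ⟨-1, Or.inr rfl, ?_⟩
    have h1 : n p 0 < 0 := by rw [h, PiLp.neg_apply, hb]; norm_num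
    filter_upwards [key, hc.eventually (gt_mem_nhds h1)] with x hx hx1 hxS
    rcases hx hxS with h2 | h2
    · rw [h2, hb] at hx1; linarith
    · rw [h2, neg_one_smul]

lemma edivg_eq_zero (hpair : IsSurfacePair S G)
    (hstat : IsStationary a S G) (hfin : HasLocFiniteArea S) (hp : p ∈ S)
    {n : E3 → E3} (hn : IsNormal S n p) : edivg n p = 0 := by
  -- Either p is a limit of points of S off the wall and continuity applies, or S lies in the wall
  -- near p and the normal is constantly ±e₁ there.
  by_cases hcl : p ∈ closure (S ∩ {x | 0 < x 0})
  · have hc : ContinuousAt (edivg n) p := (edivg_smooth hn.smooth.self_of_nhds).continuousAt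
    rw [mem_closure_iff_nhdsWithin_neBot] at hcl
    refine tendsto_nhds_unique (hc.continuousWithinAt (s := S ∩ {x | 0 < x 0})).tendsto
      (tendsto_const_nhds.congr' ?_)
    filter_upwards [mem_nhdsWithin_of_mem_nhds hn.eventually, self_mem_nhdsWithin] with x hx hxS
    exact (edivg_eq_zero_of_pos hpair hstat hfin hxS.1 hxS.2 hx).symm
  · have hw : ∀ᶠ x in nhds p, x ∈ S → x 0 = 0 := by
      filter_upwards [isClosed_closure.isOpen_compl.mem_nhds hcl] with x hx hxS
      by_contra h
      exact hx (subset_closure ⟨hxS, lt_of_le_of_ne (hpair.left_subset hxS) (Ne.symm h)⟩)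
    obtain ⟨ε, -, hε⟩ := hn.eq_of_subset_wall hw hp
    have hd : DifferentiableAt ℝ n p := hn.smooth.self_of_nhds.differentiableAt (by simp)
    rw [← sdiv_unit hd hn.unit, sdiv_fderiv_congr hn.unit.self_of_nhds hp (hn.plane.self_of_nhds hp)
      hd (differentiableAt_const (ε • bv 0)) hε]
    simp [sdiv_zero]

lemma IsNormal.minimal (hpair : IsSurfacePair S G)
    (hstat : IsStationary a S G) (hfin : HasLocFiniteArea S)
    {n : E3 → E3} (hn : IsNormal S n p) : IsMinimalNormal S n p := by
  refine ⟨hn.smooth.self_of_nhds, hn.unit, hn.plane, hn.split.self_of_nhds, ?_⟩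
  filter_upwards [hn.eventually] with x hx hxS using edivg_eq_zero hpair hstat hfin hxS hx

lemma IsNormal.neg {n : E3 → E3} (hn : IsNormal S n p) :
    IsNormal S (fun x => -n x) p := by
  refine ⟨?_, ?_, ?_, ?_⟩
  · filter_upwards [hn.smooth] with x hx using hx.neg
  · filter_upwards [hn.unit] with x hx using by rwa [norm_neg]
  · filter_upwards [hn.plane] with x hx hxS
    rw [hx hxS, ← neg_one_smul ℝ (n x), Submodule.span_singleton_smul_eq (by simp)]
  · filter_upwards [hn.split] with x ⟨A, k, h1, h2, h3⟩
    refine ⟨-A, k, fun ξ => ?_, fun i j => ?_, ?_⟩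
    · rw [fderiv_fun_neg]
      simp only [neg_apply, h1, inner_neg_left]
      module
    · simp [h2 i j]
    · simp [h3]

/-! ### The strong maximum principle -/

/-- Taylor's formula for the defining function, with the derivative taken at p and at x: the chord x
− p is tangential up to a quadratic error at both of its ends. -/
lemma IsPuncturedSurface.exists_normal_quadratic (hS : IsPuncturedSurface S)
    (hp : p ∈ S) : ∃ n, IsNormal S n p ∧ ∃ C : ℝ, 0 ≤ C ∧ ∀ᶠ x in nhds p, x ∈ S →
      |inner ℝ (n x) (x - p)| ≤ C * ‖x - p‖ ^ 2 ∧ |inner ℝ (n p) (x - p)| ≤ C * ‖x - p‖ ^ 2 := by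
  obtain ⟨D, F, c, h, τ, m, r, U, hD, H⟩ := hS.exists_param hp
  refine ⟨_, H.isNormal hD H.mem, ?_⟩
  have hs : ContDiffAt ℝ ∞ h p := H.def_smooth.contDiffAt (H.isOpen.mem_nhds H.mem)
  have hg0 : grd h p ≠ 0 := grd_ne_zero (H.def_ne p H.mem)
  obtain ⟨K, t, ht, hL⟩ := ((smooth_fderiv hs).of_le one_le_infty).exists_lipschitzOnWith
  obtain ⟨ρ, hρ, hρt⟩ := Metric.mem_nhds_iff.1 (inter_mem ht (H.isOpen.mem_nhds H.mem))
  have hnorm : 0 < ‖grd h p‖ := norm_pos_iff.2 hg0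
  have hcn : ContinuousAt (fun x => ‖grd h x‖) p := (grd_smooth hs).continuousAt.norm
  have hev := hcn.eventually (lt_mem_nhds (half_lt_self hnorm))
  refine ⟨2 / ‖grd h p‖ * (2 * K), by positivity, ?_⟩
  filter_upwards [ball_mem_nhds p hρ, hev] with x hx hgx hxS
  have hsub : closedBall p ‖x - p‖ ⊆ ball p ρ :=
    Metric.closedBall_subset_ball (mem_ball_iff_norm.1 hx)
  have hpm : p ∈ closedBall p ‖x - p‖ := Metric.mem_closedBall_self (norm_nonneg _)
  have hxm : x ∈ closedBall p ‖x - p‖ := by rw [mem_closedBall_iff_norm]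
  have key : ∀ z ∈ closedBall p ‖x - p‖,
      |fderiv ℝ h z (x - p)| ≤ 2 * K * ‖x - p‖ ^ 2 := by
    intro z hz
    have h1 := (convex_closedBall p ‖x - p‖).norm_image_sub_le_of_norm_hasFDerivWithin_le'
      (f := h) (f' := fderiv ℝ h) (φ := fderiv ℝ h z) (C := K * (2 * ‖x - p‖))
      (fun y hy => ((H.def_smooth.contDiffAt
        (H.isOpen.mem_nhds (hρt (hsub hy)).2)).differentiableAt (by simp)).hasFDerivAt.hasFDerivWithinAt)
      (fun y hy => by
        refine (hL.norm_sub_le (hρt (hsub hy)).1 (hρt (hsub hz)).1).trans ?_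
        gcongr
        calc ‖y - z‖ = ‖(y - p) - (z - p)‖ := by congr 1; abel
          _ ≤ ‖y - p‖ + ‖z - p‖ := norm_sub_le _ _
          _ ≤ 2 * ‖x - p‖ := by
            rw [mem_closedBall_iff_norm] at hy hz; linarith) hpm hxm
    rw [H.def_zero x (hρt hx).2 hxS, H.def_zero p H.mem hp, sub_zero, zero_sub, norm_neg,
      Real.norm_eq_abs] at h1
    calc _ ≤ _ := h1
      _ = _ := by ring
  have hfin : ∀ z ∈ closedBall p ‖x - p‖, ‖grd h p‖ / 2 < ‖grd h z‖ →
      |inner ℝ ((‖grd h z‖⁻¹ : ℝ) • grd h z) (x - p)| ≤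
        2 / ‖grd h p‖ * (2 * K) * ‖x - p‖ ^ 2 := by
    intro z hz hgz
    rw [inner_smul_left, inner_grd, conj_trivial, abs_mul, abs_of_nonneg (by positivity), mul_assoc]
    refine mul_le_mul ?_ (key z hz) (abs_nonneg _) (by positivity)
    rw [← inv_div]
    exact inv_anti₀ (by positivity) hgz.le
  exact ⟨hfin x hxm hgx, hfin p hpm (half_lt_self hnorm)⟩

/-- Near an interior point at which the normal is transversal to the wall directions,
every compactly supported field is admissible. -/
lemma IsStationary.integral_eq_zero_of_vertical (hpair : IsSurfacePair S G)
    (hstat : IsStationary a S G) (hfin : HasLocFiniteArea S) {n W : E3 → E3}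
    (hW : ContDiff ℝ ∞ W) (hc : HasCompactSupport W)
    (hn : ∀ x ∈ tsupport W, IsNormal S n x ∧ n x 0 ≠ 0 ∧ x ∉ G ∧ x ≠ 0) :
    ∫ x in S, tangentialDiv (tangentPlane S x) W x ∂μHE[2] = 0 := by
  have hsub : tsupport (fun x => W x 0) ⊆ tsupport W :=
    closure_mono fun x hx h0 => hx (by simp only [h0, PiLp.zero_apply])
  have hW0 : ContDiff ℝ ∞ (fun x => W x 0) := contDiff_euclidean.1 hW 0
  have hQs : ∀ x ∈ tsupport W, ContDiffAt ℝ ∞ (fun x => (n x 0)⁻¹ • n x) x := by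
    intro x hx
    obtain ⟨h1, h2, -⟩ := hn x hx
    exact ((contDiffAt_euclidean.1 h1.smooth.self_of_nhds 0).inv h2).smul h1.smooth.self_of_nhds
  have hQ : ContDiff ℝ ∞ (fun x => W x 0 • ((n x 0)⁻¹ • n x)) :=
    contDiff_smul_of_tsupport hW0 fun x hx => hQs x (hsub hx)
  -- The subtracted multiple of `n` makes the field tangent to the wall. It does not change the
  -- divergence integral, because the mean curvature is zero.
  set X : E3 → E3 := fun x => W x - W x 0 • ((n x 0)⁻¹ • n x) with hX
  have hXs : tsupport X ⊆ tsupport W := by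
    refine closure_mono fun x hx h0 => hx ?_
    simp [hX, h0]
  have htest : IsTestField X := by
    refine ⟨hW.sub hQ, hc.of_isClosed_subset (isClosed_tsupport _) hXs,
      fun h => (hn 0 (hXs h)).2.2.2 rfl, fun x _ => ?_⟩
    rw [mem_wallPlane]
    by_cases hx : x ∈ tsupport W
    · have := (hn x hx).2.1
      simp only [hX, PiLp.sub_apply, PiLp.smul_apply, smul_eq_mul]
      field_simp; ring
    · have : X x = 0 := image_eq_zero_of_notMem_tsupport fun h => hx (hXs h)
      rw [this]; rfl
  have h1 := hstat X htest
  unfold firstVariation at h1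
  rw [setIntegral_eq_zero_of_forall_eq_zero (t := G), mul_zero, add_zero] at h1
  · rw [← h1]
    refine setIntegral_congr_fun hpair.surface_left.measurableSet fun x hxS => ?_
    by_cases hx : x ∈ tsupport W
    · obtain ⟨h2, h3, -⟩ := hn x hx
      have hd : DifferentiableAt ℝ n x := h2.smooth.self_of_nhds.differentiableAt (by simp)
      have hf : DifferentiableAt ℝ (fun x => W x 0 * (n x 0)⁻¹) x :=
        (hW0.contDiffAt.mul
          ((contDiffAt_euclidean.1 h2.smooth.self_of_nhds 0).inv h3)).differentiableAt (by simp)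
      have hWd : DifferentiableAt ℝ W x := hW.contDiffAt.differentiableAt (by simp)
      rw [tangentialDiv_eq_sdiv h2.unit.self_of_nhds (h2.plane.self_of_nhds hxS),
        tangentialDiv_eq_sdiv h2.unit.self_of_nhds (h2.plane.self_of_nhds hxS)]
      simp only [hX, smul_smul]
      rw [fderiv_fun_sub hWd (hf.fun_smul hd), sdiv_sub, sdiv_smul_normal hf hd h2.unit,
        edivg_eq_zero hpair hstat hfin hxS h2]
      ring
    · rw [tangentialDiv_of_notMem_tsupport _ hx,
        tangentialDiv_of_notMem_tsupport _ fun h => hx (hXs h)]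
  · intro x hx
    exact tangentialDiv_of_notMem_tsupport _ fun hxs => (hn x (hXs hxs)).2.2.1 hx

/-- The primitive of the smooth transition function. -/
def ramp (t : ℝ) : ℝ := ∫ u in (0 : ℝ)..t, Real.smoothTransition u

lemma contDiff_primitive {f : ℝ → ℝ} (hf : ContDiff ℝ ∞ f) (b : ℝ) :
    ContDiff ℝ ∞ (fun t => ∫ u in b..t, f u) ∧
      ∀ t, HasDerivAt (fun t => ∫ u in b..t, f u) (f t) t := by
  have h : ∀ t, HasDerivAt (fun t => ∫ u in b..t, f u) (f t) t := fun t =>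
    intervalIntegral.integral_hasDerivAt_right (hf.continuous.intervalIntegrable _ _)
      (hf.continuous.stronglyMeasurableAtFilter _ _) hf.continuous.continuousAt
  refine ⟨contDiff_infty_iff_deriv.2 ⟨fun t => (h t).differentiableAt, ?_⟩, h⟩
  rwa [show deriv (fun t => ∫ u in b..t, f u) = f from funext fun t => (h t).deriv]

lemma ramp_contDiff : ContDiff ℝ ∞ ramp :=
  (contDiff_primitive Real.smoothTransition.contDiff 0).1

lemma ramp_hasDerivAt (t : ℝ) : HasDerivAt ramp (Real.smoothTransition t) t :=
  (contDiff_primitive Real.smoothTransition.contDiff 0).2 t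

lemma ramp_of_nonpos {t : ℝ} (h : t ≤ 0) : ramp t = 0 := by
  unfold ramp
  rw [intervalIntegral.integral_symm]
  rw [intervalIntegral.integral_congr (g := fun _ => 0)]
  · simp
  · intro u hu
    rw [Set.uIcc_of_le h] at hu
    exact Real.smoothTransition.zero_of_nonpos hu.2

lemma ramp_le (t : ℝ) : ramp t ≤ t * Real.smoothTransition t := by
  rcases le_total t 0 with h | h
  · rw [ramp_of_nonpos h, Real.smoothTransition.zero_of_nonpos h, mul_zero]
  · unfold ramp
    calc _ ≤ ∫ _ in (0 : ℝ)..t, Real.smoothTransition t := by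
          refine intervalIntegral.integral_mono_on h
            (Real.smoothTransition.continuous.intervalIntegrable _ _)
            intervalIntegrable_const fun u hu => Real.smoothTransition.monotone hu.2
      _ = _ := by simp

lemma eq_zero_of_inner_frame {n τ m v : E3} (hn : ‖n‖ = 1) (hf : IsFrame τ m)
    (h1 : inner ℝ n τ = 0) (h2 : inner ℝ n m = 0) (hv1 : inner ℝ n v = 0)
    (hv2 : inner ℝ τ v = 0) (hv3 : inner ℝ m v = 0) : v = 0 := by
  have hnn : inner ℝ n n = (1 : ℝ) := by rw [real_inner_self_eq_norm_sq, hn]; norm_num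
  have ho : Orthonormal ℝ ![n, τ, m] := by
    rw [orthonormal_iff_ite]
    intro i j
    fin_cases i <;> fin_cases j <;>
      simp [hn, hf.norm_left, hf.norm_right, h1, h2, hf.orth, real_inner_comm n τ,
        real_inner_comm n m, real_inner_comm τ m]
  have hb := coe_basisOfOrthonormalOfCardEqFinrank ho (by simp)
  refine InnerProductSpace.ext_inner_left_basis (basisOfOrthonormalOfCardEqFinrank ho (by simp)) fun i => ?_
  rw [hb, inner_zero_right]
  fin_cases i
  · exact hv1
  · exact hv2
  · exact hv3

lemma IsDomain2.uniqueDiffWithinAt (hD : IsDomain2 D) {y : E2} (hy : y ∈ D) :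
    UniqueDiffWithinAt ℝ D y := by
  obtain ⟨z, s, hs, hz⟩ := hD.exists_ball one_pos
  refine uniqueDiffWithinAt_convex hD.convex ⟨z, interior_mono (hz.trans Set.inter_subset_left) ?_⟩
    (subset_closure hy)
  rw [isOpen_ball.interior_eq]
  exact mem_ball_self hs

lemma IsParam.frame_mem (H : IsParam S p D F c h τ m r U)
    (hD : IsDomain2 D) (hp : p ∈ S) (y : E2) : frameMap τ m y ∈ tangentPlane S p := by
  rw [H.tangentPlane_eq hD H.mem hp, mem_perp_iff, inner_grd]
  have hh : HasFDerivAt h (fderiv ℝ h p) (F 0) := by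
    rw [H.base]
    exact ((H.def_smooth.contDiffAt (H.isOpen.mem_nhds H.mem)).differentiableAt
      (by simp)).hasFDerivAt
  have h1 := (hh.comp 0 H.deriv_zero).hasFDerivWithinAt (s := D)
  have h2 : HasFDerivWithinAt (h ∘ F) (0 : E2 →L[ℝ] ℝ) D 0 := by
    refine (hasFDerivWithinAt_const (0 : ℝ) 0 D).congr_of_eventuallyEq ?_ ?_
    · filter_upwards [self_mem_nhdsWithin,
        mem_nhdsWithin_of_mem_nhds (ball_mem_nhds 0 H.pos)] with z hz hzr
      obtain ⟨h3, -, h4⟩ := H.maps z hzr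
      exact H.def_zero _ h3 (h4.2 hz)
    · rw [Function.comp_apply, H.base]; exact H.def_zero p H.mem hp
  exact congrArg (fun L => L y) ((hD.uniqueDiffWithinAt ((H.maps 0 (mem_ball_self H.pos)).2.2.1
    (by rwa [H.base]))).eq h1 h2)

/-- Along S the coordinate x₁ has a minimum at p, so the tangent plane is that of the wall. The
formula expresses that the normal is ±e₁ without naming the sign. -/
lemma IsNormal.vertical_of_contact {n : E3 → E3} (hn : IsNormal S n p)
    (hS : S ⊆ halfSpace) (hi : IsInteriorPoint S p) (hp0 : p 0 = 0) :
    bv 0 = n p 0 • n p := by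
  obtain ⟨F, c, h, τ, m, r, U, H⟩ := exists_param_interior hi
  have hmem := H.frame_mem (Or.inl rfl) hi.1
  have hd : HasFDerivAt (fun y => F y 0)
      ((coordL 0).comp (frameMap τ m)) 0 :=
    (coordL 0).hasFDerivAt.comp 0 H.deriv_zero
  have hz := IsLocalMin.hasFDerivAt_eq_zero (by
    filter_upwards [ball_mem_nhds 0 H.pos] with y hy
    simp only [H.base, hp0]
    exact hS ((H.maps y hy).2.2.2 trivial)) hd
  have hz' : ∀ y, frameMap τ m y 0 = 0 := fun y => congrArg (fun L => L y) hz
  have e0 : frameMap τ m (EuclideanSpace.single 0 1) = τ := by simp [frameMap_apply]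
  have e1 : frameMap τ m (EuclideanSpace.single 1 1) = m := by simp [frameMap_apply]
  have m0 := hmem (EuclideanSpace.single 0 1)
  have m1 := hmem (EuclideanSpace.single 1 1)
  have z0 := hz' (EuclideanSpace.single 0 1)
  have z1 := hz' (EuclideanSpace.single 1 1)
  rw [hn.plane.self_of_nhds hi.1, mem_perp_iff] at m0 m1
  rw [e0] at m0 z0
  rw [e1] at m1 z1
  rw [← sub_eq_zero]
  have hu := hn.unit.self_of_nhds
  refine eq_zero_of_inner_frame hu H.frame m0 m1 ?_ ?_ ?_
  · rw [inner_sub_right, inner_smul_right, real_inner_self_eq_norm_sq, hu, inner_bv_right]; ring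
  · rw [inner_sub_right, inner_smul_right, inner_bv_right, z0, real_inner_comm, m0]; ring
  · rw [inner_sub_right, inner_smul_right, inner_bv_right, z1, real_inner_comm, m1]; ring

/-- The coefficient in the radial field below. -/
def radialWeight (B u : ℝ) : ℝ := ramp (u - B) / u ^ 2

lemma radialWeight_contDiff {B : ℝ} (hB : 0 < B) : ContDiff ℝ ∞ (radialWeight B) := by
  rw [contDiff_iff_contDiffAt]
  intro u
  rcases lt_or_ge u B with h | h
  · refine (contDiffAt_const (c := (0 : ℝ))).congr_of_eventuallyEq ?_
    filter_upwards [gt_mem_nhds h] with v hv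
    rw [radialWeight, ramp_of_nonpos (by linarith), zero_div]
  · have h0 : u ^ 2 ≠ 0 := by have : 0 < u := hB.trans_le h
                              positivity
    exact ((ramp_contDiff.comp (contDiff_id.sub contDiff_const)).contDiffAt).div
      (contDiff_id.pow 2).contDiffAt h0

/-- The regularised inverse squared distance. -/
def invDist (ε : ℝ) (p x : E3) : ℝ := (‖x - p‖ ^ 2 + ε ^ 2)⁻¹

lemma invDist_contDiff {ε : ℝ} (hε : 0 < ε) (p : E3) : ContDiff ℝ ∞ (invDist ε p) := by
  unfold invDist
  refine ContDiff.inv (((contDiff_id.sub contDiff_const).norm_sq ℝ).add contDiff_const) ?_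
  intro x; positivity

lemma invDist_pos {ε : ℝ} (hε : 0 < ε) (p x : E3) : 0 < invDist ε p x := by
  unfold invDist; positivity

lemma invDist_mul {ε : ℝ} (hε : 0 < ε) (p x : E3) :
    invDist ε p x * (‖x - p‖ ^ 2 + ε ^ 2) = 1 := by
  unfold invDist
  exact inv_mul_cancel₀ (by positivity)

lemma invDist_fderiv {ε : ℝ} (hε : 0 < ε) (p x ξ : E3) :
    fderiv ℝ (invDist ε p) x ξ = -(invDist ε p x ^ 2 * (2 * inner ℝ (x - p) ξ)) := by
  have h1 : HasFDerivAt (fun x : E3 => ‖x - p‖ ^ 2 + ε ^ 2)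
      ((2 : ℝ) • (innerSL ℝ (x - p))) x := by
    have h2 : HasFDerivAt (fun x : E3 => x - p) (ContinuousLinearMap.id ℝ E3) x :=
      (hasFDerivAt_id x).sub_const p
    refine (h2.norm_sq.add_const (ε ^ 2)).congr_fderiv ?_
    ext; simp
  have h3 : HasDerivAt (fun u : ℝ => u⁻¹) (-(((‖x - p‖ ^ 2 + ε ^ 2)) ^ 2)⁻¹)
      (‖x - p‖ ^ 2 + ε ^ 2) := hasDerivAt_inv (by positivity)
  have h4 := (h3.comp_hasFDerivAt x h1).fderiv
  change fderiv ℝ (fun x => (‖x - p‖ ^ 2 + ε ^ 2)⁻¹) x ξ = _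
  change fderiv ℝ (fun x => (‖x - p‖ ^ 2 + ε ^ 2)⁻¹) x = _ at h4
  rw [h4]
  simp [invDist, inner_sub_left]

/-- The vector field used to prove the strong maximum principle. -/
def barrierField (B ε : ℝ) (p x : E3) : E3 :=
  (2 * x 0 * ramp (invDist ε p x - B)) • (x - p) +
    (∫ u in B..invDist ε p x, radialWeight B u) • bv 0

lemma barrierField_contDiff {B ε : ℝ} (hB : 0 < B) (hε : 0 < ε) (p : E3) :
    ContDiff ℝ ∞ (barrierField B ε p) := by
  have h1 := invDist_contDiff hε p
  have h0 : ContDiff ℝ ∞ (fun x : E3 => x 0) := contDiff_euclidean.1 contDiff_id 0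
  exact (((contDiff_const.mul h0).mul (ramp_contDiff.comp (h1.sub contDiff_const))).smul
    (contDiff_id.sub contDiff_const)).add
    (((contDiff_primitive (radialWeight_contDiff hB) B).1.comp h1).smul contDiff_const)

lemma barrierField_eq_zero {B ε : ℝ} {p x : E3} (h : invDist ε p x ≤ B) :
    barrierField B ε p x = 0 := by
  have h2 : ∫ u in B..invDist ε p x, radialWeight B u = 0 := by
    rw [intervalIntegral.integral_symm, intervalIntegral.integral_congr (g := fun _ => 0)]
    · simp
    · intro u hu
      rw [Set.uIcc_of_le h] at hu
      simp only [radialWeight, ramp_of_nonpos (sub_nonpos.2 hu.2), zero_div]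
  rw [barrierField, h2, ramp_of_nonpos (sub_nonpos.2 h)]
  simp

lemma norm_sq_le_of_invDist {B ε : ℝ} (hB : 0 < B) (hε : 0 < ε) {p x : E3}
    (h : B ≤ invDist ε p x) : ‖x - p‖ ^ 2 ≤ B⁻¹ := by
  have h1 := invDist_mul hε p x
  rw [← one_div, le_div_iff₀ hB]
  have h2 := invDist_pos hε p x
  nlinarith [sq_nonneg ε, sq_nonneg ‖x - p‖]

lemma tsupport_barrierField {B ε : ℝ} (hB : 0 < B) (hε : 0 < ε) (p : E3) :
    tsupport (barrierField B ε p) ⊆ closedBall p (Real.sqrt B⁻¹) := by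
  refine closure_minimal (fun x hx => ?_) Metric.isClosed_closedBall
  rw [mem_closedBall_iff_norm]
  apply Real.le_sqrt_of_sq_le
  by_contra h
  refine hx (barrierField_eq_zero (le_of_not_ge fun h2 => h (norm_sq_le_of_invDist hB hε h2)))

/-- Let t = `invDist ε p` and let Θ be the primitive of `radialWeight B` at t. The weight is made so
that ∇Θ = −2 `ramp (t - B)` (x − p); the field is thus Θ∇x₁ − x₁∇Θ, and as in Green's formula the
terms with the derivative of x₁ cancel. For the harmonic function x₁ this leads to a mean value
inequality at p, regularised by ε. -/
lemma sdiv_barrierField {B ε : ℝ} (hB : 0 < B) (hε : 0 < ε) (hp : p 0 = 0) (x : E3) {n : E3}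
    (hn : ‖n‖ = 1) :
    sdiv (fderiv ℝ (barrierField B ε p) x) n = 4 * (x 0 * (ramp (invDist ε p x - B) -
      Real.smoothTransition (invDist ε p x - B) * invDist ε p x ^ 2 *
        (‖x - p‖ ^ 2 - (inner ℝ n (x - p)) ^ 2))) := by
  set t := invDist ε p with ht
  have htd : HasFDerivAt t (fderiv ℝ t x) x :=
    ((invDist_contDiff hε p).contDiffAt.differentiableAt (by simp)).hasFDerivAt
  have hψ : HasFDerivAt (fun x => ramp (t x - B))
      (Real.smoothTransition (t x - B) • fderiv ℝ t x) x :=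
    HasDerivAt.comp_hasFDerivAt (h₂ := ramp) x (ramp_hasDerivAt (t x - B)) (htd.sub_const B)
  have hΘ : HasFDerivAt (fun x => ∫ u in B..t x, radialWeight B u)
      (radialWeight B (t x) • fderiv ℝ t x) x :=
    ((contDiff_primitive (radialWeight_contDiff hB) B).2 (t x)).comp_hasFDerivAt x htd
  have hx0 : HasFDerivAt (fun x : E3 => x 0) (coordL 0) x :=
    (coordL 0).hasFDerivAt
  have hf := (hx0.const_mul 2).fun_mul hψ
  have hxp : HasFDerivAt (fun x : E3 => x - p) (ContinuousLinearMap.id ℝ E3) x :=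
    (hasFDerivAt_id x).sub_const p
  have hc : HasFDerivAt (fun _ : E3 => bv 0) (0 : E3 →L[ℝ] E3) x := hasFDerivAt_const _ _
  change sdiv (fderiv ℝ (fun x => (2 * x 0 * ramp (t x - B)) • (x - p) +
    (∫ u in B..t x, radialWeight B u) • bv 0) x) n = _
  rw [fderiv_fun_add (hf.differentiableAt.fun_smul hxp.differentiableAt)
    (hΘ.differentiableAt.fun_smul hc.differentiableAt), sdiv_add,
    sdiv_fderiv_smul _ hf.differentiableAt hxp.differentiableAt,
    sdiv_fderiv_smul _ hΘ.differentiableAt hc.differentiableAt, hf.fderiv, hΘ.fderiv, hxp.fderiv,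
    hc.fderiv, sdiv_zero]
  have hid : sdiv (ContinuousLinearMap.id ℝ E3) n = 2 := by
    rw [sdiv]; simp [bv_apply, hn]; norm_num
  have hDt : ∀ ξ, fderiv ℝ t x ξ = -(t x ^ 2 * (2 * inner ℝ (x - p) ξ)) := invDist_fderiv hε p x
  have hrw : radialWeight B (t x) * t x ^ 2 = ramp (t x - B) := by
    rw [radialWeight, div_mul_cancel₀]
    have := invDist_pos hε p x
    positivity
  simp only [add_apply, smul_apply, smul_eq_mul, hDt, PiLp.proj_apply, inner_bv_right,
    real_inner_self_eq_norm_sq, PiLp.sub_apply, hp, hid, real_inner_comm n (x - p)]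
  rw [real_inner_comm n (bv 0), inner_bv_right]
  linear_combination (-2 * x 0 + 2 * inner ℝ n (x - p) * n 0) * hrw

/-- The lower bound of the divergence of the barrier field. -/
def barrierBound (B ε : ℝ) (p x : E3) : ℝ :=
  x 0 * Real.smoothTransition (invDist ε p x - B) * (1 - ε ^ 2 * invDist ε p x ^ 2)

/-- Let T be the transition factor. Then ramp(t − B) ≤ T (t − B), while t²|x − p|² = t − ε²t² and
t²⟨n, x − p⟩² ≤ C². The choice B ≥ C² + 1 leaves the margin T (1 − ε²t²). -/
lemma barrierBound_le {B C ε : ℝ} (hBC : C ^ 2 + 1 ≤ B) (hε : 0 < ε) {p x n : E3} (hx : 0 ≤ x 0)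
    (hq : |inner ℝ n (x - p)| ≤ C * ‖x - p‖ ^ 2) :
    x 0 * (ramp (invDist ε p x - B) - Real.smoothTransition (invDist ε p x - B) *
      invDist ε p x ^ 2 * (‖x - p‖ ^ 2 - (inner ℝ n (x - p)) ^ 2)) ≤ -barrierBound B ε p x := by
  have h1 := invDist_mul hε p x
  have ht := invDist_pos hε p x
  have hT := Real.smoothTransition.nonneg (invDist ε p x - B)
  have hr := ramp_le (invDist ε p x - B)
  set t := invDist ε p x
  set T := Real.smoothTransition (t - B)
  set q : ℝ := inner ℝ n (x - p)
  have hq2 : q ^ 2 ≤ (C * ‖x - p‖ ^ 2) ^ 2 := sq_le_sq' (abs_le.1 hq).1 (abs_le.1 hq).2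
  have hts : t * ‖x - p‖ ^ 2 ≤ 1 := by nlinarith [sq_nonneg ε]
  have hts0 : 0 ≤ t * ‖x - p‖ ^ 2 := by positivity
  have h2 : t ^ 2 * q ^ 2 ≤ C ^ 2 := by
    calc t ^ 2 * q ^ 2 ≤ t ^ 2 * (C * ‖x - p‖ ^ 2) ^ 2 := by gcongr
      _ = C ^ 2 * (t * ‖x - p‖ ^ 2) ^ 2 := by ring
      _ ≤ C ^ 2 * 1 := by gcongr; nlinarith
      _ = C ^ 2 := mul_one _
  have h3 : t ^ 2 * ‖x - p‖ ^ 2 = t - ε ^ 2 * t ^ 2 := by linear_combination t * h1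
  have h4 : ramp (t - B) - T * t ^ 2 * (‖x - p‖ ^ 2 - q ^ 2) ≤ T * (ε ^ 2 * t ^ 2 - 1) := by
    have : T * t ^ 2 * (‖x - p‖ ^ 2 - q ^ 2) = T * (t - ε ^ 2 * t ^ 2 - t ^ 2 * q ^ 2) := by
      rw [← h3]; ring
    rw [this]
    nlinarith [mul_le_mul_of_nonneg_left h2 hT, mul_le_mul_of_nonneg_left hBC hT]
  calc _ ≤ x 0 * (T * (ε ^ 2 * t ^ 2 - 1)) := mul_le_mul_of_nonneg_left h4 hx
    _ = _ := by unfold barrierBound; ring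

/-- A bound uniform in ε, for dominated convergence: the factor ε²t² is compensated by |x₁| ≤ C|x −
p|², because t|x − p|² and tε² are at most 1. -/
lemma abs_barrierBound_le {B C ε : ℝ} (hC : 0 ≤ C) (hε : 0 < ε) {p x : E3}
    (hx : |x 0| ≤ C * ‖x - p‖ ^ 2) : |barrierBound B ε p x| ≤ |x 0| + C := by
  have h1 := invDist_mul hε p x
  have ht := invDist_pos hε p x
  have hT := Real.smoothTransition.nonneg (invDist ε p x - B)
  have hT1 := Real.smoothTransition.le_one (invDist ε p x - B)
  unfold barrierBound
  set t := invDist ε p x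
  set T := Real.smoothTransition (t - B)
  have hts : t * ‖x - p‖ ^ 2 ≤ 1 := by nlinarith [sq_nonneg ε]
  have hte : t * ε ^ 2 ≤ 1 := by nlinarith [sq_nonneg ‖x - p‖]
  have h2 : |x 0| * (ε ^ 2 * t ^ 2) ≤ C := by
    have hC2 : C * (t * ‖x - p‖ ^ 2) * (t * ε ^ 2) ≤ C := by
      calc _ ≤ C * 1 * 1 := by gcongr
        _ = C := by ring
    calc _ ≤ C * ‖x - p‖ ^ 2 * (ε ^ 2 * t ^ 2) := by gcongr
      _ = C * (t * ‖x - p‖ ^ 2) * (t * ε ^ 2) := by ring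
      _ ≤ C := hC2
  rw [abs_mul, abs_mul, abs_of_nonneg hT]
  have h3 : |1 - ε ^ 2 * t ^ 2| ≤ 1 + ε ^ 2 * t ^ 2 := by
    rw [abs_le]; constructor <;> nlinarith [mul_nonneg (sq_nonneg ε) (sq_nonneg t)]
  calc |x 0| * T * |1 - ε ^ 2 * t ^ 2| ≤ |x 0| * 1 * (1 + ε ^ 2 * t ^ 2) := by gcongr
    _ = |x 0| + |x 0| * (ε ^ 2 * t ^ 2) := by ring
    _ ≤ _ := by linarith

/-- The inverse distance is singular at x = p, but there the factor x₁ vanishes on both sides. -/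
lemma barrierBound_tendsto (B : ℝ) {p x : E3} (hp : p 0 = 0) :
    Tendsto (fun k : ℕ => barrierBound B (1 / ((k : ℝ) + 1)) p x) atTop
      (nhds (x 0 * Real.smoothTransition ((‖x - p‖ ^ 2)⁻¹ - B))) := by
  by_cases hx : x = p
  · subst hx
    simp [barrierBound, hp]
  · have h0 : ‖x - p‖ ^ 2 ≠ 0 := by
      have := norm_pos_iff.2 (sub_ne_zero.2 hx)
      positivity
    have hε : Tendsto (fun k : ℕ => 1 / ((k : ℝ) + 1)) atTop (nhds 0) :=
      tendsto_one_div_add_atTop_nhds_zero_nat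
    have hc : ContinuousAt (fun ε : ℝ => barrierBound B ε p x) 0 := by
      have h1 : ContinuousAt (fun ε : ℝ => invDist ε p x) 0 := by
        unfold invDist
        refine ContinuousAt.inv₀ (by fun_prop) (by simpa using h0)
      have h2 : ContinuousAt (fun ε : ℝ => Real.smoothTransition (invDist ε p x - B)) 0 :=
        Real.smoothTransition.continuous.continuousAt.comp (h1.sub continuousAt_const)
      unfold barrierBound
      exact (continuousAt_const.mul h2).mul
        (continuousAt_const.sub ((continuousAt_id.pow 2).mul (h1.pow 2)))
    have h3 := hc.tendsto.comp hε
    have h4 : barrierBound B 0 p x = x 0 * Real.smoothTransition ((‖x - p‖ ^ 2)⁻¹ - B) := by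
      simp [barrierBound, invDist]
    rw [h4] at h3
    exact h3

lemma barrierBound_continuous {B ε : ℝ} (hε : 0 < ε) (p : E3) : Continuous (barrierBound B ε p) := by
  have h := (invDist_contDiff hε p).continuous
  have h2 : Continuous fun x => Real.smoothTransition (invDist ε p x - B) :=
    Real.smoothTransition.continuous.comp (h.sub continuous_const)
  unfold barrierBound
  fun_prop

/-- The strong maximum principle: the set of interior contact points is open in the surface. -/
theorem contact_isOpen (hpair : IsSurfacePair S G)
    (hstat : IsStationary a S G) (hfin : HasLocFiniteArea S) (hp : p ∈ S)
    (hpb : p ∉ bdry S) (hp0 : p 0 = 0) : ∀ᶠ x in nhds p, x ∈ S → x 0 = 0 := by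
  have hS := hpair.surface_left
  have hi : IsInteriorPoint S p := (hS.smooth p hp).resolve_right hpb
  have hpz : p ≠ 0 := fun h => hS.zero_notMem (h ▸ hp)
  have hpG : p ∉ closure G := fun h => by
    rcases hpair.surface_right.closed h with h | h
    · exact hpb (hpair.inter_eq ▸ ⟨hp, h⟩)
    · exact hpz h
  obtain ⟨n, hn, C, hC, hquad⟩ := hS.exists_normal_quadratic hp
  have hv := hn.vertical_of_contact hpair.left_subset hi hp0
  have hn0 : n p 0 ≠ 0 := fun h => by
    rw [h, zero_smul] at hv
    have := norm_bv 0
    simp [hv] at this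
  have habs : |n p 0| ≤ 1 := by
    rw [← Real.norm_eq_abs, ← hn.unit.self_of_nhds]; exact PiLp.norm_apply_le _ _
  have hnc : ContinuousAt (fun x => n x 0) p := by
    have := hn.smooth.self_of_nhds.continuousAt
    fun_prop
  obtain ⟨ρ, hρ, hball⟩ := Metric.eventually_nhds_iff_ball.1 ((hn.eventually.and
    ((hnc.eventually_ne hn0).and ((isClosed_closure.isOpen_compl.eventually_mem hpG).and
      (eventually_ne_nhds hpz)))).and hquad)
  -- The part C² + 1 serves the divergence estimate, and the last summand confines the support to
  -- the ball of radius ρ/2 about p.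
  set B : ℝ := C ^ 2 + 1 + (ρ / 2)⁻¹ ^ 2 with hB
  have hBpos : 0 < B := by positivity
  have hBρ : Real.sqrt B⁻¹ ≤ ρ / 2 := by
    rw [← Real.sqrt_sq (by positivity : 0 ≤ ρ / 2)]
    apply Real.sqrt_le_sqrt
    rw [inv_le_comm₀ hBpos (by positivity), ← inv_pow]
    have := sq_nonneg C
    linarith
  set K := closedBall p (Real.sqrt B⁻¹) with hK
  have hKρ : K ⊆ ball p ρ := Metric.closedBall_subset_ball (by linarith)
  have hKc : IsCompact K := isCompact_closedBall _ _
  have hK0 : (0 : E3) ∉ K := fun h => (hball 0 (hKρ h)).1.2.2.2 rfl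
  have hx0 : ∀ x ∈ K, x ∈ S → |x 0| ≤ C * ‖x - p‖ ^ 2 := by
    intro x hx hxS
    have h1 := ((hball x (hKρ hx)).2 hxS).2
    have h2 : x 0 = n p 0 * inner ℝ (n p) (x - p) := by
      have h3 : inner ℝ (bv 0) (x - p) = x 0 := by
        rw [real_inner_comm, inner_bv_right, PiLp.sub_apply, hp0, sub_zero]
      rw [← h3]
      conv_lhs => rw [hv, inner_smul_left, conj_trivial]
    rw [h2, abs_mul]
    calc _ ≤ 1 * |inner ℝ (n p) (x - p)| := by gcongr
      _ ≤ _ := by rw [one_mul]; exact h1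
  have hBC : C ^ 2 + 1 ≤ B := by have := sq_nonneg (ρ / 2)⁻¹; linarith
  have hoff : ∀ ε > 0, ∀ x, x ∉ K → barrierBound B ε p x = 0 := by
    intro ε hε x hx
    have : invDist ε p x ≤ B := le_of_not_ge fun h2 => hx (by
      rw [hK, mem_closedBall_iff_norm]
      exact Real.le_sqrt_of_sq_le (norm_sq_le_of_invDist hBpos hε h2))
    rw [barrierBound, Real.smoothTransition.zero_of_nonpos (sub_nonpos.2 this)]
    ring
  have hint : ∀ ε > 0, ∫ x in S, barrierBound B ε p x ∂μHE[2] ≤ 0 := by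
    intro ε hε
    have hts := tsupport_barrierField hBpos hε p
    have hW := barrierField_contDiff hBpos hε p
    have hWc : HasCompactSupport (barrierField B ε p) :=
      hKc.of_isClosed_subset (isClosed_tsupport _) hts
    -- The barrier field is not tangent to the wall; it is admissible here because the normal has a
    -- nonzero e₁ component near p.
    have h1 := hstat.integral_eq_zero_of_vertical hpair hfin (n := n) hW hWc fun x hx => by
      obtain ⟨h2, h3, h4, h5⟩ := (hball x (hKρ (hts hx))).1
      exact ⟨h2, h3, fun h => h4 (subset_closure h), h5⟩
    have hI1 : IntegrableOn (fun x => tangentialDiv (tangentPlane S x) (barrierField B ε p) x) S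
        μHE[2] := integrableOn_of_support hS hfin hKc hK0
      ((hS.continuousOn_tangentialDiv hW).mono Set.inter_subset_left)
      (fun x _ hx => tangentialDiv_of_notMem_tsupport _ fun h => hx (hts h))
    have hI2 : IntegrableOn (barrierBound B ε p) S μHE[2] :=
      integrableOn_of_support hS hfin hKc hK0 (barrierBound_continuous hε p).continuousOn
        (fun x _ hx => hoff ε hε x hx)
    have h2 : ∫ x in S, tangentialDiv (tangentPlane S x) (barrierField B ε p) x ∂μHE[2] ≤
        ∫ x in S, -4 * barrierBound B ε p x ∂μHE[2] := by
      refine setIntegral_mono_on hI1 (hI2.const_mul _) hS.measurableSet fun x hx => ?_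
      by_cases hxK : x ∈ K
      · obtain ⟨⟨h2, -⟩, h3⟩ := hball x (hKρ hxK)
        rw [tangentialDiv_eq_sdiv h2.unit.self_of_nhds (h2.plane.self_of_nhds hx),
          sdiv_barrierField hBpos hε hp0 x h2.unit.self_of_nhds]
        have := barrierBound_le hBC hε (hpair.left_subset hx) (h3 hx).1
        linarith
      · rw [tangentialDiv_of_notMem_tsupport _ fun h => hxK (hts h), hoff ε hε x hxK, mul_zero]
    rw [h1, integral_const_mul] at h2
    linarith
  set f0 : E3 → ℝ := fun x => x 0 * Real.smoothTransition ((‖x - p‖ ^ 2)⁻¹ - B) with hf0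
  have hf0m : Measurable f0 := by
    have : Measurable fun x : E3 => Real.smoothTransition ((‖x - p‖ ^ 2)⁻¹ - B) :=
      Real.smoothTransition.continuous.measurable.comp (by fun_prop)
    exact Measurable.mul (by fun_prop) this
  obtain ⟨C', hC'⟩ : ∃ C', ∀ x ∈ S, ∀ ε > 0, |barrierBound B ε p x| ≤ K.indicator (fun _ => C') x := by
    refine ⟨C * B⁻¹ + C, fun x hx ε hε => ?_⟩
    by_cases hxK : x ∈ K
    · rw [Set.indicator_of_mem hxK]
      refine (abs_barrierBound_le hC hε (hx0 x hxK hx)).trans ?_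
      have h1 := hx0 x hxK hx
      have h2 : ‖x - p‖ ^ 2 ≤ B⁻¹ := by
        rw [hK, mem_closedBall_iff_norm] at hxK
        calc ‖x - p‖ ^ 2 ≤ Real.sqrt B⁻¹ ^ 2 := by gcongr
          _ = B⁻¹ := Real.sq_sqrt (by positivity)
      have := mul_le_mul_of_nonneg_left h2 hC
      linarith
    · rw [Set.indicator_of_notMem hxK, hoff ε hε x hxK, abs_zero]
  have hεk : ∀ k : ℕ, (0 : ℝ) < 1 / ((k : ℝ) + 1) := fun k => by positivity
  have hbI : IntegrableOn (K.indicator fun _ => C') S μHE[2] :=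
    integrableOn_of_support hS hfin hKc hK0
      (continuousOn_const.congr fun x hx => Set.indicator_of_mem hx.2 _)
      (fun x _ hx => Set.indicator_of_notMem hx _)
  have hlim : ∀ x, Tendsto (fun k : ℕ => barrierBound B (1 / ((k : ℝ) + 1)) p x)
      atTop (nhds (f0 x)) := fun x => barrierBound_tendsto B hp0
  have hf0b : ∀ x ∈ S, |f0 x| ≤ K.indicator (fun _ => C') x := fun x hx =>
    le_of_tendsto (hlim x).abs (Filter.Eventually.of_forall fun k => hC' x hx _ (hεk k))
  have hf0I : IntegrableOn f0 S μHE[2] :=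
    hbI.mono' hf0m.aestronglyMeasurable (ae_restrict_of_forall_mem hS.measurableSet hf0b)
  have hconv := tendsto_integral_of_dominated_convergence (μ := μHE[2].restrict S) _
    (fun k : ℕ => (barrierBound_continuous (B := B) (hεk k) p).aestronglyMeasurable) hbI
    (fun k => ae_restrict_of_forall_mem hS.measurableSet fun x hx => hC' x hx _ (hεk k))
    (Filter.Eventually.of_forall hlim)
  have hle : ∫ x in S, f0 x ∂μHE[2] ≤ 0 :=
    le_of_tendsto hconv (Filter.Eventually.of_forall fun k => hint _ (hεk k))
  have hnn : ∀ x ∈ S, 0 ≤ f0 x := fun x hx =>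
    mul_nonneg (hpair.left_subset hx) (Real.smoothTransition.nonneg _)
  -- The limit integrand is nonnegative since S lies in the half-space, and its integral is at most
  -- zero.
  have hzero := (setIntegral_eq_zero_iff_of_nonneg_ae
    (ae_restrict_of_forall_mem hS.measurableSet hnn) hf0I).1
    (le_antisymm hle (setIntegral_nonneg hS.measurableSet hnn))
  rw [Filter.EventuallyEq, ae_iff, Measure.restrict_apply' hS.measurableSet] at hzero
  have hBi : 0 < Real.sqrt B⁻¹ := Real.sqrt_pos.2 (by positivity)
  filter_upwards [ball_mem_nhds p hBi] with x hx hxS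
  by_contra hne
  have hxpos : 0 < x 0 := lt_of_le_of_ne (hpair.left_subset hxS) (Ne.symm hne)
  have hxp : x ≠ p := fun h => hne (h ▸ hp0)
  have hnp : 0 < ‖x - p‖ ^ 2 := by
    have := norm_pos_iff.2 (sub_ne_zero.2 hxp)
    positivity
  have hxB : 0 < (‖x - p‖ ^ 2)⁻¹ - B := by
    have h1 : ‖x - p‖ ^ 2 < B⁻¹ := by
      rw [mem_ball_iff_norm] at hx
      exact (Real.lt_sqrt (norm_nonneg _)).1 hx
    have := (lt_inv_comm₀ hnp hBpos).1 h1
    linarith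
  have hpos : 0 < f0 x := mul_pos hxpos (Real.smoothTransition.pos_of_pos hxB)
  have hcont : ContinuousAt f0 x := by
    have h1 : ContinuousAt (fun x : E3 => (‖x - p‖ ^ 2)⁻¹ - B) x :=
      ((show ContinuousAt (fun x : E3 => ‖x - p‖ ^ 2) x by fun_prop).inv₀ hnp.ne').sub
        continuousAt_const
    exact ContinuousAt.mul (by fun_prop) (Real.smoothTransition.continuous.continuousAt.comp h1)
  refine (hS.measure_pos hxS (hcont.eventually (lt_mem_nhds hpos))).ne'
    (measure_mono_null ?_ hzero)
  rintro y ⟨hyS, hy⟩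
  exact ⟨ne_of_gt hy, hyS⟩

/-! ### Blow-up at boundary points -/

lemma measure_image_le_of_lipschitzOnWith {K : NNReal} {A : Set E2}
    (h : LipschitzOnWith K F A) : μHE[2] (F '' A) ≤ (K : ENNReal) ^ 2 * volume A := by
  rw [← EuclideanSpace.euclideanHausdorffMeasure_eq_volume, Measure.euclideanHausdorffMeasure_def,
    Measure.euclideanHausdorffMeasure_def]
  have h1 := h.hausdorffMeasure_image_le (d := ((2 : ℕ) : ℝ)) (by norm_num)
  simp only [Measure.smul_apply, ENNReal.smul_def, smul_eq_mul]
  calc _ ≤ _ * (((K : ENNReal) ^ ((2 : ℕ) : ℝ)) * (μH[((2 : ℕ) : ℝ)] A)) := by gcongr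
    _ = _ := by rw [ENNReal.rpow_natCast]; ring

lemma integral_le_of_measure_le {α : Type*} [MeasurableSpace α] {ν l : Measure α}
    [IsFiniteMeasure l] {κ : NNReal} (h : ν ≤ κ • l) {g : α → ℝ} (hg : Integrable g l)
    (h0 : ∀ x, 0 ≤ g x) : ∫ x, g x ∂ν ≤ κ * ∫ x, g x ∂l := by
  have h1 := integral_mono_measure h (Filter.Eventually.of_forall h0) (hg.smul_measure_nnreal)
  rwa [integral_smul_nnreal_measure, NNReal.smul_def, smul_eq_mul] at h1

/-- Adding its bound to `g` makes it nonnegative, so that the comparison of the measures carries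
over to the integrals; the difference is of order κ − 1. -/
lemma integral_close {α : Type*} [MeasurableSpace α] {ν l : Measure α} [IsFiniteMeasure ν]
    [IsFiniteMeasure l] {κ : NNReal} (hκ : 1 ≤ κ) (h1 : ν ≤ κ • l) (h2 : l ≤ κ • ν) {g : α → ℝ}
    (hg : Measurable g) {b : ℝ} (hb : ∀ x, |g x| ≤ b) :
    |∫ x, g x ∂ν - ∫ x, g x ∂l| ≤ 3 * ((κ - 1) * κ) * (b * l.real Set.univ) := by
  have hi : ∀ (m : Measure α) [IsFiniteMeasure m], Integrable g m := fun m _ =>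
    Integrable.of_bound hg.aestronglyMeasurable b (Filter.Eventually.of_forall hb)
  have e : ∀ (m : Measure α) [IsFiniteMeasure m],
      ∫ x, (g x + b) ∂m = ∫ x, g x ∂m + b * m.real Set.univ := fun m _ => by
    rw [integral_add (hi m) (integrable_const b), integral_const, smul_eq_mul, mul_comm]
  have h0 : ∀ x, 0 ≤ g x + b := fun x => by have := (abs_le.1 (hb x)).1; linarith
  have hle : ∀ x, g x + b ≤ 2 * b := fun x => by have := (abs_le.1 (hb x)).2; linarith
  have ic : ∀ (m : Measure α) [IsFiniteMeasure m], Integrable (fun x => g x + b) m := fun m _ =>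
    (hi m).add (integrable_const b)
  have a1 := integral_le_of_measure_le h1 (ic l) h0
  have a2 := integral_le_of_measure_le h2 (ic ν) h0
  have c1 := integral_le_of_measure_le h1 (integrable_const (1 : ℝ)) (fun _ => zero_le_one)
  have c2 := integral_le_of_measure_le h2 (integrable_const (1 : ℝ)) (fun _ => zero_le_one)
  have u1 : ∀ (m : Measure α) [IsFiniteMeasure m],
      ∫ x, (g x + b) ∂m ≤ 2 * b * m.real Set.univ := fun m _ => by
    calc _ ≤ ∫ _, 2 * b ∂m := integral_mono (ic m) (integrable_const _) hle
      _ = _ := by rw [integral_const, smul_eq_mul, mul_comm]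
  have u2 := u1 ν
  have u3 := u1 l
  rw [e] at a1 a2 u2 u3
  rw [e] at a1 a2
  simp only [integral_const, smul_eq_mul, mul_one] at c1 c2
  have hκ' : (1 : ℝ) ≤ κ := hκ
  have hn1 : 0 ≤ ν.real Set.univ := measureReal_nonneg
  have hn2 : 0 ≤ l.real Set.univ := measureReal_nonneg
  rcases isEmpty_or_nonempty α with hα | hα
  · simp [Subsingleton.elim ν 0, Subsingleton.elim l 0]
  have hb0 : 0 ≤ b := (abs_nonneg _).trans (hb hα.some)
  set I := ∫ x, g x ∂ν
  set J := ∫ x, g x ∂l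
  set x := ν.real Set.univ
  set y := l.real Set.univ
  set k : ℝ := (κ : ℝ)
  have c1' : b * x ≤ k * (b * y) := by nlinarith
  have c2' : b * y ≤ k * (b * x) := by nlinarith
  set X := b * x
  set Y := b * y
  have hX : 0 ≤ X := by positivity
  have hY : 0 ≤ Y := by positivity
  have k1 : 0 ≤ k - 1 := by linarith
  have b1 : J + Y ≤ 2 * Y := by linarith
  have b2 : I + X ≤ 2 * X := by linarith
  have b3 := mul_le_mul_of_nonneg_left b1 k1
  have b4 := mul_le_mul_of_nonneg_left b2 k1
  have b5 := mul_le_mul_of_nonneg_left c1' k1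
  have b6 := mul_nonneg k1 (mul_nonneg k1 hY)
  have b7 := mul_nonneg k1 hY
  rw [abs_le]
  constructor <;> nlinarith

lemma IsParam.mem_domain (H : IsParam S p D F c h τ m r U) {x : E3}
    (hx : x ∈ U) (hxS : x ∈ S) : c x ∈ D ∧ c x ∈ ball (0 : E2) r ∧ F (c x) = x := by
  obtain ⟨h1, h2⟩ := H.coord x hx (H.def_zero x hx hxS)
  exact ⟨(H.maps _ h1).2.2.1 (h2.symm ▸ hxS), h1, h2⟩

lemma IsParam.isOpen_preimage (H : IsParam S p D F c h τ m r U) (ρ : ℝ) :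
    IsOpen (U ∩ c ⁻¹' ball 0 ρ) :=
  H.coord_smooth.continuousOn.isOpen_inter_preimage H.isOpen isOpen_ball

/-- Near `p`, the surface measure is comparable with the area in the parameter plane, with constants
close to `1`. -/
lemma IsParam.measure_compare (H : IsParam S p D F c h τ m r U)
    (hS : MeasurableSet S) {K : NNReal} (hK : 1 < K) :
    ∃ ρ₀ > 0, ∀ ρ, 0 < ρ → ρ ≤ ρ₀ →
      let V := U ∩ c ⁻¹' ball 0 ρ
      let ν := (μHE[2].restrict (S ∩ V)).map c
      let l := (volume : Measure E2).restrict (D ∩ ball 0 ρ)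
      AEMeasurable c (μHE[2].restrict (S ∩ V)) ∧ ν ≤ (K ^ 2 : NNReal) • l ∧
        l ≤ (K ^ 2 : NNReal) • ν := by
  have hK0 : (0 : ℝ) < K := by exact_mod_cast zero_lt_one.trans hK
  have hK1 : (1 : ℝ) < K := by exact_mod_cast hK
  -- With this tolerance 1 + δ ≤ K and 1 − δ = 1/K, so F and its inverse are both K-Lipschitz near
  -- the origin.
  set δ : NNReal := 1 - K⁻¹ with hδ
  have hδ0 : 0 < δ := tsub_pos_of_lt (inv_lt_one_of_one_lt₀ hK)
  have hδr : (δ : ℝ) = 1 - (K : ℝ)⁻¹ := by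
    rw [hδ, NNReal.coe_sub (inv_lt_one_of_one_lt₀ hK).le]; simp
  have hstrict : HasStrictFDerivAt F (frameMap τ m) 0 :=
    (H.smooth.contDiffAt (ball_mem_nhds 0 H.pos)).hasStrictFDerivAt' H.deriv_zero (by simp)
  obtain ⟨s, hs, happ⟩ := hstrict.approximates_deriv_on_nhds (c := δ) (Or.inr hδ0)
  obtain ⟨ρ₁, hρ₁, hρs⟩ := Metric.mem_nhds_iff.1 hs
  refine ⟨min ρ₁ r, lt_min hρ₁ H.pos, fun ρ hρ hρle => ?_⟩
  have hbs : ball (0 : E2) ρ ⊆ s :=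
    (Metric.ball_subset_ball (hρle.trans (min_le_left _ _))).trans hρs
  have hbr : ball (0 : E2) ρ ⊆ ball 0 r :=
    Metric.ball_subset_ball (hρle.trans (min_le_right _ _))
  have hLF : LipschitzOnWith K F (ball 0 ρ) := by
    refine LipschitzOnWith.of_dist_le_mul fun x hx y hy => ?_
    rw [dist_eq_norm, dist_eq_norm]
    have h1 := happ x (hbs hx) y (hbs hy)
    have h2 : ‖F x - F y‖ ≤ ‖F x - F y - frameMap τ m (x - y)‖ + ‖frameMap τ m (x - y)‖ := by
      simpa using norm_add_le (F x - F y - frameMap τ m (x - y)) (frameMap τ m (x - y))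
    rw [H.frame.norm_map] at h2
    have h3 : 1 + (δ : ℝ) ≤ K := by
      rw [hδr]
      have : (K : ℝ) * (K : ℝ)⁻¹ = 1 := mul_inv_cancel₀ hK0.ne'
      have h4 : 0 < (K : ℝ)⁻¹ := by positivity
      nlinarith [mul_pos (sub_pos.2 hK1) (sub_pos.2 hK1)]
    nlinarith [norm_nonneg (x - y)]
  have hLc : ∀ A ⊆ ball (0 : E2) ρ, LipschitzOnWith K c (F '' A) := by
    intro A hA
    refine LipschitzOnWith.of_dist_le_mul ?_
    rintro _ ⟨x, hx, rfl⟩ _ ⟨y, hy, rfl⟩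
    rw [(H.maps x (hbr (hA hx))).2.1, (H.maps y (hbr (hA hy))).2.1, dist_eq_norm, dist_eq_norm]
    have h1 := happ x (hbs (hA hx)) y (hbs (hA hy))
    have h2 : ‖frameMap τ m (x - y)‖ ≤ ‖F x - F y - frameMap τ m (x - y)‖ + ‖F x - F y‖ := by
      have := norm_sub_le (F x - F y) (F x - F y - frameMap τ m (x - y))
      rw [sub_sub_cancel] at this
      linarith
    rw [H.frame.norm_map, ] at h2
    have h3 : ‖x - y‖ * (K : ℝ)⁻¹ ≤ ‖F x - F y‖ := by rw [hδr] at h1; nlinarith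
    calc ‖x - y‖ = K * (‖x - y‖ * (K : ℝ)⁻¹) := by field_simp
      _ ≤ _ := by gcongr
  intro V ν l
  have hVm : MeasurableSet (S ∩ V) := hS.inter (H.isOpen_preimage ρ).measurableSet
  have hae : AEMeasurable c (μHE[2].restrict (S ∩ V)) :=
    (H.coord_smooth.continuousOn.mono fun x hx => hx.2.1).aemeasurable hVm
  have himg : ∀ E : Set E2, c ⁻¹' E ∩ (S ∩ V) = F '' (E ∩ (D ∩ ball 0 ρ)) := by
    intro E
    ext x
    constructor
    · rintro ⟨hE, hxS, hxU, hxρ⟩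
      obtain ⟨h1, -, h3⟩ := H.mem_domain hxU hxS
      exact ⟨c x, ⟨hE, h1, hxρ⟩, h3⟩
    · rintro ⟨y, ⟨hE, hyD, hyρ⟩, rfl⟩
      obtain ⟨h1, h2, h3⟩ := H.maps y (hbr hyρ)
      refine ⟨?_, h3.2 hyD, h1, ?_⟩ <;> simpa only [Set.mem_preimage, h2]
  have hν : ∀ E, MeasurableSet E → ν E = μHE[2] (F '' (E ∩ (D ∩ ball 0 ρ))) := by
    intro E hE
    rw [Measure.map_apply_of_aemeasurable hae hE, Measure.restrict_apply' hVm, himg]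
  refine ⟨hae, Measure.le_iff.2 fun E hE => ?_, Measure.le_iff.2 fun E hE => ?_⟩
  · rw [hν E hE, Measure.smul_apply, Measure.restrict_apply hE, ENNReal.smul_def, smul_eq_mul,
      ENNReal.coe_pow]
    exact measure_image_le_of_lipschitzOnWith (hLF.mono fun y hy => hy.2.2)
  · rw [Measure.smul_apply, hν E hE, Measure.restrict_apply hE, ENNReal.smul_def, smul_eq_mul,
      ENNReal.coe_pow]
    have h1 := volume_le_of_lipschitzOnWith (hLc (E ∩ (D ∩ ball 0 ρ)) fun y hy => hy.2.2)
    refine le_trans (measure_mono ?_) h1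
    intro y hy
    exact ⟨F y, ⟨y, hy, rfl⟩, (H.maps y (hbr hy.2.2)).2.1⟩

/-- A smooth cutoff profile: `1` for `s ≤ 0`, `0` for `s ≥ 1`. -/
def cutf (s : ℝ) : ℝ := Real.smoothTransition (1 - s)

lemma cutf_contDiff : ContDiff ℝ ∞ cutf :=
  Real.smoothTransition.contDiff.comp (contDiff_const.sub contDiff_id)

lemma cutf_of_one_le {s : ℝ} (h : 1 ≤ s) : cutf s = 0 :=
  Real.smoothTransition.zero_of_nonpos (by linarith)

lemma cutf_of_nonpos {s : ℝ} (h : s ≤ 0) : cutf s = 1 :=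
  Real.smoothTransition.one_of_one_le (by linarith)

lemma cutf_antitone : Antitone cutf := fun _ _ h =>
  Real.smoothTransition.monotone (by linarith)

lemma deriv_cutf_contDiff : ContDiff ℝ ∞ (deriv cutf) :=
  (contDiff_infty_iff_deriv.1 cutf_contDiff).2

lemma cutf_hasDerivAt (s : ℝ) : HasDerivAt cutf (deriv cutf s) s :=
  ((contDiff_infty_iff_deriv.1 cutf_contDiff).1 s).hasDerivAt

lemma deriv_cutf_nonpos (s : ℝ) : deriv cutf s ≤ 0 := cutf_antitone.deriv_nonpos

lemma deriv_cutf_of_one_lt {s : ℝ} (h : 1 < s) : deriv cutf s = 0 := by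
  have : cutf =ᶠ[nhds s] fun _ => 0 := by
    filter_upwards [lt_mem_nhds h] with t ht using cutf_of_one_le ht.le
  rw [this.deriv_eq, deriv_const]

lemma deriv_cutf_of_one_le {s : ℝ} (h : 1 ≤ s) : deriv cutf s = 0 := by
  have h1 : Set.EqOn (deriv cutf) 0 (closure (Set.Ioi 1)) :=
    Set.EqOn.closure (fun t ht => deriv_cutf_of_one_lt ht) deriv_cutf_contDiff.continuous
      continuous_const
  rw [closure_Ioi] at h1
  exact h1 h

lemma deriv_cutf_of_neg {s : ℝ} (h : s < 0) : deriv cutf s = 0 := by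
  have : cutf =ᶠ[nhds s] fun _ => 1 := by
    filter_upwards [gt_mem_nhds h] with t ht using cutf_of_nonpos (le_of_lt ht)
  rw [this.deriv_eq, deriv_const]

lemma hasCompactSupport_deriv_cutf : HasCompactSupport (deriv cutf) := by
  refine HasCompactSupport.intro (isCompact_Icc (a := (0 : ℝ)) (b := 1)) fun s hs => ?_
  rw [Set.mem_Icc, not_and_or, not_le, not_le] at hs
  rcases hs with h | h
  · exact deriv_cutf_of_neg h
  · exact deriv_cutf_of_one_lt h

lemma exists_deriv_cutf_bounds : ∃ L : ℝ, 0 ≤ L ∧ (∀ s, |deriv cutf s| ≤ L) ∧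
    ∀ s t, |deriv cutf s - deriv cutf t| ≤ L * |s - t| := by
  obtain ⟨C, hC⟩ := hasCompactSupport_deriv_cutf.exists_bound_of_continuous
    deriv_cutf_contDiff.continuous
  obtain ⟨C', hC'⟩ := ContDiff.lipschitzWith_of_hasCompactSupport hasCompactSupport_deriv_cutf
    deriv_cutf_contDiff (by simp)
  refine ⟨max C C', le_max_of_le_right C'.2, fun s => (hC s).trans (le_max_left _ _), fun s t => ?_⟩
  have := hC'.dist_le_mul s t
  rw [Real.dist_eq, Real.dist_eq] at this
  exact this.trans (mul_le_mul_of_nonneg_right (le_max_right _ _) (abs_nonneg _))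

/-- The divergence of the field `cutf (|x - p|² / r²) e` along `ν^⊥`. -/
def blowInt (p : E3) (ν : E3 → E3) (e : E3) (r : ℝ) (x : E3) : ℝ :=
  2 / r ^ 2 * deriv cutf (‖x - p‖ ^ 2 / r ^ 2) *
    (inner ℝ (x - p) e - inner ℝ (x - p) (ν x) * inner ℝ (ν x) e)

/-- The limit of `blowInt` in the parameter plane. -/
def flatInt (v : E2 → ℝ) (r : ℝ) (y : E2) : ℝ :=
  2 / r ^ 2 * deriv cutf (‖y‖ ^ 2 / r ^ 2) * v y

lemma abs_flatInt_le {L : ℝ} (hL : 0 ≤ L) (hL' : ∀ s, |deriv cutf s| ≤ L) {v : E2 → ℝ}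
    (hv : ∀ y, |v y| ≤ ‖y‖) (hr : 0 < r) (y : E2) : |flatInt v r y| ≤ 2 * L / r := by
  unfold flatInt
  by_cases hy : ‖y‖ ≤ r
  · rw [abs_mul, abs_mul, abs_of_pos (by positivity : 0 < 2 / r ^ 2)]
    calc _ ≤ 2 / r ^ 2 * L * r := by
          gcongr
          · exact hL' _
          · exact (hv y).trans hy
      _ = _ := by field_simp
  · rw [deriv_cutf_of_one_le]
    · simp; positivity
    · rw [one_le_div (by positivity)]
      push Not at hy
      gcongr

/-- Here w is the linear approximation of x − p and n₀ the normal at p. Replacing x − p and ν(x) by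
them costs O(η/r) pointwise, and since the relevant area is O(r²), the integral changes by O(ηr),
which is small against the main term of order r. -/
lemma blowInt_close {L : ℝ} (hL : 0 ≤ L) (hL' : ∀ s, |deriv cutf s| ≤ L)
    (hL2 : ∀ s t, |deriv cutf s - deriv cutf t| ≤ L * |s - t|) {η r : ℝ} (hη : 0 ≤ η) (hη1 : η ≤ 1)
    (hr : 0 < r) {p x e w n₀ : E3} (he : ‖e‖ ≤ 1) (hn : ‖ν x‖ = 1)
    (hw : ‖x - p - w‖ ≤ η * ‖w‖) (hn0 : ‖ν x - n₀‖ ≤ η) (hw0 : inner ℝ w n₀ = 0)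
    (hwr : ‖w‖ ≤ 2 * r) :
    |blowInt p ν e r x - 2 / r ^ 2 * deriv cutf (‖w‖ ^ 2 / r ^ 2) * inner ℝ w e| ≤
      60 * L * η / r := by
  set u := x - p with hu
  have h1 : |inner ℝ u (ν x)| ≤ 2 * η * ‖w‖ := by
    have : inner ℝ u (ν x) = inner ℝ (u - w) (ν x) + inner ℝ w (ν x - n₀) := by
      rw [inner_sub_left u w, inner_sub_right, hw0]; ring
    rw [this]
    refine (abs_add_le _ _).trans ?_
    have a1 := abs_real_inner_le_norm (u - w) (ν x)
    have a2 := abs_real_inner_le_norm w (ν x - n₀)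
    rw [hn, mul_one] at a1
    have a3 : ‖w‖ * ‖ν x - n₀‖ ≤ ‖w‖ * η := by gcongr
    linarith
  have h2 : |inner ℝ (ν x) e| ≤ 1 := by
    refine (abs_real_inner_le_norm _ _).trans ?_
    rw [hn, one_mul]; exact he
  have h3 : |(inner ℝ u e - inner ℝ u (ν x) * inner ℝ (ν x) e) - inner ℝ w e| ≤ 3 * η * ‖w‖ := by
    have : (inner ℝ u e - inner ℝ u (ν x) * inner ℝ (ν x) e) - inner ℝ w e =
        inner ℝ (u - w) e - inner ℝ u (ν x) * inner ℝ (ν x) e := by rw [inner_sub_left u w]; ring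
    rw [this]
    refine (abs_sub _ _).trans ?_
    have a1 : |inner ℝ (u - w) e| ≤ η * ‖w‖ := by
      refine (abs_real_inner_le_norm _ _).trans ?_
      calc _ ≤ η * ‖w‖ * 1 := by gcongr
        _ = _ := mul_one _
    have a2 : |inner ℝ u (ν x) * inner ℝ (ν x) e| ≤ 2 * η * ‖w‖ * 1 := by
      rw [abs_mul]; gcongr
    linarith
  have h4 : |‖u‖ ^ 2 - ‖w‖ ^ 2| ≤ 3 * η * ‖w‖ ^ 2 := by
    have b1 : |‖u‖ - ‖w‖| ≤ η * ‖w‖ := (abs_norm_sub_norm_le u w).trans hw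
    have b2 : ‖u‖ + ‖w‖ ≤ 3 * ‖w‖ := by
      have := (abs_le.1 b1).2
      nlinarith [norm_nonneg w]
    have : ‖u‖ ^ 2 - ‖w‖ ^ 2 = (‖u‖ - ‖w‖) * (‖u‖ + ‖w‖) := by ring
    rw [this, abs_mul, abs_of_nonneg (by positivity : 0 ≤ ‖u‖ + ‖w‖)]
    calc _ ≤ η * ‖w‖ * (3 * ‖w‖) := by gcongr
      _ = _ := by ring
  have h5 : |deriv cutf (‖u‖ ^ 2 / r ^ 2) - deriv cutf (‖w‖ ^ 2 / r ^ 2)| ≤ 12 * L * η := by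
    refine (hL2 _ _).trans ?_
    rw [← sub_div, abs_div, abs_of_pos (by positivity : 0 < r ^ 2)]
    have : |‖u‖ ^ 2 - ‖w‖ ^ 2| / r ^ 2 ≤ 12 * η := by
      rw [div_le_iff₀ (by positivity)]
      calc _ ≤ 3 * η * ‖w‖ ^ 2 := h4
        _ ≤ 3 * η * (2 * r) ^ 2 := by gcongr
        _ = _ := by ring
    calc _ ≤ L * (12 * η) := by gcongr
      _ = _ := by ring
  have h6 : |inner ℝ w e| ≤ 2 * r := by
    refine (abs_real_inner_le_norm _ _).trans ?_
    calc _ ≤ 2 * r * 1 := by gcongr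
      _ = _ := mul_one _
  have h7 : |blowInt p ν e r x - 2 / r ^ 2 * deriv cutf (‖w‖ ^ 2 / r ^ 2) * inner ℝ w e| ≤
      2 / r ^ 2 * (L * (3 * η * (2 * r)) + 12 * L * η * (2 * r)) := by
    have : blowInt p ν e r x - 2 / r ^ 2 * deriv cutf (‖w‖ ^ 2 / r ^ 2) * inner ℝ w e =
        2 / r ^ 2 * (deriv cutf (‖u‖ ^ 2 / r ^ 2) *
          ((inner ℝ u e - inner ℝ u (ν x) * inner ℝ (ν x) e) - inner ℝ w e) +
        (deriv cutf (‖u‖ ^ 2 / r ^ 2) - deriv cutf (‖w‖ ^ 2 / r ^ 2)) * inner ℝ w e) := by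
      unfold blowInt; ring
    rw [this, abs_mul, abs_of_pos (by positivity : 0 < 2 / r ^ 2)]
    gcongr
    refine (abs_add_le _ _).trans (add_le_add ?_ ?_)
    · rw [abs_mul]
      refine mul_le_mul (hL' _) (h3.trans ?_) (abs_nonneg _) hL
      gcongr
    · rw [abs_mul]
      exact mul_le_mul h5 h6 (abs_nonneg _) (by positivity)
  refine h7.trans (le_of_eq ?_)
  field_simp
  ring

lemma continuous_flatInt {v : E2 → ℝ} (hv : Continuous v) (r : ℝ) : Continuous (flatInt v r) := by
  unfold flatInt
  refine (continuous_const.mul (deriv_cutf_contDiff.continuous.comp ?_)).mul hv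
  fun_prop

/-- Asymptotics of the first variation under blow-up at a boundary point. -/
lemma IsParam.blowup (hS : IsPuncturedSurface S) (hfin : HasLocFiniteArea S) {r₀ : ℝ}
    (H : IsParam S p D F c h τ m r₀ U) (hp : p ∈ S)
    (hνu : ∀ᶠ x in nhds p, ‖ν x‖ = 1) (hνc : ∀ᶠ x in nhds p, ContinuousAt ν x)
    (hντ : ∀ y, inner ℝ (frameMap τ m y) (ν p) = 0) {e : E3} (he : ‖e‖ ≤ 1) {ε : ℝ} (hε : 0 < ε) :
    ∀ᶠ r in 𝓝[>] (0 : ℝ), |∫ x in S, blowInt p ν e r x ∂μHE[2] -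
      ∫ y in D ∩ ball 0 (2 * r), flatInt (fun y => inner ℝ (frameMap τ m y) e) r y| ≤
        ε * r := by
  obtain ⟨L, hL, hL1, hL2⟩ := exists_deriv_cutf_bounds
  set v : E2 → ℝ := fun y => inner ℝ (frameMap τ m y) e with hv
  have hvc : Continuous v := by fun_prop
  have hvb : ∀ y, |v y| ≤ ‖y‖ := fun y => by
    refine (abs_real_inner_le_norm _ _).trans ?_
    rw [H.frame.norm_map]
    exact mul_le_of_le_one_right (norm_nonneg _) he
  set A₁ : ℝ := (volume : Measure E2).real (ball 0 1) with hA₁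
  have hA₁0 : 0 ≤ A₁ := measureReal_nonneg
  -- the choice of the small constants
  obtain ⟨K, hK, hKε⟩ : ∃ K : NNReal, 1 < K ∧
      3 * (((K : ℝ) ^ 2 - 1) * K ^ 2) * (2 * L * (4 * A₁)) ≤ ε / 2 ∧ (K : ℝ) ^ 2 ≤ 2 := by
    have hcont : ContinuousAt (fun K : ℝ => 3 * ((K ^ 2 - 1) * K ^ 2) * (2 * L * (4 * A₁))) 1 := by
      fun_prop
    have hc2 : ContinuousAt (fun K : ℝ => K ^ 2) 1 := by fun_prop
    have e1 : ∀ᶠ K : ℝ in nhds 1, 3 * ((K ^ 2 - 1) * K ^ 2) * (2 * L * (4 * A₁)) < ε / 2 :=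
      hcont.eventually (gt_mem_nhds (by have := half_pos hε; simpa using this))
    have e2 : ∀ᶠ K : ℝ in nhds 1, K ^ 2 < 2 := hc2.eventually (gt_mem_nhds (by norm_num))
    obtain ⟨δ, hδ, hball⟩ := Metric.eventually_nhds_iff_ball.1 (e1.and e2)
    have hT : ((1 + δ / 2).toNNReal : ℝ) = 1 + δ / 2 := Real.coe_toNNReal _ (by positivity)
    refine ⟨(1 + δ / 2).toNNReal, ?_, ?_⟩
    · rw [← NNReal.coe_lt_coe, hT, NNReal.coe_one]
      linarith
    · rw [hT]
      have := hball (1 + δ / 2) (by simp [abs_of_pos hδ]; linarith)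
      exact ⟨this.1.le, this.2.le⟩
  -- The bound 1/4 guarantees that points of S within r of p have parameters within 2r. The other
  -- bound makes the pointwise error times the area 8 A₁ r² at most ε r / 2.
  set η : ℝ := min (1 / 4) (ε / (2 * (60 * L * (8 * A₁) + 1))) with hη
  have hη0 : 0 < η := by positivity
  have hη4 : η ≤ 1 / 4 := min_le_left _ _
  have hηε : 60 * L * η * (8 * A₁) ≤ ε / 2 := by
    have h1 : η ≤ ε / (2 * (60 * L * (8 * A₁) + 1)) := min_le_right _ _
    rw [le_div_iff₀ (by positivity)] at h1
    nlinarith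
  obtain ⟨ρ₀, hρ₀, hcomp⟩ := H.measure_compare hS.measurableSet hK
  have hF0 : ∀ᶠ y in nhds (0 : E2), ‖F y - p - frameMap τ m y‖ ≤ η * ‖y‖ := by
    have := H.deriv_zero.isLittleO.def hη0
    simpa [H.base] using this
  have hνp : ∀ᶠ x in nhds p, ‖ν x - ν p‖ ≤ η := by
    have := Metric.tendsto_nhds.1 hνc.self_of_nhds.tendsto η hη0
    filter_upwards [this] with x hx
    rw [dist_eq_norm] at hx; exact hx.le
  have hFp : ContinuousAt F 0 := H.deriv_zero.continuousAt
  have hνF : ∀ᶠ y in nhds (0 : E2), ‖ν (F y) - ν p‖ ≤ η ∧ ‖ν (F y)‖ = 1 := by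
    have h1 : Tendsto F (nhds 0) (nhds p) := by simpa only [H.base] using hFp.tendsto
    exact h1.eventually (hνp.and hνu)
  obtain ⟨ρ₁, hρ₁, hball⟩ := Metric.eventually_nhds_iff_ball.1 (hF0.and hνF)
  have hcp : ContinuousAt c p := (H.coord_smooth.contDiffAt (H.isOpen.mem_nhds H.mem)).continuousAt
  have hc0 : c p = 0 := by
    have := (H.maps 0 (mem_ball_self H.pos)).2.1
    rwa [H.base] at this
  have hpz : p ≠ 0 := fun h0 => hS.zero_notMem (h0 ▸ hp)
  have hxnear : ∀ᶠ x in nhds p, x ∈ U ∧ c x ∈ ball (0 : E2) ρ₁ ∧ ContinuousAt ν x ∧ x ≠ 0 := by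
    have : ∀ᶠ x in nhds p, c x ∈ ball (0 : E2) ρ₁ := by
      apply hcp.eventually_mem
      rw [hc0]; exact ball_mem_nhds 0 hρ₁
    exact (H.isOpen.eventually_mem H.mem).and (this.and (hνc.and (eventually_ne_nhds hpz)))
  obtain ⟨ρ₂, hρ₂, hball2⟩ := Metric.eventually_nhds_iff_ball.1 hxnear
  have hrs : ∀ᶠ r in 𝓝[>] (0 : ℝ), 0 < r ∧ r < ρ₂ ∧ 2 * r < ρ₁ ∧ 2 * r < ρ₀ := by
    have : Set.Ioo (0 : ℝ) (min ρ₂ (min (ρ₁ / 2) (ρ₀ / 2))) ∈ 𝓝[>] (0 : ℝ) :=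
      Ioo_mem_nhdsGT (by positivity)
    filter_upwards [this] with r hr
    obtain ⟨h0, h1⟩ := hr
    have h2 := lt_min_iff.1 h1
    have h3 := lt_min_iff.1 h2.2
    exact ⟨h0, h2.1, by linarith [h3.1], by linarith [h3.2]⟩
  filter_upwards [hrs] with r hr
  obtain ⟨hr0, hr2, hr1, hrρ⟩ := hr
  obtain ⟨hae, hle1, hle2⟩ := hcomp (2 * r) (by positivity) hrρ.le
  set V := U ∩ c ⁻¹' ball 0 (2 * r) with hV
  set νm := (μHE[2].restrict (S ∩ V)).map c with hνm
  set l := (volume : Measure E2).restrict (D ∩ ball 0 (2 * r)) with hl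
  have hVo : IsOpen V := H.isOpen_preimage _
  have hVm : MeasurableSet (S ∩ V) := hS.measurableSet.inter hVo.measurableSet
  have hlfin : IsFiniteMeasure l := ⟨by
    rw [hl, Measure.restrict_apply_univ]
    exact (measure_mono Set.inter_subset_right).trans_lt Metric.isBounded_ball.measure_lt_top⟩
  have hlu : l.real Set.univ ≤ 4 * A₁ * r ^ 2 := by
    have h1 : l.real Set.univ ≤ (volume : Measure E2).real (ball 0 (2 * r)) := by
      rw [hl, measureReal_restrict_apply_univ]
      exact measureReal_mono Set.inter_subset_right Metric.isBounded_ball.measure_lt_top.ne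
    have h2 : (volume : Measure E2).real (ball 0 (2 * r)) = (2 * r) ^ 2 * A₁ := by
      rw [Measure.real, Measure.addHaar_ball _ _ (by positivity), ENNReal.toReal_mul,
        ENNReal.toReal_ofReal (by positivity), finrank_euclideanSpace_fin]
      rfl
    rw [h2] at h1
    linarith
  have hνfin : IsFiniteMeasure νm := ⟨by
    have h1 := hle1 Set.univ
    refine h1.trans_lt ?_
    rw [Measure.smul_apply, ENNReal.smul_def, smul_eq_mul]
    exact ENNReal.mul_lt_top ENNReal.coe_lt_top (measure_lt_top l _)⟩
  have hνu2 : νm.real Set.univ ≤ 8 * A₁ * r ^ 2 := by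
    have h1 := ENNReal.toReal_mono (by
      rw [Measure.smul_apply, ENNReal.smul_def, smul_eq_mul]
      exact ENNReal.mul_ne_top ENNReal.coe_ne_top (measure_ne_top l _)) (hle1 Set.univ)
    rw [Measure.smul_apply, ENNReal.smul_def, smul_eq_mul, ENNReal.toReal_mul] at h1
    change νm.real Set.univ ≤ ((K ^ 2 : NNReal) : ℝ) * l.real Set.univ at h1
    rw [NNReal.coe_pow] at h1
    have : (K : ℝ) ^ 2 * l.real Set.univ ≤ 2 * (4 * A₁ * r ^ 2) := by
      gcongr
      exact hKε.2
    linarith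
  have hSVfin : IsFiniteMeasure (μHE[2].restrict (S ∩ V)) := ⟨by
    have : νm Set.univ = (μHE[2].restrict (S ∩ V)) Set.univ := by
      rw [hνm, Measure.map_apply_of_aemeasurable hae MeasurableSet.univ, Set.preimage_univ]
    rw [← this]; exact measure_lt_top _ _⟩
  have hSVu : (μHE[2]).real (S ∩ V) = νm.real Set.univ := by
    rw [Measure.real, Measure.real, hνm, Measure.map_apply_of_aemeasurable hae MeasurableSet.univ,
      Set.preimage_univ, Measure.restrict_apply_univ]
  -- comparison in the parameter plane
  have hA := integral_close (κ := K ^ 2) (one_le_pow₀ hK.le) hle1 hle2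
    (continuous_flatInt hvc r).measurable (abs_flatInt_le hL hL1 hvb hr0)
  rw [hνm, integral_map hae (continuous_flatInt hvc r).aestronglyMeasurable] at hA
  -- comparison on the surface
  have hpt : ∀ x ∈ S ∩ V, |blowInt p ν e r x - flatInt v r (c x)| ≤ 60 * L * η / r := by
    rintro x ⟨hxS, hxU, hxc⟩
    obtain ⟨-, -, hFx⟩ := H.mem_domain hxU hxS
    have hcx : ‖c x‖ < 2 * r := by simpa using hxc
    obtain ⟨g1, g2, g3⟩ := hball (c x) (by rw [mem_ball_zero_iff]; linarith)
    rw [hFx] at g1 g2 g3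
    have := blowInt_close hL hL1 hL2 hη0.le (by linarith) hr0 he g3 (w := frameMap τ m (c x))
      (by rw [H.frame.norm_map]; exact g1) g2 (hντ _) (by rw [H.frame.norm_map]; exact hcx.le)
    rwa [H.frame.norm_map] at this
  have hsupp : ∀ x, r ≤ ‖x - p‖ → blowInt p ν e r x = 0 := by
    intro x hx
    rw [blowInt, deriv_cutf_of_one_le, mul_zero, zero_mul]
    rw [one_le_div (by positivity)]
    gcongr
  have hin : ∀ x ∈ S, x ∉ V → blowInt p ν e r x = 0 := by
    intro x hxS hxV
    apply hsupp
    by_contra hlt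
    push Not at hlt
    obtain ⟨g1, g2, -⟩ := hball2 x (by rw [mem_ball_iff_norm]; linarith)
    obtain ⟨-, -, hFx⟩ := H.mem_domain g1 hxS
    obtain ⟨g3, -⟩ := hball (c x) g2
    rw [hFx] at g3
    refine hxV ⟨g1, ?_⟩
    rw [Set.mem_preimage, mem_ball_zero_iff]
    have h1 : ‖frameMap τ m (c x)‖ ≤ ‖x - p‖ + ‖x - p - frameMap τ m (c x)‖ := by
      have := norm_sub_le (x - p) (x - p - frameMap τ m (c x))
      rwa [sub_sub_cancel] at this
    rw [H.frame.norm_map] at h1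
    nlinarith [norm_nonneg (c x)]
  have hIS : ∫ x in S, blowInt p ν e r x ∂μHE[2] = ∫ x in S ∩ V, blowInt p ν e r x ∂μHE[2] := by
    refine (setIntegral_eq_of_subset_of_forall_sdiff_eq_zero hS.measurableSet
      Set.inter_subset_left fun x hx => hin x hx.1 fun hV => hx.2 ⟨hx.1, hV⟩)
  have hcB : ∀ x ∈ closedBall p r, ContinuousAt ν x ∧ x ≠ 0 := fun x hx =>
    (hball2 x (Metric.closedBall_subset_ball hr2 hx)).2.2
  have hint1 : IntegrableOn (blowInt p ν e r) S μHE[2] := by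
    refine integrableOn_of_support hS hfin (isCompact_closedBall p r) (fun h0 => (hcB 0 h0).2 rfl)
      (fun x hx => ContinuousAt.continuousWithinAt ?_) (fun x _ hx => hsupp x ?_)
    · have hc1 := (hcB x hx.2).1
      have hc2 : ContinuousAt (fun x : E3 => deriv cutf (‖x - p‖ ^ 2 / r ^ 2)) x :=
        (deriv_cutf_contDiff.continuous.comp (by fun_prop)).continuousAt
      unfold blowInt
      exact (continuousAt_const.mul hc2).mul (by fun_prop)
    · rw [mem_closedBall_iff_norm, not_le] at hx; exact hx.le
  have hint2 : Integrable (fun x => flatInt v r (c x)) (μHE[2].restrict (S ∩ V)) := by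
    refine Integrable.of_bound ((continuous_flatInt hvc r).measurable.comp_aemeasurable
      hae).aestronglyMeasurable (2 * L / r) (Filter.Eventually.of_forall fun x => ?_)
    exact abs_flatInt_le hL hL1 hvb hr0 _
  have hB : |∫ x in S ∩ V, blowInt p ν e r x ∂μHE[2] - ∫ x in S ∩ V, flatInt v r (c x) ∂μHE[2]| ≤
      60 * L * η / r * (8 * A₁ * r ^ 2) := by
    rw [← integral_sub (hint1.mono_set Set.inter_subset_left) hint2, ← Real.norm_eq_abs]
    refine (norm_setIntegral_le_of_norm_le_const (C := 60 * L * η / r) ?_ hpt).trans ?_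
    · have := measure_lt_top (μHE[2].restrict (S ∩ V)) Set.univ
      rwa [Measure.restrict_apply_univ] at this
    · rw [hSVu]
      gcongr
  rw [hIS]
  have hC : 60 * L * η / r * (8 * A₁ * r ^ 2) ≤ ε / 2 * r := by
    calc _ = 60 * L * η * (8 * A₁) * r := by field_simp
      _ ≤ _ := by gcongr
  have hE : 3 * ((((K ^ 2 : NNReal) : ℝ) - 1) * (K ^ 2 : NNReal)) * (2 * L / r * l.real Set.univ) ≤
      ε / 2 * r := by
    rw [NNReal.coe_pow]
    have hK1 : (1 : ℝ) ≤ (K : ℝ) ^ 2 := one_le_pow₀ (by exact_mod_cast hK.le)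
    have hK2 : 0 ≤ (K : ℝ) ^ 2 - 1 := by linarith
    calc _ ≤ 3 * (((K : ℝ) ^ 2 - 1) * (K : ℝ) ^ 2) * (2 * L / r * (4 * A₁ * r ^ 2)) := by gcongr
      _ = 3 * (((K : ℝ) ^ 2 - 1) * (K : ℝ) ^ 2) * (2 * L * (4 * A₁)) * r := by field_simp
      _ ≤ _ := by gcongr; exact hKε.1
  calc _ ≤ _ := abs_sub_le _ (∫ x in S ∩ V, flatInt v r (c x) ∂μHE[2]) _
    _ ≤ ε / 2 * r + ε / 2 * r := add_le_add (hB.trans hC) (hA.trans hE)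
    _ = ε * r := by ring

/-! ### The contact angle -/

/-- The constant in the blow-up limit. -/
def flatB : ℝ := ∫ y in halfD, 2 * deriv cutf (‖y‖ ^ 2) * y 1

lemma measurableSet_halfD : MeasurableSet halfD :=
  measurableSet_le measurable_const (by fun_prop)

lemma continuous_flatB : Continuous fun y : E2 => 2 * deriv cutf (‖y‖ ^ 2) * y 1 := by
  refine (continuous_const.mul (deriv_cutf_contDiff.continuous.comp ?_)).mul ?_ <;> fun_prop

/-- The profile falls from 1 to 0 on [0, 1], so its derivative, which is never positive, is negative
somewhere and hence on an open set. That the constant is nonzero lets the blow-up determine the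
contact angle. -/
lemma flatB_neg : flatB < 0 := by
  have hsupp : HasCompactSupport fun y : E2 => 2 * deriv cutf (‖y‖ ^ 2) * y 1 := by
    refine HasCompactSupport.intro (isCompact_closedBall (0 : E2) 1) fun y hy => ?_
    rw [mem_closedBall_zero_iff, not_le] at hy
    rw [deriv_cutf_of_one_le (one_le_pow₀ hy.le)]; ring
  have hint := continuous_flatB.integrable_of_hasCompactSupport (μ := volume) hsupp
  have hnp : ∀ y ∈ halfD, 2 * deriv cutf (‖y‖ ^ 2) * y 1 ≤ 0 := fun y hy =>
    mul_nonpos_of_nonpos_of_nonneg (by have := deriv_cutf_nonpos (‖y‖ ^ 2); linarith) hy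
  obtain ⟨s, ⟨hs0, hs1⟩, hs⟩ : ∃ s ∈ Set.Ioo (0 : ℝ) 1, deriv cutf s < 0 := by
    obtain ⟨s, hs, hd⟩ := exists_deriv_eq_slope cutf (zero_lt_one' ℝ)
      cutf_contDiff.continuous.continuousOn
      (fun x _ => (cutf_hasDerivAt x).differentiableAt.differentiableWithinAt)
    rw [cutf_of_one_le le_rfl, cutf_of_nonpos le_rfl] at hd
    exact ⟨s, hs, by rw [hd]; norm_num⟩
  by_contra hge
  have hzero : ∫ y in halfD, -(2 * deriv cutf (‖y‖ ^ 2) * y 1) = 0 := by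
    rw [integral_neg, neg_eq_zero]
    exact le_antisymm (setIntegral_nonpos measurableSet_halfD hnp) (not_lt.1 hge)
  have h0 := (setIntegral_eq_zero_iff_of_nonneg_ae (ae_restrict_of_forall_mem measurableSet_halfD
    fun y hy => neg_nonneg.2 (hnp y hy)) hint.integrableOn.neg).1 hzero
  rw [Filter.EventuallyEq, ae_iff, Measure.restrict_apply' measurableSet_halfD] at h0
  set W : Set E2 := {y | 2 * deriv cutf (‖y‖ ^ 2) * y 1 < 0 ∧ 0 < y 1}
  have hWo : IsOpen W := (isOpen_lt continuous_flatB continuous_const).inter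
    (isOpen_lt continuous_const (show Continuous fun y : E2 => y 1 by fun_prop))
  have hWn : W.Nonempty := by
    refine ⟨EuclideanSpace.single 1 (Real.sqrt s), ?_, by simpa using hs0⟩
    have h1 : ‖(EuclideanSpace.single 1 (Real.sqrt s) : E2)‖ ^ 2 = s := by
      simp [Real.sq_sqrt hs0.le]
    rw [h1]
    have : 0 < Real.sqrt s := Real.sqrt_pos.2 hs0
    simp only [PiLp.single_apply, if_true]
    nlinarith
  refine (hWo.measure_pos volume hWn).ne' (measure_mono_null ?_ h0)
  rintro y ⟨h1, h2⟩
  refine ⟨?_, h2.le⟩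
  simp only [Set.mem_ofPred_eq, Pi.zero_apply, neg_eq_zero]
  exact h1.ne

/-- Rescaling by r: the area gives r², the prefactor r⁻², and the coordinate a factor r. -/
lemma integral_flatInt (hr : 0 < r) (k : ℝ) :
    ∫ y in halfD ∩ ball 0 (2 * r), flatInt (fun y => y 1 * k) r y = k * flatB * r := by
  have h1 : ∫ y in halfD ∩ ball 0 (2 * r), flatInt (fun y => y 1 * k) r y =
      ∫ y in halfD, flatInt (fun y => y 1 * k) r y := by
    refine (setIntegral_eq_of_subset_of_forall_sdiff_eq_zero measurableSet_halfD
      Set.inter_subset_left fun y hy => ?_).symm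
    have hy2 : 2 * r ≤ ‖y‖ := by
      by_contra h
      exact hy.2 ⟨hy.1, by rw [mem_ball_zero_iff]; linarith⟩
    rw [flatInt, deriv_cutf_of_one_le, mul_zero, zero_mul]
    rw [one_le_div (by positivity)]
    gcongr
    linarith
  have h2 := Measure.integral_comp_smul (volume : Measure E2)
    (halfD.indicator (flatInt (fun y => y 1 * k) r)) r
  rw [finrank_euclideanSpace_fin, abs_of_pos (by positivity),
    integral_indicator measurableSet_halfD, smul_eq_mul] at h2
  have h3 : (fun y : E2 => halfD.indicator (flatInt (fun y => y 1 * k) r) (r • y)) =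
      halfD.indicator (fun y => (r⁻¹ * k) * (2 * deriv cutf (‖y‖ ^ 2) * y 1)) := by
    ext y
    have hmem : r • y ∈ halfD ↔ y ∈ halfD := by
      simp only [halfD, Set.mem_ofPred_eq, PiLp.smul_apply, smul_eq_mul]
      exact mul_nonneg_iff_of_pos_left hr
    by_cases hy : y ∈ halfD
    · rw [Set.indicator_of_mem hy, Set.indicator_of_mem (hmem.2 hy), flatInt, norm_smul,
        Real.norm_eq_abs, abs_of_pos hr, mul_pow, mul_div_cancel_left₀ _ (by positivity)]
      simp only [PiLp.smul_apply, smul_eq_mul]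
      field_simp
    · rw [Set.indicator_of_notMem hy, Set.indicator_of_notMem (fun h => hy (hmem.1 h))]
  rw [h3, integral_indicator measurableSet_halfD, integral_const_mul] at h2
  rw [h1]
  change r⁻¹ * k * flatB = _ at h2
  generalize ∫ y in halfD, flatInt (fun y => y 1 * k) r y = I at h2 ⊢
  field_simp at h2
  linarith

/-- The field used in the blow-up. -/
lemma blowField_isTestField {p e : E3} (he : e 0 = 0) (hr : 0 < r) (hrp : r < ‖p‖) :
    IsTestField (fun x => cutf (‖x - p‖ ^ 2 / r ^ 2) • e) ∧
      tsupport (fun x => cutf (‖x - p‖ ^ 2 / r ^ 2) • e) ⊆ closedBall p r := by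
  have hs : tsupport (fun x => cutf (‖x - p‖ ^ 2 / r ^ 2) • e) ⊆ closedBall p r := by
    refine closure_minimal (fun x hx => ?_) Metric.isClosed_closedBall
    rw [mem_closedBall_iff_norm]
    by_contra h
    refine hx ?_
    simp only
    rw [cutf_of_one_le, zero_smul]
    rw [one_le_div (by positivity)]
    push Not at h
    gcongr
  refine ⟨⟨?_, (isCompact_closedBall p r).of_isClosed_subset (isClosed_tsupport _) hs, fun h => ?_,
    fun x _ => ?_⟩, hs⟩
  · exact (cutf_contDiff.comp (((contDiff_id.sub contDiff_const).norm_sq ℝ).div_const _)).smul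
      contDiff_const
  · have := hs h
    rw [mem_closedBall_iff_norm, zero_sub, norm_neg] at this
    linarith
  · rw [mem_wallPlane, PiLp.smul_apply, he, smul_zero]

lemma sdiv_blowField (p e : E3) (r : ℝ) (ν : E3 → E3) (x : E3) :
    sdiv (fderiv ℝ (fun x => cutf (‖x - p‖ ^ 2 / r ^ 2) • e) x) (ν x) = blowInt p ν e r x := by
  have h2 : HasFDerivAt (fun x : E3 => x - p) (ContinuousLinearMap.id ℝ E3) x :=
    (hasFDerivAt_id x).sub_const p
  have h3 := h2.norm_sq.mul_const (r ^ 2)⁻¹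
  have h4 : HasFDerivAt (fun x => cutf (‖x - p‖ ^ 2 / r ^ 2)) _ x :=
    HasDerivAt.comp_hasFDerivAt (h₂ := cutf) x (cutf_hasDerivAt (‖x - p‖ ^ 2 * (r ^ 2)⁻¹)) h3
  rw [sdiv_fderiv_smul _ h4.differentiableAt (differentiableAt_const e), fderiv_fun_const, h4.fderiv]
  simp only [Pi.zero_apply, sdiv_zero, smul_apply, smul_eq_mul, ContinuousLinearMap.comp_apply,
    innerSL_apply_apply, ContinuousLinearMap.id_apply, blowInt, nsmul_eq_mul]
  rw [real_inner_comm (ν x) e]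
  simp [div_eq_mul_inv]
  ring

/-- The curve t ↦ F(t, 0) runs in ∂S = ∂G, so in the parameters of G its second coordinate vanishes.
Differentiating at 0 shows that the unit vectors τ and τ' are proportional. -/
lemma IsParam.bdry_tangent {F F' : E2 → E3} {c c' : E3 → E2}
    {h h' : E3 → ℝ} {τ m τ' m' : E3} {r r' : ℝ} {U U' : Set E3}
    (H : IsParam S p halfD F c h τ m r U) (H' : IsParam G p halfD F' c' h' τ' m' r' U')
    (hb : ∀ y ∈ ball (0 : E2) r, y 1 = 0 → IsBoundaryPoint S (F y))
    (hb' : ∀ y ∈ ball (0 : E2) r', 0 < y 1 → IsInteriorPoint G (F' y))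
    (hSG : bdry S = bdry G) : τ = τ' ∨ τ = -τ' := by
  set γ : ℝ → E3 := fun t => F (t • EuclideanSpace.single 0 1) with hγ
  have hline : HasDerivAt (fun t : ℝ => t • (EuclideanSpace.single 0 1 : E2))
      (EuclideanSpace.single 0 1) 0 := by
    simpa using (hasDerivAt_id (0 : ℝ)).smul_const (EuclideanSpace.single 0 1 : E2)
  have hγd : HasDerivAt γ τ 0 := by
    have h0 : HasFDerivAt F (frameMap τ m) ((0 : ℝ) • (EuclideanSpace.single 0 1 : E2)) := by
      rw [zero_smul]; exact H.deriv_zero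
    have := h0.comp_hasDerivAt 0 hline
    refine this.congr_deriv ?_
    simp [frameMap_apply]
  have hγ0 : γ 0 = p := by simp [hγ, H.base]
  have hcd : HasFDerivAt c' (fderiv ℝ c' p) p :=
    ((H'.coord_smooth.contDiffAt (H'.isOpen.mem_nhds H'.mem)).differentiableAt (by simp)).hasFDerivAt
  set w := fderiv ℝ c' p τ with hw
  have hu : HasDerivAt (fun t => c' (γ t)) w 0 := by
    have h0 : HasFDerivAt c' (fderiv ℝ c' p) (γ 0) := by rw [hγ0]; exact hcd
    exact h0.comp_hasDerivAt 0 hγd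
  have hc0 : c' p = 0 := by
    have := (H'.maps 0 (mem_ball_self H'.pos)).2.1
    rwa [H'.base] at this
  have hev : ∀ᶠ t in nhds (0 : ℝ), c' (γ t) 1 = 0 ∧ F' (c' (γ t)) = γ t := by
    have e1 : ∀ᶠ t in nhds (0 : ℝ), t • (EuclideanSpace.single 0 1 : E2) ∈ ball (0 : E2) r := by
      apply hline.continuousAt.eventually_mem
      rw [zero_smul]; exact ball_mem_nhds 0 H.pos
    have e2 : ∀ᶠ t in nhds (0 : ℝ), γ t ∈ U' := by
      apply hγd.continuousAt.eventually_mem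
      rw [hγ0]; exact H'.isOpen.mem_nhds H'.mem
    filter_upwards [e1, e2] with t ht1 ht2
    have hbt : γ t ∈ bdry G := by
      rw [← hSG]
      exact hb _ ht1 (by simp)
    obtain ⟨g1, g2, g3⟩ := H'.mem_domain ht2 hbt.1
    refine ⟨?_, g3⟩
    by_contra hne
    have hpos : 0 < c' (γ t) 1 := lt_of_le_of_ne g1 (Ne.symm hne)
    have := hb' _ g2 hpos
    rw [g3] at this
    exact not_interior_and_boundary this hbt
  have hw1 : w 1 = 0 := by
    have d1 := (EuclideanSpace.proj (𝕜 := ℝ) (1 : Fin 2) : E2 →L[ℝ] ℝ).hasFDerivAt.comp_hasDerivAt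
      (0 : ℝ) hu
    have d2 : HasDerivAt (fun _ : ℝ => (0 : ℝ)) (w 1) 0 :=
      d1.congr_of_eventuallyEq (by filter_upwards [hev] with t ht using ht.1.symm)
    exact d2.unique (hasDerivAt_const _ _)
  have hτ : τ = w 0 • τ' := by
    have h0 : HasFDerivAt F' (frameMap τ' m') (c' (γ 0)) := by
      rw [hγ0, hc0]; exact H'.deriv_zero
    have d1 := h0.comp_hasDerivAt 0 hu
    have d2 := hγd.unique (d1.congr_of_eventuallyEq (by filter_upwards [hev] with t ht using ht.2.symm))
    rw [frameMap_apply, hw1, zero_smul, add_zero] at d2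
    exact d2
  have habs : |w 0| = 1 := by
    have := congrArg norm hτ
    rw [norm_smul, H.frame.norm_left, H'.frame.norm_left, mul_one, Real.norm_eq_abs] at this
    exact this.symm
  rcases (abs_eq zero_le_one).1 habs with h1 | h1
  · left; rw [hτ, h1, one_smul]
  · right; rw [hτ, h1, neg_one_smul]

lemma IsParam.wall_frame {G : Set E3} (H : IsParam G p D F c h τ m r U)
    (hD : IsDomain2 D) (hG : G ⊆ wall) (hp : p ∈ G) (y : E2) : frameMap τ m y 0 = 0 := by
  have h1 := H.frame_mem hD hp y
  have h2 := fderiv_eq_of_eqOn (f := fun y : E3 => y 0) (g := fun _ => (0 : ℝ)) hp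
    (by fun_prop) (by fun_prop) (Filter.Eventually.of_forall fun x hx => hG hx) h1
  have h3 : fderiv ℝ (fun y : E3 => y 0) p = EuclideanSpace.proj (𝕜 := ℝ) 0 :=
    (coordL 0).fderiv
  rw [h3] at h2
  simpa using h2

/-- The one-sided derivative of g along t ↦ F(0, t), a curve that enters S from p in the direction
m. -/
lemma IsParam.fderiv_conormal_nonneg (H : IsParam S p halfD F c h τ m r U)
    {g : E3 → ℝ} (hg : DifferentiableAt ℝ g p) (hg0 : g p = 0)
    (hgS : ∀ᶠ x in nhds p, x ∈ S → 0 ≤ g x) : 0 ≤ fderiv ℝ g p m := by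
  have hline : HasDerivAt (fun t : ℝ => t • (EuclideanSpace.single 1 1 : E2))
      (EuclideanSpace.single 1 1) 0 := by
    simpa using (hasDerivAt_id (0 : ℝ)).smul_const (EuclideanSpace.single 1 1 : E2)
  have h0 : HasFDerivAt F (frameMap τ m) ((0 : ℝ) • (EuclideanSpace.single 1 1 : E2)) := by
    rw [zero_smul]; exact H.deriv_zero
  have hF1 := h0.comp_hasDerivAt (0 : ℝ) hline
  have hF0 : F ((0 : ℝ) • (EuclideanSpace.single 1 1 : E2)) = p := by rw [zero_smul, H.base]
  have hg1 : HasFDerivAt g (fderiv ℝ g p) (F ((0 : ℝ) • (EuclideanSpace.single 1 1 : E2))) := by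
    rw [hF0]; exact hg.hasFDerivAt
  have h2 : HasDerivAt (fun t : ℝ => g (F (t • (EuclideanSpace.single 1 1 : E2))))
      (fderiv ℝ g p m) 0 := by
    refine (hg1.comp_hasDerivAt (0 : ℝ) hF1).congr_deriv ?_
    simp [frameMap_apply]
  have h3 := (hasDerivAt_iff_tendsto_slope_zero.1 h2).mono_left
    (nhdsWithin_mono (0 : ℝ) (show Set.Ioi (0 : ℝ) ⊆ {0}ᶜ from fun t ht => ne_of_gt ht))
  refine ge_of_tendsto h3 ?_
  have e1 : ∀ᶠ t in nhds (0 : ℝ), t • (EuclideanSpace.single 1 1 : E2) ∈ ball (0 : E2) r := by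
    apply hline.continuousAt.eventually_mem
    rw [zero_smul]; exact ball_mem_nhds 0 H.pos
  have e2 : ∀ᶠ t in nhds (0 : ℝ), F (t • (EuclideanSpace.single 1 1 : E2)) ∈ S →
      0 ≤ g (F (t • (EuclideanSpace.single 1 1 : E2))) := by
    have hc : Tendsto (fun t : ℝ => F (t • (EuclideanSpace.single 1 1 : E2))) (nhds 0)
        (nhds p) := by rw [← hF0]; exact hF1.continuousAt.tendsto
    exact hc.eventually hgS
  filter_upwards [mem_nhdsWithin_of_mem_nhds e1, mem_nhdsWithin_of_mem_nhds e2,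
    self_mem_nhdsWithin] with t ht1 ht2 ht3
  have ht0 : 0 < t := ht3
  have hge := ht2 ((H.maps _ ht1).2.2.2 (by simp [halfD, ht0.le]))
  have hz : g (F ((0 : ℝ) • (EuclideanSpace.single 1 1 : E2))) = 0 := by rw [hF0, hg0]
  simp only [zero_add, hz, sub_zero, smul_eq_mul]
  positivity

lemma IsParam.conormal_nonneg (H : IsParam S p halfD F c h τ m r U)
    (hS : S ⊆ halfSpace) (hp0 : p 0 = 0) : 0 ≤ m 0 := by
  have h1 := H.fderiv_conormal_nonneg (g := fun x => x 0) (by fun_prop) hp0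
    (Filter.Eventually.of_forall fun x hx => hS hx)
  rw [show fderiv ℝ (fun y : E3 => y 0) p = EuclideanSpace.proj (𝕜 := ℝ) 0 from
    (coordL 0).fderiv] at h1
  simpa using h1

lemma isDomain2_halfD : IsDomain2 halfD := Or.inr rfl

/-- Young's law: the inner conormals of `S` and `G` make a fixed angle. -/
lemma inner_conormal_eq (hpair : IsSurfacePair S G)
    (hstat : IsStationary a S G) (hfin : HasLocFiniteArea S) (hpS : p ∈ S) (hpG : p ∈ G)
    {F F' : E2 → E3} {c c' : E3 → E2} {h h' : E3 → ℝ} {τ m τ' m' : E3} {r r' : ℝ} {U U' : Set E3}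
    (H : IsParam S p halfD F c h τ m r U) (H' : IsParam G p halfD F' c' h' τ' m' r' U')
    (hτ : τ = τ' ∨ τ = -τ') : inner ℝ m m' = -a := by
  have hS := hpair.surface_left
  have hG := hpair.surface_right
  have hfinG := hasLocFiniteArea_of_subset_wall hpair.right_subset
  have hw := H'.wall_frame isDomain2_halfD hpair.right_subset hpG
  have hm'0 : m' 0 = 0 := by simpa [frameMap_apply] using hw (EuclideanSpace.single 1 1)
  obtain ⟨n, hn⟩ := hS.exists_normal hpS
  have hnp : ∀ y, inner ℝ (frameMap τ m y) (n p) = 0 := fun y => by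
    have h1 := H.frame_mem isDomain2_halfD hpS y
    rw [hn.plane.self_of_nhds hpS, Submodule.mem_orthogonal_singleton_iff_inner_left] at h1
    exact h1
  have hnc : ∀ᶠ x in nhds p, ContinuousAt n x := by
    filter_upwards [hn.smooth] with x hx using hx.continuousAt
  have hpz : p ≠ 0 := fun h0 => hS.zero_notMem (h0 ▸ hpS)
  have hτm : inner ℝ τ m' = (0 : ℝ) := by
    rcases hτ with h1 | h1
    · rw [h1]; exact H'.frame.orth
    · rw [h1, inner_neg_left, H'.frame.orth, neg_zero]
  have hv : (fun y : E2 => inner ℝ (frameMap τ m y) m') = fun y => y 1 * inner ℝ m m' := by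
    ext y
    rw [frameMap_apply, inner_add_left, inner_smul_left, inner_smul_left, hτm]
    simp
  have hv' : (fun y : E2 => inner ℝ (frameMap τ' m' y) m') = fun y => y 1 * 1 := by
    ext y
    rw [frameMap_apply, inner_add_left, inner_smul_left, inner_smul_left, H'.frame.orth,
      H'.frame.inner_right]
    simp
  by_contra hne
  have hB := flatB_neg
  set d : ℝ := inner ℝ m m' + a with hd
  have hd0 : 0 < |d| := abs_pos.2 fun h0 => hne (by linarith)
  -- Chosen so that the total error (1 + |a|) ε t is half of the main term |d flatB| t.
  set ε : ℝ := |d| * (-flatB) / (2 * (1 + |a|)) with hε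
  have hε0 : 0 < ε := by
    have : 0 < -flatB := by linarith
    positivity
  have b1 := H.blowup hS hfin hpS hn.unit hnc hnp (e := m') H'.frame.norm_right.le hε0
  have b2 := H'.blowup hG hfinG hpG (ν := fun _ => bv 0) (Filter.Eventually.of_forall fun _ => norm_bv 0)
    (Filter.Eventually.of_forall fun _ => continuousAt_const)
    (fun y => by rw [inner_bv_right]; exact hw y) (e := m') H'.frame.norm_right.le hε0
  obtain ⟨ρ, hρ, hρn⟩ := Metric.eventually_nhds_iff_ball.1 hn.eventually
  have b3 : ∀ᶠ t in 𝓝[>] (0 : ℝ), t < min ρ ‖p‖ :=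
    mem_nhdsWithin_of_mem_nhds (gt_mem_nhds (lt_min hρ (norm_pos_iff.2 hpz)))
  obtain ⟨t, ⟨⟨b1, b2⟩, b3⟩, ht⟩ := (((b1.and b2).and b3).and self_mem_nhdsWithin).exists
  have ht0 : 0 < t := ht
  obtain ⟨htest, hsup⟩ := blowField_isTestField hm'0 ht0 (b3.trans_le (min_le_right _ _))
  have hst := hstat _ htest
  unfold firstVariation at hst
  have i1 : ∫ x in S, tangentialDiv (tangentPlane S x)
      (fun x => cutf (‖x - p‖ ^ 2 / t ^ 2) • m') x ∂μHE[2] = ∫ x in S, blowInt p n m' t x ∂μHE[2] := by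
    refine setIntegral_congr_fun hS.measurableSet fun x hx => ?_
    by_cases hxb : x ∈ ball p ρ
    · have := hρn x hxb
      rw [tangentialDiv_eq_sdiv this.unit.self_of_nhds (this.plane.self_of_nhds hx), sdiv_blowField]
    · have hxt : x ∉ tsupport (fun x => cutf (‖x - p‖ ^ 2 / t ^ 2) • m') := fun h0 => hxb
        (Metric.closedBall_subset_ball (b3.trans_le (min_le_left _ _)) (hsup h0))
      rw [tangentialDiv_of_notMem_tsupport _ hxt, ← sdiv_blowField,
        fderiv_zero_of_notMem_tsupport hxt, sdiv_zero]
  have i2 : ∫ x in G, tangentialDiv wallPlane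
      (fun x => cutf (‖x - p‖ ^ 2 / t ^ 2) • m') x ∂μHE[2] =
        ∫ x in G, blowInt p (fun _ => bv 0) m' t x ∂μHE[2] := by
    refine setIntegral_congr_fun hG.measurableSet fun x hx => ?_
    rw [tangentialDiv_eq (norm_bv 0) wallPlane_eq, ← sdiv_blowField]
  rw [i1, i2] at hst
  rw [hv, integral_flatInt ht0] at b1
  rw [hv', integral_flatInt ht0] at b2
  set I := ∫ x in S, blowInt p n m' t x ∂μHE[2]
  set J := ∫ x in G, blowInt p (fun _ => bv 0) m' t x ∂μHE[2]
  -- Stationarity reads I + a J = 0, while the blow-up compares I with ⟨m, m'⟩ flatB t and J with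
  -- flatB t.
  have key : |d * flatB * t| ≤ (1 + |a|) * (ε * t) := by
    have e1 : d * flatB * t = -(I - inner ℝ m m' * flatB * t) - a * (J - 1 * flatB * t) := by
      rw [hd]; linear_combination hst
    rw [e1]
    refine (abs_sub _ _).trans ?_
    rw [abs_neg, abs_mul]
    have := mul_le_mul_of_nonneg_left b2 (abs_nonneg a)
    linarith
  rw [abs_mul, abs_mul, abs_of_neg hB, abs_of_pos ht0, hε] at key
  have e2 : (1 + |a|) * (|d| * (-flatB) / (2 * (1 + |a|)) * t) = |d| * (-flatB) * t / 2 := by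
    field_simp
  rw [e2] at key
  have : 0 < |d| * (-flatB) * t := mul_pos (mul_pos hd0 (by linarith)) ht0
  linarith

/-- Parametrisations of `S` and `G` near a common boundary point, in position relative to each
other. -/
lemma exists_contact (hpair : IsSurfacePair S G)
    (hstat : IsStationary a S G) (hfin : HasLocFiniteArea S) (hp : p ∈ bdry S) :
    ∃ F c h τ m r U F' c' h' τ' m' r' U', IsParam S p halfD F c h τ m r U ∧
      IsParam G p halfD F' c' h' τ' m' r' U' ∧
      (∀ y ∈ ball (0 : E2) r, y 1 = 0 → F y ∈ bdry S) ∧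
      (∀ y ∈ ball (0 : E2) r', y 1 = 0 → F' y ∈ bdry S) ∧
      (∀ y ∈ ball (0 : E2) r', 0 < y 1 → IsInteriorPoint G (F' y)) ∧
      (τ = τ' ∨ τ = -τ') ∧ τ' 0 = 0 ∧ m' 0 = 0 ∧
      m = Real.sqrt (1 - a ^ 2) • bv 0 - a • m' := by
  have hp2 : p ∈ bdry G := hpair.bdry_eq ▸ hp
  have hpw : p 0 = 0 := hpair.right_subset hp2.1
  obtain ⟨F, c, h, τ, m, r, U, H, hb⟩ := exists_param_boundary hp
  obtain ⟨F', c', h', τ', m', r', U', H', hb'⟩ := exists_param_boundary hp2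
  have hτ := H.bdry_tangent H' (fun y hy => (hb y hy).1) (fun y hy => (hb' y hy).2) hpair.bdry_eq
  have hw := H'.wall_frame isDomain2_halfD hpair.right_subset hp2.1
  have hm'0 : m' 0 = 0 := by simpa [frameMap_apply] using hw (EuclideanSpace.single 1 1)
  have hτ'0 : τ' 0 = 0 := by simpa [frameMap_apply] using hw (EuclideanSpace.single 0 1)
  have hin := inner_conormal_eq hpair hstat hfin hp.1 hp2.1 H H' hτ
  have hm0 := H.conormal_nonneg hpair.left_subset hpw
  have hτm : inner ℝ τ' m = (0 : ℝ) := by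
    rcases hτ with h1 | h1
    · rw [← h1]; exact H.frame.orth
    · have := H.frame.orth
      rwa [h1, inner_neg_left, neg_eq_zero] at this
  -- Comparison in the orthonormal basis e₁, τ', m': Young's law gives the component along m', and
  -- the one along τ' is zero. The first one is nonnegative because S lies in the half-space, which
  -- later selects the positive root.
  have hm : m = m 0 • bv 0 - a • m' := by
    rw [← sub_eq_zero]
    have b0 : ∀ v : E3, inner ℝ (bv 0) v = v 0 := fun v => by rw [real_inner_comm, inner_bv_right]
    refine eq_zero_of_inner_frame (norm_bv 0) H'.frame ?_ ?_ ?_ ?_ ?_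
    · rw [b0, hτ'0]
    · rw [b0, hm'0]
    · rw [b0]; simp [bv_apply, hm'0]
    · rw [inner_sub_right, inner_sub_right, inner_smul_right, inner_smul_right, inner_bv_right,
        hτm, hτ'0, H'.frame.orth]; ring
    · rw [inner_sub_right, inner_sub_right, inner_smul_right, inner_smul_right, inner_bv_right,
        hm'0, H'.frame.inner_right, real_inner_comm, hin]; ring
  have hsq : m 0 ^ 2 = 1 - a ^ 2 := by
    have h1 := H.frame.inner_right
    have h2 := congrArg (fun v => inner ℝ m v) hm
    simp only [inner_sub_right, inner_smul_right, inner_bv_right] at h2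
    rw [h2, hin] at h1
    linarith
  refine ⟨F, c, h, τ, m, r, U, F', c', h', τ', m', r', U', H, H', fun y hy => (hb y hy).1,
    fun y hy hy1 => ?_, fun y hy => (hb' y hy).2, hτ, hτ'0, hm'0, ?_⟩
  · rw [hpair.bdry_eq]; exact (hb' y hy).1 hy1
  · rw [← hsq, Real.sqrt_sq hm0]; exact hm

/-! ### Local structure at contact points -/

lemma IsParam.neg (H : IsParam S p D F c h τ m r U) :
    IsParam S p D F c (fun x => -h x) τ m r U := by
  refine ⟨H.frame, H.pos, H.isOpen, H.mem, H.base, H.smooth, H.deriv_zero, H.maps,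
    fun x hx h0 => H.coord x hx (neg_eq_zero.1 h0), H.coord_smooth, H.def_smooth.neg,
    fun x hx hxS => neg_eq_zero.2 (H.def_zero x hx hxS), fun x hx h0 => H.def_ne x hx ?_,
    fun y hy => neg_eq_zero.2 (H.def_map y hy)⟩
  rwa [fderiv_fun_neg, neg_eq_zero] at h0

/-- A function vanishing on a line with nonzero transversal derivative has the sign of the
transversal coordinate. -/
lemma sign_of_transversal {g : E2 → ℝ} (hr : 0 < r) (hg : ContDiffOn ℝ ∞ g (ball 0 r))
    (h0 : ∀ y ∈ ball (0 : E2) r, y 1 = 0 → g y = 0)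
    (hpos : 0 < fderiv ℝ g 0 (EuclideanSpace.single 1 1)) :
    ∀ᶠ y in nhds (0 : E2), ∃ k : ℝ, 0 < k ∧ g y = k * y 1 := by
  have hd : ∀ y ∈ ball (0 : E2) r, HasFDerivAt g (fderiv ℝ g y) y := fun y hy =>
    ((hg.contDiffAt (isOpen_ball.mem_nhds hy)).differentiableAt (by simp)).hasFDerivAt
  have hc : ContinuousAt (fun y => fderiv ℝ g y (EuclideanSpace.single 1 1)) 0 :=
    ((smooth_fderiv (hg.contDiffAt (ball_mem_nhds 0 hr))).continuousAt).clm_apply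
      continuousAt_const
  obtain ⟨ρ, hρ, hball⟩ := Metric.eventually_nhds_iff_ball.1
    ((hc.eventually (lt_mem_nhds hpos)).and (ball_mem_nhds (0 : E2) hr))
  filter_upwards [ball_mem_nhds (0 : E2) hρ] with y hy
  have hz : (EuclideanSpace.single 0 (y 0) : E2) ∈ ball (0 : E2) ρ := by
    rw [mem_ball_zero_iff] at hy ⊢
    rw [PiLp.norm_single]
    exact (PiLp.norm_apply_le y 0).trans_lt hy
  obtain ⟨z, hzs, hzz⟩ := domain_mvt (fun x hx => (hd x (hball x hx).2).hasFDerivWithinAt)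
    (convex_ball (0 : E2) ρ) hz hy
  rw [h0 _ (hball _ hz).2 (by simp), sub_zero] at hzz
  have e : y - EuclideanSpace.single 0 (y 0) = y 1 • EuclideanSpace.single 1 1 := by
    ext i; fin_cases i <;> simp
  rw [e, map_smul, smul_eq_mul] at hzz
  have hzb : z ∈ ball (0 : E2) ρ := (convex_ball (0 : E2) ρ).segment_subset hz hy hzs
  exact ⟨_, (hball z hzb).1, by rw [hzz, mul_comm]⟩

/-- The two possible normals at a contact point. -/
lemma normal_of_frame (ha : a ^ 2 < 1) {τ m τ' m' n : E3} (hf' : IsFrame τ' m')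
    (hτ : τ = τ' ∨ τ = -τ') (hτ'0 : τ' 0 = 0) (hm'0 : m' 0 = 0)
    (hm : m = Real.sqrt (1 - a ^ 2) • bv 0 - a • m') (hn : ‖n‖ = 1) (hnτ : inner ℝ n τ = 0)
    (hnm : inner ℝ n m = 0) :
    ∃ ε : ℝ, (ε = 1 ∨ ε = -1) ∧ n = ε • (Real.sqrt (1 - a ^ 2) • m' + a • bv 0) := by
  set s := Real.sqrt (1 - a ^ 2) with hs
  have hs0 : 0 < s := Real.sqrt_pos.2 (by linarith)
  have hs2 : s ^ 2 = 1 - a ^ 2 := Real.sq_sqrt (by linarith)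
  have b0 : ∀ v : E3, inner ℝ (bv 0) v = v 0 := fun v => by rw [real_inner_comm, inner_bv_right]
  have hnτ' : inner ℝ n τ' = 0 := by
    rcases hτ with h | h
    · rwa [← h]
    · rwa [h, inner_neg_right, neg_eq_zero] at hnτ
  rw [hm, inner_sub_right, inner_smul_right, inner_smul_right, inner_bv_right] at hnm
  set q : ℝ := inner ℝ n m' with hq
  have hn0 : n 0 = a * q / s := by field_simp; linarith
  have key : n = (q / s) • (s • m' + a • bv 0) := by
    rw [← sub_eq_zero]
    refine eq_zero_of_inner_frame (norm_bv 0) hf' ?_ ?_ ?_ ?_ ?_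
    · rw [b0, hτ'0]
    · rw [b0, hm'0]
    · rw [b0]; simp [bv_apply, hm'0, hn0]; field_simp; ring
    · rw [inner_sub_right, inner_smul_right, inner_add_right, inner_smul_right, inner_smul_right,
        hf'.orth, inner_bv_right, hτ'0, real_inner_comm, hnτ']; ring
    · rw [inner_sub_right, inner_smul_right, inner_add_right, inner_smul_right, inner_smul_right,
        hf'.inner_right, inner_bv_right, hm'0, real_inner_comm, ← hq]; field_simp; ring
  have hunit : ‖s • m' + a • bv 0‖ = 1 := by
    have h1 : ‖s • m' + a • bv 0‖ ^ 2 = 1 := by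
      rw [← real_inner_self_eq_norm_sq]
      simp only [inner_add_left, inner_add_right, inner_smul_left, inner_smul_right, inner_bv_right,
        b0, hf'.inner_right, hm'0, conj_trivial]
      simp [bv_apply]
      nlinarith
    nlinarith [norm_nonneg (s • m' + a • bv 0)]
  refine ⟨q / s, ?_, key⟩
  have h1 := congrArg norm key
  rw [norm_smul, hunit, hn, mul_one, Real.norm_eq_abs] at h1
  exact (abs_eq zero_le_one).1 h1.symm

/-- The map which straightens `S` and the wall simultaneously. -/
def wedgeMap (τ : E3) (h : E3 → ℝ) (x : E3) : E3 := !₂[x 0, inner ℝ τ x, h x]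

lemma wedgeMap_contDiffAt {τ : E3} {x : E3} (hh : ContDiffAt ℝ ∞ h x) :
    ContDiffAt ℝ ∞ (wedgeMap τ h) x := by
  rw [contDiffAt_euclidean]
  intro i
  fin_cases i
  · exact contDiffAt_euclidean.1 contDiffAt_id 0
  · exact contDiffAt_const.inner ℝ contDiffAt_id
  · exact hh

lemma wedgeMap_fderiv {τ : E3} {x : E3} (hh : ContDiffAt ℝ ∞ h x) (ξ : E3) :
    fderiv ℝ (wedgeMap τ h) x ξ = !₂[ξ 0, inner ℝ τ ξ, fderiv ℝ h x ξ] := by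
  have hd : DifferentiableAt ℝ (wedgeMap τ h) x :=
    (wedgeMap_contDiffAt hh).differentiableAt (by simp)
  ext i
  rw [← fderiv_coord hd]
  fin_cases i
  · change fderiv ℝ (fun y : E3 => y 0) x ξ = ξ 0
    rw [show fderiv ℝ (fun y : E3 => y 0) x = EuclideanSpace.proj (𝕜 := ℝ) 0 from
      (coordL 0).fderiv]
    simp
  · change fderiv ℝ (fun y : E3 => inner ℝ τ y) x ξ = inner ℝ τ ξ
    rw [show fderiv ℝ (fun y : E3 => inner ℝ τ y) x = innerSL ℝ τ from (innerSL ℝ τ).fderiv]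
    simp
  · rfl

/-- An open box. -/
def box (u : E3) (δ : ℝ) : Set E3 := {v | ∀ i, |v i - u i| < δ}

lemma box_isOpen (u : E3) (δ : ℝ) : IsOpen (box u δ) := by
  have : box u δ = ⋂ i, {v : E3 | |v i - u i| < δ} := by ext; simp [box]
  rw [this]
  refine isOpen_iInter_of_finite fun i => ?_
  exact isOpen_lt (by fun_prop) continuous_const

lemma mem_box_self (u : E3) {δ : ℝ} (hδ : 0 < δ) : u ∈ box u δ := fun i => by simpa using hδ

lemma exists_box_subset {u : E3} {W : Set E3} (hW : W ∈ nhds u) : ∃ δ > 0, box u δ ⊆ W := by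
  obtain ⟨ε, hε, hW⟩ := Metric.mem_nhds_iff.1 hW
  refine ⟨ε / 3, by positivity, fun v hv => hW ?_⟩
  rw [mem_ball_iff_norm]
  have h1 : ‖v - u‖ ^ 2 < ε ^ 2 := by
    rw [norm_sq_three]
    have h : ∀ i, (v - u) i ^ 2 ≤ (ε / 3) ^ 2 := fun i => by
      have := hv i
      rw [PiLp.sub_apply]
      exact sq_le_sq' (by linarith [(abs_lt.1 this).1]) (abs_lt.1 this).2.le
    nlinarith [h 0, h 1, h 2, sq_nonneg ε, mul_pos hε hε]
  exact lt_of_pow_lt_pow_left₀ 2 hε.le h1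

lemma box_convex (u : E3) (δ : ℝ) : Convex ℝ (box u δ) := by
  have : box u δ = ⋂ i, (coordL i) ⁻¹' ball (u i) δ := by
    ext; simp [box, Real.dist_eq]
  rw [this]
  exact convex_iInter fun i => (convex_ball _ _).is_linear_preimage
    (coordL i).isLinear

/-- A chart which straightens `S`, `G` and the wall near a contact point. -/
structure IsContactChart (a : ℝ) (S G : Set E3) (e : OpenPartialHomeomorph E3 E3) : Prop where
  chart : IsSmoothChart e
  target : ∃ u δ, 0 < δ ∧ u 0 = 0 ∧ u 2 = 0 ∧ e.target = box u δ
  coord : ∀ x ∈ e.source, e x 0 = x 0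
  left_iff : ∀ x ∈ e.source, (x ∈ S ↔ e x 2 = 0 ∧ 0 ≤ x 0)
  right_iff : ∀ x ∈ e.source, (x ∈ G ↔ x 0 = 0 ∧ e x 2 ≤ 0)
  normal : ∀ x ∈ e.source, IsNormal S (fun y => (‖grd (fun z => e z 2) y‖⁻¹ : ℝ) •
    grd (fun z => e z 2) y) x
  angle : ∀ x ∈ e.source, x ∈ S → x ∈ G → (‖grd (fun z => e z 2) x‖⁻¹ : ℝ) *
    grd (fun z => e z 2) x 0 = -a

/-- The inverse function theorem, with the target shrunk to a box so that its convex parts have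
connected preimages. -/
lemma exists_smooth_inverse {f : E3 → E3} (hf : ∀ᶠ x in nhds p, ContDiffAt ℝ ∞ f x)
    (hinj : ∀ ξ, fderiv ℝ f p ξ = 0 → ξ = 0) {W : Set E3} (hW : W ∈ nhds p) :
    ∃ e : OpenPartialHomeomorph E3 E3, p ∈ e.source ∧ e.source ⊆ W ∧ IsSmoothChart e ∧
      (∀ x, e x = f x) ∧ ∃ δ > 0, e.target = box (f p) δ := by
  have hp := hf.self_of_nhds
  let A : E3 ≃L[ℝ] E3 := (LinearEquiv.ofInjectiveEndo (fderiv ℝ f p : E3 →ₗ[ℝ] E3)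
    ((injective_iff_map_eq_zero _).2 hinj)).toContinuousLinearEquiv
  have hA : (A : E3 →L[ℝ] E3) = fderiv ℝ f p := by ext ξ; rfl
  have hd : HasFDerivAt f (A : E3 →L[ℝ] E3) p := by
    rw [hA]; exact (hp.differentiableAt (by simp)).hasFDerivAt
  set e0 := hp.toOpenPartialHomeomorph f hd (by simp) with he0
  have hcoe : ∀ x, e0 x = f x := fun x => rfl
  have hps : p ∈ e0.source := hp.mem_toOpenPartialHomeomorph_source hd (by simp)
  have hcf : ContinuousAt (fderiv ℝ f) p := (smooth_fderiv hp).continuousAt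
  have hgood : ∀ᶠ x in nhds p, x ∈ W ∧ ContDiffAt ℝ ∞ f x ∧
      ∃ B : E3 ≃L[ℝ] E3, (B : E3 →L[ℝ] E3) = fderiv ℝ f x := by
    have h1 : ∀ᶠ x in nhds p, fderiv ℝ f x ∈
        Set.range ((↑) : (E3 ≃L[ℝ] E3) → E3 →L[ℝ] E3) :=
      hcf.eventually_mem (by rw [← hA]; exact ContinuousLinearEquiv.nhds A)
    filter_upwards [hW, hf, h1] with x a1 a2 a3 using ⟨a1, a2, a3⟩
  obtain ⟨W', hW', hW'o, hpW'⟩ := eventually_nhds_iff.1 hgood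
  have hopen : IsOpen (e0.target ∩ e0.symm ⁻¹' W') := e0.isOpen_inter_preimage_symm hW'o
  have hmem : f p ∈ e0.target ∩ e0.symm ⁻¹' W' := by
    refine ⟨e0.map_source hps, ?_⟩
    rw [Set.mem_preimage, ← hcoe, e0.left_inv hps]; exact hpW'
  obtain ⟨δ, hδ, hbox⟩ := exists_box_subset (hopen.mem_nhds hmem)
  set e := (e0.symm.restrOpen (box (f p) δ) (box_isOpen _ _)).symm with he
  have ht : e.target = box (f p) δ := by
    have : e.target = e0.target ∩ box (f p) δ := rfl
    rw [this]; exact Set.inter_eq_right.2 fun x hx => (hbox hx).1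
  have hs : ∀ x ∈ e.source, x ∈ e0.source ∧ f x ∈ box (f p) δ := by
    intro x hx
    have h1 := e.map_source hx
    rw [ht] at h1
    have h2 : e.symm (e x) = x := e.left_inv hx
    have h3 : e0.symm (f x) = x := h2
    exact ⟨by rw [← h3]; exact e0.map_target (hbox h1).1, h1⟩
  have hsW : ∀ x ∈ e.source, x ∈ W' := by
    intro x hx
    have h1 := (hbox (hs x hx).2).2
    rw [Set.mem_preimage, ← hcoe, e0.left_inv (hs x hx).1] at h1
    exact h1
  refine ⟨e, ?_, fun x hx => (hW' x (hsW x hx)).1, ⟨?_, ?_⟩, fun x => rfl, δ, hδ, ht⟩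
  · have h1 : f p ∈ e.target := by rw [ht]; exact mem_box_self _ hδ
    have h2 := e.map_target h1
    have h3 : e.symm (f p) = p := by
      have : e.symm (f p) = e0.symm (f p) := rfl
      rw [this, ← hcoe, e0.left_inv hps]
    rwa [h3] at h2
  · intro x hx
    exact (hW' x (hsW x hx)).2.1.contDiffWithinAt
  · intro u hu
    have hx := e.map_target hu
    obtain ⟨-, h1, B, hB⟩ := hW' _ (hsW _ hx)
    refine (e.contDiffAt_symm hu (f₀' := B) ?_ h1).contDiffWithinAt
    rw [hB]; exact (h1.differentiableAt (by simp)).hasFDerivAt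

/-- Read in the coordinates x₂, x₃, the parametrisation of G has invertible derivative, so its image
is a neighbourhood: G is open in the wall near its interior points. -/
lemma interior_point_wall {G : Set E3} (hG : G ⊆ wall) {z : E3} (hz : IsInteriorPoint G z) :
    ∀ᶠ x in nhds z, x ∈ wall → x ∈ G := by
  obtain ⟨F, c, h, τ, m, r, U, H⟩ := exists_param_interior hz
  have hw := H.wall_frame (Or.inl rfl) hG hz.1
  set π := frameCoord (bv 1) (bv 2) with hπ
  have hπ1 : ∀ x : E3, π x = !₂[x 1, x 2] := by
    intro x
    ext i
    have b : ∀ j, inner ℝ (bv j) x = x j := fun j => by rw [real_inner_comm, inner_bv_right]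
    fin_cases i
    · change frameCoord (bv 1) (bv 2) x 0 = x 1
      rw [frameCoord_zero, b]
    · change frameCoord (bv 1) (bv 2) x 1 = x 2
      rw [frameCoord_one, b]
  have hinjw : ∀ x y : E3, x 0 = 0 → y 0 = 0 → π x = π y → x = y := by
    intro x y hx hy hxy
    rw [hπ1, hπ1] at hxy
    have h1 := congrArg (fun v : E2 => v 0) hxy
    have h2 := congrArg (fun v : E2 => v 1) hxy
    simp at h1 h2
    ext i; fin_cases i
    · exact hx.trans hy.symm
    · exact h1
    · exact h2
  have hstrict : HasStrictFDerivAt F (frameMap τ m) 0 :=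
    (H.smooth.contDiffAt (ball_mem_nhds 0 H.pos)).hasStrictFDerivAt' H.deriv_zero (by simp)
  have hcomp := π.hasStrictFDerivAt.comp (0 : E2) hstrict
  have hsurj : (π.comp (frameMap τ m)).range = ⊤ := by
    have hinj : Function.Injective (π.comp (frameMap τ m) : E2 →ₗ[ℝ] E2) := by
      refine (injective_iff_map_eq_zero _).2 fun y hy => ?_
      have h1 : frameMap τ m y = 0 := hinjw _ 0 (hw y) rfl (by
        rw [map_zero]; exact hy)
      rw [← norm_eq_zero, ← H.frame.norm_map, h1, norm_zero]
    exact LinearMap.range_eq_top.2 (LinearMap.injective_iff_surjective.1 hinj)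
  have hmap := hcomp.map_nhds_eq_of_surj hsurj
  have himg : (fun y => π (F y)) '' ball 0 r ∈ nhds (π z) := by
    have h1 : π (F 0) = π z := by rw [H.base]
    rw [← h1]
    refine (show Filter.map (fun y => π (F y)) (nhds 0) = nhds (π (F 0)) from hmap) ▸ ?_
    exact Filter.image_mem_map (ball_mem_nhds 0 H.pos)
  filter_upwards [π.continuous.continuousAt.preimage_mem_nhds himg] with x hx hxw
  obtain ⟨y, hy, hyx⟩ := hx
  have hFG : F y ∈ G := (H.maps y hy).2.2.2 trivial
  rw [← hinjw (F y) x (hG hFG) hxw hyx]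
  exact hFG

lemma IsNormal.frame_orthogonal {n : E3 → E3} (hn : IsNormal S n p)
    (H : IsParam S p D F c h τ m r U) (hD : IsDomain2 D) (hp : p ∈ S) :
    inner ℝ (n p) τ = 0 ∧ inner ℝ (n p) m = 0 := by
  have h1 : ∀ y, inner ℝ (n p) (frameMap τ m y) = 0 := fun y => by
    have h1 := H.frame_mem hD hp y
    rwa [hn.plane.self_of_nhds hp, mem_perp_iff] at h1
  exact ⟨by simpa [frameMap_apply] using h1 (EuclideanSpace.single 0 1),
    by simpa [frameMap_apply] using h1 (EuclideanSpace.single 1 1)⟩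

lemma inner_contact_conormal {m' : E3} (hm : ‖m'‖ = 1) (hm0 : m' 0 = 0) :
    inner ℝ (Real.sqrt (1 - a ^ 2) • m' + a • bv 0) m' = Real.sqrt (1 - a ^ 2) := by
  rw [inner_add_left, inner_smul_left, inner_smul_left, real_inner_self_eq_norm_sq, hm,
    real_inner_comm, inner_bv_right, hm0]
  simp

lemma grd_neg (h : E3 → ℝ) (x : E3) : grd (fun y => -h y) x = -grd h x := by
  ext i
  rw [PiLp.neg_apply, grd_apply, grd_apply, fderiv_fun_neg]
  rfl

/-- The coordinates are x₁, the component along the tangent of ∂S, and a defining function h of S.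
They are independent because S meets the wall transversally, which is where a² < 1 enters. The sign
of h is such that h ≤ 0 on G, and then the unit normal ∇h/|∇h| has first component −a along ∂S. -/
lemma exists_contactChart (ha : a ^ 2 < 1) (hpair : IsSurfacePair S G)
    (hstat : IsStationary a S G) (hfin : HasLocFiniteArea S) (hp : p ∈ bdry S) :
    ∃ e, p ∈ e.source ∧ IsContactChart a S G e := by
  have hs0 : 0 < Real.sqrt (1 - a ^ 2) := Real.sqrt_pos.2 (by linarith)
  have hbd : ∀ {x}, x ∈ bdry S → x ∈ S ∧ x ∈ G := fun {x} hx => by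
    rw [← hpair.inter_eq] at hx; exact hx
  have hpw : p 0 = 0 := hpair.right_subset (hbd hp).2
  have hpz : p ≠ 0 := fun h => hpair.surface_left.zero_notMem (h ▸ hp.1)
  obtain ⟨F, c, h₀, τ, m, r, U, F', c', h', τ', m', r', U', H₀, H', hb, hb', hi', hτ, hτ'0, hm'0,
    hm⟩ := exists_contact hpair hstat hfin hp
  -- Replaces h₀ by −h₀ if necessary, so that the function decreases from p into G.
  obtain ⟨h, k, hk, H, hgrd⟩ : ∃ (h : E3 → ℝ) (k : ℝ), 0 < k ∧ IsParam S p halfD F c h τ m r U ∧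
      grd h p = -(k • (Real.sqrt (1 - a ^ 2) • m' + a • bv 0)) := by
    have hn := H₀.isNormal isDomain2_halfD H₀.mem
    obtain ⟨h1, h2⟩ := hn.frame_orthogonal H₀ isDomain2_halfD hp.1
    obtain ⟨ε, hε, hεn⟩ := normal_of_frame ha H'.frame hτ hτ'0 hm'0 hm hn.unit.self_of_nhds h1 h2
    have hg0 : 0 < ‖grd h₀ p‖ := norm_pos_iff.2 (grd_ne_zero (H₀.def_ne p H₀.mem))
    have hg : grd h₀ p = ‖grd h₀ p‖ • (ε • (Real.sqrt (1 - a ^ 2) • m' + a • bv 0)) := by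
      rw [← hεn, smul_smul, mul_inv_cancel₀ hg0.ne', one_smul]
    rcases hε with rfl | rfl
    · refine ⟨_, _, hg0, H₀.neg, ?_⟩
      rw [grd_neg]
      nth_rw 1 [hg]
      rw [one_smul]
    · refine ⟨_, _, hg0, H₀, ?_⟩
      nth_rw 1 [hg]
      rw [neg_one_smul, smul_neg]
  have hhs : ∀ x ∈ U, ContDiffAt ℝ ∞ h x := fun x hx =>
    H.def_smooth.contDiffAt (H.isOpen.mem_nhds hx)
  -- the height on the parametrised surface
  have sS : ∀ᶠ y in nhds (0 : E2), ∃ k : ℝ, 0 < k ∧ F y 0 = k * y 1 := by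
    have hd : HasFDerivAt (fun y => F y 0)
        ((coordL 0).comp (frameMap τ m)) 0 :=
      (coordL 0).hasFDerivAt.comp 0 H.deriv_zero
    refine sign_of_transversal H.pos (contDiffOn_euclidean.1 H.smooth 0)
      (fun y hy hy1 => hpair.right_subset (hbd (hb y hy hy1)).2) ?_
    rw [hd.fderiv]
    have : m 0 = Real.sqrt (1 - a ^ 2) := by
      have := congrArg (fun v : E3 => v 0) hm
      simpa [bv_apply, hm'0] using this
    simp [frameMap_apply, this, hs0]
  have hF'c : ContinuousAt F' 0 := H'.deriv_zero.continuousAt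
  have sG : ∀ᶠ y in nhds (0 : E2), ∃ k : ℝ, 0 < k ∧ -h (F' y) = k * y 1 := by
    have h1 : ∀ᶠ y in nhds (0 : E2), F' y ∈ U := by
      apply hF'c.eventually_mem
      rw [H'.base]; exact H.isOpen.mem_nhds H.mem
    obtain ⟨ρ, hρ, hball⟩ := Metric.eventually_nhds_iff_ball.1
      (h1.and (ball_mem_nhds (0 : E2) H'.pos))
    have hhF : HasFDerivAt h (fderiv ℝ h p) (F' 0) := by
      rw [H'.base]; exact ((hhs p H.mem).differentiableAt (by simp)).hasFDerivAt
    have hd := (hhF.comp (0 : E2) H'.deriv_zero).neg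
    refine sign_of_transversal hρ ?_ (fun y hy hy1 => ?_) ?_
    · exact (H.def_smooth.comp (H'.smooth.mono fun y hy => (hball y hy).2)
        fun y hy => (hball y hy).1).neg
    · rw [H.def_zero _ (hball y hy).1 (hb' y (hball y hy).2 hy1).1, neg_zero]
    · change 0 < fderiv ℝ (-(h ∘ F')) 0 _
      rw [hd.fderiv]
      have e1 : frameMap τ' m' (EuclideanSpace.single 1 1) = m' := by simp [frameMap_apply]
      rw [neg_apply, ContinuousLinearMap.comp_apply, e1, ← inner_grd, hgrd, inner_neg_left,
        inner_smul_left, inner_contact_conormal H'.frame.norm_right hm'0, neg_neg]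
      exact mul_pos hk hs0
  have hc0 : c p = 0 := by
    have := (H.maps 0 (mem_ball_self H.pos)).2.1
    rwa [H.base] at this
  have hc'0 : c' p = 0 := by
    have := (H'.maps 0 (mem_ball_self H'.pos)).2.1
    rwa [H'.base] at this
  have hcc : Tendsto c (nhds p) (nhds 0) := by
    rw [← hc0]
    exact (H.coord_smooth.contDiffAt (H.isOpen.mem_nhds H.mem)).continuousAt.tendsto
  have hcc' : Tendsto c' (nhds p) (nhds 0) := by
    rw [← hc'0]
    exact (H'.coord_smooth.contDiffAt (H'.isOpen.mem_nhds H'.mem)).continuousAt.tendsto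
  have hW := ((H.isOpen.eventually_mem H.mem).and (H'.isOpen.eventually_mem H'.mem)).and
    ((hcc.eventually sS).and ((hcc'.eventually sG).and (eventually_ne_nhds hpz)))
  have hfs : ∀ᶠ x in nhds p, ContDiffAt ℝ ∞ (wedgeMap τ h) x := by
    filter_upwards [H.isOpen.mem_nhds H.mem] with x hx using wedgeMap_contDiffAt (hhs x hx)
  obtain ⟨e, hpe, hesW, hec, hef, δ, hδ, het⟩ := exists_smooth_inverse hfs (fun ξ hξ => by
    rw [wedgeMap_fderiv (hhs p H.mem)] at hξ
    have h0 := congrArg (fun v : E3 => v 0) hξ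
    have h1 := congrArg (fun v : E3 => v 1) hξ
    have h2 := congrArg (fun v : E3 => v 2) hξ
    simp only [PiLp.zero_apply] at h0 h1 h2
    change ξ 0 = 0 at h0
    change inner ℝ τ ξ = 0 at h1
    change fderiv ℝ h p ξ = 0 at h2
    have b0 : ∀ v : E3, inner ℝ (bv 0) v = v 0 := fun v => by rw [real_inner_comm, inner_bv_right]
    rw [← inner_grd, hgrd, inner_neg_left, inner_smul_left, inner_add_left, inner_smul_left,
      inner_smul_left, b0, h0] at h2
    refine eq_zero_of_inner_frame (norm_bv 0) H'.frame (by rw [b0, hτ'0]) (by rw [b0, hm'0])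
      (by rw [b0, h0]) ?_ ?_
    · rcases hτ with h | h
      · rwa [← h]
      · rwa [h, inner_neg_left, neg_eq_zero] at h1
    · simpa [hk.ne', hs0.ne'] using h2) hW
  have he2 : (fun z => e z 2) = h := by
    funext z; rw [hef]; rfl
  have he2' : ∀ z, e z 2 = h z := fun z => congrFun he2 z
  have he0 : ∀ z, e z 0 = z 0 := fun z => by rw [hef]; rfl
  have hfp0 : wedgeMap τ h p 0 = 0 := hpw
  have hfp2 : wedgeMap τ h p 2 = 0 := H.def_zero p H.mem hp.1
  have hSiff : ∀ x ∈ e.source, (x ∈ S ↔ e x 2 = 0 ∧ 0 ≤ x 0) := by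
    intro x hx
    obtain ⟨⟨hxU, -⟩, ⟨k, hk, hkx⟩, -, -⟩ := hesW hx
    rw [he2']
    refine ⟨fun h => ⟨H.def_zero x hxU h, hpair.left_subset h⟩, fun ⟨h1, h2⟩ => ?_⟩
    obtain ⟨h3, h4⟩ := H.coord x hxU h1
    rw [h4] at hkx
    rw [← h4]
    refine (H.maps _ h3).2.2.2 ?_
    rw [hkx] at h2
    exact (mul_nonneg_iff_of_pos_left hk).1 h2
  have hGle : ∀ x ∈ e.source, x ∈ G → h x ≤ 0 := by
    intro x hx hxG
    obtain ⟨⟨-, hxU⟩, -, ⟨k, hk, hkx⟩, -⟩ := hesW hx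
    obtain ⟨h1, -, h3⟩ := H'.mem_domain hxU hxG
    rw [h3] at hkx
    have : 0 ≤ k * c' x 1 := mul_nonneg hk.le h1
    linarith
  have hzero : ∀ x ∈ e.source, x 0 = 0 → h x = 0 → x ∈ G := by
    intro x hx hx0 hhx
    obtain ⟨⟨hxU, -⟩, ⟨k, hk, hkx⟩, -, -⟩ := hesW hx
    obtain ⟨h3, h4⟩ := H.coord x hxU hhx
    rw [h4, hx0] at hkx
    have h5 := hb _ h3 ((mul_eq_zero.1 hkx.symm).resolve_left hk.ne')
    rw [h4] at h5
    exact (hbd h5).2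
  have hGiff : ∀ x ∈ e.source, (x ∈ G ↔ x 0 = 0 ∧ e x 2 ≤ 0) := by
    intro x hx
    rw [he2']
    refine ⟨fun h => ⟨hpair.right_subset h, hGle x hx h⟩, fun ⟨hx0, hx2⟩ => ?_⟩
    rcases hx2.eq_or_lt with hx2 | hx2
    · exact hzero x hx hx0 hx2
    -- In the chart the part of the wall with h < 0 is convex, hence connected. G is open and closed
    -- in it and meets it, so G contains all of it.
    set Q : Set E3 := e.target ∩ {u | u 0 = 0 ∧ u 2 < 0} with hQ
    have hQc : Convex ℝ Q := by
      rw [hQ, het]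
      refine (box_convex _ _).inter ?_
      intro u hu v hv α β hα hβ hαβ
      refine ⟨by simp [hu.1, hv.1], ?_⟩
      simp only [PiLp.add_apply, PiLp.smul_apply, smul_eq_mul]
      rcases hα.eq_or_lt with h0 | h0
      · have : β = 1 := by linarith
        rw [← h0, this]; linarith [hv.2]
      · nlinarith [hu.2, hv.2, mul_nonneg hβ (neg_nonneg.2 hv.2.le),
          mul_pos h0 (neg_pos.2 hu.2)]
    have hCc : IsPreconnected (e.symm '' Q) :=
      hQc.isPreconnected.image _ (e.continuousOn_symm.mono Set.inter_subset_left)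
    have hC : ∀ z, z ∈ e.symm '' Q ↔ z ∈ e.source ∧ z 0 = 0 ∧ h z < 0 := by
      intro z
      constructor
      · rintro ⟨u, ⟨hu1, hu2, hu3⟩, rfl⟩
        refine ⟨e.map_target hu1, ?_, ?_⟩
        · rw [← he0, e.right_inv hu1]; exact hu2
        · rw [← he2', e.right_inv hu1]; exact hu3
      · rintro ⟨h1, h2, h3⟩
        exact ⟨e z, ⟨e.map_source h1, (he0 z).trans h2, by rw [he2']; exact h3⟩, e.left_inv h1⟩
    set u1 := interior {z | z ∈ wall → z ∈ G} with hu1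
    have hint : ∀ z ∈ e.symm '' Q, z ∈ G → z ∈ u1 := by
      intro z hz hzG
      obtain ⟨h1, h2, h3⟩ := (hC z).1 hz
      rw [hu1, mem_interior_iff_mem_nhds]
      refine interior_point_wall hpair.right_subset
        ((hpair.surface_right.smooth z hzG).resolve_right fun hbz => ?_)
      have : z ∈ bdry S := hpair.bdry_eq ▸ hbz
      have := ((hSiff z h1).1 this.1).1
      rw [he2'] at this
      linarith
    have hpt : (e.symm '' Q ∩ u1).Nonempty := by
      have h1 : ∀ᶠ t in nhds (0 : ℝ), F' (t • EuclideanSpace.single 1 1) ∈ e.source ∧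
          (∃ k : ℝ, 0 < k ∧ -h (F' (t • EuclideanSpace.single 1 1)) =
            k * (t • EuclideanSpace.single 1 1 : E2) 1) ∧
          t • (EuclideanSpace.single 1 1 : E2) ∈ ball (0 : E2) r' := by
        have hl : Tendsto (fun t : ℝ => t • (EuclideanSpace.single 1 1 : E2)) (nhds 0)
            (nhds 0) := by
          have : Continuous (fun t : ℝ => t • (EuclideanSpace.single 1 1 : E2)) := by fun_prop
          simpa using this.tendsto 0
        have h2 : ∀ᶠ y in nhds (0 : E2), F' y ∈ e.source := by
          apply hF'c.eventually_mem
          rw [H'.base]; exact e.open_source.mem_nhds hpe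
        exact hl.eventually (h2.and (sG.and (ball_mem_nhds 0 H'.pos)))
      obtain ⟨t, ⟨g1, ⟨k, hk, g2⟩, g3⟩, ht⟩ :=
        ((h1.filter_mono nhdsWithin_le_nhds).and (self_mem_nhdsWithin (s := Set.Ioi (0 : ℝ)))).exists
      have ht0 : 0 < t := ht
      have hI := hi' _ g3 (by simpa using ht0)
      have hneg : h (F' (t • EuclideanSpace.single 1 1)) < 0 := by
        have : 0 < k * (t • EuclideanSpace.single 1 1 : E2) 1 := by simp; positivity
        linarith
      have hmem : F' (t • EuclideanSpace.single 1 1) ∈ e.symm '' Q :=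
        (hC _).2 ⟨g1, hpair.right_subset hI.1, hneg⟩
      exact ⟨_, hmem, hint _ hmem hI.1⟩
    by_contra hxG
    have hGcl : ∀ z ∈ e.symm '' Q, z ∉ G → z ∈ (closure G)ᶜ := by
      intro z hz hzG hcl
      rcases hpair.surface_right.closed hcl with h1 | h1
      · exact hzG h1
      · exact (hesW ((hC z).1 hz).1).2.2.2 h1
    obtain ⟨z, hz, hz1, hz2⟩ := hCc u1 (closure G)ᶜ isOpen_interior isClosed_closure.isOpen_compl
      (fun z hz => by
        by_cases hzG : z ∈ G
        · exact Or.inl (hint z hz hzG)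
        · exact Or.inr (hGcl z hz hzG)) hpt
      ⟨x, (hC x).2 ⟨hx, hx0, hx2⟩, hGcl x ((hC x).2 ⟨hx, hx0, hx2⟩) hxG⟩
    exact hz2 (subset_closure (interior_subset hz1 ((hC z).1 hz).2.1))
  refine ⟨e, hpe, ⟨hec, ⟨_, δ, hδ, hfp0, hfp2, het⟩, fun x _ => he0 x, hSiff, hGiff, ?_, ?_⟩⟩
  · intro x hx
    rw [he2]
    exact H.isNormal isDomain2_halfD (hesW hx).1.1
  · intro x hx hxS hxG
    rw [he2]
    have hxU := (hesW hx).1.1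
    have hn := H.isNormal isDomain2_halfD hxU
    have hxb : x ∈ bdry S := hpair.inter_eq ▸ ⟨hxS, hxG⟩
    -- The angle at a further boundary point x comes from contact frames at x itself; the wrong sign
    -- of the normal is excluded since h ≤ 0 on G.
    obtain ⟨F₂, c₂, h₂, τ₂, m₂, r₂, U₂, F₂', c₂', h₂', τ₂', m₂', r₂', U₂', H₂, H₂', -, -, -, g1, g2, g3,
      g4⟩ := exists_contact hpair hstat hfin hxb
    obtain ⟨h1, h2⟩ := hn.frame_orthogonal H₂ isDomain2_halfD hxS
    obtain ⟨ε, hε, hεn⟩ := normal_of_frame ha H₂'.frame g1 g2 g3 g4 hn.unit.self_of_nhds h1 h2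
    have hle := H₂'.fderiv_conormal_nonneg (g := fun x => -h x)
      ((hhs x hxU).differentiableAt (by simp)).neg (by
        have := ((hSiff x hx).1 hxS).1
        rw [he2'] at this
        rw [this, neg_zero]) (by
      filter_upwards [e.open_source.mem_nhds hx] with z hz hzG
      have := hGle z hz hzG
      linarith)
    rw [fderiv_fun_neg, neg_apply, ← inner_grd] at hle
    have hg0 : 0 < ‖grd h x‖ := norm_pos_iff.2 (grd_ne_zero (H.def_ne x hxU))
    have hg : grd h x = ‖grd h x‖ • (ε • (Real.sqrt (1 - a ^ 2) • m₂' + a • bv 0)) := by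
      rw [← hεn, smul_smul, mul_inv_cancel₀ hg0.ne', one_smul]
    rcases hε with rfl | rfl
    · exfalso
      rw [hg, inner_smul_left, one_smul, inner_contact_conormal H₂'.frame.norm_right g3] at hle
      have := mul_pos hg0 hs0
      simp only [conj_trivial] at hle
      linarith
    · have := congrArg (fun v : E3 => v 0) hεn
      simp only [PiLp.smul_apply, smul_eq_mul, PiLp.add_apply, g3, bv_apply] at this
      rw [this]; simp

/-! ### Sides of the surface and a global unit normal -/

/-- A locally constant sign cocycle on a contractible space is a coboundary. -/
theorem exists_signs {B : Type} [TopologicalSpace B] (U : B → Set B) (hU : ∀ i, IsOpen (U i))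
    (hmem : ∀ x, x ∈ U x) (c : B → B → B → ℤˣ) (hself : ∀ i, ∀ x ∈ U i, c i i x = 1)
    (hc : ∀ i j, ∀ x ∈ U i ∩ U j, ∀ᶠ y in nhds x, c i j y = c i j x)
    (hcomp : ∀ i j k, ∀ x ∈ U i ∩ U j ∩ U k, c j k x * c i j x = c i k x)
    (H : C(unitInterval × B, B)) (b : B) (H0 : ∀ x, H (0, x) = b) (H1 : ∀ x, H (1, x) = x) :
    ∃ s : B → B → ℤˣ, (∀ i, ∀ x ∈ U i, ∀ᶠ y in nhds x, s i y = s i x) ∧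
      ∀ i j, ∀ x ∈ U i ∩ U j, s j x = c i j x * s i x := by
  have hdisc : DiscreteTopology ℤˣ := inferInstance
  -- The cocycle glues copies of ℤˣ to a double covering of B. Lifting the contraction `H` from the
  -- base point gives a global section, and the signs are its local coordinates.
  let Z : FiberBundleCore B B ℤˣ :=
    { baseSet := U
      isOpen_baseSet := hU
      indexAt := id
      mem_baseSet_at := hmem
      coordChange := fun i j x v => c i j x * v
      coordChange_self := fun i x hx v => by rw [hself i x hx, one_mul]
      continuousOn_coordChange := fun i j => by
        intro q hq
        have h1 : ContinuousAt (fun q : B × ℤˣ => c i j q.1 * q.2) q := by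
          have h2 : ContinuousAt (fun q : B × ℤˣ => c i j q.1) q := by
            refine ContinuousAt.comp (f := Prod.fst) (g := c i j) ?_ continuousAt_fst
            exact (continuousAt_const (y := c i j q.1)).congr
              ((hc i j q.1 hq.1).mono fun y hy => hy.symm)
          exact h2.mul continuousAt_snd
        exact h1.continuousWithinAt
      coordChange_comp := fun i j k x hx v => by rw [← mul_assoc, hcomp i j k x hx] }
  have hcov : IsCoveringMap Z.proj := FiberBundle.isCoveringMap (F := ℤˣ) (E := Z.Fiber)
  let e₀ : Z.TotalSpace := ⟨b, (1 : ℤˣ)⟩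
  let f : C(B, Z.TotalSpace) := ContinuousMap.const B e₀
  have hf : ∀ x, H (0, x) = Z.proj (f x) := fun x => H0 x
  let L := hcov.liftHomotopy H f hf
  have hL : ∀ x, Z.proj (L (1, x)) = x := fun x => by
    have := congrFun (hcov.liftHomotopy_lifts H f hf) (1, x)
    exact this.trans (H1 x)
  refine ⟨fun i x => (Z.localTriv i (L (1, x))).2, ?_, ?_⟩
  · intro i x hx
    have h1 : ContinuousAt (fun x => Z.localTriv i (L (1, x))) x := by
      refine ContinuousAt.comp (f := fun x => L (1, x)) (g := Z.localTriv i) ?_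
        (L.continuous.comp (by fun_prop)).continuousAt
      refine (Z.localTriv i).continuousAt ?_
      have h2 : Z.proj (L (1, x)) ∈ U i := by rw [hL]; exact hx
      exact (Z.mem_localTriv_source i _).2 h2
    exact h1.snd.eventually ((isOpen_discrete {(Z.localTriv i (L (1, x))).2}).mem_nhds rfl)
  · intro i j x hx
    let v : ℤˣ := (L (1, x)).2
    have h1 : ∀ k, (Z.localTriv k (L (1, x))).2 = c x k x * v := fun k => by
      have h2 : (L (1, x)).1 = x := hL x
      change c (L (1, x)).1 k (L (1, x)).1 * v = _
      rw [h2]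
    simp only [h1]
    rw [← mul_assoc, hcomp x i j x ⟨⟨hmem x, hx.1⟩, hx.2⟩]

/-- The sign of a real number, as an integer. -/
def sgn (r : ℝ) : ℤ := SignType.sign r

lemma sgn_of_pos (h : 0 < r) : sgn r = 1 := by simp [sgn, sign_pos h]

lemma sgn_of_neg (h : r < 0) : sgn r = -1 := by simp [sgn, sign_neg h]

lemma sgn_zero : sgn 0 = 0 := by simp [sgn]

lemma sgn_neg (r : ℝ) : sgn (-r) = -sgn r := by simp [sgn, Left.sign_neg]

lemma sgn_ne_zero (h : r ≠ 0) : sgn r ≠ 0 := by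
  rcases lt_or_gt_of_ne h with h | h
  · rw [sgn_of_neg h]; decide
  · rw [sgn_of_pos h]; decide

lemma eventually_sgn_of_pos {x : E3} (hc : ContinuousAt h x) (hx : 0 < h x) :
    ∀ᶠ y in nhds x, sgn (h y) = 1 :=
  (hc.eventually (lt_mem_nhds hx)).mono fun _ => sgn_of_pos

lemma eventually_sgn_of_neg {x : E3} (hc : ContinuousAt h x) (hx : h x < 0) :
    ∀ᶠ y in nhds x, sgn (h y) = -1 :=
  (hc.eventually (gt_mem_nhds hx)).mono fun _ => sgn_of_neg

/-- Near `x`, the set `S` is the zero set of `h`, and `h` has two sides there or does not vanish. -/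
structure SideFun (S : Set E3) (h : E3 → ℝ) (x : E3) : Prop where
  zero : ∀ᶠ y in nhds x, y ∈ S ↔ h y = 0
  cont : ∀ᶠ y in nhds x, ContinuousAt h y
  conn : ∀ O ∈ nhds x, ∃ W ∈ nhds x, W ⊆ O ∧ IsPreconnected (W ∩ {y | 0 < h y}) ∧
    IsPreconnected (W ∩ {y | h y < 0})
  cross : h x = 0 → (∃ᶠ y in nhds x, 0 < h y) ∧ ∃ᶠ y in nhds x, h y < 0

lemma SideFun.neg {x : E3} (H : SideFun S h x) :
    SideFun S (fun y => -h y) x := by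
  refine ⟨H.zero.mono fun y hy => by rw [hy, neg_eq_zero], H.cont.mono fun y hy => hy.neg, ?_, ?_⟩
  · intro O hO
    obtain ⟨W, hW, hWO, h1, h2⟩ := H.conn O hO
    refine ⟨W, hW, hWO, ?_, ?_⟩
    · simpa only [neg_pos] using h2
    · simpa only [neg_lt_zero] using h1
  · intro h0
    obtain ⟨h1, h2⟩ := H.cross (neg_eq_zero.1 h0)
    exact ⟨by simpa only [neg_pos] using h2, by simpa only [neg_lt_zero] using h1⟩

lemma SideFun.frequently_ne {x : E3} (H : SideFun S h x) :
    ∃ᶠ y in nhds x, sgn (h y) ≠ 0 := by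
  by_cases h0 : h x = 0
  · exact (H.cross h0).1.mono fun y hy => sgn_ne_zero hy.ne'
  · exact ((H.cont.self_of_nhds.eventually_ne h0).mono fun y hy => sgn_ne_zero hy).frequently

lemma pos_or_neg_of_preconnected {C : Set E3} (hC : IsPreconnected C)
    (hc : ContinuousOn h C) (h0 : ∀ y ∈ C, h y ≠ 0) :
    (∀ y ∈ C, 0 < h y) ∨ ∀ y ∈ C, h y < 0 := by
  by_contra! hcon
  obtain ⟨⟨y, hy, hy'⟩, z, hz, hz'⟩ := hcon
  obtain ⟨w, hw, hw0⟩ := hC.intermediate_value hy hz hc ⟨hy', hz'⟩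
  exact h0 w hw hw0

/-- Both functions vanish exactly on S near x. Each side of S is connected, so h' has a constant
sign on it, and the signs on the two sides differ because h' takes both signs near a zero. -/
lemma SideFun.sgn_eq {h h' : E3 → ℝ} {x : E3} (H : SideFun S h x)
    (H' : SideFun S h' x) : ∃ ε : ℤˣ, ∀ᶠ y in nhds x, sgn (h' y) = ε * sgn (h y) := by
  have hz : h x = 0 ↔ h' x = 0 := by rw [← H.zero.self_of_nhds, H'.zero.self_of_nhds]
  by_cases h0 : h x = 0
  · have h0' := hz.1 h0
    obtain ⟨W, hW, hWO, hp, hn⟩ := H.conn _ ((H.zero.and H'.zero).and H'.cont)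
    have hc : ContinuousOn h' W := fun y hy => (hWO hy).2.continuousWithinAt
    have hne : ∀ y ∈ W, (h y = 0 ↔ h' y = 0) := fun y hy => by
      rw [← (hWO hy).1.1, (hWO hy).1.2]
    have e1 := pos_or_neg_of_preconnected hp (hc.mono Set.inter_subset_left)
      fun y hy h => hy.2.ne' ((hne y hy.1).2 h)
    have e2 := pos_or_neg_of_preconnected hn (hc.mono Set.inter_subset_left)
      fun y hy h => hy.2.ne ((hne y hy.1).2 h)
    obtain ⟨f1, f2⟩ := H'.cross h0'
    rcases e1 with e1 | e1 <;> rcases e2 with e2 | e2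
    · exfalso
      refine f2 ?_
      filter_upwards [hW] with y hy
      rcases lt_trichotomy (h y) 0 with g | g | g
      · exact (e2 y ⟨hy, g⟩).not_gt
      · exact ((hne y hy).1 g).not_lt
      · exact (e1 y ⟨hy, g⟩).not_gt
    · refine ⟨1, ?_⟩
      filter_upwards [hW] with y hy
      rcases lt_trichotomy (h y) 0 with g | g | g
      · rw [sgn_of_neg g, sgn_of_neg (e2 y ⟨hy, g⟩)]; simp
      · rw [g, (hne y hy).1 g]; simp
      · rw [sgn_of_pos g, sgn_of_pos (e1 y ⟨hy, g⟩)]; simp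
    · refine ⟨-1, ?_⟩
      filter_upwards [hW] with y hy
      rcases lt_trichotomy (h y) 0 with g | g | g
      · rw [sgn_of_neg g, sgn_of_pos (e2 y ⟨hy, g⟩)]; simp
      · rw [g, (hne y hy).1 g]; simp [sgn_zero]
      · rw [sgn_of_pos g, sgn_of_neg (e1 y ⟨hy, g⟩)]; simp
    · exfalso
      refine f1 ?_
      filter_upwards [hW] with y hy
      rcases lt_trichotomy (h y) 0 with g | g | g
      · exact (e2 y ⟨hy, g⟩).not_gt
      · exact ((hne y hy).1 g).not_gt
      · exact (e1 y ⟨hy, g⟩).not_gt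
  · have h0' : h' x ≠ 0 := fun h => h0 (hz.2 h)
    have c1 := H.cont.self_of_nhds
    have c2 := H'.cont.self_of_nhds
    rcases lt_or_gt_of_ne h0 with g | g <;> rcases lt_or_gt_of_ne h0' with g' | g'
    · refine ⟨1, ?_⟩
      filter_upwards [eventually_sgn_of_neg c1 g, eventually_sgn_of_neg c2 g'] with y e1 e2
      rw [e1, e2]; simp
    · refine ⟨-1, ?_⟩
      filter_upwards [eventually_sgn_of_neg c1 g, eventually_sgn_of_pos c2 g'] with y e1 e2
      rw [e1, e2]; simp
    · refine ⟨-1, ?_⟩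
      filter_upwards [eventually_sgn_of_pos c1 g, eventually_sgn_of_neg c2 g'] with y e1 e2
      rw [e1, e2]; simp
    · refine ⟨1, ?_⟩
      filter_upwards [eventually_sgn_of_pos c1 g, eventually_sgn_of_pos c2 g'] with y e1 e2
      rw [e1, e2]; simp

lemma SideFun.unit_unique {x : E3} (H : SideFun S h x) {f : E3 → ℤ}
    {ε δ : ℤˣ} (h1 : ∀ᶠ y in nhds x, f y = ε * sgn (h y))
    (h2 : ∀ᶠ y in nhds x, f y = δ * sgn (h y)) : ε = δ := by
  obtain ⟨y, hy, e1, e2⟩ := (H.frequently_ne.and_eventually (h1.and h2)).exists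
  exact Units.ext (mul_right_cancel₀ hy (e1.symm.trans e2))

/-- Local side functions are unique up to sign, so their ratios form a locally constant ℤˣ cocycle;
on the convex, hence contractible, set Ω it is a coboundary. -/
theorem exists_side {S Ω : Set E3} (hΩ : Convex ℝ Ω) (hΩo : IsOpen Ω) (hne : Ω.Nonempty)
    (hloc : ∀ x ∈ Ω, ∃ h, ∀ᶠ y in nhds x, SideFun S h y) :
    ∃ f : E3 → ℤ, ∀ x ∈ Ω, ∃ h, SideFun S h x ∧ ∀ᶠ y in nhds x, f y = sgn (h y) := by
  obtain ⟨b, hb⟩ := hne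
  have hloc' : ∀ x : Ω, ∃ (h : E3 → ℝ) (U : Set E3), IsOpen U ∧ (x : E3) ∈ U ∧
      ∀ y ∈ U, SideFun S h y := fun x => by
    obtain ⟨h, hh⟩ := hloc x x.2
    obtain ⟨U, hU, hUo, hxU⟩ := eventually_nhds_iff.1 hh
    exact ⟨h, U, hUo, hxU, hU⟩
  choose h U hUo hxU hU using hloc'
  have hc : ∀ i j x : Ω, ∃ ε : ℤˣ, (x : E3) ∈ U i ∩ U j →
      ∀ᶠ y in nhds (x : E3), sgn (h j y) = ε * sgn (h i y) := fun i j x => by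
    by_cases hx : (x : E3) ∈ U i ∩ U j
    · obtain ⟨ε, hε⟩ := (hU i x hx.1).sgn_eq (hU j x hx.2)
      exact ⟨ε, fun _ => hε⟩
    · exact ⟨1, fun h => absurd h hx⟩
  choose c hc using hc
  have k1 : ∀ i : Ω, ∀ x ∈ ((↑) : Ω → E3) ⁻¹' U i, c i i x = 1 := by
    intro i x hx
    exact (hU i x hx).unit_unique (hc i i x ⟨hx, hx⟩) (by simp)
  have k2 : ∀ i j : Ω, ∀ x ∈ ((↑) : Ω → E3) ⁻¹' U i ∩ ((↑) : Ω → E3) ⁻¹' U j,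
      ∀ᶠ y in nhds x, c i j y = c i j x := by
    intro i j x hx
    rw [nhds_subtype, Filter.eventually_comap]
    filter_upwards [(hc i j x hx).eventually_nhds, (hUo i).mem_nhds hx.1,
      (hUo j).mem_nhds hx.2] with y h1 h2 h3 z hz
    subst hz
    exact (hU i z h2).unit_unique (hc i j z ⟨h2, h3⟩) h1
  have k3 : ∀ i j k : Ω, ∀ x ∈ ((↑) : Ω → E3) ⁻¹' U i ∩ ((↑) : Ω → E3) ⁻¹' U j ∩
      ((↑) : Ω → E3) ⁻¹' U k, c j k x * c i j x = c i k x := by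
    intro i j k x hx
    refine (hU i x hx.1.1).unit_unique ?_ (hc i k x ⟨hx.1.1, hx.2⟩)
    filter_upwards [hc i j x hx.1, hc j k x ⟨hx.1.2, hx.2⟩] with y h1 h2
    rw [h2, h1, Units.val_mul, mul_assoc]
  let H : C(unitInterval × Ω, Ω) :=
    ⟨fun q => ⟨(1 - (q.1 : ℝ)) • b + (q.1 : ℝ) • (q.2 : E3),
      hΩ hb q.2.2 (by linarith [q.1.2.2]) q.1.2.1 (by ring)⟩, by fun_prop⟩
  obtain ⟨s, hs, hss⟩ := exists_signs (fun i : Ω => ((↑) : Ω → E3) ⁻¹' U i)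
    (fun i => (hUo i).preimage continuous_subtype_val) hxU c k1 k2 k3 H ⟨b, hb⟩
    (fun x => Subtype.ext (by simp [H])) (fun x => Subtype.ext (by simp [H]))
  · have hval : ∀ i x : Ω, (x : E3) ∈ U i →
        (s x x : ℤ) * sgn (h x x) = s i x * sgn (h i x) := fun i x hx => by
      have h1 := (hc i x x ⟨hx, hxU x⟩).self_of_nhds
      rw [hss i x x ⟨hx, hxU x⟩, h1, Units.val_mul]
      have h2 : (c i x x : ℤ) * c i x x = 1 := by
        rw [← Units.val_mul, Int.units_mul_self]; rfl
      linear_combination (s i x : ℤ) * sgn (h i x) * h2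
    classical
    refine ⟨fun y => if hy : y ∈ Ω then (s ⟨y, hy⟩ ⟨y, hy⟩ : ℤ) * sgn (h ⟨y, hy⟩ y) else 0, ?_⟩
    intro x hx
    have h1 : ∀ᶠ y in nhds x, (if hy : y ∈ Ω then
        (s ⟨y, hy⟩ ⟨y, hy⟩ : ℤ) * sgn (h ⟨y, hy⟩ y) else 0) =
          s ⟨x, hx⟩ ⟨x, hx⟩ * sgn (h ⟨x, hx⟩ y) := by
      have h2 := hs ⟨x, hx⟩ ⟨x, hx⟩ (hxU _)
      rw [nhds_subtype, Filter.eventually_comap] at h2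
      filter_upwards [h2, hΩo.mem_nhds hx, (hUo ⟨x, hx⟩).mem_nhds (hxU _)] with y e1 e2 e3
      rw [dif_pos e2, ← e1 ⟨y, e2⟩ rfl]
      exact hval ⟨x, hx⟩ ⟨y, e2⟩ e3
    rcases Int.units_eq_one_or (s ⟨x, hx⟩ ⟨x, hx⟩) with e | e
    · refine ⟨_, hU _ _ (hxU ⟨x, hx⟩), ?_⟩
      filter_upwards [h1] with y hy
      rw [hy, e]; simp
    · refine ⟨_, (hU _ _ (hxU ⟨x, hx⟩)).neg, ?_⟩
      filter_upwards [h1] with y hy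
      rw [hy, e, sgn_neg]; simp

lemma exists_sign_of_preconnected {S Ω : Set E3} {f : E3 → ℤ}
    (hf : ∀ x ∈ Ω, ∃ h, SideFun S h x ∧ ∀ᶠ y in nhds x, f y = sgn (h y)) {C : Set E3}
    (hC : IsPreconnected C) (hCΩ : C ⊆ Ω) (hh : ∀ x ∈ C, SideFun S h x) :
    ∃ ε : ℤˣ, ∀ x ∈ C, ∀ᶠ y in nhds x, f y = ε * sgn (h y) := by
  have hopen : ∀ ε : ℤˣ, IsOpen {x | ∀ᶠ y in nhds x, f y = ε * sgn (h y)} := fun ε =>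
    isOpen_iff_mem_nhds.2 fun x hx => Filter.Eventually.eventually_nhds hx
  have hcov : C ⊆ {x | ∀ᶠ y in nhds x, f y = (1 : ℤˣ) * sgn (h y)} ∪
      {x | ∀ᶠ y in nhds x, f y = (-1 : ℤˣ) * sgn (h y)} := fun x hx => by
    obtain ⟨g, hg, hfg⟩ := hf x (hCΩ hx)
    obtain ⟨ε, hε⟩ := (hh x hx).sgn_eq hg
    have h1 : ∀ᶠ y in nhds x, f y = ε * sgn (h y) := by
      filter_upwards [hε, hfg] with y e1 e2
      rw [e2, e1]
    rcases Int.units_eq_one_or ε with e | e <;> rw [e] at h1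
    · exact Or.inl h1
    · exact Or.inr h1
  rcases isPreconnected_iff_subset_of_disjoint.1 hC _ _ (hopen 1) (hopen (-1)) hcov (by
    rw [Set.eq_empty_iff_forall_notMem]
    rintro x ⟨hx, h1, h2⟩
    exact absurd ((hh x hx).unit_unique h1 h2) (by decide)) with h1 | h1
  · exact ⟨1, h1⟩
  · exact ⟨-1, h1⟩

lemma chart_path {Φ : OpenPartialHomeomorph E3 E3} {x : E3} (hx : x ∈ Φ.source) (v : E3) :
    Tendsto (fun t : ℝ => Φ.symm (Φ x + t • v)) (𝓝[>] 0) (nhds x) ∧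
      ∀ᶠ t in 𝓝[>] (0 : ℝ), 0 < t ∧ Φ.symm (Φ x + t • v) ∈ Φ.source ∧
        Φ (Φ.symm (Φ x + t • v)) = Φ x + t • v := by
  have h1 : Tendsto (fun t : ℝ => Φ x + t • v) (𝓝[>] 0) (nhds (Φ x)) := by
    have : ContinuousAt (fun t : ℝ => Φ x + t • v) 0 := by fun_prop
    have h2 := this.tendsto
    simp only [zero_smul, add_zero] at h2
    exact h2.mono_left nhdsWithin_le_nhds
  refine ⟨?_, ?_⟩
  · have h2 := Φ.tendsto_symm hx
    exact h2.comp h1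
  · filter_upwards [h1 (Φ.open_target.mem_nhds (Φ.map_source hx)), self_mem_nhdsWithin] with t ht h0
    exact ⟨h0, Φ.map_target ht, Φ.right_inv ht⟩

lemma chart_sideFun {S V : Set E3} {Φ : OpenPartialHomeomorph E3 E3} (hV : IsOpen V)
    (hVs : V ⊆ Φ.source) (hS : ∀ x ∈ V, (x ∈ S ↔ Φ x 2 = 0)) {x : E3} (hx : x ∈ V) :
    SideFun S (fun y => Φ y 2) x := by
  have hxs := hVs hx
  refine ⟨?_, ?_, ?_, ?_⟩
  · filter_upwards [hV.mem_nhds hx] with y hy using hS y hy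
  · filter_upwards [Φ.open_source.mem_nhds hxs] with y hy
    exact (coordL 2).continuous.continuousAt.comp
      (Φ.continuousAt hy)
  · intro O hO
    have h1 : Φ.symm ⁻¹' O ∩ Φ.target ∈ nhds (Φ x) :=
      inter_mem (Φ.tendsto_symm hxs hO) (Φ.open_target.mem_nhds (Φ.map_source hxs))
    obtain ⟨r, hr, hb⟩ := Metric.mem_nhds_iff.1 h1
    have hpre : ∀ P : Set E3, Convex ℝ P →
        IsPreconnected (Φ.source ∩ Φ ⁻¹' ball (Φ x) r ∩ Φ ⁻¹' P) := fun P hP => by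
      have h2 : Φ.source ∩ Φ ⁻¹' ball (Φ x) r ∩ Φ ⁻¹' P =
          Φ.symm '' (ball (Φ x) r ∩ P) := by
        ext y
        constructor
        · rintro ⟨⟨h1, h2⟩, h3⟩
          exact ⟨Φ y, ⟨h2, h3⟩, Φ.left_inv h1⟩
        · rintro ⟨v, ⟨h1, h2⟩, rfl⟩
          have h3 := (hb h1).2
          refine ⟨⟨Φ.map_target h3, ?_⟩, ?_⟩
          · rw [Set.mem_preimage, Φ.right_inv h3]; exact h1
          · rw [Set.mem_preimage, Φ.right_inv h3]; exact h2
      rw [h2]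
      refine ((convex_ball _ _).inter hP).isPreconnected.image _ fun v hv => ?_
      exact (Φ.continuousAt_symm (hb hv.1).2).continuousWithinAt
    refine ⟨Φ.source ∩ Φ ⁻¹' ball (Φ x) r, ?_, ?_, ?_, ?_⟩
    · exact inter_mem (Φ.open_source.mem_nhds hxs)
        ((Φ.continuousAt hxs).preimage_mem_nhds (ball_mem_nhds _ hr))
    · rintro y ⟨h1, h2⟩
      have := (hb h2).1
      rwa [Set.mem_preimage, Φ.left_inv h1] at this
    · exact hpre {v | 0 < v 2}
        (convex_halfSpace_gt (coordL 2).isLinear 0)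
    · exact hpre {v | v 2 < 0}
        (convex_halfSpace_lt (coordL 2).isLinear 0)
  · intro h0
    refine ⟨?_, ?_⟩
    · obtain ⟨h1, h2⟩ := chart_path hxs (bv 2)
      refine h1.frequently (Filter.Eventually.frequently ?_)
      filter_upwards [h2] with t ht
      rw [ht.2.2]; simpa [h0] using ht.1
    · obtain ⟨h1, h2⟩ := chart_path hxs (-bv 2)
      refine h1.frequently (Filter.Eventually.frequently ?_)
      filter_upwards [h2] with t ht
      rw [ht.2.2]; simpa [h0] using ht.1

lemma sideFun_one {x : E3} (hx : ∀ᶠ y in nhds x, y ∉ S) :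
    SideFun S (fun _ => 1) x := by
  refine ⟨hx.mono fun y hy => by simp [hy], Filter.Eventually.of_forall fun y =>
    continuousAt_const, fun O hO => ?_, fun h => by simp at h⟩
  obtain ⟨r, hr, hb⟩ := Metric.mem_nhds_iff.1 hO
  refine ⟨_, ball_mem_nhds x hr, hb, ?_, ?_⟩
  · simpa using (convex_ball x r).isPreconnected
  · norm_num
    exact isPreconnected_empty

lemma IsPuncturedSurface.eventually_notMem (hS : IsPuncturedSurface S) {x : E3}
    (hx : x ∉ S) (h0 : x ≠ 0) : ∀ᶠ y in nhds x, y ∉ S := by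
  have h1 : x ∉ closure S := fun h => by
    rcases hS.closed h with h | h
    · exact hx h
    · exact h0 h
  filter_upwards [isClosed_closure.isOpen_compl.mem_nhds h1] with y hy h using hy (subset_closure h)

lemma IsSurfacePair.of_mem_bdry (h : IsSurfacePair S G) {x : E3} (hx : x ∈ bdry S) :
    x ∈ S ∧ x ∈ G ∧ x 0 = 0 := by
  have := hx
  rw [← h.inter_eq] at this
  exact ⟨this.1, this.2, h.right_subset this.2⟩

/-- The open half-space. -/
def openHalf : Set E3 := {x | 0 < x 0}

lemma openHalf_isOpen : IsOpen openHalf := isOpen_lt continuous_const (by fun_prop)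

lemma openHalf_convex : Convex ℝ openHalf :=
  convex_halfSpace_gt (coordL 0).isLinear 0

lemma interior_of_pos (hpair : IsSurfacePair S G) {x : E3} (hx : x ∈ S)
    (h0 : x ∈ openHalf) : IsInteriorPoint S x :=
  (hpair.surface_left.smooth x hx).resolve_right fun h =>
    (ne_of_gt h0) (hpair.of_mem_bdry h).2.2

lemma exists_sideFun (hpair : IsSurfacePair S G) {x : E3} (hx : x ∈ openHalf) :
    ∃ h, ∀ᶠ y in nhds x, SideFun S h y := by
  by_cases hxS : x ∈ S
  · obtain ⟨-, Φ, hp, -, hΦ⟩ := interior_of_pos hpair hxS hx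
    refine ⟨fun y => Φ y 2, ?_⟩
    filter_upwards [Φ.open_source.mem_nhds hp] with y hy
    exact chart_sideFun Φ.open_source le_rfl hΦ hy
  · refine ⟨fun _ => 1, ?_⟩
    have h0 : x ≠ 0 := fun h => by rw [h] at hx; simp [openHalf] at hx
    filter_upwards [(hpair.surface_left.eventually_notMem hxS h0).eventually_nhds] with y hy
    exact sideFun_one hy

/-- On the wall near `x`, the set `G` is where `h ≤ 0`, and `f` has the sign `ε h` next to it. -/
def WallSide (S G : Set E3) (f : E3 → ℤ) (ε : ℤˣ) (x : E3) : Prop :=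
  ∃ h : E3 → ℝ, ∀ᶠ y in nhds x, (y ∈ openHalf → f y = ε * sgn (h y)) ∧ ContinuousAt h y ∧
    (y ∈ wall → (y ∈ G ↔ h y ≤ 0) ∧ (h y = 0 → y ∈ bdry S))

/-- In the chart the part above the wall is a convex piece of a box. It is therefore connected, and
f has the sign of the third coordinate there up to one global sign. -/
lemma IsContactChart.sign {e : OpenPartialHomeomorph E3 E3}
    (he : IsContactChart a S G e) (hpair : IsSurfacePair S G) {f : E3 → ℤ}
    (hf : ∀ x ∈ openHalf, ∃ h, SideFun S h x ∧ ∀ᶠ y in nhds x, f y = sgn (h y)) :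
    ∃ ε : ℤˣ, (∀ x ∈ e.source, x ∈ openHalf → f x = ε * sgn (e x 2)) ∧
      ∀ x ∈ e.source, WallSide S G f ε x := by
  obtain ⟨u, δ, -, -, -, ht⟩ := he.target
  have hpre : IsPreconnected (e.source ∩ openHalf) := by
    have h2 : e.source ∩ openHalf = e.symm '' (box u δ ∩ openHalf) := by
      ext y
      constructor
      · rintro ⟨h1, h2⟩
        refine ⟨e y, ⟨?_, ?_⟩, e.left_inv h1⟩
        · rw [← ht]; exact e.map_source h1
        · change 0 < e y 0
          rw [he.coord y h1]; exact h2
      · rintro ⟨v, ⟨h1, h2⟩, rfl⟩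
        rw [← ht] at h1
        refine ⟨e.map_target h1, ?_⟩
        change 0 < e.symm v 0
        rw [← he.coord _ (e.map_target h1), e.right_inv h1]; exact h2
    rw [h2]
    refine ((box_convex u δ).inter openHalf_convex).isPreconnected.image _ fun v hv => ?_
    refine (e.continuousAt_symm ?_).continuousWithinAt
    rw [ht]; exact hv.1
  have hside : ∀ x ∈ e.source ∩ openHalf, SideFun S (fun y => e y 2) x := fun x hx =>
    chart_sideFun (e.open_source.inter openHalf_isOpen) Set.inter_subset_left
      (fun y hy => by
        rw [he.left_iff y hy.1]
        exact ⟨fun h => h.1, fun h => ⟨h, le_of_lt hy.2⟩⟩) hx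
  obtain ⟨ε, hε⟩ := exists_sign_of_preconnected hf hpre Set.inter_subset_right hside
  refine ⟨ε, fun x hx h0 => (hε x ⟨hx, h0⟩).self_of_nhds, fun x hx => ⟨fun y => e y 2, ?_⟩⟩
  filter_upwards [e.open_source.mem_nhds hx] with y hy
  refine ⟨fun h0 => (hε y ⟨hy, h0⟩).self_of_nhds, ?_, fun hyw => ⟨?_, fun h0 => ?_⟩⟩
  · exact (coordL 2).continuous.continuousAt.comp
      (e.continuousAt hy)
  · rw [he.right_iff y hy]
    exact ⟨fun h => h.2, fun h => ⟨hyw, h⟩⟩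
  · rw [← hpair.inter_eq]
    exact ⟨(he.left_iff y hy).2 ⟨h0, le_of_eq (Eq.symm hyw)⟩, (he.right_iff y hy).2 ⟨hyw, h0.le⟩⟩

/-- Nothing is known at the origin, so it has to be removed; one point does not disconnect a plane.
-/
lemma wall_punctured_preconnected : IsPreconnected (wall \ {0}) := by
  have h1 : IsConnected ({0}ᶜ : Set E2) :=
    isConnected_compl_singleton_of_one_lt_rank (by
      rw [← Module.finrank_eq_rank, finrank_euclideanSpace_fin]; norm_num) 0
  have h2 : wall \ {0} = frameMap (bv 1) (bv 2) '' ({0}ᶜ : Set E2) := by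
    ext x
    constructor
    · rintro ⟨h1, h2⟩
      refine ⟨!₂[x 1, x 2], fun h => h2 ?_, ?_⟩
      · have e1 := congrFun (congrArg WithLp.ofLp h) 0
        have e2 := congrFun (congrArg WithLp.ofLp h) 1
        ext i
        fin_cases i
        · exact h1
        · exact e1
        · exact e2
      · rw [frameMap_apply]
        ext i
        fin_cases i
        · simpa using Eq.symm h1
        · simp
        · simp
    · rintro ⟨y, hy, rfl⟩
      rw [frameMap_apply]
      refine ⟨by simp [wall], fun h => hy ?_⟩
      have e1 := congrFun (congrArg WithLp.ofLp h) 1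
      have e2 := congrFun (congrArg WithLp.ofLp h) 2
      ext i
      fin_cases i
      · simpa using e1
      · simpa using e2
  rw [h2]
  exact h1.isPreconnected.image _ (frameMap _ _).continuous.continuousOn

/-- Immediately above the wall the side function has one sign over G and the opposite sign over the
complement, and the two change together across ∂S. Which sign belongs to G is locally constant along
the wall without 0, a connected set, so it can be normalised once for all contact charts. -/
theorem exists_oriented_side (ha : a ^ 2 < 1) (hpair : IsSurfacePair S G)
    (hstat : IsStationary a S G) (hfin : HasLocFiniteArea S) :
    ∃ f : E3 → ℤ, (∀ x ∈ openHalf, ∃ h, SideFun S h x ∧ ∀ᶠ y in nhds x, f y = sgn (h y)) ∧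
      ∀ e, IsContactChart a S G e → ∀ x ∈ e.source, x ∈ openHalf → f x = sgn (e x 2) := by
  obtain ⟨f, hf⟩ := exists_side (S := S) openHalf_convex openHalf_isOpen
    ⟨bv 0, by simp [openHalf]⟩ fun x hx => exists_sideFun hpair hx
  have hS := hpair.surface_left
  have hex : ∀ x ∈ wall \ {0}, ∃ ε, WallSide S G f ε x := by
    rintro x ⟨hxw, hx0⟩
    have hx0 : x ≠ 0 := hx0
    by_cases hxb : x ∈ bdry S
    · obtain ⟨e, hxe, he⟩ := exists_contactChart ha hpair hstat hfin hxb
      obtain ⟨ε, -, hε⟩ := he.sign hpair hf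
      exact ⟨ε, hε x hxe⟩
    · have h1 : ∀ᶠ y in nhds x, y ∈ S → y 0 = 0 := by
        by_cases hxS : x ∈ S
        · exact contact_isOpen hpair hstat hfin hxS hxb hxw
        · filter_upwards [hS.eventually_notMem hxS hx0] with y hy h using absurd h hy
      obtain ⟨r, hr, hb⟩ := Metric.mem_nhds_iff.1 h1
      have hside : ∀ y ∈ ball x r ∩ openHalf, SideFun S (fun _ => 1) y := fun y hy => by
        refine sideFun_one ?_
        filter_upwards [(isOpen_ball.inter openHalf_isOpen).mem_nhds hy] with z hz hzS
        exact ne_of_gt hz.2 (hb hz.1 hzS)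
      obtain ⟨ε, hε⟩ := exists_sign_of_preconnected hf
        ((convex_ball x r).inter openHalf_convex).isPreconnected Set.inter_subset_right hside
      by_cases hxG : x ∈ G
      · have hi : IsInteriorPoint G x := (hpair.surface_right.smooth x hxG).resolve_right
          fun h => hxb (by rw [hpair.bdry_eq]; exact h)
        refine ⟨-ε, fun _ => -1, ?_⟩
        filter_upwards [ball_mem_nhds x hr, interior_point_wall hpair.right_subset hi]
          with y hy hyG
        refine ⟨fun h0 => ?_, continuousAt_const, fun hyw => ⟨?_, fun h => by norm_num at h⟩⟩
        · rw [(hε y ⟨hy, h0⟩).self_of_nhds, sgn_of_pos one_pos, sgn_of_neg (by norm_num)]; simp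
        · simp [hyG hyw]
      · refine ⟨ε, fun _ => 1, ?_⟩
        filter_upwards [ball_mem_nhds x hr, hpair.surface_right.eventually_notMem hxG hx0]
          with y hy hyG
        refine ⟨fun h0 => ?_, continuousAt_const, fun hyw => ⟨?_, fun h => by norm_num at h⟩⟩
        · exact (hε y ⟨hy, h0⟩).self_of_nhds
        · simp [hyG]
  -- Near x there are wall points z outside ∂S. Above such a z the value of f is nonzero and is
  -- dictated by whether z belongs to G, so the two signs exclude each other.
  have hdis : ∀ x ∈ wall \ {0}, WallSide S G f 1 x → WallSide S G f (-1) x → False := by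
    rintro x ⟨hxw, hx0⟩ ⟨h, hh⟩ ⟨h', hh'⟩
    have hfr : ∃ᶠ z in nhds x, z ∈ wall ∧ z ∉ bdry S := by
      by_cases hxb : x ∈ bdry S
      · obtain ⟨e, hxe, he⟩ := exists_contactChart ha hpair hstat hfin hxb
        obtain ⟨h1, h2⟩ := chart_path hxe (bv 2)
        refine h1.frequently (Filter.Eventually.frequently ?_)
        filter_upwards [h2] with t ht
        have hx2 := ((he.left_iff x hxe).1 (hpair.of_mem_bdry hxb).1).1
        refine ⟨?_, fun hb => ?_⟩
        · change _ = _
          rw [← he.coord _ ht.2.1, ht.2.2]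
          simp [he.coord x hxe]; exact hxw
        · have h3 := ((he.left_iff _ ht.2.1).1 (hpair.of_mem_bdry hb).1).1
          rw [ht.2.2] at h3
          simp [hx2] at h3
          exact ht.1.ne' h3
      · intro h
        exact h.self_of_nhds ⟨hxw, hxb⟩
    obtain ⟨z, ⟨hzw, hzb⟩, hz, hz'⟩ :=
      (hfr.and_eventually (hh.eventually_nhds.and hh'.eventually_nhds)).exists
    have g := hz.self_of_nhds
    have g' := hz'.self_of_nhds
    have hne : h z ≠ 0 := fun h => hzb ((g.2.2 hzw).2 h)
    have hne' : h' z ≠ 0 := fun h => hzb ((g'.2.2 hzw).2 h)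
    have hiff : h z ≤ 0 ↔ h' z ≤ 0 := by rw [← (g.2.2 hzw).1, (g'.2.2 hzw).1]
    have hcl : ∃ᶠ y in nhds z, y ∈ openHalf := by
      have h1 : Tendsto (fun t : ℝ => z + t • bv 0) (𝓝[>] 0) (nhds z) := by
        have h2 : ContinuousAt (fun t : ℝ => z + t • bv 0) 0 := by fun_prop
        have h2 := h2.tendsto
        simp only [zero_smul, add_zero] at h2
        exact h2.mono_left nhdsWithin_le_nhds
      refine h1.frequently (Filter.Eventually.frequently ?_)
      filter_upwards [self_mem_nhdsWithin] with t ht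
      have hz0 : z 0 = 0 := hzw
      simpa [openHalf, hz0] using ht
    rcases lt_or_gt_of_ne hne with k | k
    · have k' : h' z < 0 := lt_of_le_of_ne (hiff.1 k.le) hne'
      obtain ⟨y, hy, ⟨e1, e2⟩, e3, e4⟩ := (hcl.and_eventually ((hz.and
        (eventually_sgn_of_neg g.2.1 k)).and (hz'.and (eventually_sgn_of_neg g'.2.1 k')))).exists
      have h1 := e1.1 hy
      rw [e3.1 hy, e2, e4] at h1
      exact absurd h1 (by decide)
    · have k' : 0 < h' z := lt_of_not_ge fun h => absurd (hiff.2 h) (not_le.2 k)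
      obtain ⟨y, hy, ⟨e1, e2⟩, e3, e4⟩ := (hcl.and_eventually ((hz.and
        (eventually_sgn_of_pos g.2.1 k)).and (hz'.and (eventually_sgn_of_pos g'.2.1 k')))).exists
      have h1 := e1.1 hy
      rw [e3.1 hy, e2, e4] at h1
      exact absurd h1 (by decide)
  have hopen : ∀ ε, IsOpen {x | WallSide S G f ε x} := fun ε => by
    refine isOpen_iff_mem_nhds.2 fun x hx => ?_
    obtain ⟨h, hh⟩ := hx
    filter_upwards [hh.eventually_nhds] with y hy using ⟨h, hy⟩
  obtain ⟨ε₀, hε₀⟩ : ∃ ε₀ : ℤˣ, ∀ x ∈ wall \ {0}, WallSide S G f ε₀ x := by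
    rcases isPreconnected_iff_subset_of_disjoint.1 wall_punctured_preconnected _ _ (hopen 1)
      (hopen (-1)) (fun x hx => by
        obtain ⟨ε, hε⟩ := hex x hx
        rcases Int.units_eq_one_or ε with e | e <;> rw [e] at hε
        · exact Or.inl hε
        · exact Or.inr hε) (by
        rw [Set.eq_empty_iff_forall_notMem]
        rintro x ⟨hx, h1, h2⟩
        exact hdis x hx h1 h2) with h1 | h1
    · exact ⟨1, h1⟩
    · exact ⟨-1, h1⟩
  have huniq : ∀ x ∈ wall \ {0}, ∀ ε, WallSide S G f ε x → ε = ε₀ := fun x hx ε hε => by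
    have h0 := hε₀ x hx
    rcases Int.units_eq_one_or ε with e | e <;> rcases Int.units_eq_one_or ε₀ with e' | e' <;>
      rw [e] at hε ⊢ <;> rw [e'] at h0 ⊢
    · exact (hdis x hx hε h0).elim
    · exact (hdis x hx h0 hε).elim
  refine ⟨fun y => ε₀ * f y, fun x hx => ?_, fun e he x hx h0 => ?_⟩
  · obtain ⟨h, h1, h2⟩ := hf x hx
    rcases Int.units_eq_one_or ε₀ with e | e
    · exact ⟨h, h1, by filter_upwards [h2] with y hy; rw [hy, e]; simp⟩
    · exact ⟨_, h1.neg, by filter_upwards [h2] with y hy; rw [hy, e, sgn_neg]; simp⟩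
  · obtain ⟨ε, h1, h2⟩ := he.sign hpair hf
    obtain ⟨u, δ, hδ, hu0, hu2, ht⟩ := he.target
    have hu : u ∈ e.target := by rw [ht]; exact mem_box_self u hδ
    have hus := e.map_target hu
    have hmem : e.symm u ∈ S := by
      rw [he.left_iff _ hus, ← he.coord _ hus, e.right_inv hu]
      exact ⟨hu2, hu0.ge⟩
    have hw : e.symm u ∈ wall := by
      change _ = _
      rw [← he.coord _ hus, e.right_inv hu, hu0]
    have hε := huniq (e.symm u) ⟨hw, fun h => hS.zero_notMem (by
      have h : e.symm u = 0 := h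
      rwa [h] at hmem)⟩ ε (h2 _ hus)
    have hsq : (ε₀ : ℤ) * ε₀ = 1 := by rw [← Units.val_mul, Int.units_mul_self]; rfl
    change (ε₀ : ℤ) * f x = _
    rw [h1 x hx h0, hε, ← mul_assoc, hsq, one_mul]

/-- `S` without its interior contact points with the wall. -/
def sheet (S : Set E3) : Set E3 := {x | x ∈ S ∧ (x ∈ openHalf ∨ x ∈ bdry S)}

/-- The unit vector `v` points into the positive side of `f` at `x`. -/
def PointsIn (f : E3 → ℤ) (x v : E3) : Prop :=
  ∀ᶠ t in 𝓝[>] (0 : ℝ), f (x + t • v) = 1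

lemma tendsto_add_smul (x v : E3) :
    Tendsto (fun t : ℝ => x + t • v) (𝓝[>] 0) (nhds x) := by
  have h2 : ContinuousAt (fun t : ℝ => x + t • v) 0 := by fun_prop
  have h2 := h2.tendsto
  simp only [zero_smul, add_zero] at h2
  exact h2.mono_left nhdsWithin_le_nhds

lemma eventually_pos_of_fderiv {x v : E3} (hd : DifferentiableAt ℝ h x)
    (h0 : h x = 0) (hv : 0 < fderiv ℝ h x v) :
    ∀ᶠ t in 𝓝[>] (0 : ℝ), 0 < h (x + t • v) := by
  have h1 : HasDerivAt (fun t : ℝ => h (x + t • v)) (fderiv ℝ h x v) 0 := by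
    have h2 : HasDerivAt (fun t : ℝ => x + t • v) v 0 := by
      simpa using ((hasDerivAt_id (0 : ℝ)).smul_const v).const_add x
    have h3 : HasFDerivAt h (fderiv ℝ h x) (x + (0 : ℝ) • v) := by simpa using hd.hasFDerivAt
    exact h3.comp_hasDerivAt 0 h2
  have h4 := eventually_nhdsWithin_sign_eq_of_deriv_pos (f := fun t : ℝ => h (x + t • v))
    (x₀ := 0) (by rwa [h1.deriv]) (by simpa using h0)
  filter_upwards [nhdsWithin_le_nhds h4, self_mem_nhdsWithin] with t ht ht0
  rw [sub_zero, sign_pos (Set.mem_Ioi.1 ht0)] at ht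
  exact sign_eq_one_iff.1 ht

lemma normal_deriv_ne {x v : E3} (hx : x ∈ S)
    (hd : DifferentiableAt ℝ h x) (hS : ∀ᶠ y in nhds x, y ∈ S → h y = 0)
    (h0 : fderiv ℝ h x ≠ 0) (hv : ‖v‖ = 1) (hp : tangentPlane S x = (ℝ ∙ v)ᗮ) :
    fderiv ℝ h x v ≠ 0 := by
  intro hz
  refine h0 (ContinuousLinearMap.ext fun ξ => ?_)
  have h1 : ξ - inner ℝ v ξ • v ∈ tangentPlane S x := by
    rw [hp, mem_perp_iff, inner_sub_right v ξ,
      inner_smul_right, real_inner_self_eq_norm_sq, hv]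
    ring
  have h2 := fderiv_eq_of_eqOn (g := fun _ => (0 : ℝ)) hx hd (by fun_prop) hS h1
  simp only [map_sub, map_smul, hz] at h2
  simpa using h2

lemma chart_coord_fderiv_ne {Φ : OpenPartialHomeomorph E3 E3} (hΦ : IsSmoothChart Φ) {x : E3}
    (hx : x ∈ Φ.source) (i : Fin 3) :
    ContDiffAt ℝ ∞ (fun y => Φ y i) x ∧ fderiv ℝ (fun y => Φ y i) x ≠ 0 := by
  have hs := hΦ.1.contDiffAt (Φ.open_source.mem_nhds hx)
  refine ⟨contDiffAt_euclidean.1 hs i, fun h => ?_⟩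
  obtain ⟨A, hA, -⟩ := chart_fderiv hΦ hx
  have h1 := fderiv_coord hA.differentiableAt (i := i) (ξ := A.symm (bv i))
  rw [h, hA.fderiv] at h1
  simp at h1

/-- The unit normals at an interior point which point into the positive side agree. -/
lemma pointsIn_unique (hpair : IsSurfacePair S G) {f : E3 → ℤ}
    (hf : ∀ x ∈ openHalf, ∃ h, SideFun S h x ∧ ∀ᶠ y in nhds x, f y = sgn (h y)) {x v v' : E3}
    (hx : x ∈ S) (h0 : x ∈ openHalf) (hv : ‖v‖ = 1) (hv' : ‖v'‖ = 1)
    (hp : tangentPlane S x = (ℝ ∙ v)ᗮ) (hp' : tangentPlane S x = (ℝ ∙ v')ᗮ) (hi : PointsIn f x v)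
    (hi' : PointsIn f x v') : v = v' := by
  rcases eq_or_eq_neg_of_orthogonal_le hv hv' (hp.symm.trans hp').le with h | h
  · exact h
  exfalso
  obtain ⟨-, Φ, hxΦ, hs, hΦ⟩ := interior_of_pos hpair hx h0
  have hΦx := (hΦ x hxΦ).1 hx
  obtain ⟨hsm, hne⟩ := chart_coord_fderiv_ne hs hxΦ 2
  have hd : DifferentiableAt ℝ (fun y => Φ y 2) x := hsm.differentiableAt (by simp)
  have hl := normal_deriv_ne hx hd (by
    filter_upwards [Φ.open_source.mem_nhds hxΦ] with y hy using (hΦ y hy).1) hne hv hp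
  obtain ⟨g, hg, hfg⟩ := hf x h0
  obtain ⟨ε, hε⟩ := (chart_sideFun Φ.open_source le_rfl hΦ hxΦ).sgn_eq hg
  have key : ∀ w : E3, 0 < fderiv ℝ (fun y => Φ y 2) x w →
      ∀ᶠ t in 𝓝[>] (0 : ℝ), f (x + t • w) = ε ∧ f (x + t • -w) = -ε := by
    intro w hw
    have e1 := eventually_pos_of_fderiv hd hΦx hw
    have e2 := eventually_pos_of_fderiv (h := fun y => -Φ y 2) (v := -w) hd.neg
      (by simp [hΦx]) (by
        rw [show fderiv ℝ (fun y => -Φ y 2) x = -fderiv ℝ (fun y => Φ y 2) x from fderiv_fun_neg]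
        simpa using hw)
    filter_upwards [e1, e2, (tendsto_add_smul x w).eventually (hfg.and hε),
      (tendsto_add_smul x (-w)).eventually (hfg.and hε)] with t t1 t2 t3 t4
    rw [t3.1, t3.2, t4.1, t4.2, sgn_of_pos t1, sgn_of_neg (neg_pos.1 t2)]
    simp
  have hcon : ∀ w : E3, 0 < fderiv ℝ (fun y => Φ y 2) x w → PointsIn f x w →
      PointsIn f x (-w) → False := fun w hw i1 i2 => by
    obtain ⟨t, ⟨k1, k2⟩, k3, k4⟩ := ((key w hw).and (i1.and i2)).exists
    rw [k1] at k3; rw [k2] at k4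
    omega
  rcases lt_or_gt_of_ne hl with h2 | h2
  · refine hcon (-v) (by simpa using h2) ?_ (by rwa [neg_neg])
    rwa [h, neg_neg]
  · refine hcon v h2 hi ?_
    rwa [h, neg_neg]

/-- The normal field `n` of `S` points into the positive side near `p`. -/
def Oriented (S : Set E3) (f : E3 → ℤ) (n : E3 → E3) (p : E3) : Prop :=
  IsNormal S n p ∧ ∀ᶠ x in nhds p, x ∈ S → x ∈ openHalf → PointsIn f x (n x)

lemma oriented_of_side {f : E3 → ℤ} {n : E3 → E3}
    (hh : ∀ᶠ x in nhds p, ContDiffAt ℝ ∞ h x) (hS : ∀ᶠ x in nhds p, x ∈ S → h x = 0)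
    (hf : ∀ᶠ x in nhds p, x ∈ openHalf → f x = sgn (h x)) (hn : IsNormal S n p)
    (hpos : 0 < fderiv ℝ h p (n p)) : Oriented S f n p := by
  refine ⟨hn, ?_⟩
  have hc : ContinuousAt (fun x => fderiv ℝ h x (n x)) p :=
    ContinuousAt.clm_apply (smooth_fderiv hh.self_of_nhds).continuousAt
      hn.smooth.self_of_nhds.continuousAt
  filter_upwards [hc.eventually (lt_mem_nhds hpos), hh, hS, hf.eventually_nhds]
    with x h1 h2 h3 h4 hxS hx0
  filter_upwards [eventually_pos_of_fderiv (h2.differentiableAt (by simp)) (h3 hxS) h1,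
    (tendsto_add_smul x (n x)).eventually (h4.and (openHalf_isOpen.mem_nhds hx0))] with t t1 t2
  rw [t2.1 t2.2, sgn_of_pos t1]

lemma IsContactChart.eventually_sheet (hpair : IsSurfacePair S G)
    {e : OpenPartialHomeomorph E3 E3} (he : IsContactChart a S G e) {x : E3} (hx : x ∈ e.source)
    (hxS : x ∈ S) : x ∈ sheet S := by
  refine ⟨hxS, ?_⟩
  obtain ⟨h2, h0⟩ := (he.left_iff x hx).1 hxS
  rcases h0.lt_or_eq with h | h
  · exact Or.inl h
  · right
    rw [← hpair.inter_eq]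
    exact ⟨hxS, (he.right_iff x hx).2 ⟨h.symm, h2.le⟩⟩

lemma grd_pos {x : E3} (h0 : fderiv ℝ h x ≠ 0) :
    0 < fderiv ℝ h x ((‖grd h x‖⁻¹ : ℝ) • grd h x) := by
  have h1 := grd_ne_zero h0
  rw [map_smul, smul_eq_mul]
  have h2 : fderiv ℝ h x (grd h x) = ‖grd h x‖ ^ 2 := by
    rw [← real_inner_self_eq_norm_sq, inner_grd]
  rw [h2]
  have := norm_pos_iff.2 h1
  positivity

/-- A consistent choice of the unit normal, with the right contact angle. -/
theorem exists_orientation (ha : a ^ 2 < 1) (hpair : IsSurfacePair S G)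
    (hstat : IsStationary a S G) (hfin : HasLocFiniteArea S) :
    ∃ ν : E3 → E3, (∀ p ∈ sheet S, ∃ n, IsNormal S n p ∧
        ∀ᶠ x in nhds p, x ∈ S → x ∈ sheet S ∧ ν x = n x) ∧ ∀ p ∈ bdry S, ν p 0 = -a := by
  obtain ⟨f, hf, hfe⟩ := exists_oriented_side ha hpair hstat hfin
  have hS := hpair.surface_left
  have hchart : ∀ p ∈ bdry S, ∃ n, Oriented S f n p ∧ n p 0 = -a := fun p hp => by
    obtain ⟨e, hpe, he⟩ := exists_contactChart ha hpair hstat hfin hp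
    obtain ⟨h1, h2, h3⟩ := hpair.of_mem_bdry hp
    refine ⟨_, oriented_of_side (h := fun y => e y 2) ?_ ?_ ?_ (he.normal p hpe) ?_, ?_⟩
    · filter_upwards [e.open_source.mem_nhds hpe] with y hy
      exact (chart_coord_fderiv_ne he.chart hy 2).1
    · filter_upwards [e.open_source.mem_nhds hpe] with y hy hyS
      exact ((he.left_iff y hy).1 hyS).1
    · filter_upwards [e.open_source.mem_nhds hpe] with y hy using hfe e he y hy
    · exact grd_pos (chart_coord_fderiv_ne he.chart hpe 2).2
    · rw [PiLp.smul_apply, smul_eq_mul]; exact he.angle p hpe h1 h2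
  have hex : ∀ p ∈ sheet S, ∃ n, Oriented S f n p := by
    rintro p ⟨hpS, h0 | hpb⟩
    · obtain ⟨n, hn⟩ := hS.exists_normal hpS
      obtain ⟨-, Φ, hpΦ, hs, hΦ⟩ := interior_of_pos hpair hpS h0
      obtain ⟨hsm, hne⟩ := chart_coord_fderiv_ne hs hpΦ 2
      have hsm' : ∀ᶠ x in nhds p, ContDiffAt ℝ ∞ (fun y => Φ y 2) x := by
        filter_upwards [Φ.open_source.mem_nhds hpΦ] with y hy
        exact (chart_coord_fderiv_ne hs hy 2).1
      have hz : ∀ᶠ y in nhds p, y ∈ S → Φ y 2 = 0 := by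
        filter_upwards [Φ.open_source.mem_nhds hpΦ] with y hy using (hΦ y hy).1
      have hl := normal_deriv_ne hpS (hsm.differentiableAt (by simp)) hz hne
        hn.unit.self_of_nhds (hn.plane.self_of_nhds hpS)
      obtain ⟨g, hg, hfg⟩ := hf p h0
      obtain ⟨ε, hε⟩ := (chart_sideFun Φ.open_source le_rfl hΦ hpΦ).sgn_eq hg
      have main : ∃ h : E3 → ℝ, (∀ᶠ x in nhds p, ContDiffAt ℝ ∞ h x) ∧
          (∀ᶠ x in nhds p, x ∈ S → h x = 0) ∧ (∀ᶠ x in nhds p, x ∈ openHalf → f x = sgn (h x)) ∧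
          fderiv ℝ h p (n p) ≠ 0 := by
        rcases Int.units_eq_one_or ε with e | e
        · refine ⟨_, hsm', hz, ?_, hl⟩
          filter_upwards [hfg, hε] with x e1 e2 _
          rw [e1, e2, e]; simp
        · refine ⟨fun y => -Φ y 2, hsm'.mono fun x hx => hx.neg,
            hz.mono fun x hx hxS => by simp [hx hxS], ?_, ?_⟩
          · filter_upwards [hfg, hε] with x e1 e2 _
            rw [e1, e2, e, sgn_neg]; simp
          · rw [show fderiv ℝ (fun y => -Φ y 2) p = -fderiv ℝ (fun y => Φ y 2) p from fderiv_fun_neg]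
            simpa using hl
      obtain ⟨h, k1, k2, k3, k4⟩ := main
      rcases lt_or_gt_of_ne k4 with k | k
      · exact ⟨_, oriented_of_side k1 k2 k3 hn.neg (by simpa using k)⟩
      · exact ⟨_, oriented_of_side k1 k2 k3 hn k⟩
    · obtain ⟨n, hn, -⟩ := hchart p hpb
      exact ⟨n, hn⟩
  -- Off the wall the normal is determined by the side to which it points. A boundary point is a
  -- limit of such points of S along the first coordinate line of a contact chart.
  have huniq : ∀ x ∈ sheet S, ∀ n n', Oriented S f n x → Oriented S f n' x → n x = n' x := by
    rintro x ⟨hxS, hx⟩ n n' hn hn'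
    have h1 : ∀ᶠ y in nhds x, y ∈ S ∩ openHalf → n y = n' y := by
      filter_upwards [hn.1.unit, hn'.1.unit, hn.1.plane, hn'.1.plane, hn.2, hn'.2]
        with y a1 a2 a3 a4 a5 a6 hy
      exact pointsIn_unique hpair hf hy.1 hy.2 a1 a2 (a3 hy.1) (a4 hy.1) (a5 hy.1 hy.2)
        (a6 hy.1 hy.2)
    rcases hx with h0 | hxb
    · exact h1.self_of_nhds ⟨hxS, h0⟩
    · obtain ⟨e, hxe, he⟩ := exists_contactChart ha hpair hstat hfin hxb
      obtain ⟨hx2, -⟩ := (he.left_iff x hxe).1 hxS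
      obtain ⟨c1, c2⟩ := chart_path hxe (bv 0)
      have hx0 : e x 0 = 0 := by rw [he.coord x hxe, (hpair.of_mem_bdry hxb).2.2]
      refine tendsto_nhds_unique (hn.1.smooth.self_of_nhds.continuousAt.tendsto.comp c1)
        ((hn'.1.smooth.self_of_nhds.continuousAt.tendsto.comp c1).congr' ?_)
      filter_upwards [c1.eventually h1, c2] with t t1 t2
      have t3 : e.symm (e x + t • bv 0) 0 = t := by
        rw [← he.coord _ t2.2.1, t2.2.2]; simp [hx0]
      refine (t1 ⟨(he.left_iff _ t2.2.1).2 ⟨?_, ?_⟩, ?_⟩).symm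
      · rw [t2.2.2]; simpa using hx2
      · rw [t3]; exact t2.1.le
      · change 0 < e.symm (e x + t • bv 0) 0
        rw [t3]; exact t2.1
  classical
  choose n hn using hex
  refine ⟨fun x => if hx : x ∈ sheet S then n x hx x else 0, fun p hp => ⟨n p hp, (hn p hp).1, ?_⟩,
    fun p hp => ?_⟩
  · have hsh : ∀ᶠ x in nhds p, x ∈ S → x ∈ sheet S := by
      rcases hp.2 with h0 | hpb
      · filter_upwards [openHalf_isOpen.mem_nhds h0] with x hx hxS using ⟨hxS, Or.inl hx⟩
      · obtain ⟨e, hpe, he⟩ := exists_contactChart ha hpair hstat hfin hpb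
        filter_upwards [e.open_source.mem_nhds hpe] with x hx hxS
        exact he.eventually_sheet hpair hx hxS
    filter_upwards [hsh, (hn p hp).1.eventually, (hn p hp).2.eventually_nhds] with x h1 h2 h3 hxS
    refine ⟨h1 hxS, ?_⟩
    rw [dif_pos (h1 hxS)]
    exact huniq x (h1 hxS) _ _ (hn x _) ⟨h2, h3⟩
  · obtain ⟨m, hm, hma⟩ := hchart p hp
    have hps : p ∈ sheet S := ⟨(hpair.of_mem_bdry hp).1, Or.inr hp⟩
    simp only [dif_pos hps]
    rw [huniq p hps _ _ (hn p hps) hm, hma]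

/-! ### Smooth extension of the variation field -/

/-- Partition of unity. It produces both the variation field and the correction field, since
prescribed values and prescribed tangential parts are convex conditions at each point. -/
lemma exists_contDiff_of_local {t : E3 → Set E3} (ht : ∀ x, Convex ℝ (t x))
    (hloc : ∀ x, ∃ g : E3 → E3, ∀ᶠ y in nhds x, ContDiffAt ℝ ∞ g y ∧ g y ∈ t y) :
    ∃ g : E3 → E3, ContDiff ℝ ∞ g ∧ ∀ x, g x ∈ t x := by
  obtain ⟨g, hg⟩ := exists_contMDiffMap_forall_mem_convex_of_local
    (I := modelWithCornersSelf ℝ E3) (n := (⊤ : ℕ∞)) ht fun x => by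
    obtain ⟨g, hg⟩ := hloc x
    exact ⟨_, hg, g, fun y hy => hy.1.contMDiffAt.contMDiffWithinAt, fun y hy => hy.2⟩
  exact ⟨g, g.contMDiff.contDiff, hg⟩

/-- Near a boundary point there is a smooth retraction to `S` which maps the wall to `bdry S`. -/
lemma IsContactChart.exists_retraction {e : OpenPartialHomeomorph E3 E3}
    (he : IsContactChart a S G e) (hpair : IsSurfacePair S G) (hp : p ∈ e.source)
    (hpS : p ∈ S) : ∃ r : E3 → E3, r p = p ∧ ∀ᶠ x in nhds p, ContDiffAt ℝ ∞ r x ∧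
      (x ∈ S → r x = x) ∧ (x ∈ wall → r x ∈ bdry S) := by
  let flat : E3 → E3 := fun v => v - v 2 • bv 2
  obtain ⟨u, δ, hδ, hu0, hu2, ht⟩ := he.target
  have hflat : ∀ v ∈ e.target, flat v ∈ e.target := fun v hv => by
    rw [ht] at hv ⊢
    intro i
    have := hv i
    fin_cases i
    · simpa [flat] using this
    · simpa [flat] using this
    · simpa [flat, hu2] using hδ
  have hS : ∀ x ∈ e.source, x ∈ S → e.symm (flat (e x)) = x := fun x hx hxS => by
    have h1 : flat (e x) = e x := by simp [flat, ((he.left_iff x hx).1 hxS).1]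
    rw [h1, e.left_inv hx]
  refine ⟨fun x => e.symm (flat (e x)), hS p hp hpS, ?_⟩
  filter_upwards [e.open_source.mem_nhds hp] with x hx
  have hm := hflat _ (e.map_source hx)
  refine ⟨?_, hS x hx, fun hxw => ?_⟩
  · have h1 : ContDiffAt ℝ ∞ e x := he.chart.1.contDiffAt (e.open_source.mem_nhds hx)
    have h2 : ContDiffAt ℝ ∞ e.symm (flat (e x)) :=
      he.chart.2.contDiffAt (e.open_target.mem_nhds hm)
    have h3 : ContDiffAt ℝ ∞ (fun y => flat (e y)) x :=
      h1.sub ((contDiffAt_euclidean.1 h1 2).smul contDiffAt_const)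
    exact h2.comp x h3
  · have hs := e.map_target hm
    have e0 : e.symm (flat (e x)) 0 = 0 := by
      rw [← he.coord _ hs, e.right_inv hm]
      have : x 0 = 0 := hxw
      simp [flat, he.coord x hx, this]
    have e2 : e (e.symm (flat (e x))) 2 = 0 := by
      rw [e.right_inv hm]; simp [flat]
    rw [← hpair.inter_eq]
    exact ⟨(he.left_iff _ hs).2 ⟨e2, e0.ge⟩, (he.right_iff _ hs).2 ⟨e0, e2.le⟩⟩

/-- The local normal field `n` extends the normal `ν` of `S` near `x`. -/
def Adapted (S : Set E3) (ν n : E3 → E3) (x : E3) : Prop :=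
  IsNormal S n x ∧ ∀ᶠ y in nhds x, y ∈ S → ν y = n y

/-- A global choice of the unit normal along the sheet, with the right contact angle. -/
structure IsOrientation (a : ℝ) (S : Set E3) (ν : E3 → E3) : Prop where
  adapted : ∀ p ∈ sheet S, ∃ n, Adapted S ν n p
  sheet_open : ∀ p ∈ sheet S, ∀ᶠ x in nhds p, x ∈ S → x ∈ sheet S
  angle : ∀ p ∈ bdry S, ν p 0 = -a

lemma exists_isOrientation (ha : a ^ 2 < 1) (hpair : IsSurfacePair S G)
    (hstat : IsStationary a S G) (hfin : HasLocFiniteArea S) : ∃ ν, IsOrientation a S ν := by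
  obtain ⟨ν, h1, h2⟩ := exists_orientation ha hpair hstat hfin
  refine ⟨ν, fun p hp => ?_, fun p hp => ?_, h2⟩
  · obtain ⟨n, hn, hν⟩ := h1 p hp
    exact ⟨n, hn, hν.mono fun x hx hxS => (hx hxS).2⟩
  · obtain ⟨n, -, hν⟩ := h1 p hp
    exact hν.mono fun x hx hxS => (hx hxS).1

/-- By the maximum principle S lies in the wall near an interior contact point, and all nearby
points of S are again interior contact points. The sheet is thus closed in S. -/
lemma eventually_notMem_sheet (hpair : IsSurfacePair S G)
    (hstat : IsStationary a S G) (hfin : HasLocFiniteArea S) (hp : p ∈ S)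
    (hps : p ∉ sheet S) : ∀ᶠ x in nhds p, x ∈ S → x 0 = 0 ∧ x ∉ sheet S := by
  have h0 : p ∉ openHalf := fun h => hps ⟨hp, Or.inl h⟩
  have hb : p ∉ bdry S := fun h => hps ⟨hp, Or.inr h⟩
  have hi : IsInteriorPoint S p := (hpair.surface_left.smooth p hp).resolve_right hb
  have hw : p 0 = 0 := le_antisymm (not_lt.1 h0) (hpair.left_subset hp)
  obtain ⟨-, Φ, hpΦ, hs, hΦ⟩ := hi
  filter_upwards [contact_isOpen hpair hstat hfin hp hb hw, Φ.open_source.mem_nhds hpΦ]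
    with x hx hxΦ hxS
  refine ⟨hx hxS, ?_⟩
  rintro ⟨-, h | h⟩
  · exact (ne_of_gt h) (hx hxS)
  · exact not_interior_and_boundary ⟨hxS, Φ, hxΦ, hs, hΦ⟩ h

/-- The extension of the variation field `ν + a e₁`. -/
structure IsExtension (a : ℝ) (S : Set E3) (ν : E3 → E3) (ρ : ℝ) (V : E3 → E3) : Prop where
  smooth : ContDiff ℝ ∞ V
  wall : ∀ x ∈ wall, V x 0 = 0
  sheet : ∀ x ∈ sheet S, ρ ≤ ‖x‖ → V x = ν x + a • bv 0
  contact : ∀ x ∈ S, x ∉ Capillary.sheet S → ρ ≤ ‖x‖ → V x = 0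

/-- The only delicate local candidate is at a boundary point: n ∘ r + a e₁, where the retraction r
to S maps the wall into ∂S. There n has first component −a, so the field is tangent to the wall. At
interior contact points the value zero is prescribed, as no oriented normal is available. -/
theorem exists_extension (ha : a ^ 2 < 1) (hpair : IsSurfacePair S G)
    (hstat : IsStationary a S G) (hfin : HasLocFiniteArea S)
    (hν : IsOrientation a S ν) {ρ : ℝ} (hρ : 0 < ρ) : ∃ V, IsExtension a S ν ρ V := by
  let t : E3 → Set E3 := fun x => {z | (x ∈ wall → z 0 = 0) ∧
    (x ∈ sheet S → ρ ≤ ‖x‖ → z = ν x + a • bv 0) ∧ (x ∈ S → x ∉ sheet S → ρ ≤ ‖x‖ → z = 0)}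
  have ht : ∀ x, Convex ℝ (t x) := by
    rintro x z ⟨h1, h2, h3⟩ z' ⟨h1', h2', h3'⟩ α β hα hβ hαβ
    refine ⟨fun hx => by simp [h1 hx, h1' hx], fun hx hr => ?_, fun hx hs hr => by
      simp [h3 hx hs hr, h3' hx hs hr]⟩
    rw [h2 hx hr, h2' hx hr, ← add_smul, hαβ, one_smul]
  obtain ⟨V, hV, hVt⟩ := exists_contDiff_of_local ht fun x => by
    by_cases hx0 : x = 0
    · refine ⟨fun _ => 0, ?_⟩
      filter_upwards [ball_mem_nhds x hρ] with y hy
      rw [hx0, mem_ball_zero_iff] at hy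
      exact ⟨contDiffAt_const, by simp, fun _ h => absurd h (not_le.2 hy), by simp⟩
    by_cases hxS : x ∈ S
    · by_cases hxs : x ∈ sheet S
      · obtain ⟨n, hn, hnν⟩ := hν.adapted x hxs
        rcases hxs.2 with h0 | hxb
        · refine ⟨fun y => n y + a • bv 0, ?_⟩
          filter_upwards [openHalf_isOpen.mem_nhds h0, hn.smooth, hnν] with y h1 h2 h3
          refine ⟨h2.add contDiffAt_const, fun hw => absurd hw (ne_of_gt h1),
            fun hy _ => by rw [h3 hy.1], fun hy hy' => absurd ⟨hy, Or.inl h1⟩ hy'⟩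
        · obtain ⟨e, hxe, he⟩ := exists_contactChart ha hpair hstat hfin hxb
          obtain ⟨r, hrx, hr⟩ := he.exists_retraction hpair hxe hxS
          have hrc : Tendsto r (nhds x) (nhds x) := by
            have := hr.self_of_nhds.1.continuousAt.tendsto
            rwa [hrx] at this
          refine ⟨fun y => n (r y) + a • bv 0, ?_⟩
          filter_upwards [hr, hrc.eventually (hn.smooth.and hnν), e.open_source.mem_nhds hxe]
            with y h1 h2 h3
          refine ⟨(h2.1.comp y h1.1).add contDiffAt_const, fun hw => ?_, fun hy _ => ?_,
            fun hy hy' => absurd (he.eventually_sheet hpair h3 hy) hy'⟩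
          · have hb := h1.2.2 hw
            have := hν.angle _ hb
            rw [h2.2 (hpair.of_mem_bdry hb).1] at this
            simp [this]
          · have h4 := h2.2
            rw [h1.2.1 hy.1] at h4 ⊢
            rw [h4 hy.1]
      · refine ⟨fun _ => 0, ?_⟩
        filter_upwards [eventually_notMem_sheet hpair hstat hfin hxS hxs] with y hy
        exact ⟨contDiffAt_const, by simp, fun h => absurd h (hy h.1).2, by simp⟩
    · refine ⟨fun _ => 0, ?_⟩
      filter_upwards [hpair.surface_left.eventually_notMem hxS hx0] with y hy
      exact ⟨contDiffAt_const, by simp, fun h => absurd h.1 hy, by simp⟩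
  exact ⟨V, hV, fun x hx => (hVt x).1 hx, fun x hx hr => (hVt x).2.1 hx hr,
    fun x hx hs hr => (hVt x).2.2 hx hs hr⟩

/-! ### The correction field and its compatibility along the contact line -/

lemma IsSplit.inner_comm {M A : E3 →L[ℝ] E3} {n k : E3} (h : IsSplit M A n k) {ξ η : E3}
    (hξ : inner ℝ n ξ = 0) (hη : inner ℝ n η = 0) : inner ℝ (M ξ) η = inner ℝ (M η) ξ := by
  rw [h.eq ξ, h.eq η, hξ, hη, zero_smul, add_zero, add_zero, inner_three, inner_three]
  simp only [map_apply_three A ξ, map_apply_three A η, h.symm 1 0, h.symm 2 0, h.symm 2 1]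
  ring

/-- At a boundary point the two prescriptions for the correction field are compatible. -/
lemma contact_compat_linear {M N A : E3 →L[ℝ] E3} {n k : E3} (ha : a ^ 2 < 1)
    (hn : ‖n‖ = 1) (hn0 : n 0 = -a) (hM : IsSplit M A n k) (hMn : ∀ ξ, inner ℝ (M ξ) n = 0)
    (htr : M (bv 0) 0 + M (bv 1) 1 + M (bv 2) 2 = 0) (hN : ∀ ξ, inner ℝ n ξ = 0 → N ξ = M ξ)
    (hN0 : ∀ j : Fin 3, j ≠ 0 → N (bv j) 0 = 0) {V C : E3} (hV : V = n + a • bv 0)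
    (hC : C = (inner ℝ (N V) (cross (bv 0) V) / (1 - a ^ 2)) • cross n (bv 0) -
      a • M (bv 0 - n 0 • n) - ((N (bv 1) 1 + N (bv 2) 2) • V - N V)) :
    C - inner ℝ C n • n = 0 := by
  have hs : (1 - a ^ 2 : ℝ) ≠ 0 := by linarith
  have hn2 : n 1 ^ 2 + n 2 ^ 2 = 1 - a ^ 2 := by
    have : n 0 ^ 2 + n 1 ^ 2 + n 2 ^ 2 = 1 := by rw [← norm_sq_three, hn]; norm_num
    rw [hn0] at this; linarith
  -- T is tangent to ∂S, V is the normal of ∂S within the wall, and v is the tangential part of e₁;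
  -- all three have squared length 1 − a². The vectors T and v are orthogonal and span n^⊥, so it
  -- suffices to test C against them.
  set T : E3 := cross (bv 0) V with hT
  set v : E3 := bv 0 - n 0 • n with hv
  have V0 : V 0 = 0 := by simp [hV, hn0]
  have V1 : V 1 = n 1 := by simp [hV]
  have V2 : V 2 = n 2 := by simp [hV]
  have T0 : T 0 = 0 := by rw [hT, cross_zero]; simp
  have T1 : T 1 = -n 2 := by rw [hT, cross_one]; simp [V2]
  have T2 : T 2 = n 1 := by rw [hT, cross_two]; simp [V1]
  have v0 : v 0 = 1 - a ^ 2 := by simp [hv, hn0]; ring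
  have v1 : v 1 = a * n 1 := by simp [hv, hn0]
  have v2 : v 2 = a * n 2 := by simp [hv, hn0]
  have hnT : inner ℝ n T = 0 := by rw [inner_three, T0, T1, T2]; ring
  have hnv : inner ℝ n v = 0 := by
    rw [inner_three, v0, v1, v2, hn0]; linear_combination a * hn2
  have hNT := hN T hnT
  have N01 := hN0 1 (by decide)
  have N02 := hN0 2 (by decide)
  have hMT0 : M T 0 = 0 := by
    rw [← hNT, map_apply_three, T0, N01, N02]; ring
  -- Joachimsthal's theorem: the surface meets the wall at a constant angle, so the contact line is
  -- a line of curvature.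
  have e1 : inner ℝ (M v) T = 0 := by
    rw [hM.inner_comm hnv hnT]
    have h1 := hMn T
    rw [inner_three] at h1 ⊢
    rw [v0, v1, v2]
    rw [hn0] at h1
    linear_combination a * h1 + hMT0
  -- Zero mean curvature, read in the orthogonal frame v, T.
  have e2 : inner ℝ (M v) v + inner ℝ (M T) T = 0 := by
    have h1 := hMn n
    rw [inner_three] at h1 ⊢
    rw [inner_three]
    simp only [map_apply_three M v, map_apply_three M T, map_apply_three M n, T0, T1, T2, v0, v1,
      v2, hn0] at h1 ⊢
    linear_combination (1 - a ^ 2) * htr - (1 - a ^ 2) * h1 +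
       (M (bv 1) 1 + M (bv 2) 2) * hn2
  have hNV0 : N V 0 = 0 := by rw [map_apply_three, V0, N01, N02]; ring
  -- The divergence within the wall, read in the orthogonal frame V, T.
  have e3 : (N (bv 1) 1 + N (bv 2) 2) * (1 - a ^ 2) = inner ℝ (N V) V + inner ℝ (M T) T := by
    rw [← hNT, inner_three, inner_three]
    simp only [map_apply_three N V, map_apply_three N T, T0, T1, T2, V0, V1, V2, N01, N02]
    linear_combination -(N (bv 1) 1 + N (bv 2) 2) * hn2
  set d := N (bv 1) 1 + N (bv 2) 2 with hd
  set b : ℝ := inner ℝ (N V) T / (1 - a ^ 2) with hb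
  have hb' : b * (1 - a ^ 2) = inner ℝ (N V) T := by rw [hb]; field_simp
  have x0 : cross n (bv 0) 0 = 0 := by rw [cross_zero]; simp
  have x1 : cross n (bv 0) 1 = n 2 := by rw [cross_one]; simp
  have x2 : cross n (bv 0) 2 = -n 1 := by rw [cross_two]; simp
  have hCi : ∀ i, C i = b * cross n (bv 0) i - a * M v i - (d * V i - N V i) := fun i => by
    rw [hC]; simp
  have hCT : inner ℝ C T = 0 := by
    rw [inner_three] at e1 hb' ⊢
    rw [hCi, hCi, hCi, x0, x1, x2, V0, V1, V2]
    rw [T0, T1, T2] at e1 hb' ⊢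
    linear_combination -a * e1 - hb' - b * hn2
  have hCv : inner ℝ C v = 0 := by
    rw [inner_three (M v) v] at e2
    rw [inner_three (N V) V] at e3
    rw [inner_three, hCi, hCi, hCi, x0, x1, x2, V0, V1, V2]
    rw [v0, v1, v2] at e2 ⊢
    rw [V0, V1, V2] at e3
    linear_combination -a * e2 - a * e3 + (1 - a ^ 2) * hNV0 - a * d * hn2
  rw [inner_three] at hCT hCv
  rw [T0, T1, T2] at hCT
  rw [v0, v1, v2] at hCv
  have key : ∀ i, (1 - a ^ 2) * (C i - inner ℝ C n * n i) = 0 := by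
    intro i
    rw [inner_three, hn0]
    fin_cases i
    · simp only [Fin.zero_eta, hn0]
      linear_combination (1 - a ^ 2) * hCv
    · simp only [Fin.mk_one]
      linear_combination -n 2 * hCT + a * n 1 * hCv - C 1 * hn2
    · simp only [Fin.reduceFinMk]
      linear_combination n 1 * hCT + a * n 2 * hCv - C 2 * hn2
  ext i
  have := (mul_eq_zero.1 (key i)).resolve_left hs
  simpa using this

lemma cross_contDiffAt {f g : E3 → E3} {x : E3} (hf : ContDiffAt ℝ ∞ f x)
    (hg : ContDiffAt ℝ ∞ g x) : ContDiffAt ℝ ∞ (fun y => cross (f y) (g y)) x := by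
  rw [contDiffAt_euclidean]
  have hf := contDiffAt_euclidean.1 hf
  have hg := contDiffAt_euclidean.1 hg
  intro i
  fin_cases i
  · exact ((hf 1).mul (hg 2)).sub ((hf 2).mul (hg 1))
  · exact ((hf 2).mul (hg 0)).sub ((hf 0).mul (hg 2))
  · exact ((hf 0).mul (hg 1)).sub ((hf 1).mul (hg 0))

lemma inner_cross_left (x y : E3) : inner ℝ (cross x y) x = 0 := by
  rw [inner_three, cross_zero, cross_one, cross_two]; ring

lemma Adapted.eventually {ν n : E3 → E3} {x : E3} (h : Adapted S ν n x) :
    ∀ᶠ y in nhds x, Adapted S ν n y := by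
  filter_upwards [h.1.eventually, h.2.eventually_nhds] with y h1 h2 using ⟨h1, h2⟩

lemma Adapted.eq {ν n n' : E3 → E3} {x : E3} (h : Adapted S ν n x)
    (h' : Adapted S ν n' x) (hx : x ∈ S) : n x = n' x := by
  rw [← h.2.self_of_nhds hx, h'.2.self_of_nhds hx]

lemma Adapted.fderiv_eq {ν n n' : E3 → E3} {x : E3} (h : Adapted S ν n x)
    (h' : Adapted S ν n' x) (hx : x ∈ S) {ξ : E3} (hξ : inner ℝ (n x) ξ = 0) :
    fderiv ℝ n x ξ = fderiv ℝ n' x ξ := by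
  refine fderiv_eq_of_eqOn hx (h.1.smooth.self_of_nhds.differentiableAt (by simp))
    (h'.1.smooth.self_of_nhds.differentiableAt (by simp)) ?_ ?_
  · filter_upwards [h.2, h'.2] with y h1 h2 hy
    rw [← h1 hy, h2 hy]
  · rwa [h.1.plane.self_of_nhds hx, mem_perp_iff]

/-- The prescribed values of the correction field on the wall. -/
def wallField (X : E3 → E3) (x : E3) : E3 :=
  (fderiv ℝ X x (bv 1) 1 + fderiv ℝ X x (bv 2) 2) • X x - fderiv ℝ X x (X x)

/-- The prescribed tangential part of the correction field on the surface with normal `n`. -/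
def sheetField (a : ℝ) (φ ψ : E3 → ℝ) (n : E3 → E3) (x : E3) : E3 :=
  cross (n x) (grd ψ x) - (φ x ^ 2 * a) • fderiv ℝ n x (bv 0 - n x 0 • n x)

lemma wallField_contDiff {X : E3 → E3} (hX : ContDiff ℝ ∞ X) : ContDiff ℝ ∞ (wallField X) := by
  rw [contDiff_iff_contDiffAt]
  intro x
  have h1 : ContDiffAt ℝ ∞ (fderiv ℝ X) x := smooth_fderiv hX.contDiffAt
  have h2 : ∀ i j, ContDiffAt ℝ ∞ (fun y => fderiv ℝ X y (bv i) j) x := fun i j =>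
    contDiffAt_euclidean.1 (h1.clm_apply contDiffAt_const) j
  exact (((h2 1 1).add (h2 2 2)).smul hX.contDiffAt).sub (h1.clm_apply hX.contDiffAt)

lemma wallField_eq_zero {X : E3 → E3} {x : E3} (hx : x ∉ tsupport X) : wallField X x = 0 := by
  simp [wallField, fderiv_zero_of_notMem_tsupport hx]

lemma sheetField_contDiffAt {φ ψ : E3 → ℝ} {n : E3 → E3} {x : E3}
    (hφ : ContDiff ℝ ∞ φ) (hψ : ContDiff ℝ ∞ ψ) (hn : ContDiffAt ℝ ∞ n x) :
    ContDiffAt ℝ ∞ (sheetField a φ ψ n) x := by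
  have hn0 : ContDiffAt ℝ ∞ (fun x => n x 0) x := contDiffAt_euclidean.1 hn 0
  exact (cross_contDiffAt hn (grd_smooth hψ.contDiffAt)).sub
    (((hφ.contDiffAt.pow 2).mul contDiffAt_const).smul
      ((smooth_fderiv hn).clm_apply (contDiffAt_const.sub (hn0.smul hn))))

lemma sheetField_inner {φ ψ : E3 → ℝ} {n : E3 → E3} {x : E3}
    (hn : IsNormal S n x) : inner ℝ (sheetField a φ ψ n x) (n x) = 0 := by
  rw [sheetField, inner_sub_left, inner_smul_left, inner_cross_left,
    inner_fderiv_unit (hn.smooth.self_of_nhds.differentiableAt (by simp)) hn.unit]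
  simp

lemma sheetField_congr {ν n n' : E3 → E3} {φ ψ : E3 → ℝ} {x : E3}
    (h : Adapted S ν n x) (h' : Adapted S ν n' x) (hx : x ∈ S) :
    sheetField a φ ψ n x = sheetField a φ ψ n' x := by
  have h0 := h.eq h' hx
  have h1 : inner ℝ (n x) (bv 0 - n x 0 • n x) = 0 := by
    rw [inner_sub_right (n x) (bv 0), inner_smul_right, real_inner_self_eq_norm_sq,
      h.1.unit.self_of_nhds, inner_bv_right]
    ring
  rw [sheetField, sheetField, h.fderiv_eq h' hx h1, h0]

/-- The terms with derivatives of φ cancel because V is tangent to the wall at q. Only φ² remains,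
so the compatibility along ∂S is a statement about V alone. -/
lemma wallField_smul {φ : E3 → ℝ} {V : E3 → E3} {q : E3} (hφ : DifferentiableAt ℝ φ q)
    (hV : DifferentiableAt ℝ V q) (h0 : V q 0 = 0) :
    wallField (fun x => φ x • V x) q = φ q ^ 2 •
      ((fderiv ℝ V q (bv 1) 1 + fderiv ℝ V q (bv 2) 2) • V q - fderiv ℝ V q (V q)) := by
  have hD : ∀ ξ, fderiv ℝ (fun x => φ x • V x) q ξ =
      φ q • fderiv ℝ V q ξ + fderiv ℝ φ q ξ • V q := fun ξ => by
    rw [fderiv_fun_smul hφ hV]; simp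
  have hφV : fderiv ℝ φ q (V q) = V q 1 * fderiv ℝ φ q (bv 1) + V q 2 * fderiv ℝ φ q (bv 2) := by
    conv_lhs => rw [eq_sum_bv (V q)]
    simp [Fin.sum_univ_three, h0]
  rw [wallField]
  simp only [hD, map_smul, PiLp.add_apply, PiLp.smul_apply, smul_eq_mul, hφV]
  module

/-- The stream function of the divergence free part of the correction field. -/
def streamFun (a : ℝ) (φ : E3 → ℝ) (V : E3 → E3) (x : E3) : ℝ :=
  φ x * (φ x * (x 0 * (inner ℝ (fderiv ℝ V x (V x)) (cross (bv 0) (V x)) / (1 - a ^ 2))))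

lemma streamFun_aux {V : E3 → E3} (hV : ContDiff ℝ ∞ V) : ContDiff ℝ ∞ fun x =>
    inner ℝ (fderiv ℝ V x (V x)) (cross (bv 0) (V x)) / (1 - a ^ 2) := by
  rw [contDiff_iff_contDiffAt]
  intro x
  exact (((smooth_fderiv hV.contDiffAt).clm_apply hV.contDiffAt).inner ℝ
    (cross_contDiffAt contDiffAt_const hV.contDiffAt)).div_const _

lemma streamFun_contDiff {φ : E3 → ℝ} {V : E3 → E3} (hφ : ContDiff ℝ ∞ φ)
    (hV : ContDiff ℝ ∞ V) : ContDiff ℝ ∞ (streamFun a φ V) :=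
  hφ.mul (hφ.mul (((coordL 0).contDiff).mul
    (streamFun_aux hV)))

/-- The factor x₁ makes ψ vanish on the wall with a prescribed normal derivative, and the
coefficient is the one that cancels the T component in `contact_compat_linear`. -/
lemma grd_streamFun {φ : E3 → ℝ} {V : E3 → E3} (hφ : ContDiff ℝ ∞ φ)
    (hV : ContDiff ℝ ∞ V) {q : E3} (hq : q 0 = 0) : grd (streamFun a φ V) q =
      (φ q ^ 2 * (inner ℝ (fderiv ℝ V q (V q)) (cross (bv 0) (V q)) / (1 - a ^ 2))) • bv 0 := by
  set b : E3 → ℝ := fun x => inner ℝ (fderiv ℝ V x (V x)) (cross (bv 0) (V x)) / (1 - a ^ 2)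
    with hb
  have h1 : HasFDerivAt (fun x : E3 => x 0 * (φ x * (φ x * b x)))
      (q 0 • fderiv ℝ (fun x => φ x * (φ x * b x)) q + (φ q * (φ q * b q)) •
        (coordL 0)) q := by
    have h2 : DifferentiableAt ℝ (fun x => φ x * (φ x * b x)) q :=
      (hφ.mul (hφ.mul (streamFun_aux hV))).contDiffAt.differentiableAt (by simp)
    exact ((coordL 0).hasFDerivAt (x := q)).mul
      h2.hasFDerivAt
  have h3 : streamFun a φ V = fun x : E3 => x 0 * (φ x * (φ x * b x)) := by
    ext x; simp only [streamFun, hb]; ring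
  ext i
  rw [grd_apply, h3, h1.fderiv, hq]
  fin_cases i <;> (simp [b]; try ring)

lemma sheetField_eq_zero {φ : E3 → ℝ} {V n : E3 → E3} {x : E3} (hx : x ∉ tsupport φ) :
    sheetField a φ (streamFun a φ V) n x = 0 := by
  have h1 : x ∉ tsupport (streamFun a φ V) := fun h =>
    hx (tsupport_smul_subset φ (fun x => φ x * (x 0 *
      (inner ℝ (fderiv ℝ V x (V x)) (cross (bv 0) (V x)) / (1 - a ^ 2)))) h)
  have h2 : grd (streamFun a φ V) x = 0 := by
    ext i
    rw [grd_apply, show fderiv ℝ (streamFun a φ V) x = 0 from by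
      by_contra h; exact h1 (support_fderiv_subset ℝ h)]
    simp
  have h3 : φ x = 0 := image_eq_zero_of_notMem_tsupport hx
  have h4 : cross (n x) 0 = 0 := by
    ext i; fin_cases i <;> simp [cross]
  rw [sheetField, h2, h3, h4]; simp

/-- The correction field on the wall and on the surface. -/
structure IsCorrection (a : ℝ) (S : Set E3) (ν : E3 → E3) (φ : E3 → ℝ) (V Z : E3 → E3) :
    Prop where
  test : IsTestField Z
  wall : ∀ x ∈ wall, Z x = wallField (fun x => φ x • V x) x
  sheet : ∀ x ∈ sheet S, ∀ n, Adapted S ν n x →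
    Z x - inner ℝ (Z x) (n x) • n x = sheetField a φ (streamFun a φ V) n x

/-- Both prescriptions carry the common factor φ(q)², which reduces the claim to
`contact_compat_linear`. -/
lemma contact_compat (ha : a ^ 2 < 1) (hpair : IsSurfacePair S G)
    (hstat : IsStationary a S G) (hfin : HasLocFiniteArea S)
    (hν : IsOrientation a S ν) {ρ : ℝ} {φ : E3 → ℝ} {V : E3 → E3}
    (hV : IsExtension a S ν ρ V) (hφ : ContDiff ℝ ∞ φ) {q : E3} (hq : q ∈ bdry S)
    (hqρ : ρ < ‖q‖) {n : E3 → E3} (hn : Adapted S ν n q) {C : E3}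
    (hC : C = sheetField a φ (streamFun a φ V) n q - wallField (fun x => φ x • V x) q) :
    C - inner ℝ C (n q) • n q = 0 := by
  obtain ⟨hqS, -, hq0⟩ := hpair.of_mem_bdry hq
  have hqs : q ∈ sheet S := ⟨hqS, Or.inr hq⟩
  have hnq := hn.2.self_of_nhds hqS
  have hn0 : n q 0 = -a := by rw [← hnq, hν.angle q hq]
  have hnd : DifferentiableAt ℝ n q := hn.1.smooth.self_of_nhds.differentiableAt (by simp)
  have hVd : DifferentiableAt ℝ V q := hV.smooth.contDiffAt.differentiableAt (by simp)
  obtain ⟨A, k, hM⟩ := hn.1.split.self_of_nhds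
  have hVS : ∀ᶠ x in nhds q, x ∈ S → V x = n x + a • bv 0 := by
    filter_upwards [hν.sheet_open q hqs, hn.2,
      continuous_norm.continuousAt.eventually (lt_mem_nhds hqρ)] with x h1 h2 h3 hx
    rw [hV.sheet x (h1 hx) (le_of_lt h3), h2 hx]
  have hN : ∀ ξ, inner ℝ (n q) ξ = 0 → fderiv ℝ V q ξ = fderiv ℝ n q ξ := fun ξ hξ => by
    rw [fderiv_eq_of_eqOn hqS hVd (g := fun x => n x + a • bv 0) (hnd.add_const _) hVS (by
      rwa [hn.1.plane.self_of_nhds hqS, mem_perp_iff]),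
      fderiv_add_const]
  have hN0 : ∀ j : Fin 3, j ≠ 0 → fderiv ℝ V q (bv j) 0 = 0 := fun j hj => by
    rw [← fderiv_coord hVd, fderiv_eq_of_wall (g := fun _ => (0 : ℝ)) hq0 _
      (differentiableAt_const _) hV.wall hj]
    · simp
    · exact (coordL 0).differentiableAt.comp q hVd
  have htr := edivg_eq_zero hpair hstat hfin hqS hn.1
  have hVq := hVS.self_of_nhds hqS
  refine (fun C' (hC' : C' - inner ℝ C' (n q) • n q = 0) (h : C = φ q ^ 2 • C') => ?_)
    _ (contact_compat_linear ha hn.1.unit.self_of_nhds hn0 hM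
      (inner_fderiv_unit hnd hn.1.unit) htr hN hN0 hVq rfl) ?_
  · rw [h, inner_smul_left, conj_trivial, mul_smul, ← smul_sub, hC', smul_zero]
  · rw [hC, wallField_smul (hφ.contDiffAt.differentiableAt (by simp)) hVd
      (hV.wall q hq0), sheetField, grd_streamFun hφ hV.smooth hq0]
    have hcr : ∀ c : ℝ, cross (n q) (c • bv 0) = c • cross (n q) (bv 0) := fun c => by
      ext i; fin_cases i <;> simp [cross] <;> ring
    rw [hcr]
    module

/-- Away from ∂S the sheet field or the wall field serves as local solution, since only one of the
two prescriptions is active. Near ∂S they are interpolated, and the compatibility along ∂S makes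
this possible. -/
theorem exists_correction (ha : a ^ 2 < 1) (hpair : IsSurfacePair S G)
    (hstat : IsStationary a S G) (hfin : HasLocFiniteArea S)
    (hν : IsOrientation a S ν) {ρ R : ℝ} (hρ : 0 < ρ) {φ : E3 → ℝ} {V : E3 → E3}
    (hV : IsExtension a S ν ρ V) (hφ : ContDiff ℝ ∞ φ)
    (hsupp : ∀ x ∈ tsupport φ, ρ < ‖x‖ ∧ ‖x‖ < R) : ∃ Z, IsCorrection a S ν φ V Z := by
  set ψ := streamFun a φ V with hψ
  set X : E3 → E3 := fun x => φ x • V x with hX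
  have hψs : ContDiff ℝ ∞ ψ := streamFun_contDiff hφ hV.smooth
  have hXs : ContDiff ℝ ∞ X := hφ.smul hV.smooth
  have hws : ContDiff ℝ ∞ (wallField X) := wallField_contDiff hXs
  have hw0 : ∀ x ∉ tsupport φ, wallField X x = 0 := fun x hx =>
    wallField_eq_zero fun h => hx (tsupport_smul_subset φ V h)
  let t : E3 → Set E3 := fun x => {z | (x ∈ wall → z = wallField X x) ∧
    (x ∈ sheet S → ∀ n, Adapted S ν n x → z - inner ℝ z (n x) • n x = sheetField a φ ψ n x) ∧
    (¬(ρ < ‖x‖ ∧ ‖x‖ < R) → z = 0)}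
  have ht : ∀ x, Convex ℝ (t x) := by
    rintro x z ⟨h1, h2, h3⟩ z' ⟨h1', h2', h3'⟩ α β hα hβ hαβ
    refine ⟨fun hx => ?_, fun hx n hn => ?_, fun hx => by simp [h3 hx, h3' hx]⟩
    · rw [h1 hx, h1' hx, ← add_smul, hαβ, one_smul]
    · have e1 : α • z + β • z' - inner ℝ (α • z + β • z') (n x) • n x =
          α • (z - inner ℝ z (n x) • n x) + β • (z' - inner ℝ z' (n x) • n x) := by
        rw [inner_add_left, inner_smul_left, inner_smul_left, conj_trivial, conj_trivial]
        module
      rw [e1, h2 hx n hn, h2' hx n hn, ← add_smul, hαβ, one_smul]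
  obtain ⟨Z, hZ, hZt⟩ := exists_contDiff_of_local ht fun x => by
    by_cases hxφ : x ∈ tsupport φ
    swap
    · refine ⟨fun _ => 0, ?_⟩
      filter_upwards [(isClosed_tsupport φ).isOpen_compl.mem_nhds hxφ] with y hy
      refine ⟨contDiffAt_const, fun _ => (hw0 y hy).symm, fun _ n _ => ?_, fun _ => rfl⟩
      rw [hψ, sheetField_eq_zero hy]; simp
    have hO : ∀ᶠ y in nhds x, ρ < ‖y‖ ∧ ‖y‖ < R :=
      (continuous_norm.continuousAt.eventually (lt_mem_nhds (hsupp x hxφ).1)).and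
        (continuous_norm.continuousAt.eventually (gt_mem_nhds (hsupp x hxφ).2))
    have hx0 : x ≠ 0 := fun h => by
      have := (hsupp x hxφ).1
      rw [h, norm_zero] at this; linarith
    by_cases hxS : x ∈ S
    · by_cases hxs : x ∈ sheet S
      · obtain ⟨n, hn⟩ := hν.adapted x hxs
        rcases hxs.2 with h0 | hxb
        · refine ⟨sheetField a φ ψ n, ?_⟩
          filter_upwards [openHalf_isOpen.mem_nhds h0, hn.1.smooth, hn.eventually, hO]
            with y h1 h2 h3 h4
          refine ⟨sheetField_contDiffAt hφ hψs h2, fun hw => absurd hw (ne_of_gt h1),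
            fun hy n' hn' => ?_, fun h => absurd h4 h⟩
          rw [sheetField_congr hn' h3 hy.1, ← h3.eq hn' hy.1, sheetField_inner h3.1, zero_smul,
            sub_zero]
        · obtain ⟨e, hxe, he⟩ := exists_contactChart ha hpair hstat hfin hxb
          obtain ⟨r, hrx, hr⟩ := he.exists_retraction hpair hxe hxS
          have hrc : Tendsto r (nhds x) (nhds x) := by
            have := hr.self_of_nhds.1.continuousAt.tendsto
            rwa [hrx] at this
          let E : E3 → E3 := fun y => sheetField a φ ψ n y - wallField X y
          -- The tangential part of the discrepancy between the two prescriptions. It vanishes on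
          -- ∂S, to which r maps the wall, so P ∘ r changes nothing on the wall; on S it replaces
          -- the tangential part of the wall field by the sheet field.
          let P : E3 → E3 := fun y => E y - inner ℝ (E y) (n y) • n y
          have hP : ∀ y, ContDiffAt ℝ ∞ n y → ContDiffAt ℝ ∞ P y := fun y hy => by
            have h1 : ContDiffAt ℝ ∞ E y :=
              (sheetField_contDiffAt hφ hψs hy).sub hws.contDiffAt
            exact h1.sub ((h1.inner ℝ hy).smul hy)
          refine ⟨fun y => wallField X y + P (r y), ?_⟩
          filter_upwards [hr, hrc.eventually (hn.1.smooth.and (hn.eventually.and hO)),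
            hn.eventually, hO] with y h1 h2 h3 h4
          refine ⟨hws.contDiffAt.add ((hP _ h2.1).comp y h1.1), fun hw => ?_, fun hy n' hn' => ?_,
            fun h => absurd h4 h⟩
          · have hb := h1.2.2 hw
            have : P (r y) = 0 := contact_compat ha hpair hstat hfin hν hV hφ hb h2.2.2.1 h2.2.1 rfl
            rw [this, add_zero]
          · rw [h1.2.1 hy.1, sheetField_congr hn' h3 hy.1, ← h3.eq hn' hy.1]
            have e1 : inner ℝ (sheetField a φ ψ n y) (n y) = 0 := sheetField_inner h3.1
            have e2 : inner ℝ (n y) (n y) = (1 : ℝ) := by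
              rw [real_inner_self_eq_norm_sq, h3.1.unit.self_of_nhds]; norm_num
            simp only [P, E, inner_add_left, inner_sub_left, inner_smul_left, e1, e2, conj_trivial]
            module
      · refine ⟨wallField X, ?_⟩
        filter_upwards [eventually_notMem_sheet hpair hstat hfin hxS hxs, hO] with y hy h4
        exact ⟨hws.contDiffAt, fun _ => rfl, fun h => absurd h (hy h.1).2, fun h => absurd h4 h⟩
    · refine ⟨wallField X, ?_⟩
      filter_upwards [hpair.surface_left.eventually_notMem hxS hx0, hO] with y hy h4
      exact ⟨hws.contDiffAt, fun _ => rfl, fun h => absurd h.1 hy, fun h => absurd h4 h⟩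
  have hts : tsupport Z ⊆ {x | ρ ≤ ‖x‖} ∩ closedBall 0 R := by
    refine closure_minimal (fun x hx => ?_) (IsClosed.inter
      (isClosed_le continuous_const continuous_norm) Metric.isClosed_closedBall)
    have h1 : ρ < ‖x‖ ∧ ‖x‖ < R := by
      by_contra h
      exact hx ((hZt x).2.2 h)
    exact ⟨h1.1.le, by rw [mem_closedBall_zero_iff]; exact h1.2.le⟩
  refine ⟨Z, ⟨hZ, ?_, ?_, ?_⟩, fun x hx => (hZt x).1 hx, fun x hx => (hZt x).2.1 hx⟩
  · exact HasCompactSupport.of_support_subset_isCompact (isCompact_closedBall (0 : E3) R)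
      ((subset_tsupport Z).trans (hts.trans Set.inter_subset_right))
  · intro h
    have := (hts h).1
    simp only [Set.mem_ofPred_eq, norm_zero] at this
    linarith
  · intro x hx
    rw [mem_wallPlane, (hZt x).1 hx]
    have hX0 : ∀ y ∈ wall, X y 0 = 0 := fun y hy => by simp [X, hV.wall y hy]
    have hXd : DifferentiableAt ℝ X x := hXs.contDiffAt.differentiableAt (by simp)
    have h0 : ∀ j : Fin 3, j ≠ 0 → fderiv ℝ X x (bv j) 0 = 0 := fun j hj => by
      rw [← fderiv_coord hXd, fderiv_eq_of_wall (g := fun _ => (0 : ℝ)) hx _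
        (differentiableAt_const _) hX0 hj]
      · simp
      · exact (coordL 0).differentiableAt.comp x hXd
    rw [wallField, PiLp.sub_apply, PiLp.smul_apply, map_apply_three _ (X x), h0 1 (by decide),
      h0 2 (by decide), hX0 x hx]
    simp

/-! ### Second variation of area along a flow -/

lemma fderiv_slice {Ψ : ℝ × E3 → E3} (hΨ : ContDiff ℝ ∞ Ψ) (t : ℝ) (x : E3) :
    fderiv ℝ (fun y => Ψ (t, y)) x =
      (fderiv ℝ Ψ (t, x)).comp (ContinuousLinearMap.inr ℝ ℝ E3) := by
  have h1 : HasFDerivAt Ψ (fderiv ℝ Ψ (t, x)) (t, x) :=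
    (hΨ.contDiffAt.differentiableAt (by simp)).hasFDerivAt
  exact (h1.comp x (hasFDerivAt_prodMk_right t x)).fderiv

lemma hasDerivAt_slice {F : Type*} [NormedAddCommGroup F] [NormedSpace ℝ F] {E : Type*}
    [NormedAddCommGroup E] [NormedSpace ℝ E] {g : ℝ × E → F} {t : ℝ} {x : E}
    (hg : DifferentiableAt ℝ g (t, x)) :
    HasDerivAt (fun s => g (s, x)) (fderiv ℝ g (t, x) (1, 0)) t := by
  have h1 := (hg.hasFDerivAt.comp t (hasFDerivAt_prodMk_left t x)).hasDerivAt
  refine (h1 : HasDerivAt (fun s => g (s, x)) _ t).congr_deriv ?_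
  simp

/-- Derivatives in time and in space commute. -/
lemma hasDerivAt_fderiv_slice {Ψ Ψ1 : ℝ × E3 → E3} (hΨ : ContDiff ℝ ∞ Ψ) (hΨ1 : ContDiff ℝ ∞ Ψ1)
    (h : ∀ t x, HasDerivAt (fun s => Ψ (s, x)) (Ψ1 (t, x)) t) (t : ℝ) (x : E3) :
    HasDerivAt (fun s => fderiv ℝ (fun y => Ψ (s, y)) x) (fderiv ℝ (fun y => Ψ1 (t, y)) x) t := by
  have hs : ContDiffAt ℝ ∞ (fderiv ℝ Ψ) (t, x) := smooth_fderiv hΨ.contDiffAt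
  have hsd : DifferentiableAt ℝ (fderiv ℝ Ψ) (t, x) := hs.differentiableAt (by simp)
  have h1 := hasDerivAt_slice hsd
  have h2 := (((ContinuousLinearMap.compL ℝ E3 (ℝ × E3) E3).flip
    (ContinuousLinearMap.inr ℝ ℝ E3)).hasFDerivAt).comp_hasDerivAt t h1
  have h3 : HasDerivAt (fun s => fderiv ℝ (fun y => Ψ (s, y)) x)
      ((fderiv ℝ (fderiv ℝ Ψ) (t, x) (1, 0)).comp (ContinuousLinearMap.inr ℝ ℝ E3)) t := by
    simp only [fderiv_slice hΨ]
    exact h2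
  refine h3.congr_deriv ?_
  rw [fderiv_slice hΨ1]
  have h4 : Ψ1 = fun z => fderiv ℝ Ψ z (1, 0) := by
    funext z
    obtain ⟨t, x⟩ := z
    exact (h t x).unique (hasDerivAt_slice (hΨ.contDiffAt.differentiableAt (by simp)))
  ext1 ξ
  rw [h4]
  simp only [ContinuousLinearMap.comp_apply]
  have h5 := (hsd.hasFDerivAt.clm_apply (hasFDerivAt_const ((1, 0) : ℝ × E3) (t, x))).fderiv
  rw [h5]
  simp only [add_apply, ContinuousLinearMap.comp_apply, zero_apply, map_zero, zero_add,
    ContinuousLinearMap.flip_apply]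
  exact (hΨ.contDiffAt.isSymmSndFDerivAt (by simpa using two_le_infty)).eq _ _

lemma cofv_smooth {E : Type*} [NormedAddCommGroup E] [NormedSpace ℝ E] {B : E → E3 →L[ℝ] E3}
    {n : E → E3} (hB : ContDiff ℝ ∞ B) (hn : ContDiff ℝ ∞ n) :
    ContDiff ℝ ∞ fun z => cofv (B z) (n z) := by
  have hb : ∀ i j, ContDiff ℝ ∞ fun z => B z (bv i) j := fun i j =>
    contDiff_euclidean.1 (hB.clm_apply contDiff_const) j
  have hn := contDiff_euclidean.1 hn
  rw [contDiff_euclidean]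
  intro i
  fin_cases i
  · exact ((((hn 0).mul (((hb _ _).mul (hb _ _)).sub ((hb _ _).mul (hb _ _)))).add
      ((hn 1).mul (((hb _ _).mul (hb _ _)).sub ((hb _ _).mul (hb _ _))))).add
      ((hn 2).mul (((hb _ _).mul (hb _ _)).sub ((hb _ _).mul (hb _ _)))))
  · exact ((((hn 0).mul (((hb _ _).mul (hb _ _)).sub ((hb _ _).mul (hb _ _)))).add
      ((hn 1).mul (((hb _ _).mul (hb _ _)).sub ((hb _ _).mul (hb _ _))))).add
      ((hn 2).mul (((hb _ _).mul (hb _ _)).sub ((hb _ _).mul (hb _ _)))))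
  · exact ((((hn 0).mul (((hb _ _).mul (hb _ _)).sub ((hb _ _).mul (hb _ _)))).add
      ((hn 1).mul (((hb _ _).mul (hb _ _)).sub ((hb _ _).mul (hb _ _))))).add
      ((hn 2).mul (((hb _ _).mul (hb _ _)).sub ((hb _ _).mul (hb _ _)))))

/-- Differentiation twice under the integral sign. -/
lemma hasDerivAt_integral_twice {A : Set E3} {μ : Measure E3} (hA : MeasurableSet A)
    (hμ : μ A < ⊤) {J J1 J2 : ℝ → E3 → ℝ} {δ C : ℝ} (hδ : 0 < δ)
    (h1 : ∀ x ∈ A, ∀ t ∈ ball (0 : ℝ) δ, HasDerivAt (fun s => J s x) (J1 t x) t)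
    (h2 : ∀ x ∈ A, ∀ t ∈ ball (0 : ℝ) δ, HasDerivAt (fun s => J1 s x) (J2 t x) t)
    (hm : ∀ t, AEStronglyMeasurable (J t) (μ.restrict A))
    (hb : ∀ x ∈ A, ∀ t ∈ ball (0 : ℝ) δ, ‖J t x‖ ≤ C ∧ ‖J1 t x‖ ≤ C ∧ ‖J2 t x‖ ≤ C) :
    (∀ᶠ t in nhds (0 : ℝ), HasDerivAt (fun t => ∫ x in A, J t x ∂μ) (∫ x in A, J1 t x ∂μ) t) ∧
      HasDerivAt (fun t => ∫ x in A, J1 t x ∂μ) (∫ x in A, J2 0 x ∂μ) 0 := by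
  have : IsFiniteMeasure (μ.restrict A) := ⟨by simpa using hμ⟩
  have hae : ∀ P : E3 → Prop, (∀ x ∈ A, P x) → ∀ᵐ x ∂(μ.restrict A), P x := fun P hP =>
    (ae_restrict_iff' hA).2 (Filter.Eventually.of_forall hP)
  -- Measurability of the derivatives is inherited from that of J, as they are limits of difference
  -- quotients.
  have hlim : ∀ (F F' : ℝ → E3 → ℝ) (t : ℝ), (∀ x ∈ A, HasDerivAt (fun s => F s x) (F' t x) t) →
      (∀ᶠ s in nhds t, AEStronglyMeasurable (F s) (μ.restrict A)) →
      AEStronglyMeasurable (F' t) (μ.restrict A) := by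
    intro F F' t hd hF
    obtain ⟨η, hη, hFη⟩ := Metric.eventually_nhds_iff_ball.1 hF
    have hseq : Tendsto (fun k : ℕ => η / 2 * (1 / ((k : ℝ) + 1))) atTop
        (𝓝[>] 0) := by
      refine tendsto_nhdsWithin_iff.2 ⟨?_, Filter.Eventually.of_forall fun k => ?_⟩
      · simpa using (tendsto_one_div_add_atTop_nhds_zero_nat (𝕜 := ℝ)).const_mul (η / 2)
      · exact Set.mem_Ioi.2 (by positivity)
    refine aestronglyMeasurable_of_tendsto_ae atTop
      (f := fun k : ℕ => fun x => (η / 2 * (1 / ((k : ℝ) + 1)))⁻¹ •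
        (F (t + η / 2 * (1 / ((k : ℝ) + 1))) x - F t x)) (fun k => ?_) ?_
    · have hk : t + η / 2 * (1 / ((k : ℝ) + 1)) ∈ ball t η := by
        rw [Metric.mem_ball, Real.dist_eq, add_sub_cancel_left, abs_of_pos (by positivity)]
        have : 1 / ((k : ℝ) + 1) ≤ 1 := by
          rw [div_le_one (by positivity)]; linarith [(Nat.cast_nonneg k : (0 : ℝ) ≤ k)]
        nlinarith
      exact AEStronglyMeasurable.const_smul
        ((hFη _ hk).sub (hFη t (mem_ball_self hη))) ((η / 2 * (1 / ((k : ℝ) + 1)))⁻¹ : ℝ)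
    · exact hae _ fun x hx => ((hd x hx).tendsto_slope_zero_right).comp hseq
  have hball : ∀ t ∈ ball (0 : ℝ) δ, ball (0 : ℝ) δ ∈ nhds t := fun t ht =>
    isOpen_ball.mem_nhds ht
  have hm1 : ∀ t ∈ ball (0 : ℝ) δ, AEStronglyMeasurable (J1 t) (μ.restrict A) :=
    fun t ht => hlim J J1 t (fun x hx => h1 x hx t ht) (Filter.Eventually.of_forall hm)
  have h0 : (0 : ℝ) ∈ ball (0 : ℝ) δ := mem_ball_self hδ
  refine ⟨?_, ?_⟩
  · filter_upwards [ball_mem_nhds (0 : ℝ) hδ] with t ht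
    exact (hasDerivAt_integral_of_dominated_loc_of_deriv_le (bound := fun _ => C) (hball t ht)
      (Filter.Eventually.of_forall hm)
      (Integrable.of_bound (hm t) C (hae _ fun x hx => (hb x hx t ht).1)) (hm1 t ht)
      (hae _ fun x hx s hs => (hb x hx s hs).2.1) (integrable_const C)
      (hae _ fun x hx s hs => h1 x hx s hs)).2
  · have hev : ∀ᶠ t in nhds (0 : ℝ), AEStronglyMeasurable (J1 t) (μ.restrict A) := by
      filter_upwards [ball_mem_nhds (0 : ℝ) hδ] with t ht using hm1 t ht
    exact (hasDerivAt_integral_of_dominated_loc_of_deriv_le (bound := fun _ => C) (hball 0 h0)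
      hev (Integrable.of_bound (hm1 0 h0) C (hae _ fun x hx => (hb x hx 0 h0).2.1))
      (hlim J1 J2 0 (fun x hx => h2 x hx 0 h0) hev)
      (hae _ fun x hx s hs => (hb x hx s hs).2.2) (integrable_const C)
      (hae _ fun x hx s hs => h2 x hx s hs)).2

/-- The second variation of area for the flow `ψ` of `X`. -/
lemma second_variation {X : E3 → E3} {ψ : ℝ → E3 → E3} (hX : ContDiff ℝ ∞ X) (hψ : IsFlow X ψ)
    {A K : Set E3} (hA : MeasurableSet A) {μ : Measure E3} (hμ : μ A < ⊤) (hK : IsCompact K)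
    (hAK : A ⊆ K) {N : E3 → E3} (hN : ∀ x ∈ A, ‖N x‖ = 1)
    (hm : ∀ t, AEStronglyMeasurable (fun x => ‖cofv (fderiv ℝ (ψ t) x) (N x)‖) (μ.restrict A)) :
    ∃ I1 : ℝ → ℝ, (∀ᶠ t in nhds (0 : ℝ),
      HasDerivAt (fun t => ∫ x in A, ‖cofv (fderiv ℝ (ψ t) x) (N x)‖ ∂μ) (I1 t) t) ∧
      HasDerivAt I1 (∫ x in A, (qf (fderiv ℝ X x) (N x) +
        sdiv (fderiv ℝ (fun y => fderiv ℝ X y (X y)) x) (N x)) ∂μ) 0 := by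
  let Ψ : ℝ × E3 → E3 := fun z => ψ z.1 z.2
  have hΨ : ContDiff ℝ ∞ Ψ := hψ.smooth
  -- The normal is treated as an independent variable. This makes w jointly smooth, although the
  -- field N may jump between a normal and its opposite.
  let w : ℝ × (E3 × E3) → E3 := fun z => cofv ((fderiv ℝ Ψ (z.1, z.2.1)).comp
    (ContinuousLinearMap.inr ℝ ℝ E3)) z.2.2
  have hfs : ContDiff ℝ ∞ (fderiv ℝ Ψ) := contDiff_iff_contDiffAt.2 fun z =>
    smooth_fderiv hΨ.contDiffAt
  have hw : ContDiff ℝ ∞ w := by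
    refine cofv_smooth (B := fun z : ℝ × (E3 × E3) => (fderiv ℝ Ψ (z.1, z.2.1)).comp
      (ContinuousLinearMap.inr ℝ ℝ E3)) (n := fun z => z.2.2) ?_ (by fun_prop)
    exact (hfs.comp (by fun_prop : ContDiff ℝ ∞ fun z : ℝ × (E3 × E3) => (z.1, z.2.1))).clm_comp
      contDiff_const
  have hwe : ∀ t x n, w (t, x, n) = cofv (fderiv ℝ (ψ t) x) n := fun t x n => by
    simp only [w]
    rw [← fderiv_slice hΨ]
  have hψ0 : ψ 0 = id := funext hψ.initial
  let g : ℝ × (E3 × E3) → ℝ := fun z => ‖w z‖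
  have hO : IsOpen {z | w z ≠ 0} := isOpen_ne_fun hw.continuous continuous_const
  have hg : ∀ z ∈ {z | w z ≠ 0}, ContDiffAt ℝ ∞ g z := fun z hz => hw.contDiffAt.norm ℝ hz
  let g1 : ℝ × (E3 × E3) → ℝ := fun z => fderiv ℝ g z (1, 0)
  have hg1 : ∀ z ∈ {z | w z ≠ 0}, ContDiffAt ℝ ∞ g1 z := fun z hz =>
    (smooth_fderiv (hg z hz)).clm_apply contDiffAt_const
  let g2 : ℝ × (E3 × E3) → ℝ := fun z => fderiv ℝ g1 z (1, 0)
  have hg2 : ∀ z ∈ {z | w z ≠ 0}, ContDiffAt ℝ ∞ g2 z := fun z hz =>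
    (smooth_fderiv (hg1 z hz)).clm_apply contDiffAt_const
  have hKs : IsCompact (K ×ˢ Metric.sphere (0 : E3) 1) := hK.prod (isCompact_sphere 0 1)
  -- By compactness w stays nonzero on K times the unit sphere for a uniform time, so its norm is
  -- smooth there and its derivatives are bounded.
  obtain ⟨u, v, hu, hv, h0u, hKv, huv⟩ := generalized_tube_lemma
    (isCompact_singleton (x := (0 : ℝ))) hKs hO (by
      rintro ⟨t, x, n⟩ ⟨ht, hx, hn⟩
      have ht : t = 0 := ht
      change w (t, x, n) ≠ 0
      rw [hwe, ht, hψ0, fderiv_id, cofv_id]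
      intro h
      rw [h] at hn
      simp at hn)
  obtain ⟨δ, hδ, hδu⟩ := Metric.nhds_basis_closedBall.mem_iff.1 (hu.mem_nhds (h0u rfl))
  have hQ : IsCompact (closedBall (0 : ℝ) δ ×ˢ (K ×ˢ Metric.sphere (0 : E3) 1)) :=
    (isCompact_closedBall 0 δ).prod hKs
  have hQO : closedBall (0 : ℝ) δ ×ˢ (K ×ˢ Metric.sphere (0 : E3) 1) ⊆ {z | w z ≠ 0} :=
    (Set.prod_mono hδu hKv).trans huv
  obtain ⟨C0, hC0⟩ := hQ.exists_bound_of_continuousOn (f := g) fun z hz =>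
    (hg z (hQO hz)).continuousAt.continuousWithinAt
  obtain ⟨C1, hC1⟩ := hQ.exists_bound_of_continuousOn (f := g1) fun z hz =>
    (hg1 z (hQO hz)).continuousAt.continuousWithinAt
  obtain ⟨C2, hC2⟩ := hQ.exists_bound_of_continuousOn (f := g2) fun z hz =>
    (hg2 z (hQO hz)).continuousAt.continuousWithinAt
  have hmem : ∀ x ∈ A, ∀ t ∈ ball (0 : ℝ) δ, (t, x, N x) ∈
      closedBall (0 : ℝ) δ ×ˢ (K ×ˢ Metric.sphere (0 : E3) 1) := fun x hx t ht =>
    ⟨Metric.ball_subset_closedBall ht, hAK hx, by rw [mem_sphere_zero_iff_norm]; exact hN x hx⟩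
  have d1 : ∀ x ∈ A, ∀ t ∈ ball (0 : ℝ) δ,
      HasDerivAt (fun s => ‖cofv (fderiv ℝ (ψ s) x) (N x)‖) (g1 (t, x, N x)) t :=
    fun x hx t ht => by
    have h := hasDerivAt_slice ((hg _ (hQO (hmem x hx t ht))).differentiableAt (by simp))
    have e : (fun s => g (s, x, N x)) = fun s => ‖cofv (fderiv ℝ (ψ s) x) (N x)‖ := by
      funext s; simp only [g, hwe]
    rwa [e] at h
  have d2 : ∀ x ∈ A, ∀ t ∈ ball (0 : ℝ) δ,
      HasDerivAt (fun s => g1 (s, x, N x)) (g2 (t, x, N x)) t := fun x hx t ht =>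
    hasDerivAt_slice ((hg1 _ (hQO (hmem x hx t ht))).differentiableAt (by simp))
  obtain ⟨r1, r2⟩ := hasDerivAt_integral_twice (J := fun t x => ‖cofv (fderiv ℝ (ψ t) x) (N x)‖)
    (J1 := fun t x => g1 (t, x, N x)) (J2 := fun t x => g2 (t, x, N x)) hA hμ hδ d1 d2 hm
    (C := max C0 (max C1 C2)) (fun x hx t ht => by
      have h := hmem x hx t ht
      have h0 := hC0 _ h
      simp only [g, hwe] at h0
      exact ⟨h0.trans (le_max_left _ _), (hC1 _ h).trans ((le_max_left _ _).trans
        (le_max_right _ _)), (hC2 _ h).trans ((le_max_right _ _).trans (le_max_right _ _))⟩)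
  refine ⟨_, r1, ?_⟩
  convert r2 using 1
  refine setIntegral_congr_fun hA fun x hx => ?_
  have hball : ball (0 : ℝ) δ ∈ nhds (0 : ℝ) := ball_mem_nhds 0 hδ
  have e1 : deriv (deriv fun t => ‖cofv (fderiv ℝ (ψ t) x) (N x)‖) 0 = g2 (0, x, N x) := by
    have : deriv (fun t => ‖cofv (fderiv ℝ (ψ t) x) (N x)‖) =ᶠ[nhds 0] fun t => g1 (t, x, N x) := by
      filter_upwards [hball] with t ht using (d1 x hx t ht).deriv
    rw [this.deriv_eq]
    exact (d2 x hx 0 (mem_ball_self hδ)).deriv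
  have hΨ1 : ContDiff ℝ ∞ fun z => X (Ψ z) := hX.comp hΨ
  have hXs : ContDiff ℝ ∞ fun y => fderiv ℝ X y (X y) := contDiff_iff_contDiffAt.2 fun z =>
    (smooth_fderiv hX.contDiffAt).clm_apply hX.contDiffAt
  have hΨ2 : ContDiff ℝ ∞ fun z => fderiv ℝ X (Ψ z) (X (Ψ z)) := hXs.comp hΨ
  have b1 := fun t => hasDerivAt_fderiv_slice hΨ hΨ1 (fun t x => hψ.ode t x) t x
  have b2 := hasDerivAt_fderiv_slice hΨ1 hΨ2 (fun t x =>
    ((hX.contDiffAt.differentiableAt (by simp)).hasFDerivAt (x := Ψ (t, x))).comp_hasDerivAt t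
      (hψ.ode t x)) 0 x
  have e2 := deriv2_norm_cofv (hN x hx) (B := fun t => fderiv ℝ (ψ t) x) (by
    simp only [hψ0]; exact fderiv_id) b1 b2
  rw [← e1, e2]
  simp only [Ψ, hψ.initial]

lemma cofv_neg (B : E3 →L[ℝ] E3) (n : E3) : cofv B (-n) = -cofv B n := by
  ext i
  fin_cases i
  · simp only [Fin.zero_eta, cofv_zero, PiLp.neg_apply]; ring
  · simp only [Fin.mk_one, cofv_one, PiLp.neg_apply]; ring
  · simp only [Fin.reduceFinMk, cofv_two, PiLp.neg_apply]; ring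

lemma qf_neg (B : E3 →L[ℝ] E3) (n : E3) : qf B (-n) = qf B n := by
  simp [qf, cofv_neg]

lemma sdiv_neg (B : E3 →L[ℝ] E3) (n : E3) : sdiv B (-n) = sdiv B n := by
  simp [sdiv]

lemma qf_zero (n : E3) : qf 0 n = 0 := by
  simp [qf, inner_three, cofv_zero, cofv_one, cofv_two]

lemma continuous_sdiv {X : E3 → E3} (hX : ContDiff ℝ ∞ X) :
    Continuous fun z : E3 × E3 => sdiv (fderiv ℝ X z.1) z.2 := by
  have h1 : Continuous fun z : E3 × E3 => fderiv ℝ X z.1 :=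
    (hX.continuous_fderiv (by simp)).comp continuous_fst
  unfold sdiv
  refine Continuous.sub ?_ ((h1.clm_apply continuous_snd).inner continuous_snd)
  fun_prop

lemma continuous_cofv {X : E3 → E3} (hX : ContDiff ℝ ∞ X) :
    Continuous fun z : E3 × E3 => cofv (fderiv ℝ X z.1) z.2 := by
  have h1 : ContDiff ℝ ∞ (fderiv ℝ X) := contDiff_iff_contDiffAt.2 fun x =>
    smooth_fderiv hX.contDiffAt
  exact (cofv_smooth (h1.comp contDiff_fst) contDiff_snd).continuous

lemma continuous_qf {X : E3 → E3} (hX : ContDiff ℝ ∞ X) :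
    Continuous fun z : E3 × E3 => qf (fderiv ℝ X z.1) z.2 := by
  have h1 : Continuous fun z : E3 × E3 => fderiv ℝ X z.1 :=
    (hX.continuous_fderiv (by simp)).comp continuous_fst
  unfold qf
  refine ((continuous_finsetSum _ fun j _ => ?_).sub ?_).add
    (continuous_const.mul ((continuous_cofv hX).inner continuous_snd))
  · exact ((h1.clm_apply continuous_const).inner continuous_snd).pow 2
  · exact ((h1.clm_apply continuous_snd).inner continuous_snd).pow 2

/-- `N` is a field of unit normals of the planes `P` along `T`, continuous up to sign. -/
structure IsNormalField (T : Set E3) (P : E3 → Submodule ℝ E3) (N : E3 → E3) : Prop where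
  unit : ∀ x ∈ T, ‖N x‖ = 1
  plane : ∀ x ∈ T, P x = (ℝ ∙ (N x))ᗮ
  continuousOn : ∀ H : E3 × E3 → ℝ, Continuous H → (∀ x n, H (x, -n) = H (x, n)) →
    ContinuousOn (fun x => H (x, N x)) T

/-- Near each point N agrees up to sign with a smooth normal, and even functions do not notice the
sign. A pointwise choice of N therefore suffices. -/
lemma IsPuncturedSurface.isNormalField (hS : IsPuncturedSurface S) {N : E3 → E3}
    (h1 : ∀ x ∈ S, ‖N x‖ = 1) (h2 : ∀ x ∈ S, tangentPlane S x = (ℝ ∙ (N x))ᗮ) :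
    IsNormalField S (tangentPlane S) N := by
  refine ⟨h1, h2, fun H hH he p hp => ?_⟩
  obtain ⟨n, hn⟩ := hS.exists_normal hp
  have key : ∀ x ∈ S, ‖n x‖ = 1 → tangentPlane S x = (ℝ ∙ (n x))ᗮ →
      H (x, N x) = H (x, n x) := fun x hx e1 e2 => by
    rcases eq_or_eq_neg_of_orthogonal_le (h1 x hx) e1 ((h2 x hx).symm.trans e2).le with h | h
    · rw [h]
    · rw [h, he]
  have h3 : ContinuousAt (fun x => H (x, n x)) p :=
    hH.continuousAt.comp (continuousAt_id.prodMk hn.smooth.self_of_nhds.continuousAt)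
  refine h3.continuousWithinAt.congr_of_eventuallyEq ?_
    (key p hp hn.unit.self_of_nhds (hn.plane.self_of_nhds hp))
  filter_upwards [mem_nhdsWithin_of_mem_nhds (hn.unit.and hn.plane), self_mem_nhdsWithin]
    with x hx hxS using key x hxS hx.1 (hx.2 hxS)

lemma isNormalField_wall (G : Set E3) :
    IsNormalField G (fun _ => wallPlane) (fun _ => bv 0) :=
  ⟨fun _ _ => norm_bv 0, fun _ _ => wallPlane_eq, fun _ hH _ =>
    (hH.comp (continuous_id.prodMk continuous_const)).continuousOn⟩

lemma IsNormalField.integrableOn {T : Set E3} {P : E3 → Submodule ℝ E3} {N : E3 → E3}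
    (hN : IsNormalField T P N) (hT : IsPuncturedSurface T) (hfin : HasLocFiniteArea T) {X : E3 → E3}
    (hX : IsTestField X) {H : E3 × E3 → ℝ} (hH : Continuous H) (he : ∀ x n, H (x, -n) = H (x, n))
    (h0 : ∀ x ∉ tsupport X, ∀ n, H (x, n) = 0) : IntegrableOn (fun x => H (x, N x)) T μHE[2] :=
  integrableOn_of_support hT hfin hX.compact hX.zero_notMem
    ((hN.continuousOn H hH he).mono Set.inter_subset_left) fun x _ hx => h0 x hx _

lemma IsNormalField.integrableOn_sdiv {T : Set E3} {P : E3 → Submodule ℝ E3} {N : E3 → E3}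
    (hN : IsNormalField T P N) (hT : IsPuncturedSurface T) (hfin : HasLocFiniteArea T) {X : E3 → E3}
    (hX : IsTestField X) : IntegrableOn (fun x => sdiv (fderiv ℝ X x) (N x)) T μHE[2] :=
  hN.integrableOn hT hfin hX (continuous_sdiv hX.smooth) (fun x n => sdiv_neg _ n) fun x hx n => by
    rw [fderiv_zero_of_notMem_tsupport hx, sdiv_zero]

lemma IsNormalField.integrableOn_qf {T : Set E3} {P : E3 → Submodule ℝ E3} {N : E3 → E3}
    (hN : IsNormalField T P N) (hT : IsPuncturedSurface T) (hfin : HasLocFiniteArea T) {X : E3 → E3}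
    (hX : IsTestField X) : IntegrableOn (fun x => qf (fderiv ℝ X x) (N x)) T μHE[2] :=
  hN.integrableOn hT hfin hX (continuous_qf hX.smooth) (fun x n => qf_neg _ n) fun x hx n => by
    rw [fderiv_zero_of_notMem_tsupport hx, qf_zero]

lemma IsNormalField.integral_tangentialDiv {T : Set E3} {P : E3 → Submodule ℝ E3} {N : E3 → E3}
    (hN : IsNormalField T P N) (hT : IsPuncturedSurface T) (X : E3 → E3) :
    ∫ x in T, tangentialDiv (P x) X x ∂μHE[2] = ∫ x in T, sdiv (fderiv ℝ X x) (N x) ∂μHE[2] :=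
  setIntegral_congr_fun hT.measurableSet fun x hx =>
    tangentialDiv_eq (hN.unit x hx) (hN.plane x hx) X x

/-- The acceleration of the flow of a test field is a test field. -/
lemma IsTestField.acceleration {X : E3 → E3} (hX : IsTestField X) :
    IsTestField (fun x => fderiv ℝ X x (X x)) ∧
      tsupport (fun x => fderiv ℝ X x (X x)) ⊆ tsupport X := by
  have hs : tsupport (fun x => fderiv ℝ X x (X x)) ⊆ tsupport X :=
    closure_mono fun x hx h0 => hx (by simp [h0])
  refine ⟨⟨?_, hX.compact.of_isClosed_subset (isClosed_tsupport _) hs,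
    fun h => hX.zero_notMem (hs h), fun x hx => ?_⟩, hs⟩
  · exact contDiff_iff_contDiffAt.2 fun x =>
      (smooth_fderiv hX.smooth.contDiffAt).clm_apply hX.smooth.contDiffAt
  · have hXd : DifferentiableAt ℝ X x := hX.smooth.contDiffAt.differentiableAt (by simp)
    have ht : ∀ y ∈ wall, X y 0 = 0 := hX.tangent
    have h0 : ∀ j : Fin 3, j ≠ 0 → fderiv ℝ X x (bv j) 0 = 0 := fun j hj => by
      rw [← fderiv_coord hXd, fderiv_eq_of_wall (g := fun _ => (0 : ℝ)) hx _
        (differentiableAt_const _) ht hj]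
      · simp
      · exact (coordL 0).differentiableAt.comp x hXd
    have hX0 : X x 0 = 0 := hX.tangent x hx
    rw [mem_wallPlane, map_apply_three, h0 1 (by decide), h0 2 (by decide), hX0]
    simp

/-- The second derivative splits into a quadratic term in DX and the first variation along the
acceleration DX X of the flow; stationarity later removes the second part. -/
lemma IsNormalField.second_variation {T : Set E3} {P : E3 → Submodule ℝ E3} {N : E3 → E3}
    (hN : IsNormalField T P N) (hT : IsPuncturedSurface T) (hfin : HasLocFiniteArea T) {X : E3 → E3}
    (hX : IsTestField X) {ψ : ℝ → E3 → E3} (hψ : IsFlow X ψ) :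
    ∃ I1 : ℝ → ℝ, (∀ᶠ t in nhds (0 : ℝ), HasDerivAt
      (fun t => ∫ x in T ∩ tsupport X, jacobianAlong (P x) (ψ t) x ∂μHE[2]) (I1 t) t) ∧
      HasDerivAt I1 ((∫ x in T, qf (fderiv ℝ X x) (N x) ∂μHE[2]) +
        ∫ x in T, tangentialDiv (P x) (fun y => fderiv ℝ X y (X y)) x ∂μHE[2]) 0 := by
  have hA : MeasurableSet (T ∩ tsupport X) :=
    hT.measurableSet.inter (isClosed_tsupport X).measurableSet
  have hsm : ∀ t, ContDiff ℝ ∞ (ψ t) := fun t =>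
    hψ.smooth.comp (contDiff_const.prodMk contDiff_id)
  obtain ⟨I1, h1, h2⟩ := Capillary.second_variation hX.smooth hψ (A := T ∩ tsupport X)
    (K := tsupport X) (μ := μHE[2]) (N := N) hA (hfin _ hX.compact) hX.compact
    Set.inter_subset_right (fun x hx => hN.unit x hx.1) (fun t => by
      refine ContinuousOn.aestronglyMeasurable ?_ hA
      exact (hN.continuousOn (fun z => ‖cofv (fderiv ℝ (ψ t) z.1) z.2‖)
        (continuous_cofv (hsm t)).norm (fun x n => by rw [cofv_neg, norm_neg])).mono
        Set.inter_subset_left)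
  obtain ⟨hY, hYX⟩ := hX.acceleration
  refine ⟨I1, ?_, ?_⟩
  · have h3 : (fun t => ∫ x in T ∩ tsupport X, jacobianAlong (P x) (ψ t) x ∂μHE[2]) =
        fun t => ∫ x in T ∩ tsupport X, ‖cofv (fderiv ℝ (ψ t) x) (N x)‖ ∂μHE[2] := by
      funext t
      exact setIntegral_congr_fun hA fun x hx =>
        jacobianAlong_eq (hN.unit x hx.1) (hN.plane x hx.1) (ψ t) x
    rw [h3]
    exact h1
  · refine h2.congr_deriv ?_
    rw [hN.integral_tangentialDiv hT, ← integral_add (hN.integrableOn_qf hT hfin hX)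
      (hN.integrableOn_sdiv hT hfin hY)]
    refine (setIntegral_eq_of_subset_of_forall_sdiff_eq_zero hT.measurableSet
      Set.inter_subset_left fun x hx => ?_).symm
    have hx' : x ∉ tsupport X := fun h => hx.2 ⟨hx.1, h⟩
    rw [fderiv_zero_of_notMem_tsupport hx', qf_zero,
      fderiv_zero_of_notMem_tsupport (fun h => hx' (hYX h)), sdiv_zero, add_zero]

/-! ### Stability and the curvature inequality -/

/-- Stability, with the second order terms removed by stationarity. -/
lemma IsStable.integral_nonneg (hpair : IsSurfacePair S G)
    (hstat : IsStationary a S G) (hstab : IsStable a S G) (hfin : HasLocFiniteArea S)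
    {N : E3 → E3} (hN : IsNormalField S (tangentPlane S) N) {X Z : E3 → E3} (hX : IsTestField X)
    (hZ : IsTestField Z) (hZw : ∀ x ∈ wall, Z x = wallField X x) :
    0 ≤ ∫ x in S, (qf (fderiv ℝ X x) (N x) - sdiv (fderiv ℝ Z x) (N x)) ∂μHE[2] := by
  have hS := hpair.surface_left
  have hG := hpair.surface_right
  have hfinG := hasLocFiniteArea_of_subset_wall hpair.right_subset
  have hNG := isNormalField_wall G
  obtain ⟨ψ, hψ, h0⟩ := hstab X hX
  obtain ⟨I1, a1, a2⟩ := hN.second_variation hS hfin hX hψ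
  obtain ⟨J1, b1, b2⟩ := hNG.second_variation hG hfinG hX hψ
  obtain ⟨hY, -⟩ := hX.acceleration
  have hder : iteratedDeriv 2 (fun t => pushedEnergy a S G (tsupport X) (ψ t)) 0 =
      ((∫ x in S, qf (fderiv ℝ X x) (N x) ∂μHE[2]) +
        ∫ x in S, tangentialDiv (tangentPlane S x) (fun y => fderiv ℝ X y (X y)) x ∂μHE[2]) +
      a * ((∫ x in G, qf (fderiv ℝ X x) (bv 0) ∂μHE[2]) +
        ∫ x in G, tangentialDiv wallPlane (fun y => fderiv ℝ X y (X y)) x ∂μHE[2]) := by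
    rw [iteratedDeriv_succ, iteratedDeriv_one]
    have h1 : deriv (fun t => pushedEnergy a S G (tsupport X) (ψ t)) =ᶠ[nhds 0]
        fun t => I1 t + a * J1 t := by
      filter_upwards [a1, b1] with t t1 t2
      exact (t1.add (t2.const_mul a)).deriv
    rw [h1.deriv_eq]
    exact (a2.add (b2.const_mul a)).deriv
  rw [hder] at h0
  have h1 := hstat _ hY
  have h2 := hstat _ hZ
  unfold firstVariation at h1 h2
  rw [hN.integral_tangentialDiv hS, hNG.integral_tangentialDiv hG] at h2
  -- On the wall the integrand vanishes pointwise by the choice of Z. Stationarity along Z therefore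
  -- trades the quadratic term on G for the divergence of Z on S.
  have h3 : ∫ x in G, (qf (fderiv ℝ X x) (bv 0) - sdiv (fderiv ℝ Z x) (bv 0)) ∂μHE[2] = 0 :=
    setIntegral_eq_zero_of_forall_eq_zero fun x hx =>
      wall_integrand (hpair.right_subset hx) hX.smooth hZ.smooth hX.tangent hZw
  rw [integral_sub (hNG.integrableOn_qf hG hfinG hX) (hNG.integrableOn_sdiv hG hfinG hZ)] at h3
  rw [integral_sub (hN.integrableOn_qf hS hfin hX) (hN.integrableOn_sdiv hS hfin hZ)]
  linear_combination h0 + h1 + h2 + a * h3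

open Classical in
/-- The squared norm of the second fundamental form on the sheet, extended by zero. -/
def curv (S : Set E3) (ν : E3 → E3) (x : E3) : ℝ :=
  if h : x ∈ sheet S ∧ ∃ n, Adapted S ν n x then
    sff (fderiv ℝ h.2.choose x) (h.2.choose x) else 0

/-- Two adapted normals agree on S, hence so do their tangential derivatives; the choice in the
definition is immaterial. -/
lemma curv_eq {ν n : E3 → E3} {x : E3} (hx : x ∈ sheet S) (hn : Adapted S ν n x) :
    curv S ν x = sff (fderiv ℝ n x) (n x) := by
  have h : x ∈ sheet S ∧ ∃ n, Adapted S ν n x := ⟨hx, n, hn⟩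
  rw [curv, dif_pos h]
  have hm := h.2.choose_spec
  rw [hm.eq hn hx.1]
  exact sff_eq_of_eqOn_plane hn.1.unit.self_of_nhds fun ξ hξ =>
    hm.fderiv_eq hn hx.1 (by
      rw [hm.eq hn hx.1]
      exact mem_perp_iff.1 hξ)

lemma curv_of_notMem {x : E3} (hx : x ∉ sheet S) : curv S ν x = 0 := by
  rw [curv, dif_neg fun h => hx h.1]

lemma curv_nonneg (S : Set E3) (ν : E3 → E3) (x : E3) : 0 ≤ curv S ν x := by
  rw [curv]
  split_ifs
  · exact sff_nonneg _ _
  · exact le_rfl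

/-- The extension by zero is continuous because the sheet is open and closed in S. -/
lemma curv_continuousOn (hpair : IsSurfacePair S G)
    (hstat : IsStationary a S G) (hfin : HasLocFiniteArea S)
    (hν : IsOrientation a S ν) : ContinuousOn (curv S ν) S := by
  intro p hp
  by_cases hps : p ∈ sheet S
  · obtain ⟨n, hn⟩ := hν.adapted p hps
    have hs := hn.1.smooth.self_of_nhds
    have h1 : ContinuousAt (fderiv ℝ n) p := (smooth_fderiv hs).continuousAt
    have hnc : ContinuousAt n p := hs.continuousAt
    have h2 : ContinuousAt (fun x => sff (fderiv ℝ n x) (n x)) p := by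
      have hj : ∀ j, ContinuousAt (fun x => ‖fderiv ℝ n x (bv j - n x j • n x)‖ ^ 2) p := fun j => by
        have e0 : ContinuousAt (fun x => n x j) p :=
          (EuclideanSpace.proj (𝕜 := ℝ) j).continuous.continuousAt.comp hnc
        have e1 : ContinuousAt (fun x => bv j - n x j • n x) p :=
          (continuousAt_const (y := bv j)).sub (e0.smul hnc)
        exact ((h1.clm_apply e1).norm).pow 2
      exact tendsto_finsetSum _ fun j _ => hj j
    refine h2.continuousWithinAt.congr_of_eventuallyEq ?_ (curv_eq hps hn)
    filter_upwards [mem_nhdsWithin_of_mem_nhds (hν.sheet_open p hps),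
      mem_nhdsWithin_of_mem_nhds hn.eventually, self_mem_nhdsWithin] with x e1 e2 hx
      using curv_eq (e1 hx) e2
  · refine (continuousWithinAt_const (b := (0 : ℝ))).congr_of_eventuallyEq ?_ (curv_of_notMem hps)
    filter_upwards [mem_nhdsWithin_of_mem_nhds (eventually_notMem_sheet hpair hstat hfin hp hps),
      self_mem_nhdsWithin] with x e1 hx using curv_of_notMem (e1 hx).2

/-- The integrand vanishes at interior contact points. -/
lemma contact_integrand {X Z : E3 → E3} {n : E3} (hp : p ∈ S)
    (hX : ContDiff ℝ ∞ X) (hZ : ContDiff ℝ ∞ Z) (hXS : ∀ᶠ x in nhds p, x ∈ S → X x = 0)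
    (hZS : ∀ᶠ x in nhds p, x ∈ S → Z x = 0) (hn : ‖n‖ = 1) (hT : tangentPlane S p = (ℝ ∙ n)ᗮ) :
    qf (fderiv ℝ X p) n - sdiv (fderiv ℝ Z p) n = 0 := by
  have hnn : inner ℝ n n = (1 : ℝ) := by rw [real_inner_self_eq_norm_sq, hn]; norm_num
  have key : ∀ W : E3 → E3, ContDiff ℝ ∞ W → (∀ᶠ x in nhds p, x ∈ S → W x = 0) →
      ∀ ξ, fderiv ℝ W p ξ = inner ℝ n ξ • fderiv ℝ W p n := fun W hW hWS ξ => by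
    have h1 : ξ - inner ℝ n ξ • n ∈ tangentPlane S p := by
      rw [hT, mem_perp_iff, inner_sub_right n ξ,
        inner_smul_right, hnn]
      ring
    have h2 := fderiv_eq_of_eqOn (g := fun _ => (0 : E3)) hp
      (hW.contDiffAt.differentiableAt (by simp)) (differentiableAt_const _) hWS h1
    rw [map_sub, map_smul] at h2
    rw [← sub_eq_zero, h2]
    simp
  have hn2 : n 0 ^ 2 + n 1 ^ 2 + n 2 ^ 2 = 1 := by rw [← norm_sq_three, hn]; norm_num
  have e1 : ∀ (W : E3 → E3) (i j : Fin 3), (∀ ξ, fderiv ℝ W p ξ = inner ℝ n ξ • fderiv ℝ W p n) →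
      fderiv ℝ W p (bv i) j = n i * fderiv ℝ W p n j := fun W i j h => by
    rw [h (bv i), inner_bv_right]; simp
  have hq : qf (fderiv ℝ X p) n = 0 := by
    have h := fun i j => e1 X i j (key X hX hXS)
    simp only [qf, inner_three, Fin.sum_univ_three, cofv_zero, cofv_one, cofv_two, h]
    linear_combination (fderiv ℝ X p n 0 * n 0 + fderiv ℝ X p n 1 * n 1 +
      fderiv ℝ X p n 2 * n 2) ^ 2 * hn2
  have hd : sdiv (fderiv ℝ Z p) n = 0 := by
    have h := fun i j => e1 Z i j (key Z hZ hZS)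
    simp only [sdiv, inner_three, h]
    ring
  rw [hq, hd, sub_zero]

/-- The stability inequality. -/
theorem stability_inequality (ha₀ : 0 ≤ a) (ha₁ : a < 1)
    (hpair : IsSurfacePair S G) (hstat : IsStationary a S G) (hstab : IsStable a S G)
    (hfin : HasLocFiniteArea S) (hν : IsOrientation a S ν) {φ : E3 → ℝ} {ρ R : ℝ}
    (hρ : 0 < ρ) (hφ : ContDiff ℝ ∞ φ) (hsupp : ∀ x ∈ tsupport φ, ρ < ‖x‖ ∧ ‖x‖ < R) :
    (1 - a) * ∫ x in S, φ x ^ 2 * curv S ν x ∂μHE[2] ≤ 4 * ∫ x in S, ‖grd φ x‖ ^ 2 ∂μHE[2] := by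
  have ha : a ^ 2 < 1 := by nlinarith
  have hS := hpair.surface_left
  obtain ⟨V, hV⟩ := exists_extension ha hpair hstat hfin hν hρ
  obtain ⟨Z, hZ⟩ := exists_correction ha hpair hstat hfin hν hρ hV hφ hsupp
  have hφ0 : (0 : E3) ∉ tsupport φ := fun h => by
    have := (hsupp 0 h).1
    rw [norm_zero] at this; linarith
  have hφc : HasCompactSupport φ := HasCompactSupport.of_support_subset_isCompact
    (isCompact_closedBall (0 : E3) R) fun x hx => by
      rw [mem_closedBall_zero_iff]; exact (hsupp x (subset_tsupport φ hx)).2.le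
  set X : E3 → E3 := fun x => φ x • V x with hX
  have hXs : ContDiff ℝ ∞ X := hφ.smul hV.smooth
  have hXt : IsTestField X := isTestField_smul hφ hφc hφ0 (fun x _ => hV.smooth.contDiffAt)
    fun x hx _ => hV.wall x hx
  -- Unit normals are chosen pointwise, since the oriented one is missing at interior contact
  -- points. The integrands are even in the normal.
  have hNex : ∀ x, ∃ v : E3, x ∈ S → ‖v‖ = 1 ∧ tangentPlane S x = (ℝ ∙ v)ᗮ :=
    fun x => by
    by_cases hx : x ∈ S
    · obtain ⟨n, hn⟩ := hS.exists_normal hx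
      exact ⟨n x, fun _ => ⟨hn.unit.self_of_nhds, hn.plane.self_of_nhds hx⟩⟩
    · exact ⟨0, fun h => absurd h hx⟩
  choose N hN using hNex
  have hNF : IsNormalField S (tangentPlane S) N :=
    hS.isNormalField (fun x hx => (hN x hx).1) fun x hx => (hN x hx).2
  have h0 := hstab.integral_nonneg hpair hstat hfin hNF hXt hZ.test hZ.wall
  have hloc : ∀ p ∈ S, p ∈ tsupport φ → ∀ᶠ x in nhds p, ρ < ‖x‖ := fun p hp hpφ =>
    continuous_norm.continuousAt.eventually (lt_mem_nhds (hsupp p hpφ).1)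
  have hpt : ∀ p ∈ S, qf (fderiv ℝ X p) (N p) - sdiv (fderiv ℝ Z p) (N p) ≤
      4 * ‖grd φ p‖ ^ 2 - (1 - a) * (φ p ^ 2 * curv S ν p) := by
    intro p hp
    by_cases hps : p ∈ sheet S
    · obtain ⟨n, hn⟩ := hν.adapted p hps
      have hnp := hn.1.unit.self_of_nhds
      have hNn : qf (fderiv ℝ X p) (N p) - sdiv (fderiv ℝ Z p) (N p) =
          qf (fderiv ℝ X p) (n p) - sdiv (fderiv ℝ Z p) (n p) := by
        rcases eq_or_eq_neg_of_orthogonal_le (hN p hp).1 hnp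
          ((hN p hp).2.symm.trans (hn.1.plane.self_of_nhds hp)).le with h | h
        · rw [h]
        · rw [h, qf_neg, sdiv_neg]
      by_cases hpφ : p ∈ tsupport φ
      · have h1 := surface_integrand (a := a) (Z := Z) (ψ := streamFun a φ V) hp
          (hn.1.minimal hpair hstat hfin)
          hφ.contDiffAt (streamFun_contDiff hφ hV.smooth).contDiffAt hV.smooth.contDiffAt
          hZ.test.smooth.contDiffAt (by
            filter_upwards [hn.2, hν.sheet_open p hps, hloc p hp hpφ] with x e1 e2 e3 hx
            rw [hV.sheet x (e2 hx) (le_of_lt e3), e1 hx]) (by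
            filter_upwards [hn.eventually, hν.sheet_open p hps] with x e1 e2 hx
            exact hZ.sheet x (e2 hx) n e1)
        rw [hNn]
        refine h1.le.trans ?_
        rw [curv_eq hps hn]
        have hn0 : |n p 0| ≤ 1 := by rw [← hnp]; exact PiLp.norm_apply_le (n p) 0
        obtain ⟨l1, l2⟩ := abs_le.1 hn0
        -- From |ν₁| ≤ 1 and a ≥ 0 the weight lies between 1 − a and 2; the lower bound is positive
        -- because a < 1.
        have u1 : 1 - a ≤ 1 + a * n p 0 := by nlinarith
        have u2 : 1 + a * n p 0 ≤ 2 := by nlinarith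
        have k1 := mul_le_mul_of_nonneg_right u1
          (mul_nonneg (sq_nonneg (φ p)) (sff_nonneg (fderiv ℝ n p) (n p)))
        have u3 : (1 + a * n p 0) ^ 2 ≤ 4 := by nlinarith
        have g1 : ‖grd φ p‖ ^ 2 - (inner ℝ (grd φ p) (n p)) ^ 2 ≤ ‖grd φ p‖ ^ 2 := by
          linarith [sq_nonneg (inner ℝ (grd φ p) (n p))]
        have k2 := mul_le_mul_of_nonneg_left g1 (sq_nonneg (1 + a * n p 0))
        have k3 := mul_le_mul_of_nonneg_right u3 (sq_nonneg ‖grd φ p‖)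
        linarith
      · have hz : ∀ᶠ x in nhds p, x ∉ tsupport φ :=
          (isClosed_tsupport φ).isOpen_compl.mem_nhds hpφ
        -- Off the support of φ the field V need not be ν + a e₁ along S. Since φ = 0 near p, it may
        -- be replaced by n + a e₁ without changing the product.
        have h1 := surface_integrand (a := a) (Z := Z) (ψ := streamFun a φ V)
          (V := fun x => n x + a • bv 0) hp (hn.1.minimal hpair hstat hfin)
          hφ.contDiffAt (streamFun_contDiff hφ hV.smooth).contDiffAt
          (hn.1.smooth.self_of_nhds.add contDiffAt_const)
          hZ.test.smooth.contDiffAt (Filter.Eventually.of_forall fun x _ => rfl) (by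
            filter_upwards [hn.eventually, hν.sheet_open p hps] with x e1 e2 hx
            exact hZ.sheet x (e2 hx) n e1)
        have h2 : fderiv ℝ (fun x => φ x • (n x + a • bv 0)) p = fderiv ℝ X p := by
          refine Filter.EventuallyEq.fderiv_eq ?_
          filter_upwards [hz] with x hx
          simp [hX, image_eq_zero_of_notMem_tsupport hx]
        rw [h2] at h1
        have h3 : grd φ p = 0 := by
          ext i
          rw [grd_apply, show fderiv ℝ φ p = 0 from by
            by_contra h; exact hpφ (support_fderiv_subset ℝ h)]
          simp
        rw [hNn, h1, h3, image_eq_zero_of_notMem_tsupport hpφ]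
        simp
    · have hc := eventually_notMem_sheet hpair hstat hfin hp hps
      -- At interior contact points both fields vanish along S, so nothing is contributed there.
      have hX0 : ∀ᶠ x in nhds p, x ∈ S → X x = 0 := by
        filter_upwards [hc] with x hx hxS
        by_cases hxφ : x ∈ tsupport φ
        · simp [hX, hV.contact x hxS (hx hxS).2 (hsupp x hxφ).1.le]
        · simp [hX, image_eq_zero_of_notMem_tsupport hxφ]
      have hZ0 : ∀ᶠ x in nhds p, x ∈ S → Z x = 0 := by
        filter_upwards [hc, hX0] with x hx hX0 hxS
        have hw : x ∈ wall := (hx hxS).1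
        rw [hZ.wall x hw]
        change wallField X x = 0
        rw [wallField, hX0 hxS]
        simp
      rw [contact_integrand hp hXs hZ.test.smooth hX0 hZ0 (hN p hp).1 (hN p hp).2,
        curv_of_notMem hps]
      simp
  have i1 : IntegrableOn (fun x => ‖grd φ x‖ ^ 2) S μHE[2] := by
    refine integrableOn_of_support hS hfin hφc hφ0 (Continuous.continuousOn ?_) fun x _ hx => ?_
    · exact (contDiff_iff_contDiffAt.2 fun x => grd_smooth hφ.contDiffAt).continuous.norm.pow 2
    · have h3 : grd φ x = 0 := by
        ext i
        rw [grd_apply, show fderiv ℝ φ x = 0 from by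
          by_contra h; exact hx (support_fderiv_subset ℝ h)]
        simp
      rw [h3]; simp
  have i2 : IntegrableOn (fun x => φ x ^ 2 * curv S ν x) S μHE[2] := by
    refine integrableOn_of_support hS hfin hφc hφ0 ?_ fun x _ hx => ?_
    · exact ((hφ.continuous.pow 2).continuousOn.mul
        ((curv_continuousOn hpair hstat hfin hν).mono Set.inter_subset_left))
    · rw [image_eq_zero_of_notMem_tsupport hx]; simp
  have i3 := (hNF.integrableOn_qf hS hfin hXt).sub (hNF.integrableOn_sdiv hS hfin hZ.test)
  have h1 := h0.trans (setIntegral_mono_on i3 ((i1.const_mul 4).sub (i2.const_mul (1 - a)))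
    hS.measurableSet hpt)
  simp only [Pi.sub_apply] at h1
  rw [integral_sub (i1.const_mul 4) (i2.const_mul (1 - a)), integral_const_mul,
    integral_const_mul] at h1
  linarith

/-! ### The logarithmic cutoff and vanishing of the curvature -/

open Classical in
/-- The logarithmic cutoff at the scale `L`. -/
def logCut (L : ℝ) (x : E3) : ℝ :=
  if x = 0 then 0 else cutf ((Real.log (‖x‖ ^ 2) / L) ^ 2 - 1)

lemma logCut_of_ne (L : ℝ) {x : E3} (hx : x ≠ 0) :
    logCut L x = cutf ((Real.log (‖x‖ ^ 2) / L) ^ 2 - 1) := if_neg hx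

lemma logCut_eventuallyEq (L : ℝ) {x : E3} (hx : x ≠ 0) :
    logCut L =ᶠ[nhds x] fun y => cutf ((Real.log (‖y‖ ^ 2) / L) ^ 2 - 1) := by
  filter_upwards [isOpen_ne.mem_nhds hx] with y hy using logCut_of_ne L hy

lemma one_le_of_two_mul_le {L t : ℝ} (hL : 0 < L) (h : 2 * L ≤ |t|) : 1 ≤ (t / L) ^ 2 - 1 := by
  have h1 : 2 ≤ |t / L| := by rwa [abs_div, abs_of_pos hL, le_div_iff₀ hL]
  have h2 := sq_abs (t / L)
  nlinarith

lemma logCut_eq_zero {L : ℝ} (hL : 0 < L) {x : E3} (h : 2 * L ≤ |Real.log (‖x‖ ^ 2)|) :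
    logCut L x = 0 := by
  by_cases hx : x = 0
  · exact if_pos hx
  · rw [logCut_of_ne L hx, cutf_of_one_le (one_le_of_two_mul_le hL h)]

lemma logCut_eq_one {L : ℝ} (hL : 0 < L) {x : E3} (hx : x ≠ 0) (h : |Real.log (‖x‖ ^ 2)| ≤ L) :
    logCut L x = 1 := by
  rw [logCut_of_ne L hx, cutf_of_nonpos]
  have h1 : |Real.log (‖x‖ ^ 2) / L| ≤ 1 := by rwa [abs_div, abs_of_pos hL, div_le_one hL]
  have h2 := (sq_le_one_iff_abs_le_one _).2 h1
  linarith

lemma logCut_tsupport {L : ℝ} (hL : 0 < L) {x : E3} (hx : x ∈ tsupport (logCut L)) :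
    Real.exp (-L) ≤ ‖x‖ ∧ ‖x‖ ≤ Real.exp L := by
  have hc : IsClosed {x : E3 | Real.exp (-L) ≤ ‖x‖ ∧ ‖x‖ ≤ Real.exp L} :=
    (isClosed_le continuous_const continuous_norm).inter
      (isClosed_le continuous_norm continuous_const)
  refine closure_minimal (fun y hy => ?_) hc hx
  have hy0 : y ≠ 0 := fun h => hy (if_pos h)
  have h1 : |Real.log (‖y‖ ^ 2)| < 2 * L := by
    by_contra! h
    exact hy (logCut_eq_zero hL h)
  rw [Real.log_pow, abs_lt] at h1
  push_cast at h1
  have hp := norm_pos_iff.2 hy0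
  exact ⟨(Real.le_log_iff_exp_le hp).1 (by linarith), (Real.log_le_iff_le_exp hp).1 (by linarith)⟩

lemma contDiffAt_log_norm_sq {x : E3} (hx : x ≠ 0) :
    ContDiffAt ℝ ∞ (fun y : E3 => Real.log (‖y‖ ^ 2)) x :=
  (contDiff_norm_sq ℝ).contDiffAt.log (by simpa using hx)

lemma logCut_contDiff {L : ℝ} (hL : 0 < L) : ContDiff ℝ ∞ (logCut L) := by
  refine contDiff_iff_contDiffAt.2 fun x => ?_
  by_cases hx : x ∈ tsupport (logCut L)
  · have hx0 : x ≠ 0 := norm_pos_iff.1 ((Real.exp_pos _).trans_le (logCut_tsupport hL hx).1)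
    refine ContDiffAt.congr_of_eventuallyEq ?_ (logCut_eventuallyEq L hx0)
    exact cutf_contDiff.contDiffAt.comp x
      ((((contDiffAt_log_norm_sq hx0).div_const L).pow 2).sub contDiffAt_const)
  · exact contDiffAt_const.congr_of_eventuallyEq (notMem_tsupport_iff_eventuallyEq.1 hx)

lemma grd_logCut (L : ℝ) {x : E3} (hx : x ≠ 0) : grd (logCut L) x =
    (deriv cutf ((Real.log (‖x‖ ^ 2) / L) ^ 2 - 1) * (4 * Real.log (‖x‖ ^ 2) / L ^ 2 / ‖x‖ ^ 2)) •
      x := by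
  have h1 : HasFDerivAt (fun y : E3 => ‖y‖ ^ 2) (2 • innerSL ℝ x) x :=
    (hasStrictFDerivAt_norm_sq x).hasFDerivAt
  have h2 := h1.log (by simpa using hx)
  have h3 : ∀ s : ℝ, HasDerivAt (fun t : ℝ => cutf ((t / L) ^ 2 - 1))
      (deriv cutf ((s / L) ^ 2 - 1) * (2 * (s / L) * (1 / L))) s := fun s => by
    refine (cutf_hasDerivAt _).comp s ?_
    simpa using (((hasDerivAt_id s).div_const L).pow 2).sub_const 1
  have h4 := ((h3 _).comp_hasFDerivAt x h2).congr_of_eventuallyEq (logCut_eventuallyEq L hx)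
  ext i
  rw [grd_apply, h4.fderiv]
  simp only [smul_apply, innerSL_apply_apply, PiLp.smul_apply, smul_eq_mul, inner_bv_right,
    nsmul_eq_mul]
  push_cast
  field_simp
  ring

/-- The cutoff is a profile of log|x|² at scale L whose derivative is supported where |log|x|²| ≤
2L, so its gradient is of order 1/(L|x|). -/
lemma norm_grd_logCut_sq_le {K L : ℝ} (hK : ∀ s, |deriv cutf s| ≤ K) (hL : 0 < L) {x : E3}
    (hx : x ≠ 0) : ‖grd (logCut L) x‖ ^ 2 ≤ (8 * K / L) ^ 2 / ‖x‖ ^ 2 := by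
  have hp := norm_pos_iff.2 hx
  have hK0 := (abs_nonneg _).trans (hK 0)
  rw [grd_logCut L hx, norm_smul, Real.norm_eq_abs]
  set t := Real.log (‖x‖ ^ 2)
  by_cases h : 2 * L ≤ |t|
  · rw [deriv_cutf_of_one_le (one_le_of_two_mul_le hL h)]
    simp
    positivity
  · rw [← div_pow]
    gcongr
    rw [abs_mul, abs_div, abs_div, abs_mul, abs_of_pos (by positivity : 0 < L ^ 2),
      abs_of_pos (by positivity : 0 < ‖x‖ ^ 2), abs_of_pos (by norm_num : (0 : ℝ) < 4)]
    calc _ ≤ K * (4 * (2 * L) / L ^ 2 / ‖x‖ ^ 2) * ‖x‖ := by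
          gcongr
          · exact hK _
          · exact (not_le.1 h).le
      _ = 8 * K / L / ‖x‖ := by field_simp; ring

/-- The support is divided into the shells k ≤ log|x|² < k + 1 with −2L ≤ k < 2L. By the quadratic
area bound each contributes at most (8K/L)² M e, because the factor |x|⁻² balances the area, and
there are 4L shells. -/
lemma integral_grd_logCut_le {M K : ℝ} (hM : 0 < M)
    (harea : ∀ R : ℝ, 0 < R → μHE[2] (S ∩ closedBall (0 : E3) R) ≤ ENNReal.ofReal (M * R ^ 2))
    (hS0 : (0 : E3) ∉ S) (hSm : MeasurableSet S)
    (hK : ∀ s, |deriv cutf s| ≤ K) {L : ℕ} (hL : 0 < L) :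
    ∫ x in S, ‖grd (logCut L) x‖ ^ 2 ∂μHE[2] ≤ 256 * K ^ 2 * M * Real.exp 1 / L := by
  have hL' : (0 : ℝ) < L := by exact_mod_cast hL
  set B : ℤ → Set E3 := fun k => closedBall 0 (Real.exp ((k + 1) / 2)) with hB
  set I := Finset.Ico (-(2 * L) : ℤ) (2 * L) with hI
  set c : ℤ → ℝ := fun k => (8 * K / L) ^ 2 * Real.exp (-k) with hc
  have hsq : ∀ k : ℤ, Real.exp (((k : ℝ) + 1) / 2) ^ 2 = Real.exp (k + 1) := fun k => by
    rw [← Real.exp_nat_mul]; congr 1; push_cast; ring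
  have hfin : ∀ k, (μHE[2].restrict S) (B k) ≤ ENNReal.ofReal (M * Real.exp (k + 1)) := fun k => by
    rw [Measure.restrict_apply measurableSet_closedBall, Set.inter_comm, ← hsq]
    exact harea _ (Real.exp_pos _)
  have hpt : ∀ x ∈ S, ‖grd (logCut L) x‖ ^ 2 ≤ ∑ k ∈ I, (B k).indicator (fun _ => c k) x := by
    intro x hx
    have hx0 : x ≠ 0 := fun h => hS0 (h ▸ hx)
    have hnn : ∀ k ∈ I, 0 ≤ (B k).indicator (fun _ => c k) x := fun k _ =>
      Set.indicator_nonneg (fun _ _ => by positivity) x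
    by_cases ht : 2 * (L : ℝ) ≤ |Real.log (‖x‖ ^ 2)|
    · rw [grd_logCut _ hx0, deriv_cutf_of_one_le (one_le_of_two_mul_le hL' ht)]
      simpa using Finset.sum_nonneg hnn
    · set t := Real.log (‖x‖ ^ 2) with htd
      have hxp : 0 < ‖x‖ ^ 2 := by positivity
      have hext : Real.exp t = ‖x‖ ^ 2 := Real.exp_log hxp
      obtain ⟨h1, h2⟩ := abs_lt.1 (not_le.1 ht)
      have hmem : ⌊t⌋ ∈ I := by
        rw [hI, Finset.mem_Ico]
        refine ⟨Int.le_floor.2 (by push_cast; linarith), Int.floor_lt.2 (by push_cast; linarith)⟩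
      refine le_trans ?_ (Finset.single_le_sum hnn hmem)
      have hxB : x ∈ B ⌊t⌋ := by
        rw [hB, mem_closedBall_zero_iff]
        refine le_of_sq_le_sq ?_ (Real.exp_pos _).le
        rw [hsq, ← hext]
        exact Real.exp_le_exp.2 (Int.lt_floor_add_one t).le
      rw [Set.indicator_of_mem hxB]
      refine (norm_grd_logCut_sq_le hK hL' hx0).trans ?_
      rw [div_eq_mul_inv, ← hext, ← Real.exp_neg]
      exact mul_le_mul_of_nonneg_left (Real.exp_le_exp.2 (neg_le_neg (Int.floor_le t))) (sq_nonneg _)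
  have hint : ∀ k ∈ I, Integrable ((B k).indicator fun _ => c k) (μHE[2].restrict S) := fun k _ =>
    (integrable_indicator_iff measurableSet_closedBall).2
      (integrableOn_const ((hfin k).trans_lt ENNReal.ofReal_lt_top).ne)
  calc _ ≤ ∫ x in S, ∑ k ∈ I, (B k).indicator (fun _ => c k) x ∂μHE[2] :=
        integral_mono_of_nonneg (Filter.Eventually.of_forall fun x => by positivity)
          (integrable_finsetSum _ hint) ((ae_restrict_iff' hSm).2 (Filter.Eventually.of_forall hpt))
    _ = ∑ k ∈ I, (μHE[2].restrict S).real (B k) * c k := by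
        rw [integral_finsetSum _ hint]
        refine Finset.sum_congr rfl fun k _ => ?_
        rw [integral_indicator_const _ measurableSet_closedBall, smul_eq_mul]
    _ ≤ ∑ k ∈ I, (8 * K / L) ^ 2 * (M * Real.exp 1) := by
        refine Finset.sum_le_sum fun k _ => ?_
        have h1 : (μHE[2].restrict S).real (B k) ≤ M * Real.exp (k + 1) :=
          ENNReal.toReal_le_of_le_ofReal (by positivity) (hfin k)
        calc _ ≤ M * Real.exp (k + 1) * c k := by gcongr
          _ = (8 * K / L) ^ 2 * (M * (Real.exp (k + 1) * Real.exp (-k))) := by rw [hc]; ring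
          _ = _ := by rw [← Real.exp_add]; congr 3; ring_nf
    _ = _ := by
        rw [Finset.sum_const, hI, Int.card_Ico, nsmul_eq_mul]
        have : ((2 * (L : ℤ) - -(2 * L)).toNat : ℝ) = 4 * L := by
          rw [show 2 * (L : ℤ) - -(2 * L) = ((4 * L : ℕ) : ℤ) by push_cast; ring, Int.toNat_natCast]
          push_cast; ring
        rw [this]
        field_simp
        ring

/-- A stable capillary pair of quadratic area growth has a flat surface. -/
theorem curv_eq_zero (ha₀ : 0 ≤ a) (ha₁ : a < 1)
    (hpair : IsSurfacePair S G) (hstat : IsStationary a S G) (hstab : IsStable a S G)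
    {M : ℝ} (hM : 0 < M)
    (harea : ∀ R : ℝ, 0 < R → μHE[2] (S ∩ closedBall (0 : E3) R) ≤ ENNReal.ofReal (M * R ^ 2))
    (hν : IsOrientation a S ν) (hp : p ∈ S) : curv S ν p = 0 := by
  have hS := hpair.surface_left
  have hfin := hasLocFiniteArea_of_bound harea
  have hcont := curv_continuousOn hpair hstat hfin hν
  have hp0 : p ≠ 0 := fun h => hS.zero_notMem (h ▸ hp)
  by_contra hne
  have hpos : 0 < curv S ν p := (curv_nonneg S ν p).lt_of_ne' hne
  set b := curv S ν p / 2
  have hb : 0 < b := half_pos hpos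
  set L₀ := |Real.log (‖p‖ ^ 2)| + 1
  have hW : ∀ᶠ x in nhds p, (x ∈ S → b < curv S ν x) ∧ x ≠ 0 ∧ |Real.log (‖x‖ ^ 2)| < L₀ := by
    have h1 := (hcont p hp).eventually (lt_mem_nhds (half_lt_self hpos))
    rw [eventually_nhdsWithin_iff] at h1
    exact h1.and ((isOpen_ne.eventually_mem hp0).and
      ((contDiffAt_log_norm_sq hp0).continuousAt.abs.eventually (gt_mem_nhds (lt_add_one _))))
  obtain ⟨r, hr, hrW⟩ := Metric.nhds_basis_closedBall.mem_iff.1 hW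
  set W := closedBall p r
  have hSW : μHE[2] (S ∩ W) ≠ ⊤ := (hfin W (isCompact_closedBall p r)).ne
  have hm : 0 < μHE[2].real (S ∩ W) :=
    ENNReal.toReal_pos (hS.measure_pos hp (Metric.closedBall_mem_nhds p hr)).ne' hSW
  obtain ⟨K, -, hK, -⟩ := exists_deriv_cutf_bounds
  -- Once the cutoff equals 1 on W, where the curvature exceeds b, the left side grows linearly in L
  -- while the right side does not depend on L.
  have key : ∀ L : ℕ, 0 < L → L₀ ≤ L → (1 - a) * (b * μHE[2].real (S ∩ W)) * L ≤
      4 * (256 * K ^ 2 * M * Real.exp 1) := by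
    intro L hL hL0
    have hL' : (0 : ℝ) < L := by exact_mod_cast hL
    set φ := logCut L
    have hφ : ContDiff ℝ ∞ φ := logCut_contDiff hL'
    have hsupp : ∀ x ∈ tsupport φ, Real.exp (-L) / 2 < ‖x‖ ∧ ‖x‖ < 2 * Real.exp L := fun x hx => by
      have := logCut_tsupport hL' hx
      have h1 := Real.exp_pos (-L)
      have h2 := Real.exp_pos (L : ℝ)
      exact ⟨by linarith, by linarith⟩
    have h1 := stability_inequality ha₀ ha₁ hpair hstat hstab hfin hν (by positivity) hφ hsupp
    have h2 := integral_grd_logCut_le hM harea hS.zero_notMem hS.measurableSet hK hL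
    have hφc : HasCompactSupport φ := HasCompactSupport.of_support_subset_isCompact
      (isCompact_closedBall (0 : E3) (2 * Real.exp L)) fun x hx =>
        mem_closedBall_zero_iff.2 (hsupp x (subset_tsupport φ hx)).2.le
    have hφ0 : (0 : E3) ∉ tsupport φ := fun h => by
      have := (hsupp 0 h).1
      rw [norm_zero] at this
      have := Real.exp_pos (-(L : ℝ))
      linarith
    have hint : IntegrableOn (fun x => φ x ^ 2 * curv S ν x) S μHE[2] := by
      refine integrableOn_of_support hS hfin hφc hφ0 ?_ fun x _ hx => ?_
      · exact (hφ.continuous.pow 2).continuousOn.mul (hcont.mono Set.inter_subset_left)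
      · rw [image_eq_zero_of_notMem_tsupport hx]; simp
    have h3 : b * μHE[2].real (S ∩ W) ≤ ∫ x in S, φ x ^ 2 * curv S ν x ∂μHE[2] := by
      calc _ ≤ ∫ x in S ∩ W, φ x ^ 2 * curv S ν x ∂μHE[2] := by
            refine setIntegral_ge_of_const_le_real
              (hS.measurableSet.inter measurableSet_closedBall) hSW (fun x hx => ?_)
              (hint.mono_set Set.inter_subset_left)
            obtain ⟨e1, e2, e3⟩ := hrW hx.2
            have e4 : φ x = 1 := logCut_eq_one hL' e2 (e3.le.trans hL0)
            rw [e4]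
            simpa using (e1 hx.1).le
        _ ≤ _ := setIntegral_mono_set hint (Filter.Eventually.of_forall fun x =>
            mul_nonneg (sq_nonneg _) (curv_nonneg S ν x)) Set.inter_subset_left.eventuallyLE
    rw [← le_div_iff₀ hL', mul_div_assoc]
    have h4 : 0 < 1 - a := by linarith
    nlinarith
  obtain ⟨N, hN⟩ := exists_nat_gt (max L₀ (4 * (256 * K ^ 2 * M * Real.exp 1) /
    ((1 - a) * (b * μHE[2].real (S ∩ W)))))
  have hN1 := (le_max_left _ _).trans_lt hN
  have hN2 := (le_max_right _ _).trans_lt hN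
  have h4 : 0 < 1 - a := by linarith
  rw [div_lt_iff₀ (by positivity)] at hN2
  have hL0 : 0 < L₀ := by positivity
  have := key N (by exact_mod_cast hL0.trans hN1) hN1.le
  linarith

/-! ### Flat surfaces near a point -/

/-- A smooth function whose tangential derivative along a surface vanishes is locally constant on
the surface. -/
lemma IsPuncturedSurface.eventually_const (hS : IsPuncturedSurface S)
    (hp : p ∈ S) {F' : Type*} [NormedAddCommGroup F'] [NormedSpace ℝ F'] {f : E3 → F'}
    (hf : ∀ᶠ x in nhds p, DifferentiableAt ℝ f x)
    (h0 : ∀ᶠ x in nhds p, x ∈ S → ∀ ξ ∈ tangentPlane S x, fderiv ℝ f x ξ = 0) :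
    ∀ᶠ x in nhds p, x ∈ S → f x = f p := by
  obtain ⟨D, F, c, h, τ, m, r, U, hD, H⟩ := hS.exists_param hp
  have hFc : ContinuousAt F 0 := (H.smooth.contDiffAt (ball_mem_nhds 0 H.pos)).continuousAt
  have hev := hFc.eventually (by rw [H.base]; exact hf.and h0)
  obtain ⟨s, hs, hsr⟩ := Metric.mem_nhds_iff.1 (inter_mem hev (ball_mem_nhds 0 H.pos))
  have hpS : h p = 0 := H.def_zero p H.mem hp
  obtain ⟨-, hFp⟩ := H.coord p H.mem hpS
  have hc0 : c p = 0 := by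
    have := (H.maps 0 (mem_ball_self H.pos)).2.1
    rwa [H.base] at this
  have hcc : ContinuousAt c p := (H.coord_smooth.contDiffAt (H.isOpen.mem_nhds H.mem)).continuousAt
  have hcD : ∀ x ∈ U, x ∈ S → c x ∈ D ∧ F (c x) = x := fun x hxU hxS => by
    obtain ⟨e1, e2⟩ := H.coord x hxU (H.def_zero x hxU hxS)
    exact ⟨(H.maps _ e1).2.2.1 (by rwa [e2]), e2⟩
  have hconst : ∀ y ∈ D ∩ ball 0 s, f (F y) = f p := by
    have hconv : Convex ℝ (D ∩ ball 0 s) := hD.convex.inter (convex_ball _ _)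
    have hder : ∀ y ∈ D ∩ ball 0 s, HasFDerivWithinAt (fun y => f (F y)) (0 : E2 →L[ℝ] F')
        (D ∩ ball 0 s) y := by
      rintro y ⟨hyD, hys⟩
      obtain ⟨⟨e1, e2⟩, hyr⟩ := hsr hys
      obtain ⟨hyU, -, hyS⟩ := H.maps y hyr
      have hyS := hyS.2 hyD
      have hF := ((H.smooth.contDiffAt (isOpen_ball.mem_nhds hyr)).differentiableAt
        (by simp)).hasFDerivAt
      have hh := ((H.def_smooth.contDiffAt (H.isOpen.mem_nhds hyU)).differentiableAt
        (by simp)).hasFDerivAt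
      have g1 : HasFDerivWithinAt (fun z => h (F z)) ((fderiv ℝ h (F y)).comp (fderiv ℝ F y)) D y :=
        (hh.comp y hF).hasFDerivWithinAt
      have g2 : HasFDerivWithinAt (fun z => h (F z)) (0 : E2 →L[ℝ] ℝ) D y := by
        refine (hasFDerivWithinAt_const (0 : ℝ) y D).congr_of_eventuallyEq ?_
          (H.def_zero _ hyU hyS)
        filter_upwards [mem_nhdsWithin_of_mem_nhds (isOpen_ball.mem_nhds hyr),
          self_mem_nhdsWithin] with z hz hzD
        obtain ⟨hzU, -, hzS⟩ := H.maps z hz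
        exact H.def_zero _ hzU (hzS.2 hzD)
      have g3 := (hD.uniqueDiffWithinAt hyD).eq g1 g2
      have g4 := (e1.hasFDerivAt.comp y hF).hasFDerivWithinAt (s := D ∩ ball 0 s)
      have g5 : (fderiv ℝ f (F y)).comp (fderiv ℝ F y) = 0 := by
        ext η
        refine e2 hyS _ ?_
        rw [H.tangentPlane_eq hD hyU hyS, mem_perp_iff,
          inner_grd]
        exact DFunLike.congr_fun g3 η
      rwa [g5] at g4
    intro y hy
    have h0m : (0 : E2) ∈ D ∩ ball 0 s :=
      ⟨by rw [← hc0]; exact (hcD p H.mem hp).1, mem_ball_self hs⟩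
    have := hconv.norm_image_sub_le_of_norm_hasFDerivWithin_le (C := 0) hder (by simp) h0m hy
    rw [zero_mul, norm_le_zero_iff, sub_eq_zero, H.base] at this
    exact this
  have hcs := hcc.eventually (by rw [hc0]; exact ball_mem_nhds 0 hs)
  filter_upwards [hcs, H.isOpen.mem_nhds H.mem] with x hxs hxU hxS
  obtain ⟨e1, e2⟩ := hcD x hxU hxS
  rw [← hconst (c x) ⟨e1, hxs⟩, e2]

lemma eq_zero_of_sff_eq_zero {B : E3 →L[ℝ] E3} {n ξ : E3} (h : sff B n = 0)
    (hξ : inner ℝ n ξ = 0) : B ξ = 0 := by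
  have h1 := (Finset.sum_eq_zero_iff_of_nonneg fun j _ => sq_nonneg ‖B (bv j - n j • n)‖).1 h
  have h2 : ∀ j, B (bv j) = n j • B n := fun j => by
    have := h1 j (Finset.mem_univ j)
    rw [sq_eq_zero_iff, norm_eq_zero, map_sub, map_smul, sub_eq_zero] at this
    exact this
  rw [inner_three] at hξ
  ext i
  rw [map_apply_three B ξ, h2, h2, h2, PiLp.smul_apply, PiLp.smul_apply, PiLp.smul_apply,
    PiLp.zero_apply]
  simp only [smul_eq_mul]
  linear_combination B n i * hξ

/-- With zero second fundamental form the normal is locally constant along S, and then x ↦ ⟨n(p), x⟩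
has zero tangential derivative. -/
lemma Adapted.eventually_plane (hS : IsPuncturedSurface S) {ν n : E3 → E3}
    (hn : Adapted S ν n p) (hp : p ∈ S)
    (h0 : ∀ᶠ x in nhds p, x ∈ S → sff (fderiv ℝ n x) (n x) = 0) :
    ∀ᶠ x in nhds p, x ∈ S → inner ℝ (n p) (x - p) = 0 := by
  have h1 : ∀ᶠ x in nhds p, x ∈ S → n x = n p := by
    refine hS.eventually_const hp (hn.1.smooth.mono fun x hx => hx.differentiableAt (by simp)) ?_
    filter_upwards [h0, hn.1.plane] with x e1 e2 hx ξ hξ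
    rw [e2 hx, mem_perp_iff] at hξ
    exact eq_zero_of_sff_eq_zero (e1 hx) hξ
  have h2 : ∀ᶠ x in nhds p, x ∈ S → innerSL ℝ (n p) x = innerSL ℝ (n p) p := by
    refine hS.eventually_const hp
      (Filter.Eventually.of_forall fun x => (innerSL ℝ (n p)).differentiableAt) ?_
    filter_upwards [h1, hn.1.plane] with x e1 e2 hx ξ hξ
    rw [e2 hx, mem_perp_iff, e1 hx] at hξ
    rw [(innerSL ℝ (n p)).fderiv]
    exact hξ
  filter_upwards [h2] with x hx hxS
  rw [inner_sub_right (n p) x, sub_eq_zero]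
  exact hx hxS

/-- A hypersurface contained in a plane near `p` fills the plane near `p`. -/
lemma eventually_mem_of_plane {S H : Set E3} {p m u : E3} (hs : ContDiffAt ℝ ∞ h p)
    (hp0 : h p = 0) (hu : fderiv ℝ h p u ≠ 0) (hm : inner ℝ m u ≠ (0 : ℝ))
    (hS : ∀ᶠ x in nhds p, x ∈ H → h x = 0 → x ∈ S) (hH : ∀ y ∈ H, ∀ t : ℝ, y + t • u ∈ H)
    (hpl : ∀ᶠ x in nhds p, x ∈ S → inner ℝ m (x - p) = 0) :
    ∀ᶠ y in nhds p, y ∈ H → inner ℝ m (y - p) = 0 → y ∈ S := by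
  wlog hpos : 0 < fderiv ℝ h p u generalizing u
  · refine this (u := -u) (by rwa [map_neg, neg_ne_zero]) (by rwa [inner_neg_right, neg_ne_zero])
      (fun y hy t => ?_) ?_
    · have := hH y hy (-t)
      rwa [neg_smul, ← smul_neg] at this
    · rw [map_neg, neg_pos]
      exact hu.lt_of_le (not_lt.1 hpos)
  have hcont : ∀ᶠ x in nhds p, ContinuousAt h x := by
    filter_upwards [(hs.of_le one_le_infty).eventually (by simp)] with x hx using hx.continuousAt
  obtain ⟨r, hr, hball⟩ := Metric.mem_nhds_iff.1 (hcont.and (hS.and hpl))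
  have hl : HasDerivAt (fun t : ℝ => p + t • u) u 0 := by
    simpa using ((hasDerivAt_id (0 : ℝ)).smul_const u).const_add p
  have hd : HasDerivAt (fun t : ℝ => h (p + t • u)) (fderiv ℝ h p u) 0 := by
    have h1 : HasFDerivAt h (fderiv ℝ h p) (p + (0 : ℝ) • u) := by
      rw [zero_smul, add_zero]; exact (hs.differentiableAt (by simp)).hasFDerivAt
    exact h1.comp_hasDerivAt 0 hl
  have hsign := eventually_nhdsWithin_sign_eq_of_deriv_pos (by rwa [hd.deriv])
    (show h (p + (0 : ℝ) • u) = 0 by rwa [zero_smul, add_zero])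
  have hsmall : ∀ᶠ t in nhds (0 : ℝ), |t| * ‖u‖ < r / 2 :=
    (show Continuous fun t : ℝ => |t| * ‖u‖ by fun_prop).continuousAt.eventually
      (gt_mem_nhds (by simpa using half_pos hr))
  obtain ⟨δ, hδ, hδr⟩ := Metric.mem_nhds_iff.1 (hsign.and hsmall)
  have hδm : ∀ {t : ℝ}, |t| ≤ δ / 2 → t ∈ ball (0 : ℝ) δ := fun {t} ht => by
    rw [mem_ball_zero_iff, Real.norm_eq_abs]; linarith
  have hδ2 : |δ / 2| ≤ δ / 2 := (abs_of_pos (half_pos hδ)).le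
  have hδ2' : |-(δ / 2)| ≤ δ / 2 := by rw [abs_neg]; exact hδ2
  have hin : ∀ y ∈ ball p (r / 2), ∀ t : ℝ, |t| ≤ δ / 2 → y + t • u ∈ ball p r := by
    intro y hy t ht
    rw [mem_ball_iff_norm] at hy ⊢
    have h1 := (hδr (hδm ht)).2
    calc ‖y + t • u - p‖ = ‖(y - p) + t • u‖ := by congr 1; abel
      _ ≤ ‖y - p‖ + |t| * ‖u‖ := by
          refine (norm_add_le _ _).trans ?_
          rw [norm_smul, Real.norm_eq_abs]
      _ < r := by have : |t| * ‖u‖ < r / 2 := h1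
                  linarith
  have hp2 := mem_ball_self (x := p) (half_pos hr)
  have s1 : 0 < h (p + (δ / 2) • u) := by
    have := (hδr (hδm hδ2)).1
    rw [sub_zero, sign_pos (half_pos hδ)] at this
    exact sign_eq_one_iff.1 this
  have s2 : h (p + (-(δ / 2)) • u) < 0 := by
    have := (hδr (hδm hδ2')).1
    rw [sub_zero, sign_neg (neg_neg_of_pos (half_pos hδ))] at this
    exact sign_eq_neg_one_iff.1 this
  have hct : ∀ t : ℝ, |t| ≤ δ / 2 → ContinuousAt (fun y => h (y + t • u)) p := fun t ht =>
    ContinuousAt.comp (f := fun y : E3 => y + t • u) (hball (hin p hp2 t ht)).1 (by fun_prop)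
  filter_upwards [ball_mem_nhds p (half_pos hr),
    (hct _ hδ2).eventually (lt_mem_nhds s1), (hct _ hδ2').eventually (gt_mem_nhds s2)]
    with y hy e1 e2 hyH hym
  have hle : -(δ / 2) ≤ δ / 2 := by linarith
  -- Near p the function h changes sign along each line in direction u. The line through a point y
  -- of the plane thus meets S; as S lies in the plane and u is transversal to it, the meeting point
  -- is y.
  have hivt := intermediate_value_Icc hle (f := fun t : ℝ => h (y + t • u)) fun t ht =>
    (ContinuousAt.comp (f := fun t : ℝ => y + t • u) (hball (hin y hy t (abs_le.2 ht))).1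
      (by fun_prop)).continuousWithinAt
  obtain ⟨t, ht, ht0⟩ := hivt ⟨e2.le, e1.le⟩
  obtain ⟨-, b1, b2⟩ := hball (hin y hy t (abs_le.2 ht))
  have hyS := b1 (hH y hyH t) ht0
  have h3 := b2 hyS
  rw [show y + t • u - p = (y - p) + t • u by abel, inner_add_right m (y - p), hym,
    inner_smul_right, zero_add] at h3
  rcases mul_eq_zero.1 h3 with h4 | h4
  · rwa [h4, zero_smul, add_zero] at hyS
  · exact (hm h4).elim

/-- The part in the half-space of the plane through `p` with normal `m`. -/
def flatPiece (m p : E3) : Set E3 := {y | inner ℝ m (y - p) = 0 ∧ 0 ≤ y 0}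

/-- The surface `S` coincides near `p` with the plane through `p` with unit normal `m`. -/
def FlatAt (S : Set E3) (m p : E3) : Prop :=
  ‖m‖ = 1 ∧ ∀ᶠ y in nhds p, (y ∈ S ↔ y ∈ flatPiece m p)

/-- A flat surface fills its tangent plane near an interior point. -/
lemma flatAt_of_interior (hS : IsPuncturedSurface S) (hH : S ⊆ halfSpace) {p m : E3}
    (hp : IsInteriorPoint S p) (hm : ‖m‖ = 1)
    (hpl : ∀ᶠ x in nhds p, x ∈ S → inner ℝ m (x - p) = 0) : FlatAt S m p := by
  obtain ⟨hpS, Φ, hpΦ, hΦ, hΦS⟩ := hp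
  obtain ⟨h1, h2⟩ := chart_coord_fderiv_ne hΦ hpΦ 2
  have hSΦ : ∀ᶠ x in nhds p, (x ∈ S ↔ Φ x 2 = 0) := by
    filter_upwards [Φ.open_source.mem_nhds hpΦ] with x hx using hΦS x hx
  obtain ⟨n, hn⟩ := hS.exists_normal hpS
  have hmm : inner ℝ m m = (1 : ℝ) := by rw [real_inner_self_eq_norm_sq, hm]; norm_num
  have hle : ∀ ξ ∈ tangentPlane S p, inner ℝ m ξ = 0 := fun ξ hξ => by
    have h3 := fderiv_eq_of_eqOn (f := fun x => innerSL ℝ m x) (g := fun _ => innerSL ℝ m p) hpS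
      (innerSL ℝ m).differentiableAt (differentiableAt_const _) (by
        filter_upwards [hpl] with x hx hxS
        have := hx hxS
        rw [inner_sub_right m x, sub_eq_zero] at this
        exact this) hξ
    rw [(innerSL ℝ m).fderiv, fderiv_fun_const] at h3
    exact h3
  have hmn : inner ℝ m (n p) ≠ (0 : ℝ) := fun h0 => by
    have h3 := hle m (by
      rw [hn.plane.self_of_nhds hpS, mem_perp_iff,
        real_inner_comm, h0])
    rw [hmm] at h3
    exact one_ne_zero h3
  have hd := normal_deriv_ne hpS (h1.differentiableAt (by simp)) (hSΦ.mono fun x hx => hx.1) h2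
    hn.unit.self_of_nhds (hn.plane.self_of_nhds hpS)
  have h4 := eventually_mem_of_plane (S := S) (H := Set.univ) h1 ((hΦS p hpΦ).1 hpS) hd hmn
    (hSΦ.mono fun x hx _ h => hx.2 h) (fun _ _ _ => trivial) hpl
  refine ⟨hm, ?_⟩
  filter_upwards [h4, hpl] with y e1 e2
  exact ⟨fun hy => ⟨e2 hy, hH hy⟩, fun hy => e1 trivial hy.1⟩

lemma eventually_plane_of_curv (hpair : IsSurfacePair S G)
    (hν : IsOrientation a S ν) (h0 : ∀ x ∈ S, curv S ν x = 0) (hp : p ∈ sheet S) :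
    ∃ m : E3, ‖m‖ = 1 ∧ tangentPlane S p = (ℝ ∙ m)ᗮ ∧
      ∀ᶠ x in nhds p, x ∈ S → inner ℝ m (x - p) = 0 := by
  obtain ⟨n, hn⟩ := hν.adapted p hp
  refine ⟨n p, hn.1.unit.self_of_nhds, hn.1.plane.self_of_nhds hp.1,
    hn.eventually_plane hpair.surface_left hp.1 ?_⟩
  filter_upwards [hn.eventually, hν.sheet_open p hp] with x e1 e2 hx
  rw [← curv_eq (e2 hx) e1]
  exact h0 x hx

lemma tendsto_line (y v : E3) :
    Tendsto (fun t : ℝ => y + t • v) (𝓝[>] 0) (nhds y) := by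
  have h : Continuous fun t : ℝ => y + t • v := by fun_prop
  have h2 := h.tendsto 0
  rw [zero_smul, add_zero] at h2
  exact h2.mono_left nhdsWithin_le_nhds

/-- The normal m is taken from a contact chart. It has first component −a, and the third chart
coordinate, which is nonpositive exactly on G within the wall, has derivative a positive multiple of
⟨m, ·⟩. The sign of ⟨m, v⟩ therefore decides whether a horizontal v points into G. -/
lemma exists_flatAt_bdry (ha : a ^ 2 < 1) (hpair : IsSurfacePair S G)
    (hstat : IsStationary a S G) (hfin : HasLocFiniteArea S)
    (hν : IsOrientation a S ν) (h0 : ∀ x ∈ S, curv S ν x = 0) (hp : p ∈ bdry S) :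
    ∃ m : E3, m 0 = -a ∧ FlatAt S m p ∧ ∀ v : E3, v 0 = 0 →
      (inner ℝ m v < 0 → ∀ᶠ t in 𝓝[>] (0 : ℝ), p + t • v ∈ G) ∧
      (0 < inner ℝ m v → ∀ᶠ t in 𝓝[>] (0 : ℝ), p + t • v ∉ G) := by
  obtain ⟨hpS, hpG, hp0⟩ := hpair.of_mem_bdry hp
  obtain ⟨e, hpe, he⟩ := exists_contactChart ha hpair hstat hfin hp
  obtain ⟨k, hk1, hkT, hkpl⟩ := eventually_plane_of_curv hpair hν h0 ⟨hpS, Or.inr hp⟩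
  obtain ⟨h1, h2⟩ := chart_coord_fderiv_ne he.chart hpe 2
  have hn := he.normal p hpe
  set g := grd (fun z => e z 2) p with hg
  have hgp : 0 < ‖g‖ := norm_pos_iff.2 (grd_ne_zero h2)
  have hm1 : ‖(‖g‖⁻¹ : ℝ) • g‖ = 1 := hn.unit.self_of_nhds
  have hmT : tangentPlane S p = (ℝ ∙ ((‖g‖⁻¹ : ℝ) • g))ᗮ := hn.plane.self_of_nhds hpS
  have hma : ((‖g‖⁻¹ : ℝ) • g) 0 = -a := he.angle p hpe hpS hpG
  have hd : ∀ v, fderiv ℝ (fun z => e z 2) p v = ‖g‖ * inner ℝ ((‖g‖⁻¹ : ℝ) • g) v := fun v => by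
    rw [← inner_grd, real_inner_smul_left, mul_inv_cancel_left₀ hgp.ne']
  set m := (‖g‖⁻¹ : ℝ) • g
  have hpl : ∀ᶠ x in nhds p, x ∈ S → inner ℝ m (x - p) = 0 := by
    rcases eq_or_eq_neg_of_orthogonal_le hm1 hk1 (hmT.symm.trans hkT).le with h | h <;> rw [h]
    · exact hkpl
    · filter_upwards [hkpl] with x hx hxS
      rw [inner_neg_left, hx hxS, neg_zero]
  have hu : inner ℝ m (m - m 0 • bv 0) = 1 - a ^ 2 := by
    rw [inner_sub_right m m, real_inner_self_eq_norm_sq, hm1, inner_smul_right m (bv 0),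
      inner_bv_right m, hma]
    ring
  have hune : inner ℝ m (m - m 0 • bv 0) ≠ 0 := by rw [hu]; linarith
  have hz0 : e p 2 = 0 := ((he.left_iff p hpe).1 hpS).1
  have hev : ∀ᶠ x in nhds p, x ∈ e.source := e.open_source.mem_nhds hpe
  -- The transversal direction is the horizontal part of m, because translations along it preserve
  -- the half-space.
  have h4 := eventually_mem_of_plane (S := S) (H := halfSpace) h1 hz0
    (by rw [hd]; exact mul_ne_zero hgp.ne' hune) hune
    (hev.mono fun x hx h3 h5 => (he.left_iff x hx).2 ⟨h5, h3⟩) (fun y hy t => by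
      change 0 ≤ (y + t • (m - m 0 • bv 0)) 0
      have hy : 0 ≤ y 0 := hy
      simpa using hy) hpl
  refine ⟨m, hma, ⟨hm1, ?_⟩, fun v hv => ?_⟩
  · filter_upwards [h4, hpl] with y e1 e2
    exact ⟨fun hy => ⟨e2 hy, hpair.left_subset hy⟩, fun hy => e1 hy.2 hy.1⟩
  · have hl : HasDerivAt (fun t : ℝ => p + t • v) v 0 := by
      simpa using ((hasDerivAt_id (0 : ℝ)).smul_const v).const_add p
    have hder : HasDerivAt (fun t : ℝ => e (p + t • v) 2) (‖g‖ * inner ℝ m v) 0 := by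
      have h5 : HasFDerivAt (fun z => e z 2) (fderiv ℝ (fun z => e z 2) p) (p + (0 : ℝ) • v) := by
        rw [zero_smul, add_zero]; exact (h1.differentiableAt (by simp)).hasFDerivAt
      have h6 := h5.comp_hasDerivAt 0 hl
      rwa [hd] at h6
    have hzero : e (p + (0 : ℝ) • v) 2 = 0 := by rwa [zero_smul, add_zero]
    have hsrc : ∀ᶠ t in 𝓝[>] (0 : ℝ), p + t • v ∈ e.source :=
      (tendsto_line p v).eventually hev
    have hw : ∀ t : ℝ, (p + t • v) 0 = 0 := fun t => by simp [hp0, hv]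
    refine ⟨fun hneg => ?_, fun hpos => ?_⟩
    · have hs := eventually_nhdsWithin_sign_eq_of_deriv_neg
        (by rw [hder.deriv]; exact mul_neg_of_pos_of_neg hgp hneg) hzero
      filter_upwards [hsrc, nhdsWithin_le_nhds hs, self_mem_nhdsWithin] with t e1 e2 e3
      rw [zero_sub, sign_neg (neg_neg_of_pos e3)] at e2
      exact (he.right_iff _ e1).2 ⟨hw t, (sign_eq_neg_one_iff.1 e2).le⟩
    · have hs := eventually_nhdsWithin_sign_eq_of_deriv_pos
        (by rw [hder.deriv]; exact mul_pos hgp hpos) hzero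
      filter_upwards [hsrc, nhdsWithin_le_nhds hs, self_mem_nhdsWithin] with t e1 e2 e3 e4
      have e3 : 0 < t := e3
      rw [sub_zero, sign_pos e3] at e2
      exact (not_le.2 (sign_eq_one_iff.1 e2)) ((he.right_iff _ e1).1 e4).2

/-- A flat capillary surface coincides near each of its points with a plane or a half-plane. -/
lemma exists_flatAt (ha : a ^ 2 < 1) (hpair : IsSurfacePair S G)
    (hstat : IsStationary a S G) (hfin : HasLocFiniteArea S)
    (hν : IsOrientation a S ν) (h0 : ∀ x ∈ S, curv S ν x = 0) (hp : p ∈ S) :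
    ∃ m : E3, FlatAt S m p := by
  by_cases hb : p ∈ bdry S
  · obtain ⟨m, -, hm, -⟩ := exists_flatAt_bdry ha hpair hstat hfin hν h0 hb
    exact ⟨m, hm⟩
  have hi := (hpair.surface_left.smooth p hp).resolve_right hb
  by_cases hps : p ∈ sheet S
  · obtain ⟨m, hm, -, hpl⟩ := eventually_plane_of_curv hpair hν h0 hps
    exact ⟨m, flatAt_of_interior hpair.surface_left hpair.left_subset hi hm hpl⟩
  · have h1 := eventually_notMem_sheet hpair hstat hfin hp hps
    refine ⟨bv 0, flatAt_of_interior hpair.surface_left hpair.left_subset hi (norm_bv 0) ?_⟩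
    filter_upwards [h1] with x hx hxS
    rw [real_inner_comm, inner_bv_right, PiLp.sub_apply, (hx hxS).1, (h1.self_of_nhds hp).1, sub_zero]

/-! ### Components of a flat surface -/

/-- Connectedness in the form used below: an open condition that holds somewhere on T and passes to
limit points within T holds on all of T. -/
lemma subset_of_isPreconnected {T u : Set E3} (hT : IsPreconnected T) (hu : IsOpen u)
    (hne : (T ∩ u).Nonempty) (h : ∀ x ∈ T, x ∈ closure (T ∩ u) → x ∈ u) : T ⊆ u := by
  have hv : IsOpen (closure (T ∩ u))ᶜ := isClosed_closure.isOpen_compl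
  rcases isPreconnected_iff_subset_of_disjoint.1 hT u _ hu hv (fun x hx => by
    by_cases hc : x ∈ closure (T ∩ u)
    · exact Or.inl (h x hx hc)
    · exact Or.inr hc) (Set.eq_empty_iff_forall_notMem.2 fun x hx =>
      hx.2.2 (subset_closure ⟨hx.1, hx.2.1⟩)) with h1 | h1
  · exact h1
  · obtain ⟨x, hx⟩ := hne
    exact (h1 hx.1 (subset_closure hx)).elim

/-- Two planes that agree near a common point are equal. -/
lemma eq_or_eq_neg_of_flatPiece {m k p q y : E3} (hm : ‖m‖ = 1) (hk : ‖k‖ = 1)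
    (hy : y ∈ flatPiece m p) (h : ∀ᶠ z in nhds y, z ∈ flatPiece m p → z ∈ flatPiece k q) :
    (m = k ∨ m = -k) ∧ flatPiece m p = flatPiece k q := by
  have hyk := h.self_of_nhds hy
  -- From a point of the wall one can only move into the half-space; the remaining directions follow
  -- by ξ ↦ −ξ.
  have key : ∀ ξ : E3, inner ℝ m ξ = 0 → 0 ≤ ξ 0 → inner ℝ k ξ = (0 : ℝ) := fun ξ h1 h2 => by
    have h3 : ∀ᶠ t in 𝓝[>] (0 : ℝ), y + t • ξ ∈ flatPiece m p →
        y + t • ξ ∈ flatPiece k q :=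
      (tendsto_line y ξ).eventually h
    obtain ⟨t, e1, e2⟩ := (h3.and self_mem_nhdsWithin).exists
    have e2 : 0 < t := e2
    have e3 := (e1 ⟨by
      rw [add_sub_right_comm, inner_add_right m (y - p), hy.1, inner_smul_right, h1]; ring, by
      change 0 ≤ (y + t • ξ) 0
      have := hy.2
      simp only [PiLp.add_apply, PiLp.smul_apply, smul_eq_mul]
      positivity⟩).1
    rw [add_sub_right_comm, inner_add_right k (y - q), hyk.1, inner_smul_right, zero_add] at e3
    exact (mul_eq_zero.1 e3).resolve_left e2.ne'
  have key2 : ∀ ξ : E3, inner ℝ m ξ = 0 → inner ℝ k ξ = (0 : ℝ) := fun ξ h1 => by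
    rcases le_total 0 (ξ 0) with h2 | h2
    · exact key ξ h1 h2
    · have := key (-ξ) (by rw [inner_neg_right, h1, neg_zero]) (by simpa using h2)
      rwa [inner_neg_right, neg_eq_zero] at this
  have h6 := eq_or_eq_neg_of_orthogonal_le hm hk fun ξ hξ =>
    mem_perp_iff.2
      (key2 ξ (mem_perp_iff.1 hξ))
  refine ⟨h6, ?_⟩
  have hmem : ∀ {m p : E3}, y ∈ flatPiece m p → ∀ z, (inner ℝ m (z - p) = 0 ↔
      inner ℝ m (z - y) = (0 : ℝ)) := fun {m p} h z => by
    rw [← sub_add_sub_cancel z y p, inner_add_right m (z - y), h.1, add_zero]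
  ext z
  simp only [flatPiece, Set.mem_ofPred_eq]
  rw [hmem hy, hmem hyk]
  rcases h6 with rfl | rfl
  · rfl
  · rw [inner_neg_left, neg_eq_zero]

lemma flatPiece_isClosed (m p : E3) : IsClosed (flatPiece m p) := by
  have h1 : Continuous fun y : E3 => inner ℝ m (y - p) := by fun_prop
  have h2 : Continuous fun y : E3 => y 0 := by fun_prop
  exact (isClosed_eq h1 continuous_const).inter (isClosed_le continuous_const h2)

lemma flatPiece_convex (m p : E3) : Convex ℝ (flatPiece m p) := by
  rintro x ⟨hx, hx0⟩ y ⟨hy, hy0⟩ s t hs ht hst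
  refine ⟨?_, ?_⟩
  · rw [inner_sub_right m] at hx hy ⊢
    rw [inner_add_right m (s • x), inner_smul_right, inner_smul_right]
    linear_combination s * hx + t * hy + hst * inner ℝ m p
  · simp only [PiLp.add_apply, PiLp.smul_apply, smul_eq_mul]
    positivity

/-- The direction in the plane orthogonal to `m` that leaves the wall. -/
lemma exists_upward {m : E3} (hm : ‖m‖ = 1) (h0 : m 0 ^ 2 < 1) :
    ∃ z : E3, inner ℝ m z = 0 ∧ 0 < z 0 := by
  refine ⟨bv 0 - m 0 • m, ?_, ?_⟩
  · rw [inner_sub_right m (bv 0), inner_bv_right m, inner_smul_right, real_inner_self_eq_norm_sq, hm]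
    ring
  · simp
    nlinarith

lemma flatPiece_add {m p y z : E3} (hy : y ∈ flatPiece m p) (hz : inner ℝ m z = 0) {t : ℝ}
    (h0 : 0 ≤ (y + t • z) 0) : y + t • z ∈ flatPiece m p :=
  ⟨by rw [add_sub_right_comm, inner_add_right m (y - p), hy.1, inner_smul_right, hz]; ring, h0⟩

lemma eq_zero_of_sq_eq_one {m : E3} (hm : ‖m‖ = 1) (h0 : ¬ m 0 ^ 2 < 1) :
    m 1 = 0 ∧ m 2 = 0 ∧ m 0 ≠ 0 := by
  have h1 := norm_sq_three m
  rw [hm] at h1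
  exact ⟨by nlinarith, by nlinarith, fun h => h0 (by rw [h]; norm_num)⟩

lemma flatPiece_eq_parallel {m p : E3} (hm : ‖m‖ = 1) (h0 : ¬ m 0 ^ 2 < 1) (hp : 0 ≤ p 0) :
    flatPiece m p = parallelPlane (p 0) := by
  obtain ⟨h1, h2, h3⟩ := eq_zero_of_sq_eq_one hm h0
  ext x
  simp only [flatPiece, parallelPlane, Set.mem_ofPred_eq, inner_three, PiLp.sub_apply, h1, h2]
  constructor
  · rintro ⟨h, -⟩
    exact sub_eq_zero.1 ((mul_eq_zero.1 (by linarith : m 0 * (x 0 - p 0) = 0)).resolve_left h3)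
  · intro h
    rw [h]
    exact ⟨by ring, hp⟩

/-- If the piece contains 0 and is not parallel to the wall, it is a half-plane with 0 on its edge,
and the punctured piece lies between the open half-plane and its closure. If it is parallel to the
wall, it is the wall without a point. -/
lemma flatPiece_preconnected {m p : E3} (hm : ‖m‖ = 1) (hp : 0 ≤ p 0) :
    IsPreconnected (flatPiece m p \ {0}) := by
  by_cases hz : (0 : E3) ∈ flatPiece m p
  · by_cases h0 : m 0 ^ 2 < 1
    · obtain ⟨z, hz1, hz2⟩ := exists_upward hm h0
      refine ((flatPiece_convex m p).inter openHalf_convex).isPreconnected.subset_closure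
        (fun x hx => ⟨hx.1, fun h => ?_⟩) fun y hy => ?_
      · have h1 : x = 0 := h
        have h2 : 0 < x 0 := hx.2
        rw [h1] at h2
        exact lt_irrefl _ h2
      · refine mem_closure_of_tendsto (tendsto_line y z) ?_
        filter_upwards [self_mem_nhdsWithin] with t ht
        have ht : 0 < t := ht
        have h1 : 0 < (y + t • z) 0 := by
          have := hy.1.2
          simp only [PiLp.add_apply, PiLp.smul_apply, smul_eq_mul]
          positivity
        exact ⟨flatPiece_add hy.1 hz1 h1.le, h1⟩
    · have h1 := flatPiece_eq_parallel hm h0 hp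
      have h2 : (0 : E3) 0 = p 0 := by rw [h1] at hz; exact hz
      rw [h1, ← h2]
      exact wall_punctured_preconnected
  · rw [Set.sdiff_singleton_eq_self hz]
    exact (flatPiece_convex m p).isPreconnected

/-- The component of a flat surface is a plane or a half-plane. -/
lemma connectedComponentIn_eq_flatPiece (hS : IsPuncturedSurface S) (hH : S ⊆ halfSpace)
    (hflat : ∀ p ∈ S, ∃ m, FlatAt S m p) {m p : E3} (hp : p ∈ S) (hm : FlatAt S m p) :
    connectedComponentIn S p = flatPiece m p \ {0} ∧
      ∀ x ∈ flatPiece m p \ {0}, ∀ᶠ y in nhds x, (y ∈ S ↔ y ∈ flatPiece m p) := by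
  have hpT : p ∈ flatPiece m p \ {0} :=
    ⟨(hm.2.self_of_nhds).1 hp, fun h => hS.zero_notMem (h ▸ hp)⟩
  have hT := flatPiece_preconnected (p := p) hm.1 (hH hp)
  -- Agreement of S with the piece is an open condition. A limit of points of agreement other than 0
  -- belongs to S, and S is flat there too; two pieces that agree near a point coincide.
  have h1 : flatPiece m p \ {0} ⊆ {x | ∀ᶠ y in nhds x, (y ∈ S ↔ y ∈ flatPiece m p)} := by
    refine subset_of_isPreconnected hT (isOpen_iff_mem_nhds.2 fun x hx =>
      Filter.Eventually.eventually_nhds hx) ⟨p, hpT, hm.2⟩ fun x hx hc => ?_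
    have hxS : x ∈ S := (hS.closed (closure_mono (fun z hz =>
      (Filter.Eventually.self_of_nhds hz.2).2 hz.1.1) hc)).resolve_right hx.2
    obtain ⟨k, hk1, hk2⟩ := hflat x hxS
    obtain ⟨z, hz, hzT, hzu⟩ := mem_closure_iff_nhds.1 hc _ hk2.eventually_nhds
    have hz : ∀ᶠ y in nhds z, (y ∈ S ↔ y ∈ flatPiece k x) := hz
    have hzu : ∀ᶠ y in nhds z, (y ∈ S ↔ y ∈ flatPiece m p) := hzu
    have h2 := (eq_or_eq_neg_of_flatPiece hm.1 hk1 hzT.1 (by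
      filter_upwards [hz, hzu] with y e1 e2 e3 using e1.1 (e2.2 e3))).2
    change ∀ᶠ y in nhds x, (y ∈ S ↔ y ∈ flatPiece m p)
    rwa [h2]
  have hTS : flatPiece m p \ {0} ⊆ S := fun x hx => (Filter.Eventually.self_of_nhds (h1 hx)).2 hx.1
  refine ⟨Set.Subset.antisymm ?_ (hT.subset_connectedComponentIn hpT hTS), h1⟩
  -- Conversely the component cannot leave the piece: a limit of its points that lie in the piece
  -- lies in the piece, which is closed, and there S agrees with it.
  have h3 : connectedComponentIn S p ⊆ {x | ∀ᶠ y in nhds x, y ∈ S → y ∈ flatPiece m p} := by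
    refine subset_of_isPreconnected isPreconnected_connectedComponentIn
      (isOpen_iff_mem_nhds.2 fun x hx => Filter.Eventually.eventually_nhds hx)
      ⟨p, mem_connectedComponentIn hp, hm.2.mono fun y hy => hy.1⟩ fun x hx hc => ?_
    have hxS := connectedComponentIn_subset S p hx
    have hxT : x ∈ flatPiece m p := by
      rw [← (flatPiece_isClosed m p).closure_eq]
      refine closure_mono (fun z hz => ?_) hc
      exact Filter.Eventually.self_of_nhds (p := fun y => y ∈ S → y ∈ flatPiece m p) hz.2
        (connectedComponentIn_subset S p hz.1)
    exact (h1 ⟨hxT, fun h => hS.zero_notMem (h ▸ hxS)⟩).mono fun y hy => hy.1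
  intro x hx
  have hxS := connectedComponentIn_subset S p hx
  exact ⟨Filter.Eventually.self_of_nhds (h3 hx) hxS, fun h => hS.zero_notMem (h ▸ hxS)⟩

/-- A slanted half-plane meets the wall in the boundary of the surface. -/
lemma mem_bdry_of_slanted (hpair : IsSurfacePair S G)
    (hstat : IsStationary a S G) (hfin : HasLocFiniteArea S) {m p q : E3} (hm : ‖m‖ = 1)
    (h0 : m 0 ^ 2 < 1) (hq : q ∈ flatPiece m p)
    (hloc : ∀ᶠ y in nhds q, (y ∈ S ↔ y ∈ flatPiece m p)) (hq0 : q 0 = 0) : q ∈ bdry S := by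
  have hqS : q ∈ S := hloc.self_of_nhds.2 hq
  have hs : q ∈ sheet S := by
    -- Off the sheet S would lie in the wall near q, whereas the slanted piece leaves the wall in
    -- the direction z.
    by_contra hns
    obtain ⟨z, hz1, hz2⟩ := exists_upward hm h0
    obtain ⟨t, ⟨e1, e2⟩, e3⟩ := (((tendsto_line q z).eventually
      (hloc.and (eventually_notMem_sheet hpair hstat hfin hqS hns))).and self_mem_nhdsWithin).exists
    have e3 : 0 < t := e3
    have h1 : (q + t • z) 0 = t * z 0 := by simp [hq0]
    have h2 := (e2 (e1.2 (flatPiece_add hq hz1 (by rw [h1]; positivity)))).1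
    rw [h1] at h2
    exact (mul_pos e3 hz2).ne' h2
  exact hs.2.resolve_left fun h => (ne_of_gt h) hq0

/-- The plane is followed from p in a direction that changes x₁ until it meets the wall. If this
happens at 0, a step along the line of intersection with the wall avoids it. -/
lemma exists_mem_wall {m p : E3} (hm : ‖m‖ = 1) (h0 : m 0 ^ 2 < 1) :
    ∃ q ∈ flatPiece m p \ {0}, q 0 = 0 := by
  obtain ⟨z, hz1, hz2⟩ := exists_upward hm h0
  set q := p + (-(p 0 / z 0)) • z
  have hq0 : q 0 = 0 := by simp [q]; field_simp; ring
  have hq : q ∈ flatPiece m p := by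
    refine ⟨?_, hq0.ge⟩
    rw [show q - p = (-(p 0 / z 0)) • z from add_sub_cancel_left p _, inner_smul_right, hz1, mul_zero]
  by_cases hqz : q = 0
  · set w : E3 := !₂[0, -m 2, m 1]
    have hw : inner ℝ m w = 0 := by rw [inner_three]; simp [w]; ring
    have hw0 : (q + (1 : ℝ) • w) 0 = 0 := by simp [hq0, w]
    refine ⟨q + (1 : ℝ) • w, ⟨flatPiece_add hq hw hw0.ge, fun h => ?_⟩, hw0⟩
    have h : q + (1 : ℝ) • w = 0 := h
    rw [hqz, zero_add, one_smul] at h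
    have e1 : w 1 = 0 := by rw [h]; rfl
    have e2 : w 2 = 0 := by rw [h]; rfl
    have h1 := norm_sq_three m
    simp only [w] at e1 e2
    simp at e1 e2
    rw [hm, e1, e2] at h1
    linarith
  · exact ⟨q, ⟨hq, hqz⟩, hq0⟩

/-- The vector n is the normalised horizontal part of m, so m = −a e₁ + √(1 − a²) n with √(1 − a²) =
sin θ, and w is n turned by a right angle within the wall. -/
lemma flatPiece_eq_tilted (ha₀ : 0 ≤ a) (ha₁ : a < 1) {m q : E3} (hm : ‖m‖ = 1)
    (hma : m 0 = -a) (hq : q 0 = 0) : ∃ n w : E3, IsWallFrame q n w ∧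
      flatPiece m q = tiltedHalfPlane (Real.arccos a) q n w ∧
      halfPlane q (-n) w = {x | x 0 = 0 ∧ inner ℝ m (x - q) ≤ 0} := by
  have hs0 : 0 < 1 - a ^ 2 := by nlinarith
  set s := Real.sqrt (1 - a ^ 2) with hs
  have hsp : 0 < s := Real.sqrt_pos.2 hs0
  have hss : s ^ 2 = 1 - a ^ 2 := Real.sq_sqrt hs0.le
  have hn := norm_sq_three m
  rw [hm, hma] at hn
  obtain ⟨n₁, hn1⟩ : ∃ x, m 1 = s * x := ⟨m 1 / s, by field_simp⟩
  obtain ⟨n₂, hn2⟩ : ∃ x, m 2 = s * x := ⟨m 2 / s, by field_simp⟩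
  have hnn : n₁ ^ 2 + n₂ ^ 2 = 1 := by
    have : s ^ 2 * (n₁ ^ 2 + n₂ ^ 2 - 1) = 0 := by rw [hn1, hn2] at hn; linarith
    have := (mul_eq_zero.1 this).resolve_left (by positivity)
    linarith
  have hnorm : ∀ x : E3, x 0 ^ 2 + x 1 ^ 2 + x 2 ^ 2 = 1 → ‖x‖ = 1 := fun x hx => by
    have h1 := norm_sq_three x
    rw [hx] at h1
    exact (pow_eq_one_iff_of_nonneg (norm_nonneg x) two_ne_zero).1 h1
  set n : E3 := !₂[0, n₁, n₂]
  set w : E3 := !₂[0, -n₂, n₁]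
  have hin : ∀ x : E3, inner ℝ m (x - q) =
      -a * x 0 + s * (n₁ * (x 1 - q 1) + n₂ * (x 2 - q 2)) := fun x => by
    rw [inner_three, hma, hn1, hn2, PiLp.sub_apply, PiLp.sub_apply, PiLp.sub_apply, hq]; ring
  refine ⟨n, w, ⟨hq, ?_, ?_, hnorm n ?_, hnorm w ?_, ?_⟩, ?_, ?_⟩
  · exact mem_wallPlane.2 (by simp [n])
  · exact mem_wallPlane.2 (by simp [w])
  · simpa [n] using hnn
  · simp [w]; linarith
  · rw [inner_three]; simp [n, w]; ring
  · ext x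
    simp only [flatPiece, tiltedHalfPlane, halfPlane, Set.mem_ofPred_eq, Real.sin_arccos,
      Real.cos_arccos (by linarith) ha₁.le, ← hs, hin]
    constructor
    · rintro ⟨h1, h2⟩
      refine ⟨x 0 / s, -n₂ * (x 1 - q 1) + n₁ * (x 2 - q 2), by positivity, ?_⟩
      have h3 : a * (x 0 / s) = n₁ * (x 1 - q 1) + n₂ * (x 2 - q 2) := by
        field_simp; linarith
      ext i
      fin_cases i
      · simp [n, w, hq, e₁_eq]; field_simp
      · simp [n, w, e₁_eq]
        linear_combination -n₁ * h3 - (x 1 - q 1) * hnn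
      · simp [n, w, e₁_eq]
        linear_combination -n₂ * h3 - (x 2 - q 2) * hnn
    · rintro ⟨r, t, hr, rfl⟩
      simp [n, w, hq, e₁_eq]
      exact ⟨by linear_combination s * r * a * hnn, by positivity⟩
  · ext x
    simp only [halfPlane, Set.mem_ofPred_eq, hin]
    constructor
    · rintro ⟨r, t, hr, rfl⟩
      simp [n, w, hq]
      have : s * (n₁ * (-(r * n₁) + -(t * n₂)) + n₂ * (-(r * n₂) + t * n₁)) = -(s * r) := by
        linear_combination -(s * r) * hnn
      have h2 := mul_nonneg hsp.le hr
      linarith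
    · rintro ⟨h1, h2⟩
      rw [h1] at h2
      refine ⟨-(n₁ * (x 1 - q 1) + n₂ * (x 2 - q 2)), -n₂ * (x 1 - q 1) + n₁ * (x 2 - q 2), ?_, ?_⟩
      · by_contra! h
        have := mul_pos hsp (neg_lt_zero.1 h)
        linarith
      · ext i
        fin_cases i
        · simp [n, w, hq, h1]
        · simp [n, w]
          linear_combination -(x 1 - q 1) * hnn
        · simp [n, w]
          linear_combination -(x 2 - q 2) * hnn

/-! ### The wetted region -/

/-- The origin may lie inside the open half-plane, so convexity alone is not enough. The exponential
in one variable identifies the half-plane with the whole plane, where at most one point is removed.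
-/
lemma halfWall_preconnected {b₁ b₂ : ℝ} (hb : 0 < b₁ ^ 2 + b₂ ^ 2) (d : ℝ) :
    IsPreconnected ({x : E3 | x 0 = 0 ∧ d < b₁ * x 1 + b₂ * x 2} \ {0}) := by
  set β := b₁ ^ 2 + b₂ ^ 2 with hβ
  set ψ : E2 → E3 := fun z => !₂[0, (Real.exp (z 0) + d) / β * b₁ - z 1 * b₂,
    (Real.exp (z 0) + d) / β * b₂ + z 1 * b₁] with hψ
  have h1 : ∀ z, b₁ * ψ z 1 + b₂ * ψ z 2 = Real.exp (z 0) + d := fun z => by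
    simp [hψ]; field_simp; rw [hβ]; ring
  have h2 : ∀ z, b₁ * ψ z 2 - b₂ * ψ z 1 = z 1 * β := fun z => by
    simp [hψ]; rw [hβ]; ring
  have hc : Continuous ψ := by
    refine (PiLp.continuous_toLp 2 _).comp (continuous_pi fun i => ?_)
    fin_cases i <;> simp <;> fun_prop
  have hsub : (ψ ⁻¹' {0}).Subsingleton := fun x hx y hy => by
    have hxy : ψ x = ψ y := hx.trans hy.symm
    have e1 := h1 x
    have e2 := h2 x
    rw [hxy, h1 y] at e1
    rw [hxy, h2 y] at e2
    ext i
    fin_cases i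
    · exact (Real.exp_injective (add_right_cancel e1)).symm
    · exact (mul_right_cancel₀ hb.ne' e2).symm
  have h3 : IsConnected (ψ ⁻¹' {0})ᶜ := hsub.finite.countable.isConnected_compl_of_one_lt_rank (by
    rw [← Module.finrank_eq_rank, finrank_euclideanSpace_fin]; norm_num)
  convert h3.isPreconnected.image ψ hc.continuousOn using 1
  ext x
  constructor
  · rintro ⟨⟨e1, e2⟩, e3⟩
    have e4 : ψ !₂[Real.log (b₁ * x 1 + b₂ * x 2 - d), (b₁ * x 2 - b₂ * x 1) / β] = x := by
      have e5 : 0 < b₁ * x 1 + b₂ * x 2 - d := by linarith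
      ext i
      fin_cases i <;> simp [hψ, Real.exp_log e5]
      · exact e1.symm
      · field_simp; rw [hβ]; ring
      · field_simp; rw [hβ]; ring
    exact ⟨_, fun h => e3 (by rw [← e4]; exact h), e4⟩
  · rintro ⟨z, hz, rfl⟩
    refine ⟨⟨by simp [hψ], ?_⟩, hz⟩
    rw [h1]
    linarith [Real.exp_pos (z 0)]

/-- A half of the wall cut out by a half-plane `S` is contained in `G` as soon as it meets `G`. -/
lemma halfWall_subset (hpair : IsSurfacePair S G) {m q : E3} (hq : q 0 = 0)
    (hm : 0 < m 1 ^ 2 + m 2 ^ 2) (hS : ∀ x ∈ S, inner ℝ m (x - q) = 0)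
    (h : ∃ x ∈ G, 0 < inner ℝ m (x - q)) :
    ∀ x ∈ wall \ {0}, 0 < inner ℝ m (x - q) → x ∈ G := by
  have hV : {x : E3 | x 0 = 0 ∧ m 1 * q 1 + m 2 * q 2 < m 1 * x 1 + m 2 * x 2} \ {0} =
      {x : E3 | x 0 = 0 ∧ 0 < inner ℝ m (x - q)} \ {0} := by
    congr 1
    ext x
    simp only [Set.mem_ofPred_eq, inner_three, PiLp.sub_apply, hq]
    refine and_congr_right fun h0 => ?_
    rw [h0]
    constructor <;> intro h <;> linarith
  have hpre := halfWall_preconnected hm (m 1 * q 1 + m 2 * q 2)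
  rw [hV] at hpre
  have hG := hpair.surface_right
  -- Such points are interior points of G, because ∂G = ∂S is contained in the plane of S.
  have hu : ∀ x ∈ G, 0 < inner ℝ m (x - q) → ∀ᶠ y in nhds x, y ∈ wall → y ∈ G := by
    intro x hx h0
    refine interior_point_wall hpair.right_subset ((hG.smooth x hx).resolve_right fun hb => ?_)
    have hb : x ∈ bdry S := by rw [hpair.bdry_eq]; exact hb
    exact h0.ne' (hS x (hpair.of_mem_bdry hb).1)
  obtain ⟨z, hz, hz0⟩ := h
  have hsub := subset_of_isPreconnected (u := {x | ∀ᶠ y in nhds x, y ∈ wall → y ∈ G}) hpre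
    (isOpen_iff_mem_nhds.2 fun x hx => Filter.Eventually.eventually_nhds hx)
    ⟨z, ⟨⟨hpair.right_subset hz, hz0⟩, fun h => hG.zero_notMem (h ▸ hz)⟩, hu z hz hz0⟩
    fun x hx hc => hu x ((hG.closed (closure_mono (fun y hy =>
      Filter.Eventually.self_of_nhds (p := fun y => y ∈ wall → y ∈ G) hy.2 hy.1.1.1) hc)).resolve_right
        hx.2) hx.1.2
  exact fun x hx h0 => Filter.Eventually.self_of_nhds
    (p := fun y => y ∈ wall → y ∈ G) (hsub ⟨⟨hx.1, h0⟩, hx.2⟩) hx.1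

/-- The wetted region of a half-plane. -/
lemma right_eq (hpair : IsSurfacePair S G) {m q : E3} (hq : q 0 = 0)
    (hm : 0 < m 1 ^ 2 + m 2 ^ 2) (hS : ∀ x ∈ S, inner ℝ m (x - q) = 0) (hqS : q ∈ S)
    (hline : ∀ x ∈ wall \ {0}, inner ℝ m (x - q) = 0 → x ∈ G) (hside : ∀ v : E3, v 0 = 0 →
      (inner ℝ m v < 0 → ∀ᶠ t in 𝓝[>] (0 : ℝ), q + t • v ∈ G) ∧
      (0 < inner ℝ m v → ∀ᶠ t in 𝓝[>] (0 : ℝ), q + t • v ∉ G)) :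
    G = {x | x 0 = 0 ∧ inner ℝ m (x - q) ≤ 0} \ {0} := by
  have hqz : q ≠ 0 := fun h => hpair.surface_left.zero_notMem (h ▸ hqS)
  obtain ⟨v, hv0, hv⟩ : ∃ v : E3, v 0 = 0 ∧ 0 < inner ℝ m v := by
    refine ⟨!₂[0, m 1, m 2], by simp, ?_⟩
    rw [inner_three]
    simp
    linarith
  have hn : ∀ x, inner ℝ (-m) (x - q) = -inner ℝ m (x - q) := fun x => inner_neg_left _ _
  apply Set.Subset.antisymm
  · refine fun x hx => ⟨⟨hpair.right_subset hx, ?_⟩, fun h => hpair.surface_right.zero_notMem (h ▸ hx)⟩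
    -- A single point of G on the positive side would force the whole punctured half of the wall
    -- into G, contrary to the behaviour of G near q. On the negative side the same dichotomy fills
    -- the half, as G meets it near q.
    by_contra! h
    have h1 := halfWall_subset hpair hq hm hS ⟨x, hx, h⟩
    obtain ⟨t, ⟨e1, e2⟩, e3⟩ := ((((hside v hv0).2 hv).and
      ((tendsto_line q v).eventually (isOpen_ne.eventually_mem hqz))).and self_mem_nhdsWithin).exists
    have e3 : 0 < t := e3
    refine e1 (h1 _ ⟨by simp [wall, hq, hv0], e2⟩ ?_)
    rw [add_sub_cancel_left, inner_smul_right]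
    positivity
  · rintro x ⟨⟨hx0, hx⟩, hxz⟩
    rcases hx.lt_or_eq with h | h
    · obtain ⟨t, e1, e3⟩ := (((hside (-v) (by simp [hv0])).1 (by
        rw [inner_neg_right]; linarith)).and self_mem_nhdsWithin).exists
      have e3 : 0 < t := e3
      refine halfWall_subset hpair (m := -m) hq (by simpa using hm)
        (fun y hy => by rw [hn, hS y hy, neg_zero]) ⟨_, e1, ?_⟩ x ⟨hx0, hxz⟩ (by rw [hn]; linarith)
      rw [hn, add_sub_cancel_left, inner_smul_right, inner_neg_right]
      have := mul_pos e3 hv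
      linarith
    · exact hline x ⟨hx0, hxz⟩ h

end Capillary

end

theorem mainTheorem7 (a : ℝ) (ha₀ : 0 ≤ a) (ha₁ : a < 1)
    (S G : Set Capillary.E3) (hpair : Capillary.IsSurfacePair S G)
    (hstat : Capillary.IsStationary a S G) (hstab : Capillary.IsStable a S G)
    (M : ℝ) (hM : 0 < M)
    (harea : ∀ R : ℝ, 0 < R →
      Measure.euclideanHausdorffMeasure 2 (S ∩ Metric.closedBall (0 : Capillary.E3) R) ≤
        ENNReal.ofReal (M * R ^ 2)) :
    ∃ θ : ℝ, 0 < θ ∧ θ ≤ Real.pi / 2 ∧ a = Real.cos θ ∧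
      (IsConnected S → (Capillary.bdry S).Nonempty →
        ∃ q n w : Capillary.E3, Capillary.IsWallFrame q n w ∧
          S = Capillary.tiltedHalfPlane θ q n w \ {0} ∧
          G = Capillary.halfPlane q (-n) w \ {0}) ∧
      (∀ p ∈ S,
        (∃ q n w : Capillary.E3, Capillary.IsWallFrame q n w ∧
          connectedComponentIn S p = Capillary.tiltedHalfPlane θ q n w \ {0}) ∨
        (∃ c : ℝ, 0 ≤ c ∧
          connectedComponentIn S p = Capillary.parallelPlane c \ {0})) := by
  have ha : a ^ 2 < 1 := by nlinarith
  have hS := hpair.surface_left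
  have hfin := Capillary.hasLocFiniteArea_of_bound harea
  obtain ⟨ν, hν⟩ := Capillary.exists_isOrientation ha hpair hstat hfin
  have h0 : ∀ x ∈ S, Capillary.curv S ν x = 0 := fun x hx =>
    Capillary.curv_eq_zero ha₀ ha₁ hpair hstat hstab hM harea hν hx
  have hflat : ∀ p ∈ S, ∃ m, Capillary.FlatAt S m p := fun p hp =>
    Capillary.exists_flatAt ha hpair hstat hfin hν h0 hp
  refine ⟨Real.arccos a, Real.arccos_pos.2 ha₁, Real.arccos_le_pi_div_two.2 ha₀,
    (Real.cos_arccos (by linarith) ha₁.le).symm, fun hconn hb => ?_, fun p hp => ?_⟩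
  · obtain ⟨q, hqb⟩ := hb
    obtain ⟨hqS, -, hq0⟩ := hpair.of_mem_bdry hqb
    obtain ⟨m, hma, hm, hside⟩ := Capillary.exists_flatAt_bdry ha hpair hstat hfin hν h0 hqb
    obtain ⟨hC, hloc⟩ := Capillary.connectedComponentIn_eq_flatPiece hS hpair.left_subset hflat hqS hm
    rw [hconn.isPreconnected.connectedComponentIn hqS] at hC
    obtain ⟨n, w, hf, h1, h2⟩ := Capillary.flatPiece_eq_tilted ha₀ ha₁ hm.1 hma hq0
    refine ⟨q, n, w, hf, by rw [← h1]; exact hC, ?_⟩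
    have hn := Capillary.norm_sq_three m
    rw [hm.1, hma] at hn
    rw [h2]
    refine Capillary.right_eq hpair hq0 (by linarith) (fun x hx => ?_) hqS (fun x hx hxm => ?_) hside
    · rw [hC] at hx
      exact hx.1.1
    · have hx0 : x 0 = 0 := hx.1
      exact (hpair.of_mem_bdry (Capillary.mem_bdry_of_slanted hpair hstat hfin hm.1 (by rw [hma]; linarith)
        ⟨hxm, hx0.ge⟩ (hloc x ⟨⟨hxm, hx0.ge⟩, hx.2⟩) hx0)).2.1
  · obtain ⟨m, hm⟩ := hflat p hp
    obtain ⟨hC, hloc⟩ := Capillary.connectedComponentIn_eq_flatPiece hS hpair.left_subset hflat hp hm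
    have hp0 : 0 ≤ p 0 := hpair.left_subset hp
    by_cases hs : m 0 ^ 2 < 1
    · left
      -- A component not parallel to the wall reaches it at a point q other than 0, which is a
      -- boundary point of S. The contact angle is known at q, and the component of q is that of p.
      obtain ⟨q, hq, hq0⟩ := Capillary.exists_mem_wall (p := p) hm.1 hs
      have hqb := Capillary.mem_bdry_of_slanted hpair hstat hfin hm.1 hs hq.1 (hloc q hq) hq0
      have hqS := (hpair.of_mem_bdry hqb).1
      obtain ⟨k, hka, hk, -⟩ := Capillary.exists_flatAt_bdry ha hpair hstat hfin hν h0 hqb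
      obtain ⟨n, w, hf, h1, -⟩ := Capillary.flatPiece_eq_tilted ha₀ ha₁ hk.1 hka hq0
      refine ⟨q, n, w, hf, ?_⟩
      rw [← h1, ← (Capillary.connectedComponentIn_eq_flatPiece hS hpair.left_subset hflat hqS hk).1]
      exact connectedComponentIn_eq (by rw [hC]; exact hq)
    · exact Or.inr ⟨p 0, hp0, by rw [hC, Capillary.flatPiece_eq_parallel hm.1 hs hp0]⟩
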